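/- **Setting (one value of the security parameter $\lambda$).** All objects are bit strings of fixed lengths. A *ring* is a duplicate-free list $\rho'=(a_1,\dots,a_{n})$ of public values with $1\le n\le\kappa$. A ring preimage sampleable function (RPSF) consists of a setup $\mathsf{Stp}\to pp$, a trapdoor generation $\mathsf{TpdGen}(pp)\to(a,t)$, for every ring $\rho'$ finite sets $D_{\rho'},R_{\rho'}$ and a function $f_{\rho'}:D_{\rho'}\to R_{\rho'}$, a sampler $\mathsf{SamplePre}(\rho',t,r)\in D_{\rho'}$ for $r\in R_{\rho'}$, and a sampler $\mathsf{SampleDom}(\rho')\in D_{\rho'}$ that uses uniform random coins (all of these may depend on $pp$). A pair $(a,t)$ is *honest* if it lies in the support of $\mathsf{TpdGen}(pp)$, $pp$ in the support of $\mathsf{Stp}$. For $r$ in the support of $f_{\rho'}(\mathsf{SampleDom}(\rho'))$, let $Q_{\rho',r}$ be the distribution of $d\gets\mathsf{SampleDom}(\rho')$ conditioned on $f_{\rho'}(d)=r$. Let $\Delta$ be the statistical distance and $R_\alpha(P\|Q)=\big(\sum_{x\in\mathrm{supp}P}P(x)^\alpha Q(x)^{1-\alpha}\big)^{1/(\alpha-1)}$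 for $1<\alpha<\infty$, $R_\infty(P\|Q)=\sup_{x\in\mathrm{supp} P}P(x)/Q(x)$ (infinite if $\mathrm{supp}P\not\subseteq\mathrm{supp}Q$). * *$\delta$-correct*: $\Pr[f_{\rho'}(\mathsf{SamplePre}(\rho',t,r))\ne r]\le\delta$ for every ring $\rho'$ of honest values, every honest $(a,t)$ with $a\in\rho'$, and every $r\in R_{\rho'}$. * $\epsilon^{dom}$: $\Delta\big(f_{\rho'}(\mathsf{SampleDom}(\rho')),\mathcal U(R_{\rho'})\big)\le\epsilon^{dom}$ for every ring $\rho'$ that contains at least one honest value. * $\epsilon^{pre}$, resp. $R^{pre}_\alpha$: $\Delta(\mathsf{SamplePre}(\rho',t,r),Q_{\rho',r})\le\epsilon^{pre}$, resp. $R_\alpha(\mathsf{SamplePre}(\rho',t,r)\,\|\,Q_{\rho',r})\le R^{pre}_\alpha$, for every honest $(a,t)$, every ring $\rho'\ni a$ and every $r$ as above. * *Preimage min-entropy* $\beta$: $Q_{\rho',r}(d)\le2^{-\beta}$ for every ring $\rho'$ of honest values, every $r$ as above and every $d\in D_{\rho'}$. **Unsalted ring signature $\mathsf{RSig}$ ($k=0$).**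 Keys are those of the RPSF. $\mathsf{Sign}(t,\rho',m)=\mathsf{SamplePre}(\rho',t,H(\rho',m))$. $\mathsf{Verify}(\rho',m,\sigma)$ accepts iff $\sigma\in D_{\rho'}$ and $f_{\rho'}(\sigma)=H(\rho',m)$. In the quantum random oracle model (QROM), the values $H(\rho',m)\in R_{\rho'}$ are independent and uniform, and every algorithm may query $H$ in superposition by $|x\rangle|y\rangle\mapsto|x\rangle|y\oplus H(x)\rangle$. **UF-CRA1 game.** An adversary $A$ receives $pp$ and $N$ independently generated public keys, forming the set $\rho$, and may query $H$ in superposition and a signing oracle classically. On a query $(i,\rho',m)$ the oracle returns $\bot$ if the $i$-th member of $\rho'$ does not exist or is not in $\rho$, if $(\rho',m)$ has already been signed, or if $q_s$ queries have been answered; otherwise it returns $\mathsf{Sign}(t_j,\rho',m)$ with $t_j$ a trapdoor of the game belonging to that member. $A$ wins if it outputs $(\rho^*,m^*,\sigma^*)$ with $\rho^*\subseteq\rho$, $(\rho^*,m^*)$ not signed before, and $\mathsf{Verify}(\rho^*,m^*,\sigma^*)$ accepting. Its winning probability is $\mathrm{Adv}^{\mathrm{UF\text{-}CRA1}}_{A,\mathsf{RSig},N,q_s}$.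 **Collision game.** An adversary $A_{col}$ receives $pp$ and $\kappa$ independently generated public values, forming $\rho$, and may query $H$ in superposition (it gets no signing oracle). It wins if it outputs $(d_1,d_2,\rho')$ with $\rho'\subseteq\rho$, $d_1\ne d_2\in D_{\rho'}$ and $f_{\rho'}(d_1)=f_{\rho'}(d_2)$. Its winning probability is $\mathrm{Adv}^{col}_{A_{col},\mathrm{RPSF}}$. Adversaries are quantum circuits whose operations are arbitrary unitaries on three qubits, single-qubit measurements, (superposition) evaluations of the public functions $(\rho',d)\mapsto f_{\rho'}(d)$ and $(\rho',c)\mapsto\mathsf{SampleDom}(\rho';c)$, and oracle queries; the *size* is the number of qubits plus the number of operations. **Theorem.** There is an absolute constant $C$ such that the following holds for every RPSF, all $N\le\kappa$, $q_s,q_H\ge0$, and every UF-CRA1 adversary $A$ making at most $q_s$ signing and $q_H$ hash queries. There is a collision adversary $A_{col}$ of size at most $C(\mathrm{size}(A)+\ell+1)^C$, where $\ell=\ell_{pp}+\kappa(\ell_a+1)+\ell_m+\ell_D+\ell_R+\ell_c$ is the total length of the public parameters, a ring ($\ell_a$ per public value), a message, a domain element, a range element and the coins of $\mathsf{SampleDom}$,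 such that whenever the RPSF is $\delta$-correct, has preimage min-entropy $\beta$ and satisfies the $\epsilon^{dom}$ property, then with $\epsilon=8(q_s+q_H)\sqrt{2\epsilon^{dom}}$: $$\mathrm{Adv}^{\mathrm{UF\text{-}CRA1}}_{A,\mathsf{RSig},N,q_s}\le\epsilon+q_s\,\epsilon^{pre}+2^{-\beta}+\mathrm{Adv}^{col}_{A_{col},\mathrm{RPSF}}$$ whenever the RPSF satisfies the $\epsilon^{pre}$ property, and $$\mathrm{Adv}^{\mathrm{UF\text{-}CRA1}}_{A,\mathsf{RSig},N,q_s}\le\epsilon+\Big[(R^{pre}_\alpha)^{q_s}\big(2^{-\beta}+\mathrm{Adv}^{col}_{A_{col},\mathrm{RPSF}}\big)\Big]^{\frac{\alpha-1}{\alpha}}$$ for every $\alpha\in(1,\infty]$ such that the RPSF satisfies the $R^{pre}_\alpha$ property (the exponent is $1$ for $\alpha=\infty$). -/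

import Mathlib

noncomputable section

open scoped Classical NNReal ENNReal

/-! ## Bit strings, rings of public keys, and their encodings -/

/-- Bit strings of length `n`. -/
abbrev Bits (n : ℕ) : Type := Fin n → Bool

/-- Rings: duplicate-free lists of public keys (bit strings of length `ℓ`), of size `n + 1` with
`1 ≤ n + 1 ≤ κ`. -/
abbrev KeyRing (κ ℓ : ℕ) : Type := Σ n : Fin κ, (Fin (n.1 + 1) ↪ Bits ℓ)

/-- The public key `a` is a member of the ring `ρ`. -/
def KeyRing.Has {κ ℓ : ℕ} (ρ : KeyRing κ ℓ) (a : Bits ℓ) : Prop := ∃ i, ρ.2 i = a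

/-- Positions of the encoding of a ring: each of the `κ` slots has a presence bit `(i, none)` and
the bits `(i, some j)` of a public key. -/
abbrev RingIdx (κ ℓ : ℕ) : Type := Fin κ × Option (Fin ℓ)

/-- Encoding of a ring: the slots after the last member are all zero. -/
def encRing {κ ℓ : ℕ} (ρ : KeyRing κ ℓ) : RingIdx κ ℓ → Bool := fun x =>
  if h : x.1.1 < ρ.1.1 + 1 then
    (match x.2 with
      | none => true
      | some j => ρ.2 ⟨x.1.1, h⟩ j)
  else false

theorem encRing_injective {κ ℓ : ℕ} : Function.Injective (encRing (κ := κ) (ℓ := ℓ)) := by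
  rintro ⟨n, ρ⟩ ⟨n', ρ'⟩ h
  have key : ∀ i : Fin κ, (i.1 < n.1 + 1 ↔ i.1 < n'.1 + 1) := by
    intro i
    have := congrFun h (i, none)
    by_cases h1 : i.1 < n.1 + 1 <;> by_cases h2 : i.1 < n'.1 + 1 <;>
      simp only [encRing, h1, h2] at this ⊢ <;> simp at this
  have hn : n = n' := by
    have h1 := key n
    have h2 := key n'
    ext
    omega
  subst hn
  congr 1
  ext i j
  have hi : i.1 < κ := by have := i.2; have := n.2; omega
  have := congrFun h (⟨i.1, hi⟩, some j)
  simpa [encRing, i.2] using this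

/-- Encoding of a position in a ring: the unit vector of that position. -/
def encPos {κ : ℕ} (i : Fin κ) : Fin κ → Bool := fun j => decide (j = i)

/-- Decoding with respect to an injective encoding; `none` on strings that encode nothing. -/
def decode {α β : Type} (enc : α → β) (b : β) : Option α :=
  if h : ∃ a, enc a = b then some h.choose else none

/-! ## Finite probability -/

/-- Expectation of a real-valued function on a finite sample space. -/
def expect {α : Type} [Fintype α] (p : PMF α) (g : α → ℝ) : ℝ := ∑ a, (p a).toReal * g a

/-- Statistical distance. -/
def statDist {α : Type} [Fintype α] (p q : PMF α) : ℝ :=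
  (∑ a, |(p a).toReal - (q a).toReal|) / 2

/-- Multiplicative Rényi divergence `R_α(p ‖ q)` of order `α ∈ (1, ∞]`; it equals `∞` if the
support of `p` is not contained in that of `q`. -/
def renyiDiv {α : Type} [Fintype α] (a : ℝ≥0∞) (p q : PMF α) : ℝ≥0∞ :=
  if a = ∞ then ⨆ x ∈ p.support, p x / q x
  else (∑ x, p x ^ a.toReal * q x ^ (1 - a.toReal)) ^ (1 / (a.toReal - 1))

/-! ## Ring preimage sampleable functions -/

/-- The algorithms of a ring preimage sampleable function at one value of the security parameter.
Everything is encoded by bit strings of fixed lengths. `κ` is the maximal ring size, and messages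
are bit strings of length `msgLen`. The probabilistic algorithms `Stp`, `TpdGen` and `SamplePre`
are given by their output distributions, and the domain sampler by its output as a function of its
random coins. `Dom pp ρ` and `Ran pp ρ` are the domain and the range of the function `f pp ρ` that
the ring `ρ` defines under the public parameters `pp`. -/
structure RPSF where
  κ : ℕ
  ppLen : ℕ
  keyLen : ℕ
  trapLen : ℕ
  msgLen : ℕ
  domLen : ℕ
  ranLen : ℕ
  coinLen : ℕ
  Stp : PMF (Bits ppLen)
  TpdGen : Bits ppLen → PMF (Bits keyLen × Bits trapLen)
  Dom : Bits ppLen → KeyRing κ keyLen → Finset (Bits domLen)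
  Ran : Bits ppLen → KeyRing κ keyLen → Finset (Bits ranLen)
  f : (pp : Bits ppLen) → (ρ : KeyRing κ keyLen) → Dom pp ρ → Ran pp ρ
  SamplePre : (pp : Bits ppLen) → (ρ : KeyRing κ keyLen) → Bits trapLen → Ran pp ρ →
    PMF (Dom pp ρ)
  SampleDom : (pp : Bits ppLen) → (ρ : KeyRing κ keyLen) → Bits coinLen → Dom pp ρ

namespace RPSF

variable (P : RPSF)

/-- Rings of public values of `P`. -/
abbrev Rng : Type := KeyRing P.κ P.keyLen

/-- Positions of the encoding of a ring of public values of `P`. -/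
abbrev RIdx : Type := RingIdx P.κ P.keyLen

/-- Messages. -/
abbrev Msg : Type := Bits P.msgLen

/-- Key pairs: a public value (public key) and a trapdoor (secret key). -/
abbrev KeyPair : Type := Bits P.keyLen × Bits P.trapLen

/-- Total length of the public objects that an adversary handles. -/
def bitLength : ℕ :=
  P.ppLen + P.κ * (P.keyLen + 1) + P.msgLen + P.domLen + P.ranLen + P.coinLen

variable {P}

instance instNonemptyRan (pp : Bits P.ppLen) (ρ : P.Rng) : Nonempty (P.Ran pp ρ) :=
  ⟨P.f pp ρ (P.SampleDom pp ρ (fun _ => false))⟩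

variable (P)

/-- Output distribution of the domain sampler, run on uniform coins. -/
def domDist (pp : Bits P.ppLen) (ρ : P.Rng) : PMF (P.Dom pp ρ) :=
  (PMF.uniformOfFintype (Bits P.coinLen)).map (P.SampleDom pp ρ)

/-- The target `r` is hit by the domain sampler with positive probability. -/
def Hit (pp : Bits P.ppLen) (ρ : P.Rng) (r : P.Ran pp ρ) : Prop :=
  ∃ d ∈ {d | P.f pp ρ d = r}, d ∈ (P.domDist pp ρ).support

/-- Distribution of `d ← SampleDom(ρ)` conditioned on `f_ρ(d) = r`. -/
def condDist (pp : Bits P.ppLen) (ρ : P.Rng) (r : P.Ran pp ρ) (h : P.Hit pp ρ r) :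
    PMF (P.Dom pp ρ) :=
  (P.domDist pp ρ).filter {d | P.f pp ρ d = r} h

/-- `(a, t)` is a possible output of trapdoor generation under `pp`, and `pp` of the setup. -/
def Honest (pp : Bits P.ppLen) (a : Bits P.keyLen) (t : Bits P.trapLen) : Prop :=
  pp ∈ P.Stp.support ∧ (a, t) ∈ (P.TpdGen pp).support

/-- All members of `ρ` are honestly generated public values. -/
def HonestRing (pp : Bits P.ppLen) (ρ : P.Rng) : Prop :=
  ∀ i, ∃ t, P.Honest pp (ρ.2 i) t

/-- `δ`-correctness. -/
def Correct (δ : ℝ) : Prop :=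
  ∀ pp ρ, P.HonestRing pp ρ → ∀ a t, P.Honest pp a t → ρ.Has a → ∀ r : P.Ran pp ρ,
    expect (P.SamplePre pp ρ t r) (fun d => if P.f pp ρ d ≠ r then 1 else 0) ≤ δ

/-- Domain sampling with uniform output, up to statistical distance `ε`, for every ring that
contains at least one honestly generated public value. -/
def DomUniform (ε : ℝ≥0) : Prop :=
  ∀ pp a t, P.Honest pp a t → ∀ ρ : P.Rng, ρ.Has a →
    statDist ((P.domDist pp ρ).map (P.f pp ρ)) (PMF.uniformOfFintype (P.Ran pp ρ)) ≤ ε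

/-- Preimage sampling is not detectable, up to statistical distance `ε`. -/
def PreStat (ε : ℝ≥0) : Prop :=
  ∀ pp a t, P.Honest pp a t → ∀ ρ : P.Rng, ρ.Has a → ∀ (r : P.Ran pp ρ) (h : P.Hit pp ρ r),
    statDist (P.SamplePre pp ρ t r) (P.condDist pp ρ r h) ≤ ε

/-- Preimage sampling is not detectable, with Rényi divergence of order `α` at most `R`. -/
def PreRenyi (α : ℝ≥0∞) (R : ℝ≥0) : Prop :=
  ∀ pp a t, P.Honest pp a t → ∀ ρ : P.Rng, ρ.Has a → ∀ (r : P.Ran pp ρ) (h : P.Hit pp ρ r),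
    renyiDiv α (P.SamplePre pp ρ t r) (P.condDist pp ρ r h) ≤ R

/-- Preimage min-entropy at least `β`. -/
def PreMinEntropy (β : ℝ) : Prop :=
  ∀ pp ρ, P.HonestRing pp ρ → ∀ (r : P.Ran pp ρ) (h : P.Hit pp ρ r) (d : P.Dom pp ρ),
    (P.condDist pp ρ r h d).toReal ≤ (2 : ℝ) ^ (-β)

/-! ## The unsalted ring signature -/

/-- Hash functions: a pair of a ring `ρ` and a message is mapped into the range of `f_ρ`. The
random oracle is a uniformly random element of this finite type. -/
abbrev Hash (pp : Bits P.ppLen) : Type := (x : P.Rng × P.Msg) → P.Ran pp x.1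

/-- Signing without salt: `SamplePre(ρ, sk, H(ρ, m))`. -/
def sign {pp : Bits P.ppLen} (H : P.Hash pp) (sk : Bits P.trapLen) (ρ : P.Rng) (m : P.Msg) :
    PMF (P.Dom pp ρ) :=
  P.SamplePre pp ρ sk (H (ρ, m))

/-- Verification without salt: `σ` lies in the domain and `f_ρ(σ) = H(ρ, m)`. -/
def Verify {pp : Bits P.ppLen} (H : P.Hash pp) (ρ : P.Rng) (m : P.Msg) (σ : Bits P.domLen) :
    Prop :=
  ∃ h : σ ∈ P.Dom pp ρ, P.f pp ρ ⟨σ, h⟩ = H (ρ, m)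

/-! ## The public algorithms and the hash function on bit strings

Strings that are not well-formed inputs are mapped to the zero string. -/

/-- `(ρ, d) ↦ f_ρ(d)`. -/
def fBits (pp : Bits P.ppLen) (x : P.RIdx ⊕ Fin P.domLen → Bool) : Bits P.ranLen :=
  match decode encRing (x ∘ Sum.inl) with
  | none => fun _ => false
  | some ρ => if h : x ∘ Sum.inr ∈ P.Dom pp ρ then (P.f pp ρ ⟨_, h⟩).1 else fun _ => false

/-- `(ρ, c) ↦ SampleDom(ρ; c)`. -/
def sampleDomBits (pp : Bits P.ppLen) (x : P.RIdx ⊕ Fin P.coinLen → Bool) : Bits P.domLen :=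
  match decode encRing (x ∘ Sum.inl) with
  | none => fun _ => false
  | some ρ => (P.SampleDom pp ρ (x ∘ Sum.inr)).1

/-- `(ρ, m) ↦ H(ρ, m)`. -/
def hashBits {pp : Bits P.ppLen} (H : P.Hash pp) (x : P.RIdx ⊕ Fin P.msgLen → Bool) :
    Bits P.ranLen :=
  match decode encRing (x ∘ Sum.inl) with
  | none => fun _ => false
  | some ρ => (H (ρ, x ∘ Sum.inr)).1

end RPSF

/-! ## Quantum circuits with oracle gates -/

/-- Amplitudes of a (sub-normalised) pure state of `W` qubits. -/
abbrev QState (W : ℕ) : Type := Bits W → ℂ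

/-- The computational basis state `b`. -/
def basisState {W : ℕ} (b : Bits W) : QState W := Pi.single b 1

/-- A unitary acting on the three wires `w`. -/
def applyGate {W : ℕ} (w : Fin 3 ↪ Fin W) (U : Matrix.unitaryGroup (Bits 3) ℂ) (ψ : QState W) :
    QState W :=
  fun b => ∑ u : Bits 3, U.1 (b ∘ w) u * ψ (Function.extend w u b)

/-- The string `b` with `y` added (bitwise, modulo 2) on the wires `w`. -/
def xorOn {W : ℕ} {O : Type} (w : O ↪ Fin W) (y : O → Bool) (b : Bits W) : Bits W :=
  fun i => xor (b i) (Function.extend w y (fun _ => false) i)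

/-- The unitary `|x⟩|y⟩ ↦ |x⟩|y ⊕ F(x)⟩` on an input register and a disjoint output register. As the
underlying permutation of basis states is an involution, it acts on amplitudes by composition. -/
def applyOracle {W : ℕ} {I O : Type} (w : I ⊕ O ↪ Fin W) (F : (I → Bool) → O → Bool)
    (ψ : QState W) : QState W :=
  fun b => ψ (xorOn (Function.Embedding.inr.trans w) (F (b ∘ w ∘ Sum.inl)) b)

/-- Adding a fixed string `y` on the wires `w`. -/
def applyXor {W : ℕ} {O : Type} (w : O ↪ Fin W) (y : O → Bool) (ψ : QState W) : QState W :=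
  fun b => ψ (xorOn w y b)

/-- The unnormalised state after a measurement of the wires `w` with outcome `x`. -/
def project {W : ℕ} {I : Type} (w : I → Fin W) (x : I → Bool) (ψ : QState W) : QState W :=
  fun b => if b ∘ w = x then ψ b else 0

/-- Elementary operations available to every adversary, each of cost one: three-qubit unitaries,
measurement of a qubit, evaluation of the public algorithms `f` and `SampleDom`, and a quantum
query to the random oracle. -/
inductive QOp (P : RPSF) (W : ℕ) : Type
  | gate (w : Fin 3 ↪ Fin W) (U : Matrix.unitaryGroup (Bits 3) ℂ)
  | measure (i : Fin W)
  | evalF (w : (P.RIdx ⊕ Fin P.domLen) ⊕ Fin P.ranLen ↪ Fin W)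
  | sampleDom (w : (P.RIdx ⊕ Fin P.coinLen) ⊕ Fin P.domLen ↪ Fin W)
  | hash (w : (P.RIdx ⊕ Fin P.msgLen) ⊕ Fin P.ranLen ↪ Fin W)

/-- Effect of an elementary operation: the list of unnormalised states, one for each measurement
outcome. -/
def QOp.branches {P : RPSF} {W : ℕ} (pp : Bits P.ppLen) (H : P.Hash pp) :
    QOp P W → QState W → List (QState W)
  | .gate w U, ψ => [applyGate w U ψ]
  | .measure i, ψ =>
      [project (fun _ : Unit => i) (fun _ => false) ψ,
        project (fun _ : Unit => i) (fun _ => true) ψ]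
  | .evalF w, ψ => [applyOracle w (P.fBits pp) ψ]
  | .sampleDom w, ψ => [applyOracle w (P.sampleDomBits pp) ψ]
  | .hash w, ψ => [applyOracle w (P.hashBits H) ψ]

/-- Probability that measuring all qubits of `ψ` yields a string that satisfies `p`. -/
def probOf {W : ℕ} (p : Bits W → Prop) (ψ : QState W) : ℝ :=
  ∑ b, if p b then ‖ψ b‖ ^ 2 else 0

/-- The input of an adversary: the public parameters and `n` public keys. -/
def inputBits {P : RPSF} {n : ℕ} (pp : Bits P.ppLen) (kp : Fin n → P.KeyPair) :
    Fin P.ppLen ⊕ Fin n × Fin P.keyLen → Bool :=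
  Sum.elim pp (fun x => (kp x.1).1 x.2)

/-- Initial state: the input is written on the wires `inp`, all other wires are zero. -/
def initState {P : RPSF} {n W : ℕ} (inp : (Fin P.ppLen ⊕ Fin n × Fin P.keyLen) ↪ Fin W)
    (pp : Bits P.ppLen) (kp : Fin n → P.KeyPair) : QState W :=
  basisState (Function.extend inp (inputBits pp kp) (fun _ => false))

/-- Expectation over the public parameters, `n` independent key pairs and the random oracle. -/
def RPSF.gameExpect (P : RPSF) (n : ℕ)
    (g : (pp : Bits P.ppLen) → (Fin n → P.KeyPair) → P.Hash pp → ℝ) : ℝ :=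
  expect P.Stp fun pp =>
    ∑ kp : Fin n → P.KeyPair, (∏ i, (P.TpdGen pp (kp i)).toReal) *
      expect (PMF.uniformOfFintype (P.Hash pp)) fun H => g pp kp H

/-- `ρ` is contained in the set of the public keys of `kp`. -/
def RingIn {P : RPSF} {n : ℕ} (kp : Fin n → P.KeyPair) (ρ : P.Rng) : Prop :=
  ∀ i, ∃ j, (kp j).1 = ρ.2 i

/-! ## Collision resistance -/

/-- Collision adversaries: circuits on `W` qubits that receive the public parameters and `κ` public
values, and output two strings and a ring. -/
structure ColAdversary (P : RPSF) where
  W : ℕ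
  inp : (Fin P.ppLen ⊕ Fin P.κ × Fin P.keyLen) ↪ Fin W
  out : P.RIdx ⊕ (Fin P.domLen ⊕ Fin P.domLen) ↪ Fin W
  prog : List (QOp P W)

/-- Number of qubits plus number of elementary operations. -/
def ColAdversary.size {P : RPSF} (B : ColAdversary P) : ℕ := B.W + B.prog.length

/-- Run a list of operations and sum the final values `fin` of all branches. -/
def runOps {P : RPSF} {W : ℕ} (pp : Bits P.ppLen) (H : P.Hash pp) (fin : QState W → ℝ) :
    List (QOp P W) → QState W → ℝ
  | [], ψ => fin ψ
  | o :: os, ψ => ((o.branches pp H ψ).map (fun φ => runOps pp H fin os φ)).sum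

/-- The output `(ρ', d₁, d₂)` satisfies `ρ' ⊆ ρ`, `d₁ ≠ d₂` and `f_ρ'(d₁) = f_ρ'(d₂)`. -/
def ColWins {P : RPSF} {n : ℕ} (pp : Bits P.ppLen) (kp : Fin n → P.KeyPair)
    (x : P.RIdx ⊕ (Fin P.domLen ⊕ Fin P.domLen) → Bool) : Prop :=
  ∃ ρ : P.Rng, encRing ρ = x ∘ Sum.inl ∧ RingIn kp ρ ∧
    ∃ d₁ d₂ : P.Dom pp ρ, d₁.1 = x ∘ Sum.inr ∘ Sum.inl ∧ d₂.1 = x ∘ Sum.inr ∘ Sum.inr ∧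
      d₁ ≠ d₂ ∧ P.f pp ρ d₁ = P.f pp ρ d₂

/-- The collision advantage of `B`. -/
def ColAdversary.adv {P : RPSF} (B : ColAdversary P) : ℝ :=
  P.gameExpect P.κ fun pp kp H =>
    runOps pp H (probOf fun b => ColWins pp kp (b ∘ B.out)) B.prog (initState B.inp pp kp)

/-! ## One-per-message weak unforgeability -/

/-- Operations of a forger: elementary operations and classical signing queries. A signing query
reads a ring, the signer's position in it and a message; the answer register has a flag bit `none`
(unchanged by the answer `⊥`) and the bits of the signature. -/
inductive ForgerOp (P : RPSF) (W : ℕ) : Type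
  | op (o : QOp P W)
  | sign (w : (P.RIdx ⊕ (Fin P.κ ⊕ Fin P.msgLen)) ⊕ Option (Fin P.domLen) ↪ Fin W)

/-- Is the operation a signing query? -/
def ForgerOp.isSign {P : RPSF} {W : ℕ} : ForgerOp P W → Bool
  | .sign _ => true
  | _ => false

/-- Is the operation a hash query? -/
def ForgerOp.isHash {P : RPSF} {W : ℕ} : ForgerOp P W → Bool
  | .op (.hash _) => true
  | _ => false

/-- Forgers: circuits on `W` qubits that receive the public parameters and `N` public keys, and
output a ring, a message and a signature. -/
structure Forger (P : RPSF) (N : ℕ) where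
  W : ℕ
  inp : (Fin P.ppLen ⊕ Fin N × Fin P.keyLen) ↪ Fin W
  out : P.RIdx ⊕ (Fin P.msgLen ⊕ Fin P.domLen) ↪ Fin W
  prog : List (ForgerOp P W)

/-- Number of qubits plus number of operations. -/
def Forger.size {P : RPSF} {N : ℕ} (A : Forger P N) : ℕ := A.W + A.prog.length

/-- Number of signing queries. -/
def Forger.signQueries {P : RPSF} {N : ℕ} (A : Forger P N) : ℕ := A.prog.countP ForgerOp.isSign

/-- Number of (quantum) hash queries. -/
def Forger.hashQueries {P : RPSF} {N : ℕ} (A : Forger P N) : ℕ := A.prog.countP ForgerOp.isHash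

/-- The check of the signing oracle, given the list `L` of the pairs signed so far: `none` means
that the query is answered by `⊥`; otherwise the result is the ring, the message and the index `j`
of a key pair of the game that belongs to the named member of the ring. -/
def signCheck {P : RPSF} {N : ℕ} (qs : ℕ) (kp : Fin N → P.KeyPair) (L : List (P.Rng × P.Msg))
    (x : P.RIdx ⊕ (Fin P.κ ⊕ Fin P.msgLen) → Bool) : Option (P.Rng × P.Msg × Fin N) :=
  match decode encRing (x ∘ Sum.inl), decode encPos (x ∘ Sum.inr ∘ Sum.inl) with
  | some ρ, some i =>
      let m : P.Msg := x ∘ Sum.inr ∘ Sum.inr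
      if h : ∃ j, ∃ hi : i.1 < ρ.1.1 + 1, (kp j).1 = ρ.2 ⟨i.1, hi⟩ then
        if L.length = qs ∨ (ρ, m) ∈ L then none else some (ρ, m, h.choose)
      else none
  | _, _ => none

/-- The answer register receives the flag `true` and the signature. -/
def signAnswer {n : ℕ} (σ : Bits n) : Option (Fin n) → Bool
  | none => true
  | some i => σ i

/-- Run a forger and sum the final values `fin` of all branches, weighted by the probabilities of
the signatures. -/
def runForger {P : RPSF} {N W : ℕ} (qs : ℕ) (pp : Bits P.ppLen) (kp : Fin N → P.KeyPair)
    (H : P.Hash pp) (fin : List (P.Rng × P.Msg) → QState W → ℝ) :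
    List (ForgerOp P W) → List (P.Rng × P.Msg) → QState W → ℝ
  | [], L, ψ => fin L ψ
  | .op o :: os, L, ψ => ((o.branches pp H ψ).map (fun φ => runForger qs pp kp H fin os L φ)).sum
  | .sign w :: os, L, ψ =>
      ∑ x : P.RIdx ⊕ (Fin P.κ ⊕ Fin P.msgLen) → Bool,
        match signCheck qs kp L x with
        | none => runForger qs pp kp H fin os L (project (w ∘ Sum.inl) x ψ)
        | some (ρ, m, j) =>
            expect (P.sign H (kp j).2 ρ m) fun σ =>
              runForger qs pp kp H fin os ((ρ, m) :: L)
                (applyXor (Function.Embedding.inr.trans w) (signAnswer σ.1)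
                  (project (w ∘ Sum.inl) x ψ))

/-- The output `(ρ*, m*, σ*)` is a valid signature with `ρ* ⊆ ρ` and `(ρ*, m*)` not signed
before. -/
def Forges {P : RPSF} {N : ℕ} {pp : Bits P.ppLen} (kp : Fin N → P.KeyPair) (H : P.Hash pp)
    (L : List (P.Rng × P.Msg)) (x : P.RIdx ⊕ (Fin P.msgLen ⊕ Fin P.domLen) → Bool) : Prop :=
  ∃ ρ : P.Rng, encRing ρ = x ∘ Sum.inl ∧ RingIn kp ρ ∧ (ρ, x ∘ Sum.inr ∘ Sum.inl) ∉ L ∧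
    P.Verify H ρ (x ∘ Sum.inr ∘ Sum.inl) (x ∘ Sum.inr ∘ Sum.inr)

/-- The `UF-CRA1` advantage of `A` in the quantum random oracle model, with at most `qs` signing
queries. -/
def Forger.adv {P : RPSF} {N : ℕ} (A : Forger P N) (qs : ℕ) : ℝ :=
  P.gameExpect N fun pp kp H =>
    runForger qs pp kp H (fun L => probOf fun b => Forges kp H L (b ∘ A.out)) A.prog []
      (initState A.inp pp kp)

end

/-! A collision finder can answer the forger without any trapdoor. For a ring `ρ` that contains a
key of the game, it programs the hash value at `(ρ, m)` as `f_ρ(d)` with `d = SampleDom(ρ; G(ρ, m))`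
and returns `d` as the signature; for other rings it uses its own random oracle. A forgery `σ` at an
unsigned pair has the same image as `d`. If `σ ≠ d`, this is a collision. The case `σ = d` has
probability at most `2 ^ (-β)`, because before the output only the image of `d` has been revealed.

The real game is led to this one by three changes. (1) Hash values become images of sampled
elements. All values of the oracle change their law at once, so `abs_piExp_sub_le` writes both
oracles as independent perturbations of a common random table, each point being altered with
probability at most `ε`. For a fixed table, `sum_abs_runWith_sub_le` is a hybrid argument over the
queries: a superposition query costs about `√ε`, a signing query and the verification cost `ε` each.
The loss is measured by `quadBound`, a weighted form of `‖ψ - φ‖ ‖ψ + φ‖` that adds up over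
measurement outcomes. (2) Signatures are drawn from the conditional distribution instead of
`SamplePre`. The loss per signature is additive (`abs_runWith_sub_le_of_statDist`) or, for Rényi
divergence, a factor under a power (`runWith_le_of_renyi`). (3) Since a pair is signed at most once,
all signatures may be drawn in advance (`piExp_runWith_pointSign`); `condVal_le` then separates `σ =
d` from `σ ≠ d`, and Bayes' rule (`piExp_imageWeight_condWeight`) generates image and preimage
jointly from coins.

A truly random `G` is too large for a circuit. The probability of a useful forgery is a linear
combination of functions of at most `2q + 1` values of `G`, where `q` is the number of operations
(`runWith_mem_juntaSpan`). Hence the values of a random polynomial with `2q + 1` coefficients over a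
field of characteristic two give exactly the same average (`kWise_polyFun`, `KWise.sum_eq`). Some
fixed polynomial does at least as well as the average and is built into the circuit. This choice
refers to no security parameter, so one adversary serves all bounds.

The rest is explicit circuit building: straight-line programs decide the checks of the signing
oracle and evaluate the polynomial, they are run reversibly on clean cells, and `exists_simulation`
shows that the resulting circuit reproduces the forger's run.

The term `8 (q_s + q_H) √(2ε)` leaves no room for step (1) if there are no queries. In that case a
forgery guesses a uniform range element. By Cauchy–Schwarz its probability is at most the
probability that two independent domain samples have equal images (`inv_card_le_collision`); either
the samples agree, or they collide. -/

noncomputable section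

open scoped Classical NNReal ENNReal

/-! ## Expectations over finite products -/

/-- Expectation of `g` over a product of finite (sub)distributions with weights `w x`. -/
def piExp {X : Type} [Fintype X] [DecidableEq X] {D : X → Type} [∀ x, Fintype (D x)] (w : ∀ x, D x → ℝ)
    (g : (∀ x, D x) → ℝ) : ℝ :=
  ∑ d, (∏ x, w x (d x)) * g d

/-- The weights `w` form a probability distribution. -/
def IsDist {D : Type} [Fintype D] (w : D → ℝ) : Prop := (∀ a, 0 ≤ w a) ∧ ∑ a, w a = 1

theorem isDist_toReal {D : Type} [Fintype D] (p : PMF D) : IsDist fun a => (p a).toReal := by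
  refine ⟨fun a => ENNReal.toReal_nonneg, ?_⟩
  rw [← ENNReal.toReal_sum (fun a _ => p.apply_ne_top a)]
  have := p.tsum_coe
  rw [tsum_fintype] at this
  simp [this]

theorem isDist_uniform (D : Type) [Fintype D] [Nonempty D] :
    IsDist fun _ : D => (Fintype.card D : ℝ)⁻¹ := by
  refine ⟨fun _ => by positivity, ?_⟩
  simp [Finset.card_univ]

section Pi

variable {X : Type} [Fintype X] [DecidableEq X] {D : X → Type} [∀ x, Fintype (D x)]

theorem sum_pi_prod (w : ∀ x, D x → ℝ) : ∑ d : ∀ x, D x, ∏ x, w x (d x) = ∏ x, ∑ a, w x a := by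
  rw [Finset.prod_univ_sum, Fintype.piFinset_univ]

theorem IsDist.pi {w : ∀ x, D x → ℝ} (hw : ∀ x, IsDist (w x)) :
    IsDist fun d : ∀ x, D x => ∏ x, w x (d x) := by
  refine ⟨fun d => Finset.prod_nonneg fun x _ => (hw x).1 _, ?_⟩
  rw [sum_pi_prod]
  exact Finset.prod_eq_one fun x _ => (hw x).2

theorem piExp_const {w : ∀ x, D x → ℝ} (hw : ∀ x, IsDist (w x)) (c : ℝ) :
    piExp w (fun _ => c) = c := by
  rw [piExp, ← Finset.sum_mul, (IsDist.pi hw).2, one_mul]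

theorem piExp_mono {w : ∀ x, D x → ℝ} (hw : ∀ x, IsDist (w x)) {g g' : (∀ x, D x) → ℝ}
    (h : ∀ d, (∀ x, w x (d x) ≠ 0) → g d ≤ g' d) : piExp w g ≤ piExp w g' := by
  refine Finset.sum_le_sum fun d _ => ?_
  by_cases h0 : ∏ x, w x (d x) = 0
  · simp [h0]
  · exact mul_le_mul_of_nonneg_left
      (h d fun x => (Finset.prod_ne_zero_iff.1 h0) x (Finset.mem_univ _)) ((IsDist.pi hw).1 d)

theorem piExp_congr {w : ∀ x, D x → ℝ} {g g' : (∀ x, D x) → ℝ}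
    (h : ∀ d, (∀ x, w x (d x) ≠ 0) → g d = g' d) : piExp w g = piExp w g' := by
  refine Finset.sum_congr rfl fun d _ => ?_
  by_cases h0 : ∏ x, w x (d x) = 0
  · simp [h0]
  · rw [h d fun x => (Finset.prod_ne_zero_iff.1 h0) x (Finset.mem_univ _)]

theorem piExp_add (w : ∀ x, D x → ℝ) (g g' : (∀ x, D x) → ℝ) :
    piExp w (fun d => g d + g' d) = piExp w g + piExp w g' := by
  simp [piExp, mul_add, Finset.sum_add_distrib]

theorem piExp_sub (w : ∀ x, D x → ℝ) (g g' : (∀ x, D x) → ℝ) :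
    piExp w (fun d => g d - g' d) = piExp w g - piExp w g' := by
  simp [piExp, mul_sub, Finset.sum_sub_distrib]

theorem piExp_const_mul (w : ∀ x, D x → ℝ) (c : ℝ) (g : (∀ x, D x) → ℝ) :
    piExp w (fun d => c * g d) = c * piExp w g := by
  rw [piExp, piExp, Finset.mul_sum]
  exact Finset.sum_congr rfl fun d _ => by ring

theorem piExp_sum {I : Type} (s : Finset I) (w : ∀ x, D x → ℝ) (g : I → (∀ x, D x) → ℝ) :
    piExp w (fun d => ∑ i ∈ s, g i d) = ∑ i ∈ s, piExp w (g i) := by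
  simp only [piExp, Finset.mul_sum]
  exact Finset.sum_comm

theorem piExp_list_sum {I : Type} (l : List I) (w : ∀ x, D x → ℝ) (g : I → (∀ x, D x) → ℝ) :
    piExp w (fun d => (l.map fun i => g i d).sum) = (l.map fun i => piExp w (g i)).sum := by
  induction l with
  | nil => simp [piExp]
  | cons a l ih => simp [piExp_add, ih]

theorem abs_piExp_le {w : ∀ x, D x → ℝ} (hw : ∀ x, IsDist (w x)) (g : (∀ x, D x) → ℝ) :
    |piExp w g| ≤ piExp w fun d => |g d| := by
  refine (Finset.abs_sum_le_sum_abs _ _).trans (le_of_eq ?_)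
  exact Finset.sum_congr rfl fun d _ => by rw [abs_mul, abs_of_nonneg ((IsDist.pi hw).1 d)]

/-- Sampling through a kernel, coordinate by coordinate. -/
theorem piExp_kernel {E : X → Type} [∀ x, Fintype (E x)] (c : ∀ x, D x → ℝ)
    (k : ∀ x, D x → E x → ℝ) (g : (∀ x, E x) → ℝ) :
    piExp (fun x b => ∑ a, c x a * k x a b) g
      = piExp c fun d => piExp (fun x b => k x (d x) b) g := by
  simp only [piExp, Finset.mul_sum]
  rw [Finset.sum_comm]
  refine Finset.sum_congr rfl fun e _ => ?_
  rw [← sum_pi_prod (fun x a => c x a * k x a (e x)), Finset.sum_mul]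
  refine Finset.sum_congr rfl fun d _ => ?_
  rw [Finset.prod_mul_distrib, mul_assoc]

theorem piExp_pointMass [∀ x, DecidableEq (D x)] (c : ∀ x, D x) (g : (∀ x, D x) → ℝ) :
    piExp (fun x b => if c x = b then 1 else 0) g = g c := by
  rw [piExp, Finset.sum_eq_single c]
  · simp
  · intro d _ hd
    obtain ⟨x, hx⟩ := Function.ne_iff.1 hd
    rw [Finset.prod_eq_zero (Finset.mem_univ x), zero_mul]
    simp [Ne.symm hx]
  · simp

/-- Push-forward, coordinate by coordinate. -/
theorem piExp_map {E : X → Type} [∀ x, Fintype (E x)] [∀ x, DecidableEq (E x)] (c : ∀ x, D x → ℝ)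
    (t : ∀ x, D x → E x) (g : (∀ x, E x) → ℝ) :
    piExp c (fun d => g fun x => t x (d x))
      = piExp (fun x b => ∑ a, c x a * if t x a = b then 1 else 0) g := by
  rw [piExp_kernel]
  exact piExp_congr fun d _ => (piExp_pointMass (fun x => t x (d x)) g).symm

/-- A coordinate may be resampled if the rest of the expression does not depend on it. -/
theorem piExp_resample {w : ∀ x, D x → ℝ} (x : X) (hw : ∑ a, w x a = 1)
    (g : D x → (∀ x, D x) → ℝ) (hg : ∀ a d b, g a (Function.update d x b) = g a d) :
    piExp w (fun d => g (d x) d) = ∑ a, w x a * piExp w (g a) := by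
  have key : ∀ (d : ∀ x, D x) (a : D x),
      w x (d x) * ∏ y, w y (Function.update d x a y) = w x a * ∏ y, w y (d y) := by
    intro d a
    rw [← Finset.mul_prod_erase _ _ (Finset.mem_univ x),
      ← Finset.mul_prod_erase _ (fun y => w y (d y)) (Finset.mem_univ x), Function.update_self]
    rw [Finset.prod_congr rfl fun y hy => by
      rw [Function.update_of_ne (Finset.ne_of_mem_erase hy)]]
    ring
  -- Exchanging the coordinate at `x` with a fresh draw, `(d, a) ↦ (update d x a, d x)`, is an
  -- involution that preserves the total weight by `key`.
  have swap : ∑ p : (∀ x, D x) × D x, w x p.2 * ((∏ y, w y (p.1 y)) * g p.2 p.1)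
      = ∑ p : (∀ x, D x) × D x, w x p.2 * ((∏ y, w y (p.1 y)) * g (p.1 x) p.1) := by
    refine Finset.sum_nbij' (fun p => (Function.update p.1 x p.2, p.1 x))
      (fun p => (Function.update p.1 x p.2, p.1 x)) (by simp) (by simp) (by simp) (by simp) ?_
    rintro ⟨d, a⟩ _
    simp only [Function.update_self, hg]
    rw [← mul_assoc, ← mul_assoc, key]
  rw [Fintype.sum_prod_type_right, Fintype.sum_prod_type_right] at swap
  simp only [← Finset.mul_sum, ← Finset.sum_mul] at swap
  rw [hw, one_mul] at swap
  exact swap.symm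

theorem piExp_coord {w : ∀ x, D x → ℝ} (hw : ∀ x, IsDist (w x)) (x : X) (g : D x → ℝ) :
    piExp w (fun d => g (d x)) = ∑ a, w x a * g a := by
  rw [piExp_resample x (hw x).2 (fun a _ => g a) (fun _ _ _ => rfl)]
  simp only [piExp_const hw]

/-- Two product distributions with close factors arise from a common product distribution by
changing each coordinate with small probability only. -/
theorem abs_piExp_sub_le [∀ x, DecidableEq (D x)] {u v : ∀ x, D x → ℝ} (hu : ∀ x, IsDist (u x)) (hv : ∀ x, IsDist (v x))
    {ε B : ℝ} (hε : ε < 1) (huv : ∀ x, (∑ a, |u x a - v x a|) / 2 ≤ ε) (g : (∀ x, D x) → ℝ)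
    (hB : ∀ (c : ∀ x, D x) (k : ∀ x, D x → ℝ), (∀ x, IsDist (k x)) →
      (∀ x, (∑ b, k x b * if b ≠ c x then 1 else 0) ≤ ε) → piExp k (fun d => |g d - g c|) ≤ B) :
    |piExp u g - piExp v g| ≤ 2 * B := by
  -- The pointwise minimum is the mass shared by `u x` and `v x`, and its deficit `δ x` is their
  -- statistical distance. As `ε < 1`, the shared part can be normalised to a distribution `c x`.
  set mn : ∀ x, D x → ℝ := fun x a => min (u x a) (v x a) with hmn
  set δ : X → ℝ := fun x => 1 - ∑ a, mn x a with hδ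
  have hδ' : ∀ x, δ x = (∑ a, |u x a - v x a|) / 2 := by
    intro x
    have h1 : ∀ a, mn x a = (u x a + v x a - |u x a - v x a|) / 2 := fun a => by
      simp only [hmn]
      rcases le_total (u x a) (v x a) with h | h
      · rw [min_eq_left h, abs_of_nonpos (by linarith)]; ring
      · rw [min_eq_right h, abs_of_nonneg (by linarith)]; ring
    simp only [hδ, h1]
    rw [← Finset.sum_div, Finset.sum_sub_distrib, Finset.sum_add_distrib, (hu x).2, (hv x).2]
    ring
  have hδ1 : ∀ x, δ x ≤ ε := fun x => (hδ' x).trans_le (huv x)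
  have hδ0 : ∀ x, 0 ≤ δ x := fun x => by rw [hδ' x]; positivity
  have hmass : ∀ x, ∑ a, mn x a = 1 - δ x := fun x => by simp [hδ]
  have hpos : ∀ x, 0 < 1 - δ x := fun x => by linarith [hδ1 x]
  set c : ∀ x, D x → ℝ := fun x a => mn x a / (1 - δ x) with hc
  have hcd : ∀ x, IsDist (c x) := by
    intro x
    refine ⟨fun a => div_nonneg (le_min ((hu x).1 a) ((hv x).1 a)) (hpos x).le, ?_⟩
    simp only [hc]
    rw [← Finset.sum_div, hmass, div_self (hpos x).ne']
  have main : ∀ z : ∀ x, D x → ℝ, (∀ x, IsDist (z x)) → (∀ x a, mn x a ≤ z x a) →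
      |piExp z g - piExp c g| ≤ B := by
    intro z hz hmz
    -- The kernel keeps `a` with probability `1 - δ x` and otherwise draws from the residual `z x -
    -- mn x`, which has mass `δ x`. It maps `c` to `z` and moves a coordinate with probability at
    -- most `ε`.
    set k : ∀ x, D x → D x → ℝ := fun x a b =>
      (1 - δ x) * (if a = b then 1 else 0) + (z x b - mn x b) with hk
    have hkd : ∀ x a, IsDist (k x a) := by
      intro x a
      refine ⟨fun b => ?_, ?_⟩
      · have := hmz x b
        have := hpos x
        simp only [hk]
        split_ifs <;> simp <;> linarith
      · simp only [hk]
        rw [Finset.sum_add_distrib, ← Finset.mul_sum, Finset.sum_sub_distrib, hmass, (hz x).2]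
        simp
    have hzk : z = fun x b => ∑ a, c x a * k x a b := by
      funext x b
      simp only [hk, mul_add, Finset.sum_add_distrib, ← Finset.sum_mul, (hcd x).2]
      simp only [hc, mul_ite, mul_one, mul_zero, Finset.sum_ite_eq', Finset.mem_univ, if_true]
      rw [div_mul_cancel₀ _ (hpos x).ne']
      ring
    have e1 : piExp z g = piExp c fun d => piExp (fun x b => k x (d x) b) g := by
      conv_lhs => rw [hzk]
      exact piExp_kernel c k g
    rw [e1, ← piExp_sub]
    refine (abs_piExp_le hcd _).trans ?_
    refine (piExp_mono hcd (g' := fun _ => B) fun d _ => ?_).trans_eq (piExp_const hcd B)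
    have hkd' : ∀ x, IsDist (k x (d x)) := fun x => hkd x (d x)
    have e2 : piExp (fun x b => k x (d x) b) g - g d
        = piExp (fun x b => k x (d x) b) fun e => g e - g d := by
      rw [piExp_sub, piExp_const hkd']
    rw [e2]
    refine (abs_piExp_le hkd' _).trans (hB d _ hkd' fun x => ?_)
    refine le_trans ?_ (hδ1 x)
    calc ∑ b, k x (d x) b * (if b ≠ d x then 1 else 0) ≤ ∑ b, (z x b - mn x b) := by
          refine Finset.sum_le_sum fun b _ => ?_
          have := hmz x b
          by_cases hb : b = d x
          · simp [hb]; exact hmz _ _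
          · simp [hb, hk, Ne.symm hb]
      _ = δ x := by rw [Finset.sum_sub_distrib, hmass, (hz x).2]; ring
  have h1 := main u hu fun x a => min_le_left _ _
  have h2 := main v hv fun x a => min_le_right _ _
  calc |piExp u g - piExp v g| = |(piExp u g - piExp c g) - (piExp v g - piExp c g)| := by ring_nf
    _ ≤ |piExp u g - piExp c g| + |piExp v g - piExp c g| := abs_sub _ _
    _ ≤ 2 * B := by linarith

end Pi

/-- Marginal of a product distribution. -/
theorem sum_prod_comp_embedding {I J K : Type} [Fintype I] [Fintype J] [Fintype K]
    [DecidableEq I] [DecidableEq J] (j : I ↪ J)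
    {w : K → ℝ} (hw : ∑ a, w a = 1) (g : (I → K) → ℝ) :
    ∑ d : J → K, (∏ y, w (d y)) * g (d ∘ j) = ∑ e : I → K, (∏ x, w (e x)) * g e := by
  have h1 : ∀ d : J → K, (∏ y, w (d y)) * g (d ∘ j)
      = ∑ e : I → K, (if d ∘ j = e then ∏ y, w (d y) else 0) * g e := by
    intro d
    simp
  simp only [h1]
  rw [Finset.sum_comm]
  refine Finset.sum_congr rfl fun e _ => ?_
  rw [← Finset.sum_mul]
  congr 1
  -- The condition `d ∘ j = e` factors over the coordinates: those outside the range of `j` are free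
  -- and sum to one.
  have h2 : ∀ d : J → K, (if d ∘ j = e then ∏ y, w (d y) else 0)
      = ∏ y, (if ∀ x, j x = y → d y = e x then w (d y) else 0) := by
    intro d
    by_cases h : d ∘ j = e
    · rw [if_pos h]
      refine Finset.prod_congr rfl fun y _ => ?_
      rw [if_pos]
      rintro x rfl
      exact congrFun h x
    · rw [if_neg h]
      obtain ⟨x, hx⟩ := Function.ne_iff.1 h
      exact (Finset.prod_eq_zero (Finset.mem_univ (j x))
        (if_neg fun hc => hx (hc x rfl))).symm
  simp only [h2]
  rw [sum_pi_prod (fun y a => if ∀ x, j x = y → a = e x then w a else 0)]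
  rw [← Finset.prod_subset (Finset.subset_univ (Finset.univ.map j))]
  · rw [Finset.prod_map]
    refine Finset.prod_congr rfl fun x _ => ?_
    simp
  · intro y _ hy
    have h3 : ∀ x, j x ≠ y := fun x hx => hy (by simp [← hx])
    simp only [h3, IsEmpty.forall_iff, implies_true, if_true, hw]

/-- Jensen's inequality for powers with exponent at most one. -/
theorem sum_mul_rpow_le {I : Type} (s : Finset I) {w v : I → ℝ} (hw : ∀ i ∈ s, 0 ≤ w i)
    (hw1 : ∑ i ∈ s, w i = 1) (hv : ∀ i ∈ s, 0 ≤ v i) {γ : ℝ} (h0 : 0 ≤ γ) (h1 : γ ≤ 1) :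
    ∑ i ∈ s, w i * v i ^ γ ≤ (∑ i ∈ s, w i * v i) ^ γ := by
  have := (Real.concaveOn_rpow h0 h1).le_map_sum hw hw1 (fun i hi => hv i hi)
  simpa using this

/-! ## Encodings -/

theorem decode_eq_some_iff {α β : Type} {enc : α → β} (he : Function.Injective enc) {b : β}
    {a : α} : decode enc b = some a ↔ enc a = b := by
  unfold decode
  constructor
  · intro h
    split_ifs at h with hx
    rw [← Option.some.inj h]
    exact hx.choose_spec
  · intro h
    have hx : ∃ a, enc a = b := ⟨a, h⟩
    rw [dif_pos hx]
    exact congrArg some (he (hx.choose_spec.trans h.symm))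

theorem decode_eq_none_iff {α β : Type} {enc : α → β} {b : β} :
    decode enc b = none ↔ ∀ a, enc a ≠ b := by
  unfold decode
  split_ifs with h
  · simpa using h
  · simpa using h

theorem decode_enc {α β : Type} {enc : α → β} (he : Function.Injective enc) (a : α) :
    decode enc (enc a) = some a := (decode_eq_some_iff he).2 rfl

theorem encPos_injective {κ : ℕ} : Function.Injective (encPos (κ := κ)) := by
  intro i j h
  have := congrFun h i
  simpa [encPos] using this

/-- All that the inductions on runs need about an answered query: membership of a game key gives
access to the trapdoor hypotheses, and freshness makes sampling in advance possible. -/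
theorem signCheck_eq_some {P : RPSF} {N : ℕ} {qs : ℕ} {kp : Fin N → P.KeyPair}
    {L : List (P.Rng × P.Msg)} {x : P.RIdx ⊕ (Fin P.κ ⊕ Fin P.msgLen) → Bool} {ρ : P.Rng}
    {m : P.Msg} {j : Fin N} (h : signCheck qs kp L x = some (ρ, m, j)) :
    encRing ρ = x ∘ Sum.inl ∧ m = x ∘ Sum.inr ∘ Sum.inr ∧ ρ.Has (kp j).1 ∧ (ρ, m) ∉ L := by
  unfold signCheck at h
  split at h
  · rename_i ρ' i h1 h2
    simp only at h
    split_ifs at h with h3 h4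
    · simp only [Option.some.injEq, Prod.mk.injEq] at h
      obtain ⟨rfl, rfl, rfl⟩ := h
      obtain ⟨hi, hk⟩ := h3.choose_spec
      exact ⟨(decode_eq_some_iff encRing_injective).1 h1, rfl, ⟨_, hk.symm⟩,
        fun hL => h4 (Or.inr hL)⟩
  · simp at h

/-! ## Norms of quantum states -/

/-- Squared norm. -/
def normSqr {W : ℕ} (ψ : QState W) : ℝ := ∑ b, ‖ψ b‖ ^ 2

theorem normSqr_nonneg {W : ℕ} (ψ : QState W) : 0 ≤ normSqr ψ :=
  Finset.sum_nonneg fun _ _ => by positivity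

theorem normSqr_basisState {W : ℕ} (b : Bits W) : normSqr (basisState b) = 1 := by
  rw [normSqr, Finset.sum_eq_single b] <;> simp +contextual [basisState]

theorem extend_override {W : ℕ} {J : Type} (w : J ↪ Fin W) (u v : J → Bool) (b : Bits W) :
    Function.extend w u (Function.extend w v b) = Function.extend w u b := by
  funext i
  by_cases h : ∃ j, w j = i
  · obtain ⟨j, rfl⟩ := h
    rw [w.injective.extend_apply, w.injective.extend_apply]
  · rw [Function.extend_apply' _ _ _ h, Function.extend_apply' _ _ _ h,
      Function.extend_apply' _ _ _ h]

theorem extend_comp_self {W : ℕ} {J : Type} (w : J ↪ Fin W) (u : J → Bool) (b : Bits W) :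
    Function.extend w u b ∘ w = u := by
  funext j
  exact w.injective.extend_apply _ _ _

theorem extend_self {W : ℕ} {J : Type} (w : J ↪ Fin W) (b : Bits W) :
    Function.extend w (b ∘ w) b = b := by
  funext i
  by_cases h : ∃ j, w j = i
  · obtain ⟨j, rfl⟩ := h
    rw [w.injective.extend_apply]; rfl
  · rw [Function.extend_apply' _ _ _ h]

/-- Overwriting the bits on `w` and remembering the old ones is an involution; the factor is the
number of three-bit strings. A gate can thus be treated fibre by fibre. -/
theorem sum_override {W : ℕ} (w : Fin 3 ↪ Fin W) (f : Bits W → ℝ) :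
    ∑ b, ∑ v : Bits 3, f (Function.extend w v b) = 8 * ∑ b, f b := by
  have h : ∑ p : Bits W × Bits 3, f (Function.extend w p.2 p.1) = ∑ p : Bits W × Bits 3, f p.1 := by
    refine Finset.sum_nbij' (fun p => (Function.extend w p.2 p.1, p.1 ∘ w))
      (fun p => (Function.extend w p.2 p.1, p.1 ∘ w)) (by simp) (by simp) ?_ ?_ (by simp)
    all_goals
      rintro ⟨b, v⟩ _
      simp only [extend_override, extend_comp_self, extend_self]
  rw [Fintype.sum_prod_type, Fintype.sum_prod_type] at h
  rw [h]
  simp [Finset.mul_sum]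

theorem sum_norm_unitary {n : Type} [Fintype n] [DecidableEq n] (U : Matrix.unitaryGroup n ℂ)
    (φ : n → ℂ) : ∑ v, ‖∑ u, U.1 v u * φ u‖ ^ 2 = ∑ v, ‖φ v‖ ^ 2 := by
  have h1 : ∀ χ : n → ℂ, ((∑ v, ‖χ v‖ ^ 2 : ℝ) : ℂ) = star χ ⬝ᵥ χ := by
    intro χ
    push_cast
    refine Finset.sum_congr rfl fun v _ => ?_
    simp [← Complex.normSq_eq_norm_sq, Complex.normSq_eq_conj_mul_self, ← Complex.ofReal_pow]
  have h2 : (fun v => ∑ u, U.1 v u * φ u) = U.1.mulVec φ := rfl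
  have h3 := h1 (U.1.mulVec φ)
  rw [Matrix.star_mulVec, Matrix.dotProduct_mulVec, Matrix.vecMul_vecMul,
    ← Matrix.star_eq_conjTranspose, Matrix.mem_unitaryGroup_iff'.1 U.2, Matrix.vecMul_one, ← h1] at h3
  exact_mod_cast h3

theorem normSqr_applyGate {W : ℕ} (w : Fin 3 ↪ Fin W) (U : Matrix.unitaryGroup (Bits 3) ℂ)
    (ψ : QState W) : normSqr (applyGate w U ψ) = normSqr ψ := by
  have h := sum_override w fun b => ‖applyGate w U ψ b‖ ^ 2
  have h' := sum_override w fun b => ‖ψ b‖ ^ 2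
  have : ∀ b, ∑ v : Bits 3, ‖applyGate w U ψ (Function.extend w v b)‖ ^ 2
      = ∑ v : Bits 3, ‖ψ (Function.extend w v b)‖ ^ 2 := by
    intro b
    simp only [applyGate, extend_comp_self, extend_override]
    exact sum_norm_unitary U fun v => ψ (Function.extend w v b)
  simp only [this] at h
  unfold normSqr
  linarith

theorem xorOn_self {W : ℕ} {O : Type} (w : O ↪ Fin W) (y : O → Bool) (b : Bits W) :
    xorOn w y (xorOn w y b) = b := by
  funext i
  simp [xorOn]

theorem xorOn_comp_inl {W : ℕ} {I O : Type} (w : I ⊕ O ↪ Fin W) (y : O → Bool) (b : Bits W) :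
    xorOn (Function.Embedding.inr.trans w) y b ∘ w ∘ Sum.inl = b ∘ w ∘ Sum.inl := by
  funext i
  have : ¬ ∃ o, (Function.Embedding.inr.trans w) o = w (Sum.inl i) := by
    rintro ⟨o, ho⟩
    simpa using w.injective ho
  simp only [xorOn, Function.comp_apply, Function.extend_apply' _ _ _ this, Bool.xor_false]

/-- The permutation of basis states underlying an oracle query. -/
def oraclePerm {W : ℕ} {I O : Type} (w : I ⊕ O ↪ Fin W) (F : (I → Bool) → O → Bool) :
    Equiv.Perm (Bits W) where
  toFun b := xorOn (Function.Embedding.inr.trans w) (F (b ∘ w ∘ Sum.inl)) b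
  invFun b := xorOn (Function.Embedding.inr.trans w) (F (b ∘ w ∘ Sum.inl)) b
  left_inv b := by simp only [xorOn_comp_inl, xorOn_self]
  right_inv b := by simp only [xorOn_comp_inl, xorOn_self]

theorem normSqr_applyOracle {W : ℕ} {I O : Type} (w : I ⊕ O ↪ Fin W) (F : (I → Bool) → O → Bool)
    (ψ : QState W) : normSqr (applyOracle w F ψ) = normSqr ψ :=
  Equiv.sum_comp (oraclePerm w F) fun b => ‖ψ b‖ ^ 2

theorem normSqr_applyXor {W : ℕ} {O : Type} (w : O ↪ Fin W) (y : O → Bool) (ψ : QState W) :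
    normSqr (applyXor w y ψ) = normSqr ψ :=
  Equiv.sum_comp (⟨xorOn w y, xorOn w y, xorOn_self w y, xorOn_self w y⟩ : Equiv.Perm (Bits W))
    fun b => ‖ψ b‖ ^ 2

theorem sum_normSqr_project {W : ℕ} {I : Type} [Fintype I] [DecidableEq I] (w : I → Fin W) (ψ : QState W) :
    ∑ x, normSqr (project w x ψ) = normSqr ψ := by
  unfold normSqr project
  rw [Finset.sum_comm]
  refine Finset.sum_congr rfl fun b _ => ?_
  rw [Finset.sum_eq_single (b ∘ w)] <;> simp +contextual [eq_comm]

theorem probOf_nonneg {W : ℕ} (p : Bits W → Prop) (ψ : QState W) : 0 ≤ probOf p ψ :=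
  Finset.sum_nonneg fun b _ => by split_ifs <;> positivity

theorem probOf_le {W : ℕ} (p : Bits W → Prop) (ψ : QState W) : probOf p ψ ≤ normSqr ψ :=
  Finset.sum_le_sum fun b _ => by split_ifs <;> simp

theorem probOf_mono {W : ℕ} {p q : Bits W → Prop} (h : ∀ b, p b → q b) (ψ : QState W) :
    probOf p ψ ≤ probOf q ψ :=
  Finset.sum_le_sum fun b _ => by
    by_cases hp : p b
    · simp [hp, h b hp]
    · simp only [hp, if_false]; split_ifs <;> positivity

/-- The effect of an elementary operation as a list of linear maps. -/
def QOp.maps {P : RPSF} {W : ℕ} (pp : Bits P.ppLen) (H : P.Hash pp) :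
    QOp P W → List (QState W →ₗ[ℂ] QState W)
  | .gate w U => [{
      toFun := applyGate w U
      map_add' := fun ψ φ => by
        funext b; simp [applyGate, mul_add, Finset.sum_add_distrib]
      map_smul' := fun c ψ => by
        funext b
        simp only [applyGate, Pi.smul_apply, smul_eq_mul, Finset.mul_sum, RingHom.id_apply]
        exact Finset.sum_congr rfl fun _ _ => by ring }]
  | .measure i => [false, true].map fun v => {
      toFun := project (fun _ : Unit => i) (fun _ => v)
      map_add' := fun ψ φ => by funext b; simp only [project, Pi.add_apply]; split_ifs <;> simp
      map_smul' := fun c ψ => by funext b; simp [project] }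
  | .evalF w => [{
      toFun := applyOracle w (P.fBits pp)
      map_add' := fun _ _ => rfl
      map_smul' := fun _ _ => rfl }]
  | .sampleDom w => [{
      toFun := applyOracle w (P.sampleDomBits pp)
      map_add' := fun _ _ => rfl
      map_smul' := fun _ _ => rfl }]
  | .hash w => [{
      toFun := applyOracle w (P.hashBits H)
      map_add' := fun _ _ => rfl
      map_smul' := fun _ _ => rfl }]

theorem QOp.branches_eq {P : RPSF} {W : ℕ} (pp : Bits P.ppLen) (H : P.Hash pp) (o : QOp P W)
    (ψ : QState W) : o.branches pp H ψ = (o.maps pp H).map fun M => M ψ := by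
  cases o <;> rfl

/-- A measurement distributes the squared norm over its outcomes and every other operation is
unitary. Bounds proportional to the squared norm therefore add up exactly along a run. -/
theorem QOp.sum_normSqr {P : RPSF} {W : ℕ} (pp : Bits P.ppLen) (H : P.Hash pp) (o : QOp P W)
    (ψ : QState W) : ((o.maps pp H).map fun M => normSqr (M ψ)).sum = normSqr ψ := by
  cases o with
  | gate w U => simpa [maps] using normSqr_applyGate w U ψ
  | measure i =>
      have h : ∑ x, normSqr (project (fun _ : Unit => i) x ψ) = normSqr ψ := by
        exact sum_normSqr_project (fun _ : Unit => i) ψ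
      rw [← Equiv.sum_comp (Equiv.funUnique Unit Bool).symm
        fun x => normSqr (project (fun _ : Unit => i) x ψ)] at h
      simp only [Fintype.sum_bool] at h
      rw [← h, add_comm]
      simp only [maps, List.map_cons, List.map_nil, List.sum_cons, List.sum_nil, add_zero]
      rfl
  | evalF w => exact List.sum_singleton.trans (normSqr_applyOracle w _ ψ)
  | sampleDom w => exact List.sum_singleton.trans (normSqr_applyOracle w _ ψ)
  | hash w => exact List.sum_singleton.trans (normSqr_applyOracle w _ ψ)

/-! ## Games with a general signing distribution -/

/-- Run a forger where signatures are distributed according to the weights `S`. -/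
def runWith {P : RPSF} {N W : ℕ} (qs : ℕ) (pp : Bits P.ppLen) (kp : Fin N → P.KeyPair)
    (H : P.Hash pp) (S : (ρ : P.Rng) → P.Msg → Fin N → P.Dom pp ρ → ℝ)
    (fin : List (P.Rng × P.Msg) → QState W → ℝ) :
    List (ForgerOp P W) → List (P.Rng × P.Msg) → QState W → ℝ
  | [], L, ψ => fin L ψ
  | .op o :: os, L, ψ => ((o.maps pp H).map (fun M => runWith qs pp kp H S fin os L (M ψ))).sum
  | .sign w :: os, L, ψ =>
      ∑ x : P.RIdx ⊕ (Fin P.κ ⊕ Fin P.msgLen) → Bool,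
        match signCheck qs kp L x with
        | none => runWith qs pp kp H S fin os L (project (w ∘ Sum.inl) x ψ)
        | some (ρ, m, j) =>
            ∑ σ, S ρ m j σ *
              runWith qs pp kp H S fin os ((ρ, m) :: L)
                (applyXor (Function.Embedding.inr.trans w) (signAnswer σ.1)
                  (project (w ∘ Sum.inl) x ψ))

/-- The contribution of the signing query `x` to a run with continuation `k`. -/
def signBranch {P : RPSF} {N W : ℕ} (qs : ℕ) {pp : Bits P.ppLen} (kp : Fin N → P.KeyPair)
    (S : (ρ : P.Rng) → P.Msg → Fin N → P.Dom pp ρ → ℝ)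
    (k : List (P.Rng × P.Msg) → QState W → ℝ)
    (w : (P.RIdx ⊕ (Fin P.κ ⊕ Fin P.msgLen)) ⊕ Option (Fin P.domLen) ↪ Fin W)
    (L : List (P.Rng × P.Msg)) (ψ : QState W)
    (x : P.RIdx ⊕ (Fin P.κ ⊕ Fin P.msgLen) → Bool) : ℝ :=
  match signCheck qs kp L x with
  | none => k L (project (w ∘ Sum.inl) x ψ)
  | some (ρ, m, j) => ∑ σ, S ρ m j σ * k ((ρ, m) :: L)
      (applyXor (Function.Embedding.inr.trans w) (signAnswer σ.1) (project (w ∘ Sum.inl) x ψ))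

/-- The weights `S` are probability distributions on all admissible signing queries. -/
def Stochastic {P : RPSF} {N : ℕ} {pp : Bits P.ppLen} (kp : Fin N → P.KeyPair)
    (S : (ρ : P.Rng) → P.Msg → Fin N → P.Dom pp ρ → ℝ) : Prop :=
  ∀ ρ m j, ρ.Has (kp j).1 → IsDist (S ρ m j)

section Run

variable {P : RPSF} {N W : ℕ} {qs : ℕ} {pp : Bits P.ppLen} {kp : Fin N → P.KeyPair}
  {H : P.Hash pp} {S : (ρ : P.Rng) → P.Msg → Fin N → P.Dom pp ρ → ℝ}
  {fin : List (P.Rng × P.Msg) → QState W → ℝ}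

theorem runWith_sign (os : List (ForgerOp P W)) (L : List (P.Rng × P.Msg)) (ψ : QState W)
    (w : (P.RIdx ⊕ (Fin P.κ ⊕ Fin P.msgLen)) ⊕ Option (Fin P.domLen) ↪ Fin W) :
    runWith qs pp kp H S fin (.sign w :: os) L ψ
      = ∑ x, signBranch qs kp S (runWith qs pp kp H S fin os) w L ψ x := rfl

theorem signBranch_none {k : List (P.Rng × P.Msg) → QState W → ℝ}
    {w : (P.RIdx ⊕ (Fin P.κ ⊕ Fin P.msgLen)) ⊕ Option (Fin P.domLen) ↪ Fin W}
    {L : List (P.Rng × P.Msg)} {ψ : QState W} {x : P.RIdx ⊕ (Fin P.κ ⊕ Fin P.msgLen) → Bool}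
    (h : signCheck qs kp L x = none) :
    signBranch qs kp S k w L ψ x = k L (project (w ∘ Sum.inl) x ψ) := by
  unfold signBranch
  rw [h]

theorem signBranch_some {k : List (P.Rng × P.Msg) → QState W → ℝ}
    {w : (P.RIdx ⊕ (Fin P.κ ⊕ Fin P.msgLen)) ⊕ Option (Fin P.domLen) ↪ Fin W}
    {L : List (P.Rng × P.Msg)} {ψ : QState W} {x : P.RIdx ⊕ (Fin P.κ ⊕ Fin P.msgLen) → Bool}
    {ρ : P.Rng} {m : P.Msg} {j : Fin N} (h : signCheck qs kp L x = some (ρ, m, j)) :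
    signBranch qs kp S k w L ψ x = ∑ σ, S ρ m j σ * k ((ρ, m) :: L)
      (applyXor (Function.Embedding.inr.trans w) (signAnswer σ.1)
        (project (w ∘ Sum.inl) x ψ)) := by
  unfold signBranch
  rw [h]

theorem runForger_eq (os : List (ForgerOp P W)) (L : List (P.Rng × P.Msg)) (ψ : QState W) :
    runForger qs pp kp H fin os L ψ
      = runWith qs pp kp H (fun ρ m j σ => (P.sign H (kp j).2 ρ m σ).toReal) fin os L ψ := by
  induction os generalizing L ψ with
  | nil => rfl
  | cons o os ih =>
    cases o with
    | op o =>
      simp only [runForger, runWith, QOp.branches_eq, List.map_map, Function.comp_def, ih]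
    | sign w =>
      rw [runWith_sign]
      simp only [runForger]
      refine Finset.sum_congr rfl fun x _ => ?_
      rcases hc : signCheck qs kp L x with _ | ⟨ρ, m, j⟩
      · rw [signBranch_none hc]
        exact ih _ _
      · rw [signBranch_some hc]
        simp only [ih, expect]

theorem normSqr_answer {I O : Type} (w : I ⊕ O ↪ Fin W) (y : O → Bool)
    (x : I → Bool) (ψ : QState W) :
    normSqr (applyXor (Function.Embedding.inr.trans w) y (project (w ∘ Sum.inl) x ψ))
      = normSqr (project (w ∘ Sum.inl) x ψ) := normSqr_applyXor _ _ _

/-- The upper bound is the squared norm rather than one, because intermediate branches are not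
normalised. -/
theorem runWith_bounds (hS : Stochastic kp S)
    (hfin : ∀ L ψ, 0 ≤ fin L ψ ∧ fin L ψ ≤ normSqr ψ) (os : List (ForgerOp P W))
    (L : List (P.Rng × P.Msg)) (ψ : QState W) :
    0 ≤ runWith qs pp kp H S fin os L ψ ∧ runWith qs pp kp H S fin os L ψ ≤ normSqr ψ := by
  induction os generalizing L ψ with
  | nil => exact hfin L ψ
  | cons o os ih =>
    cases o with
    | op o =>
      refine ⟨List.sum_nonneg ?_, ?_⟩
      · intro y hy
        obtain ⟨M, _, rfl⟩ := List.mem_map.1 hy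
        exact (ih L (M ψ)).1
      · refine le_trans (List.sum_le_sum fun M _ => (ih L (M ψ)).2) (o.sum_normSqr pp H ψ).le
    | sign w =>
      have key : ∀ x, 0 ≤ signBranch qs kp S (runWith qs pp kp H S fin os) w L ψ x ∧
          signBranch qs kp S (runWith qs pp kp H S fin os) w L ψ x
            ≤ normSqr (project (w ∘ Sum.inl) x ψ) := by
        intro x
        rcases hc : signCheck qs kp L x with _ | ⟨ρ, m, j⟩
        · rw [signBranch_none hc]
          exact ih _ _
        · rw [signBranch_some hc]
          have hd := hS ρ m j (signCheck_eq_some hc).2.2.1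
          refine ⟨Finset.sum_nonneg fun σ _ => mul_nonneg (hd.1 σ) (ih _ _).1, ?_⟩
          refine (Finset.sum_le_sum fun σ _ =>
            mul_le_mul_of_nonneg_left (ih _ _).2 (hd.1 σ)).trans ?_
          simp only [normSqr_answer]
          rw [← Finset.sum_mul, hd.2, one_mul]
      rw [runWith_sign]
      exact ⟨Finset.sum_nonneg fun x _ => (key x).1,
        (Finset.sum_le_sum fun x _ => (key x).2).trans (sum_normSqr_project _ ψ).le⟩

/-- The values of a run are linear in the final values. -/
theorem sum_runWith {I : Type} (s : Finset I) (c : I → ℝ)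
    (fins : I → List (P.Rng × P.Msg) → QState W → ℝ) (os : List (ForgerOp P W))
    (L : List (P.Rng × P.Msg)) (ψ : QState W) :
    ∑ i ∈ s, c i * runWith qs pp kp H S (fins i) os L ψ
      = runWith qs pp kp H S (fun L ψ => ∑ i ∈ s, c i * fins i L ψ) os L ψ := by
  induction os generalizing L ψ with
  | nil => rfl
  | cons o os ih =>
    cases o with
    | op o =>
      simp only [runWith, ← ih]
      induction o.maps pp H with
      | nil => simp
      | cons M l ihl => simp [mul_add, Finset.sum_add_distrib, ihl]
    | sign w =>
      simp only [runWith_sign, Finset.mul_sum]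
      rw [Finset.sum_comm]
      refine Finset.sum_congr rfl fun x _ => ?_
      rcases hc : signCheck qs kp L x with _ | ⟨ρ, m, j⟩
      · simp only [signBranch_none hc]
        exact ih _ _
      · simp only [signBranch_some hc, Finset.mul_sum, ← ih]
        rw [Finset.sum_comm]
        exact Finset.sum_congr rfl fun σ _ => Finset.sum_congr rfl fun i _ => by ring

theorem runWith_mono (hS : Stochastic kp S) {fin' : List (P.Rng × P.Msg) → QState W → ℝ}
    (hfin : ∀ L ψ, fin L ψ ≤ fin' L ψ) (os : List (ForgerOp P W))
    (L : List (P.Rng × P.Msg)) (ψ : QState W) :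
    runWith qs pp kp H S fin os L ψ ≤ runWith qs pp kp H S fin' os L ψ := by
  induction os generalizing L ψ with
  | nil => exact hfin L ψ
  | cons o os ih =>
    cases o with
    | op o => exact List.sum_le_sum fun M _ => ih L (M ψ)
    | sign w =>
      simp only [runWith_sign]
      refine Finset.sum_le_sum fun x _ => ?_
      rcases hc : signCheck qs kp L x with _ | ⟨ρ, m, j⟩
      · simp only [signBranch_none hc]
        exact ih _ _
      · simp only [signBranch_some hc]
        exact Finset.sum_le_sum fun σ _ => mul_le_mul_of_nonneg_left (ih _ _)
          ((hS ρ m j (signCheck_eq_some hc).2.2.1).1 σ)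

/-- Without queries, a run does not depend on the oracles. -/
theorem runWith_noQuery {H' : P.Hash pp} {S' : (ρ : P.Rng) → P.Msg → Fin N → P.Dom pp ρ → ℝ}
    (os : List (ForgerOp P W)) (hs : os.countP ForgerOp.isSign = 0)
    (hh : os.countP ForgerOp.isHash = 0) (L : List (P.Rng × P.Msg)) (ψ : QState W) :
    runWith qs pp kp H S fin os L ψ = runWith qs pp kp H' S' fin os L ψ := by
  induction os generalizing L ψ with
  | nil => rfl
  | cons o os ih =>
    rw [List.countP_cons] at hs hh
    have hs' : os.countP ForgerOp.isSign = 0 := by omega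
    have hh' : os.countP ForgerOp.isHash = 0 := by omega
    cases o with
    | op o =>
      have : o.maps pp H = o.maps pp H' := by
        cases o with
        | hash w => simp [ForgerOp.isHash] at hh
        | _ => rfl
      simp only [runWith, this, ih hs' hh']
    | sign w => simp [ForgerOp.isSign] at hs

/-! ### Continuity in the state -/

/-- A weighted bound for the difference of quadratic forms of norm at most one. -/
def quadBound (t : ℝ) (ψ φ : QState W) : ℝ :=
  (t * normSqr (ψ - φ) + t⁻¹ * normSqr (ψ + φ)) / 2

/-- `quadBound` is a combination of squared norms of `ψ ± φ`, so it is conserved over branches. The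
product `‖ψ - φ‖ ‖ψ + φ‖` would need Cauchy–Schwarz at every measurement. -/
theorem sum_quadBound_maps (t : ℝ) (o : QOp P W) (ψ φ : QState W) :
    ((o.maps pp H).map fun M => quadBound t (M ψ) (M φ)).sum = quadBound t ψ φ := by
  have h1 := o.sum_normSqr pp H (ψ - φ)
  have h2 := o.sum_normSqr pp H (ψ + φ)
  unfold quadBound
  rw [← h1, ← h2]
  induction o.maps pp H with
  | nil => simp
  | cons M l ih => simp only [List.map_cons, List.sum_cons, ih, map_sub, map_add]; ring

theorem sum_quadBound_project {I : Type} [Fintype I] [DecidableEq I] (t : ℝ) (w : I → Fin W) (ψ φ : QState W) :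
    ∑ x, quadBound t (project w x ψ) (project w x φ) = quadBound t ψ φ := by
  have h1 := sum_normSqr_project w (ψ - φ)
  have h2 := sum_normSqr_project w (ψ + φ)
  unfold quadBound
  rw [← h1, ← h2, ← Finset.sum_div, Finset.sum_add_distrib, Finset.mul_sum, Finset.mul_sum]
  have e1 : ∀ x, project w x ψ - project w x φ = project w x (ψ - φ) := fun x => by
    funext b; simp only [project, Pi.sub_apply]; split_ifs <;> simp
  have e2 : ∀ x, project w x ψ + project w x φ = project w x (ψ + φ) := fun x => by
    funext b; simp only [project, Pi.add_apply]; split_ifs <;> simp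
  simp only [e1, e2]

theorem quadBound_applyXor {O : Type} (t : ℝ) (w : O ↪ Fin W) (y : O → Bool) (ψ φ : QState W) :
    quadBound t (applyXor w y ψ) (applyXor w y φ) = quadBound t ψ φ := by
  have e1 : applyXor w y ψ - applyXor w y φ = applyXor w y (ψ - φ) := rfl
  have e2 : applyXor w y ψ + applyXor w y φ = applyXor w y (ψ + φ) := rfl
  rw [quadBound, e1, e2, normSqr_applyXor, normSqr_applyXor, quadBound]

theorem abs_list_sum_sub_le {I : Type} (l : List I) {f g B : I → ℝ}
    (h : ∀ i, |f i - g i| ≤ B i) : |(l.map f).sum - (l.map g).sum| ≤ (l.map B).sum := by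
  induction l with
  | nil => simp
  | cons a l ih =>
    simp only [List.map_cons, List.sum_cons]
    calc _ = |(f a - g a) + ((l.map f).sum - (l.map g).sum)| := by ring_nf
      _ ≤ _ := (abs_add_le _ _).trans (add_le_add (h a) ih)

theorem abs_sum_sub_le {I : Type} (s : Finset I) {f g B : I → ℝ}
    (h : ∀ i, |f i - g i| ≤ B i) : |∑ i ∈ s, f i - ∑ i ∈ s, g i| ≤ ∑ i ∈ s, B i := by
  rw [← Finset.sum_sub_distrib]
  exact (Finset.abs_sum_le_sum_abs _ _).trans (Finset.sum_le_sum fun i _ => h i)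

/-- For amplitudes, `|‖x‖² - ‖y‖²| ≤ ‖x - y‖ ‖x + y‖`, since the left side is the modulus of the
real part of `(x - y)` times the conjugate of `x + y`. The product is then split by the
arithmetic–geometric mean with weights `√t` and `1/√t`. -/
theorem abs_probOf_sub_le {t : ℝ} (ht : 0 < t) (p : Bits W → Prop) (ψ φ : QState W) :
    |probOf p ψ - probOf p φ| ≤ quadBound t ψ φ := by
  have h : quadBound t ψ φ
      = ∑ b, (t * ‖ψ b - φ b‖ ^ 2 + t⁻¹ * ‖ψ b + φ b‖ ^ 2) / 2 := by
    simp only [quadBound, normSqr, Pi.sub_apply, Pi.add_apply, ← Finset.sum_div,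
      Finset.sum_add_distrib, Finset.mul_sum]
  rw [h]
  refine abs_sum_sub_le _ fun b => ?_
  by_cases hp : p b
  · simp only [hp, if_true]
    have h1 : |‖ψ b‖ ^ 2 - ‖φ b‖ ^ 2| ≤ ‖ψ b - φ b‖ * ‖ψ b + φ b‖ := by
      rw [sq_sub_sq, abs_mul, abs_of_nonneg (by positivity : 0 ≤ ‖ψ b‖ + ‖φ b‖)]
      have e : ‖ψ b‖ ^ 2 - ‖φ b‖ ^ 2 = ((ψ b - φ b) * (starRingEnd ℂ) (ψ b + φ b)).re := by
        simp only [← Complex.normSq_eq_norm_sq, Complex.normSq_apply, Complex.mul_re,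
          Complex.sub_re, Complex.sub_im, Complex.conj_re, Complex.conj_im, Complex.add_re,
          Complex.add_im]
        ring
      rw [← abs_of_nonneg (by positivity : 0 ≤ ‖ψ b‖ + ‖φ b‖), ← abs_mul, ← sq_sub_sq, e]
      refine (Complex.abs_re_le_norm _).trans (le_of_eq ?_)
      rw [norm_mul, RCLike.norm_conj]
    refine h1.trans ?_
    have hs : 0 < Real.sqrt t := Real.sqrt_pos.2 ht
    have h2 := two_mul_le_add_sq (Real.sqrt t * ‖ψ b - φ b‖) ((Real.sqrt t)⁻¹ * ‖ψ b + φ b‖)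
    rw [mul_pow, mul_pow, inv_pow, Real.sq_sqrt ht.le] at h2
    have h3 : 2 * (Real.sqrt t * ‖ψ b - φ b‖) * ((Real.sqrt t)⁻¹ * ‖ψ b + φ b‖)
        = 2 * (‖ψ b - φ b‖ * ‖ψ b + φ b‖) := by
      field_simp
    linarith
  · simp only [hp, if_false, sub_self, abs_zero]
    positivity

/-- With the oracles fixed, no further operation can separate two states more than `quadBound`
measures at the outset. -/
theorem abs_runWith_sub_le {t : ℝ} (hS : Stochastic kp S)
    (hfin : ∀ L ψ φ, |fin L ψ - fin L φ| ≤ quadBound t ψ φ) (os : List (ForgerOp P W))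
    (L : List (P.Rng × P.Msg)) (ψ φ : QState W) :
    |runWith qs pp kp H S fin os L ψ - runWith qs pp kp H S fin os L φ| ≤ quadBound t ψ φ := by
  induction os generalizing L ψ φ with
  | nil => exact hfin L ψ φ
  | cons o os ih =>
    cases o with
    | op o =>
      rw [← sum_quadBound_maps (pp := pp) (H := H) t o ψ φ]
      exact abs_list_sum_sub_le _ fun M => ih L (M ψ) (M φ)
    | sign w =>
      rw [← sum_quadBound_project t (w ∘ Sum.inl) ψ φ]
      simp only [runWith_sign]
      refine abs_sum_sub_le _ fun x => ?_
      rcases hc : signCheck qs kp L x with _ | ⟨ρ, m, j⟩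
      · simp only [signBranch_none hc]
        exact ih _ _ _
      · simp only [signBranch_some hc]
        have hd := hS ρ m j (signCheck_eq_some hc).2.2.1
        refine (abs_sum_sub_le _ (B := fun σ => S ρ m j σ *
          quadBound t (project (w ∘ Sum.inl) x ψ) (project (w ∘ Sum.inl) x φ)) fun σ => ?_).trans ?_
        · rw [← mul_sub, abs_mul, abs_of_nonneg (hd.1 σ)]
          refine mul_le_mul_of_nonneg_left ((ih _ _ _).trans ?_) (hd.1 σ)
          rw [quadBound_applyXor]
        · rw [← Finset.sum_mul, hd.2, one_mul]

/-! ### Changing the signing distribution -/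

/-- Both weights have total mass one, so `f` may be centred at `M / 2`; this gains the factor one
half that turns the `ℓ¹` distance into statistical distance. -/
theorem abs_sum_mul_sub_le {D : Type} [Fintype D] {u v : D → ℝ} (hu : IsDist u) (hv : IsDist v)
    {f : D → ℝ} {M : ℝ} (hf : ∀ a, 0 ≤ f a ∧ f a ≤ M) :
    |∑ a, u a * f a - ∑ a, v a * f a| ≤ (∑ a, |u a - v a|) / 2 * M := by
  have h : ∑ a, u a * f a - ∑ a, v a * f a = ∑ a, (u a - v a) * (f a - M / 2) := by
    simp only [mul_sub, sub_mul, Finset.sum_sub_distrib, ← Finset.sum_mul, hu.2, hv.2]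
    ring
  rw [h]
  refine (Finset.abs_sum_le_sum_abs _ _).trans ?_
  rw [Finset.sum_div, Finset.sum_mul]
  refine Finset.sum_le_sum fun a _ => ?_
  rw [abs_mul, div_mul_eq_mul_div, mul_div_assoc]
  refine mul_le_mul_of_nonneg_left ?_ (abs_nonneg _)
  have := hf a
  rw [abs_le]
  constructor <;> linarith

/-- Hybrid argument: at each signing query the answer is replaced first, at cost `ε` times the
squared norm of the branch, and the continuation is replaced by induction. -/
theorem abs_runWith_sub_le_of_statDist {S' : (ρ : P.Rng) → P.Msg → Fin N → P.Dom pp ρ → ℝ}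
    (hS : Stochastic kp S) (hS' : Stochastic kp S')
    (hfin : ∀ L ψ, 0 ≤ fin L ψ ∧ fin L ψ ≤ normSqr ψ) {ε : ℝ} (hε : 0 ≤ ε)
    (hd : ∀ ρ m j, ρ.Has (kp j).1 → (∑ σ, |S ρ m j σ - S' ρ m j σ|) / 2 ≤ ε)
    (os : List (ForgerOp P W)) (L : List (P.Rng × P.Msg)) (ψ : QState W) :
    |runWith qs pp kp H S fin os L ψ - runWith qs pp kp H S' fin os L ψ|
      ≤ os.countP ForgerOp.isSign * ε * normSqr ψ := by
  induction os generalizing L ψ with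
  | nil => simp [runWith]
  | cons o os ih =>
    cases o with
    | op o =>
      rw [← o.sum_normSqr pp H ψ, ← List.sum_map_mul_left]
      refine abs_list_sum_sub_le _ fun M => ?_
      simpa [ForgerOp.isSign] using ih L (M ψ)
    | sign w =>
      rw [← sum_normSqr_project (w ∘ Sum.inl) ψ, Finset.mul_sum]
      simp only [runWith_sign]
      refine abs_sum_sub_le _ fun x => ?_
      have hM := normSqr_nonneg (project (w ∘ Sum.inl) x ψ)
      have hcount : ((List.countP ForgerOp.isSign (ForgerOp.sign w :: os) : ℕ) : ℝ)
          = os.countP ForgerOp.isSign + 1 := by simp [List.countP_cons, ForgerOp.isSign]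
      rw [hcount]
      rcases hc : signCheck qs kp L x with _ | ⟨ρ, m, j⟩
      · simp only [signBranch_none hc]
        refine (ih _ _).trans ?_
        nlinarith [mul_nonneg hε hM]
      · simp only [signBranch_some hc]
        have hh := (signCheck_eq_some hc).2.2.1
        have h1 := hS ρ m j hh
        have h2 := hS' ρ m j hh
        set V : P.Dom pp ρ → ℝ := fun σ => runWith qs pp kp H S fin os ((ρ, m) :: L)
          (applyXor (Function.Embedding.inr.trans w) (signAnswer σ.1)
            (project (w ∘ Sum.inl) x ψ)) with hV
        set V' : P.Dom pp ρ → ℝ := fun σ => runWith qs pp kp H S' fin os ((ρ, m) :: L)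
          (applyXor (Function.Embedding.inr.trans w) (signAnswer σ.1)
            (project (w ∘ Sum.inl) x ψ)) with hV'
        have a1 := abs_sum_mul_sub_le h1 h2 (f := V)
          (M := normSqr (project (w ∘ Sum.inl) x ψ)) fun σ => by
            have := runWith_bounds (H := H) (qs := qs) hS hfin os ((ρ, m) :: L)
              (applyXor (Function.Embedding.inr.trans w) (signAnswer σ.1)
                (project (w ∘ Sum.inl) x ψ))
            rwa [normSqr_answer] at this
        have a2 : |∑ σ, S' ρ m j σ * V σ - ∑ σ, S' ρ m j σ * V' σ|
            ≤ os.countP ForgerOp.isSign * ε * normSqr (project (w ∘ Sum.inl) x ψ) := by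
          refine (abs_sum_sub_le _ (B := fun σ => S' ρ m j σ *
            (os.countP ForgerOp.isSign * ε * normSqr (project (w ∘ Sum.inl) x ψ)))
            fun σ => ?_).trans ?_
          · rw [← mul_sub, abs_mul, abs_of_nonneg (h2.1 σ)]
            refine mul_le_mul_of_nonneg_left ((ih _ _).trans ?_) (h2.1 σ)
            rw [normSqr_answer]
          · rw [← Finset.sum_mul, h2.2, one_mul]
        have a3 := mul_le_mul_of_nonneg_right (hd ρ m j hh) hM
        change |∑ σ, S ρ m j σ * V σ - ∑ σ, S' ρ m j σ * V' σ| ≤ _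
        calc _ = |(∑ σ, S ρ m j σ * V σ - ∑ σ, S' ρ m j σ * V σ)
              + (∑ σ, S' ρ m j σ * V σ - ∑ σ, S' ρ m j σ * V' σ)| := by ring_nf
          _ ≤ _ := (abs_add_le _ _).trans (add_le_add a1 a2)
          _ ≤ _ := by linarith

/-! ### Rényi divergence -/

/-- Hölder's inequality on a two-point set with exponents `1/γ` and `1/(1 - γ)`. -/
theorem rpow_mul_rpow_add_le {a b c d γ : ℝ} (ha : 0 ≤ a) (hb : 0 ≤ b) (hc : 0 ≤ c) (hd : 0 ≤ d)
    (h0 : 0 < γ) (h1 : γ ≤ 1) :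
    a ^ γ * c ^ (1 - γ) + b ^ γ * d ^ (1 - γ) ≤ (a + b) ^ γ * (c + d) ^ (1 - γ) := by
  rcases h1.eq_or_lt with rfl | h1
  · simp
  have hpq : Real.HolderConjugate γ⁻¹ (1 - γ)⁻¹ := by
    rw [Real.holderConjugate_iff]
    exact ⟨(one_lt_inv₀ h0).2 h1, by simp⟩
  have h := Real.inner_le_Lp_mul_Lq_of_nonneg (Finset.univ : Finset Bool) hpq
    (f := fun i => (if i then a else b) ^ γ) (g := fun i => (if i then c else d) ^ (1 - γ))
    (fun i _ => by split_ifs <;> positivity) (fun i _ => by split_ifs <;> positivity)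
  have h2 : (0 : ℝ) < 1 - γ := by linarith
  simpa [← Real.rpow_mul, ha, hb, hc, hd, h0.ne', h2.ne'] using h

theorem list_sum_rpow_mul_rpow_le {I : Type} (l : List I) {a c : I → ℝ} (ha : ∀ i, 0 ≤ a i)
    (hc : ∀ i, 0 ≤ c i) {γ : ℝ} (h0 : 0 < γ) (h1 : γ ≤ 1) :
    (l.map fun i => a i ^ γ * c i ^ (1 - γ)).sum
      ≤ (l.map a).sum ^ γ * (l.map c).sum ^ (1 - γ) := by
  induction l with
  | nil => simp [Real.zero_rpow h0.ne']
  | cons i l ih =>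
    simp only [List.map_cons, List.sum_cons]
    refine (add_le_add_right ih _).trans (rpow_mul_rpow_add_le (ha i) ?_ (hc i) ?_ h0 h1)
    · exact List.sum_nonneg fun y hy => by
        obtain ⟨j, _, rfl⟩ := List.mem_map.1 hy; exact ha j
    · exact List.sum_nonneg fun y hy => by
        obtain ⟨j, _, rfl⟩ := List.mem_map.1 hy; exact hc j

/-- The factor `normSqr ψ ^ (1 - γ)` makes the right side homogeneous of degree one. Hölder's
inequality then sums the bound over the branches of a measurement, and each signing query
contributes one factor `R` inside the power. -/
theorem runWith_le_of_renyi {S' : (ρ : P.Rng) → P.Msg → Fin N → P.Dom pp ρ → ℝ}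
    (hS : Stochastic kp S) (hS' : Stochastic kp S')
    (hfin : ∀ L ψ, 0 ≤ fin L ψ ∧ fin L ψ ≤ normSqr ψ) {γ R : ℝ} (h0 : 0 < γ) (h1 : γ ≤ 1)
    (hR : 1 ≤ R)
    (hd : ∀ ρ m j, ρ.Has (kp j).1 → ∀ v : P.Dom pp ρ → ℝ, (∀ σ, 0 ≤ v σ) →
      ∑ σ, S ρ m j σ * v σ ^ γ ≤ (R * ∑ σ, S' ρ m j σ * v σ) ^ γ)
    (os : List (ForgerOp P W)) (L : List (P.Rng × P.Msg)) (ψ : QState W) :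
    runWith qs pp kp H S fin os L ψ
      ≤ (R ^ os.countP ForgerOp.isSign * runWith qs pp kp H S' fin os L ψ) ^ γ
        * normSqr ψ ^ (1 - γ) := by
  have hR0 : 0 ≤ R := by linarith
  induction os generalizing L ψ with
  | nil =>
    have := hfin L ψ
    rcases this.1.eq_or_lt with h | h
    · simp only [runWith, ← h]
      have := normSqr_nonneg ψ
      positivity
    · calc fin L ψ = fin L ψ ^ γ * fin L ψ ^ (1 - γ) := by rw [← Real.rpow_add h]; simp
        _ ≤ _ := by
          simp only [runWith, List.countP_nil, pow_zero, one_mul]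
          exact mul_le_mul_of_nonneg_left (Real.rpow_le_rpow this.1 this.2 (by linarith))
            (by positivity)
  | cons o os ih =>
    have hn : ∀ L ψ, 0 ≤ R ^ os.countP ForgerOp.isSign * runWith qs pp kp H S' fin os L ψ :=
      fun L ψ => mul_nonneg (pow_nonneg hR0 _) (runWith_bounds hS' hfin os L ψ).1
    cases o with
    | op o =>
      simp only [runWith]
      refine (List.sum_le_sum fun M _ => ih L (M ψ)).trans
        ((list_sum_rpow_mul_rpow_le _ (fun M => hn L (M ψ)) (fun M => normSqr_nonneg (M ψ))
          h0 h1).trans (le_of_eq ?_))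
      rw [o.sum_normSqr, List.sum_map_mul_left]
      simp [ForgerOp.isSign]
    | sign w =>
      have hcount : List.countP ForgerOp.isSign (ForgerOp.sign w :: os)
          = os.countP ForgerOp.isSign + 1 := by simp [List.countP_cons, ForgerOp.isSign]
      rw [hcount, ← sum_normSqr_project (w ∘ Sum.inl) ψ]
      simp only [runWith_sign]
      rw [Finset.mul_sum, ← Finset.sum_map_toList, ← Finset.sum_map_toList, ← Finset.sum_map_toList]
      refine le_trans (List.sum_le_sum fun x _ => ?_)
        (list_sum_rpow_mul_rpow_le _ (fun x => ?_) (fun x => normSqr_nonneg _) h0 h1)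
      · rcases hc : signCheck qs kp L x with _ | ⟨ρ, m, j⟩
        · simp only [signBranch_none hc]
          refine (ih _ _).trans (mul_le_mul_of_nonneg_right (Real.rpow_le_rpow (hn _ _) ?_ h0.le)
            (Real.rpow_nonneg (normSqr_nonneg _) _))
          -- A refused query uses no factor `R`; the surplus factor is harmless because `R ≥ 1`.
          simp only [pow_succ]
          nlinarith [hn L (project (w ∘ Sum.inl) x ψ)]
        · simp only [signBranch_some hc]
          have hh := (signCheck_eq_some hc).2.2.1
          have d1 := hS ρ m j hh
          set V' : P.Dom pp ρ → ℝ := fun σ => runWith qs pp kp H S' fin os ((ρ, m) :: L)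
            (applyXor (Function.Embedding.inr.trans w) (signAnswer σ.1)
              (project (w ∘ Sum.inl) x ψ)) with hV'
          refine (Finset.sum_le_sum fun σ _ =>
            mul_le_mul_of_nonneg_left (ih _ _) (d1.1 σ)).trans ?_
          simp only [normSqr_answer, ← mul_assoc]
          rw [← Finset.sum_mul]
          refine mul_le_mul_of_nonneg_right ?_ (Real.rpow_nonneg (normSqr_nonneg _) _)
          refine (hd ρ m j hh (fun σ => R ^ os.countP ForgerOp.isSign * V' σ)
            fun σ => hn _ _).trans (le_of_eq ?_)
          congr 1
          rw [pow_succ, Finset.mul_sum, Finset.mul_sum]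
          exact Finset.sum_congr rfl fun σ _ => by simp only [hV']; ring
      · rcases hc : signCheck qs kp L x with _ | ⟨ρ, m, j⟩
        · simp only [signBranch_none hc]
          exact mul_nonneg (pow_nonneg hR0 _) (runWith_bounds hS' hfin os _ _).1
        · simp only [signBranch_some hc]
          exact mul_nonneg (pow_nonneg hR0 _) (Finset.sum_nonneg fun σ _ => mul_nonneg
            ((hS' ρ m j (signCheck_eq_some hc).2.2.1).1 σ) (runWith_bounds hS' hfin os _ _).1)

/-! ### Resampling unused values -/

/-- The point masses at the values of `d`. -/
def pointSign (N : ℕ) (d : (x : P.Rng × P.Msg) → P.Dom pp x.1) (ρ : P.Rng) (m : P.Msg)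
    (_ : Fin N) (σ : P.Dom pp ρ) : ℝ := if d (ρ, m) = σ then 1 else 0

theorem stochastic_pointSign (d : (x : P.Rng × P.Msg) → P.Dom pp x.1) :
    Stochastic kp (pointSign N d) := by
  refine fun ρ m j _ => ⟨fun σ => ?_, ?_⟩
  · unfold pointSign; split_ifs <;> norm_num
  · simp [pointSign]

/-- A pair in the list is never signed again, so the run does not read the value of `d` there; by
assumption neither do the final values. -/
theorem runWith_update {d : (x : P.Rng × P.Msg) → P.Dom pp x.1}
    {fins : ((x : P.Rng × P.Msg) → P.Dom pp x.1) → List (P.Rng × P.Msg) → QState W → ℝ}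
    (hf : ∀ L, ∀ x ∈ L, ∀ d b ψ, fins (Function.update d x b) L ψ = fins d L ψ)
    (os : List (ForgerOp P W)) (L : List (P.Rng × P.Msg)) (x : P.Rng × P.Msg) (hx : x ∈ L)
    (b : P.Dom pp x.1) (ψ : QState W) :
    runWith qs pp kp H (pointSign N (Function.update d x b)) (fins (Function.update d x b)) os L ψ
      = runWith qs pp kp H (pointSign N d) (fins d) os L ψ := by
  induction os generalizing L ψ with
  | nil => exact hf L x hx d b ψ
  | cons o os ih =>
    cases o with
    | op o => simp only [runWith, ih L hx]
    | sign w =>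
      simp only [runWith_sign]
      refine Finset.sum_congr rfl fun y _ => ?_
      rcases hc : signCheck qs kp L y with _ | ⟨ρ, m, j⟩
      · simp only [signBranch_none hc]
        exact ih L hx _
      · simp only [signBranch_some hc]
        have hne : (ρ, m) ≠ x := fun h => (signCheck_eq_some hc).2.2.2 (h ▸ hx)
        refine Finset.sum_congr rfl fun σ _ => ?_
        rw [ih _ (List.mem_cons_of_mem _ hx), pointSign, pointSign, Function.update_of_ne hne]

/-- Lazy and eager sampling agree: when `(ρ, m)` is signed, its value has not been used before, and
by `runWith_update` it is not used afterwards, so that coordinate can be averaged at the query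
itself. -/
theorem piExp_runWith_pointSign {K : (x : P.Rng × P.Msg) → P.Dom pp x.1 → ℝ}
    (hK : ∀ x, IsDist (K x))
    {fins : ((x : P.Rng × P.Msg) → P.Dom pp x.1) → List (P.Rng × P.Msg) → QState W → ℝ}
    (hf : ∀ L, ∀ x ∈ L, ∀ d b ψ, fins (Function.update d x b) L ψ = fins d L ψ)
    (os : List (ForgerOp P W)) (L : List (P.Rng × P.Msg)) (ψ : QState W) :
    piExp K (fun d => runWith qs pp kp H (pointSign N d) (fins d) os L ψ)
      = runWith qs pp kp H (fun ρ m _ => K (ρ, m)) (fun L ψ => piExp K fun d => fins d L ψ)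
          os L ψ := by
  induction os generalizing L ψ with
  | nil => rfl
  | cons o os ih =>
    cases o with
    | op o => simp only [runWith, piExp_list_sum, ih]
    | sign w =>
      simp only [runWith_sign]
      rw [piExp_sum]
      refine Finset.sum_congr rfl fun y _ => ?_
      rcases hc : signCheck qs kp L y with _ | ⟨ρ, m, j⟩
      · simp only [signBranch_none hc]
        exact ih _ _
      · simp only [signBranch_some hc, ← ih]
        have h1 : ∀ d : (x : P.Rng × P.Msg) → P.Dom pp x.1,
            (∑ σ, pointSign N d ρ m j σ * runWith qs pp kp H (pointSign N d) (fins d) os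
              ((ρ, m) :: L) (applyXor (Function.Embedding.inr.trans w) (signAnswer σ.1)
                (project (w ∘ Sum.inl) y ψ)))
            = runWith qs pp kp H (pointSign N d) (fins d) os
              ((ρ, m) :: L) (applyXor (Function.Embedding.inr.trans w) (signAnswer (d (ρ, m)).1)
                (project (w ∘ Sum.inl) y ψ)) := fun d => by simp [pointSign]
        simp only [h1]
        exact piExp_resample (w := K) (ρ, m) (hK _).2
          (fun σ d => runWith qs pp kp H (pointSign N d) (fins d) os
              ((ρ, m) :: L) (applyXor (Function.Embedding.inr.trans w) (signAnswer σ.1)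
                (project (w ∘ Sum.inl) y ψ)))
          fun σ d b => runWith_update hf os _ _ List.mem_cons_self b _

end Run

/-! ## Reprogramming a few values of the random oracle -/

section Reprogram

variable {P : RPSF} {N W : ℕ} {qs : ℕ} {pp : Bits P.ppLen} {kp : Fin N → P.KeyPair}
  {Ω : Type} [Fintype Ω] {p : Ω → ℝ} {h : Ω → P.Hash pp} {a : P.Hash pp} {ε t : ℝ}

/-- A basis string of the query register addresses at most one point of the oracle; a string that
encodes no ring gets an answer independent of it. -/
theorem sum_hashBits_ne_le (hp : IsDist p) (hε : 0 ≤ ε)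
    (hbad : ∀ x, (∑ ω, p ω * if h ω x ≠ a x then 1 else 0) ≤ ε)
    (z : P.RIdx ⊕ Fin P.msgLen → Bool) :
    (∑ ω, p ω * if P.hashBits (h ω) z ≠ P.hashBits a z then 1 else 0) ≤ ε := by
  rcases hd : decode encRing (z ∘ Sum.inl) with _ | ρ
  · have : ∀ H : P.Hash pp, P.hashBits H z = fun _ => false := fun H => by
      simp [RPSF.hashBits, hd]
    simpa [this] using hε
  · have : ∀ H : P.Hash pp, P.hashBits H z = (H (ρ, z ∘ Sum.inr)).1 := fun H => by
      simp [RPSF.hashBits, hd]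
    refine le_trans (Finset.sum_le_sum fun ω _ => ?_) (hbad (ρ, z ∘ Sum.inr))
    refine mul_le_mul_of_nonneg_left ?_ (hp.1 ω)
    rw [this, this]
    by_cases hx : h ω (ρ, z ∘ Sum.inr) = a (ρ, z ∘ Sum.inr)
    · simp [hx]
    · simp only [ne_eq, hx, not_false_eq_true, if_true]
      split_ifs <;> norm_num

theorem normSqr_applyOracle_add_le {I O : Type} (w : I ⊕ O ↪ Fin W)
    (F G : (I → Bool) → O → Bool) (ψ : QState W) :
    normSqr (applyOracle w F ψ + applyOracle w G ψ) ≤ 4 * normSqr ψ := by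
  have h1 := normSqr_applyOracle w F ψ
  have h2 := normSqr_applyOracle w G ψ
  unfold normSqr at *
  have : ∀ b, ‖(applyOracle w F ψ + applyOracle w G ψ) b‖ ^ 2
      ≤ 2 * ‖applyOracle w F ψ b‖ ^ 2 + 2 * ‖applyOracle w G ψ b‖ ^ 2 := by
    intro b
    have := norm_add_le (applyOracle w F ψ b) (applyOracle w G ψ b)
    rw [Pi.add_apply]
    nlinarith [sq_nonneg (‖applyOracle w F ψ b‖ - ‖applyOracle w G ψ b‖), norm_nonneg
      (applyOracle w F ψ b + applyOracle w G ψ b)]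
  refine (Finset.sum_le_sum fun b _ => this b).trans ?_
  rw [Finset.sum_add_distrib, ← Finset.mul_sum, ← Finset.mul_sum, h1, h2]
  linarith

/-- The two queries differ only on basis states whose input register lies where `F` and `G`
disagree. Queries leave that register unchanged, hence preserve the weight of this set of states;
the constant comes from `‖x - y‖² ≤ 2‖x‖² + 2‖y‖²`. -/
theorem normSqr_applyOracle_sub_le {I O : Type} [DecidableEq (O → Bool)] (w : I ⊕ O ↪ Fin W)
    (F G : (I → Bool) → O → Bool) (ψ : QState W) :
    normSqr (applyOracle w F ψ - applyOracle w G ψ)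
      ≤ ∑ b, 4 * ((if F (b ∘ w ∘ Sum.inl) ≠ G (b ∘ w ∘ Sum.inl) then 1 else 0) * ‖ψ b‖ ^ 2) := by
  have inv : ∀ K : (I → Bool) → O → Bool,
      ∑ b, (if F (b ∘ w ∘ Sum.inl) ≠ G (b ∘ w ∘ Sum.inl) then 1 else 0)
        * ‖applyOracle w K ψ b‖ ^ 2
      = ∑ b, (if F (b ∘ w ∘ Sum.inl) ≠ G (b ∘ w ∘ Sum.inl) then 1 else 0) * ‖ψ b‖ ^ 2 := by
    intro K
    have := Equiv.sum_comp (oraclePerm w K) fun b =>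
      (if F (b ∘ w ∘ Sum.inl) ≠ G (b ∘ w ∘ Sum.inl) then (1 : ℝ) else 0) * ‖ψ b‖ ^ 2
    rw [← this]
    refine Finset.sum_congr rfl fun b _ => ?_
    have e : oraclePerm w K b ∘ w ∘ Sum.inl = b ∘ w ∘ Sum.inl := xorOn_comp_inl _ _ _
    rw [e]
    rfl
  have : ∀ b, ‖(applyOracle w F ψ - applyOracle w G ψ) b‖ ^ 2
      ≤ 2 * ((if F (b ∘ w ∘ Sum.inl) ≠ G (b ∘ w ∘ Sum.inl) then 1 else 0)
          * ‖applyOracle w F ψ b‖ ^ 2)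
        + 2 * ((if F (b ∘ w ∘ Sum.inl) ≠ G (b ∘ w ∘ Sum.inl) then 1 else 0)
          * ‖applyOracle w G ψ b‖ ^ 2) := by
    intro b
    rw [Pi.sub_apply]
    by_cases hb : F (b ∘ w ∘ Sum.inl) = G (b ∘ w ∘ Sum.inl)
    · simp [applyOracle, hb]
    · simp only [ne_eq, hb, not_false_eq_true, if_true, one_mul]
      have := norm_sub_le (applyOracle w F ψ b) (applyOracle w G ψ b)
      nlinarith [sq_nonneg (‖applyOracle w F ψ b‖ - ‖applyOracle w G ψ b‖), norm_nonneg
        (applyOracle w F ψ b - applyOracle w G ψ b)]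
  refine (Finset.sum_le_sum fun b _ => this b).trans ?_
  rw [Finset.sum_add_distrib, ← Finset.mul_sum, ← Finset.mul_sum, inv, inv, ← Finset.mul_sum]
  linarith

/-- The state does not depend on `ω`, so the average can be taken for each basis state separately,
where disagreement has probability at most `ε`. The two squared norms are at most `4ε` and `4` times
that of `ψ`, and `quadBound` halves them. -/
theorem sum_quadBound_hash_le (hp : IsDist p) (hε : 0 ≤ ε) (ht : 0 < t)
    (hbad : ∀ x, (∑ ω, p ω * if h ω x ≠ a x then 1 else 0) ≤ ε)
    (w : (P.RIdx ⊕ Fin P.msgLen) ⊕ Fin P.ranLen ↪ Fin W) (ψ : QState W) :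
    ∑ ω, p ω * quadBound t (applyOracle w (P.hashBits (h ω)) ψ) (applyOracle w (P.hashBits a) ψ)
      ≤ 2 * (t * ε + t⁻¹) * normSqr ψ := by
  have ht' : 0 < t⁻¹ := inv_pos.2 ht
  have step : ∀ ω, quadBound t (applyOracle w (P.hashBits (h ω)) ψ)
      (applyOracle w (P.hashBits a) ψ) ≤ 2 * t * ∑ b,
        ((if P.hashBits (h ω) (b ∘ w ∘ Sum.inl) ≠ P.hashBits a (b ∘ w ∘ Sum.inl) then 1 else 0)
          * ‖ψ b‖ ^ 2) + 2 * t⁻¹ * normSqr ψ := by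
    intro ω
    have h1 := normSqr_applyOracle_add_le w (P.hashBits (h ω)) (P.hashBits a) ψ
    have h2 := normSqr_applyOracle_sub_le w (P.hashBits (h ω)) (P.hashBits a) ψ
    rw [← Finset.mul_sum] at h2
    have h3 := mul_le_mul_of_nonneg_left h1 ht'.le
    have h4 := mul_le_mul_of_nonneg_left h2 ht.le
    unfold quadBound
    linarith
  refine (Finset.sum_le_sum fun ω _ => mul_le_mul_of_nonneg_left (step ω) (hp.1 ω)).trans ?_
  simp only [mul_add, Finset.sum_add_distrib]
  rw [← Finset.sum_mul, hp.2]
  have e : ∑ ω, p ω * (2 * t * ∑ b, ((if P.hashBits (h ω) (b ∘ w ∘ Sum.inl)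
        ≠ P.hashBits a (b ∘ w ∘ Sum.inl) then 1 else 0) * ‖ψ b‖ ^ 2))
      = 2 * t * ∑ b, (∑ ω, p ω * if P.hashBits (h ω) (b ∘ w ∘ Sum.inl)
        ≠ P.hashBits a (b ∘ w ∘ Sum.inl) then 1 else 0) * ‖ψ b‖ ^ 2 := by
    simp only [Finset.mul_sum, Finset.sum_mul]
    rw [Finset.sum_comm]
    exact Finset.sum_congr rfl fun b _ => Finset.sum_congr rfl fun ω _ => by ring
  rw [e]
  have h5 : ∑ b, (∑ ω, p ω * if P.hashBits (h ω) (b ∘ w ∘ Sum.inl)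
        ≠ P.hashBits a (b ∘ w ∘ Sum.inl) then 1 else 0) * ‖ψ b‖ ^ 2 ≤ ε * normSqr ψ := by
    rw [normSqr, Finset.mul_sum]
    exact Finset.sum_le_sum fun b _ => mul_le_mul_of_nonneg_right
      (sum_hashBits_ne_le hp hε hbad _) (by positivity)
  have h6 := mul_le_mul_of_nonneg_left h5 (by positivity : (0 : ℝ) ≤ 2 * t)
  linarith

theorem sum_mul_le_add (hp : IsDist p) {f g k : Ω → ℝ} {A B : ℝ} (h : ∀ ω, f ω ≤ g ω + k ω)
    (hA : ∑ ω, p ω * g ω ≤ A) (hB : ∑ ω, p ω * k ω ≤ B) : ∑ ω, p ω * f ω ≤ A + B := by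
  refine (Finset.sum_le_sum fun ω _ => mul_le_mul_of_nonneg_left (h ω) (hp.1 ω)).trans ?_
  simp only [mul_add, Finset.sum_add_distrib]
  exact add_le_add hA hB

theorem sum_abs_list_sum_sub_le {I : Type} (hp : IsDist p) (l : List I) {f : Ω → I → ℝ}
    {g B : I → ℝ} (hB : ∀ i, ∑ ω, p ω * |f ω i - g i| ≤ B i) :
    ∑ ω, p ω * |(l.map (f ω)).sum - (l.map g).sum| ≤ (l.map B).sum := by
  induction l with
  | nil => simp
  | cons i l ih =>
    simp only [List.map_cons, List.sum_cons]
    refine sum_mul_le_add hp (fun ω => ?_) (hB i) ih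
    rw [add_sub_add_comm]
    exact abs_add_le _ _

theorem sum_abs_sum_sub_le {I : Type} (hp : IsDist p) (s : Finset I) {f : Ω → I → ℝ}
    {g B : I → ℝ} (hB : ∀ i, ∑ ω, p ω * |f ω i - g i| ≤ B i) :
    ∑ ω, p ω * |∑ i ∈ s, f ω i - ∑ i ∈ s, g i| ≤ ∑ i ∈ s, B i := by
  simp only [← Finset.sum_map_toList s]
  exact sum_abs_list_sum_sub_le hp _ hB

/-- If each value of the random oracle changes with probability at most `ε` only, independently of
the queries, then a forger is unlikely to notice. -/
theorem sum_abs_runWith_sub_le (hp : IsDist p) (hε : 0 ≤ ε) (ht : 0 < t)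
    (hbad : ∀ x, (∑ ω, p ω * if h ω x ≠ a x then 1 else 0) ≤ ε)
    {T : (ρ : P.Rng) → Fin N → P.Ran pp ρ → P.Dom pp ρ → ℝ}
    (hT : ∀ ρ j r, ρ.Has (kp j).1 → IsDist (T ρ j r))
    {fin : P.Hash pp → List (P.Rng × P.Msg) → QState W → ℝ}
    (hfin : ∀ H L ψ, 0 ≤ fin H L ψ ∧ fin H L ψ ≤ normSqr ψ)
    (hfin' : ∀ H L ψ φ, |fin H L ψ - fin H L φ| ≤ quadBound t ψ φ)
    (hclose : ∀ L ψ, ∑ ω, p ω * |fin (h ω) L ψ - fin a L ψ| ≤ ε * normSqr ψ)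
    (os : List (ForgerOp P W)) (L : List (P.Rng × P.Msg)) (ψ : QState W) :
    ∑ ω, p ω * |runWith qs pp kp (h ω) (fun ρ m j => T ρ j (h ω (ρ, m))) (fin (h ω)) os L ψ
        - runWith qs pp kp a (fun ρ m j => T ρ j (a (ρ, m))) (fin a) os L ψ|
      ≤ (os.countP ForgerOp.isHash * (2 * (t * ε + t⁻¹)) + os.countP ForgerOp.isSign * ε + ε)
          * normSqr ψ := by
  have hS : ∀ H : P.Hash pp, Stochastic kp (fun ρ m j => T ρ j (H (ρ, m))) :=
    fun H ρ m j hj => hT ρ j _ hj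
  have ht' : 0 < t⁻¹ := inv_pos.2 ht
  induction os generalizing L ψ with
  | nil => simpa [runWith] using hclose L ψ
  | cons o os ih =>
    cases o with
    | op o =>
      by_cases ho : ∃ w, o = .hash w
      · obtain ⟨w, rfl⟩ := ho
        have hcount : ((List.countP ForgerOp.isHash (ForgerOp.op (.hash w) :: os) : ℕ) : ℝ)
            = os.countP ForgerOp.isHash + 1 := by simp [List.countP_cons, ForgerOp.isHash]
        have hcount' : List.countP ForgerOp.isSign (ForgerOp.op (.hash w) :: os)
            = os.countP ForgerOp.isSign := by simp [ForgerOp.isSign]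
        rw [hcount, hcount']
        have e : ∀ (H : P.Hash pp) S' fin', runWith qs pp kp H S' fin' (.op (.hash w) :: os) L ψ
            = runWith qs pp kp H S' fin' os L (applyOracle w (P.hashBits H) ψ) :=
          fun H S' fin' => List.sum_singleton
        -- The intermediate run answers this query with `a` and continues with `h ω`. The state
        -- passed to the induction then still does not depend on `ω`.
        have i1 := sum_quadBound_hash_le hp hε ht hbad w ψ
        have i2 := ih L (applyOracle w (P.hashBits a) ψ)
        rw [normSqr_applyOracle] at i2
        refine (sum_mul_le_add hp (fun ω => ?_) i1 i2).trans (by linarith)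
        rw [e, e]
        exact (abs_sub_le _ _ _).trans (add_le_add_left
          (abs_runWith_sub_le (hS (h ω)) (hfin' (h ω)) os L _ _) _)
      · have hm : ∀ H : P.Hash pp, o.maps pp H = o.maps pp a := by
          intro H
          cases o with
          | hash w => exact absurd ⟨w, rfl⟩ ho
          | _ => rfl
        have hcount : List.countP ForgerOp.isHash (ForgerOp.op o :: os)
            = os.countP ForgerOp.isHash := by
          cases o with
          | hash w => exact absurd ⟨w, rfl⟩ ho
          | _ => simp [ForgerOp.isHash]
        have hcount' : List.countP ForgerOp.isSign (ForgerOp.op o :: os)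
            = os.countP ForgerOp.isSign := by simp [ForgerOp.isSign]
        rw [hcount, hcount', ← o.sum_normSqr pp a ψ, ← List.sum_map_mul_left]
        simp only [runWith, hm]
        exact sum_abs_list_sum_sub_le hp _ fun M => ih L (M ψ)
    | sign w =>
      have hcount : ((List.countP ForgerOp.isSign (ForgerOp.sign w :: os) : ℕ) : ℝ)
          = os.countP ForgerOp.isSign + 1 := by simp [List.countP_cons, ForgerOp.isSign]
      have hcount' : List.countP ForgerOp.isHash (ForgerOp.sign w :: os)
          = os.countP ForgerOp.isHash := by simp [ForgerOp.isHash]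
      rw [hcount, hcount', ← sum_normSqr_project (w ∘ Sum.inl) ψ, Finset.mul_sum]
      simp only [runWith_sign]
      refine sum_abs_sum_sub_le hp _ fun x => ?_
      have hM := normSqr_nonneg (project (w ∘ Sum.inl) x ψ)
      rcases hc : signCheck qs kp L x with _ | ⟨ρ, m, j⟩
      · simp only [signBranch_none hc]
        refine (ih _ _).trans ?_
        nlinarith [mul_nonneg hε hM]
      · simp only [signBranch_some hc]
        have hh := (signCheck_eq_some hc).2.2.1
        set V : P.Hash pp → P.Dom pp ρ → ℝ := fun H σ =>
          runWith qs pp kp H (fun ρ m j => T ρ j (H (ρ, m))) (fin H) os ((ρ, m) :: L)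
          (applyXor (Function.Embedding.inr.trans w) (signAnswer σ.1)
            (project (w ∘ Sum.inl) x ψ)) with hV
        set M := normSqr (project (w ∘ Sum.inl) x ψ) with hMdef
        have hVb : ∀ H σ, 0 ≤ V H σ ∧ V H σ ≤ M := fun H σ => by
          have := runWith_bounds (H := H) (qs := qs) (hS H) (hfin H) os ((ρ, m) :: L)
              (applyXor (Function.Embedding.inr.trans w) (signAnswer σ.1)
                (project (w ∘ Sum.inl) x ψ))
          rwa [normSqr_answer] at this
        set c := (os.countP ForgerOp.isHash * (2 * (t * ε + t⁻¹))
          + os.countP ForgerOp.isSign * ε + ε) with hcdef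
        have hVi : ∀ σ, ∑ ω, p ω * |V (h ω) σ - V a σ| ≤ c * M := fun σ => by
          have := ih ((ρ, m) :: L) (applyXor (Function.Embedding.inr.trans w) (signAnswer σ.1)
            (project (w ∘ Sum.inl) x ψ))
          rwa [normSqr_answer] at this
        -- If the oracle is altered at the signed point, the difference is bounded trivially by `M`.
        -- Otherwise the signature has the same law in both runs and only the continuations differ.
        have step : ∀ ω, |∑ σ, T ρ j (h ω (ρ, m)) σ * V (h ω) σ - ∑ σ, T ρ j (a (ρ, m)) σ * V a σ|
            ≤ (if h ω (ρ, m) ≠ a (ρ, m) then 1 else 0) * M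
              + ∑ σ, T ρ j (a (ρ, m)) σ * |V (h ω) σ - V a σ| := by
          intro ω
          have hpos : 0 ≤ ∑ σ, T ρ j (a (ρ, m)) σ * |V (h ω) σ - V a σ| :=
            Finset.sum_nonneg fun σ _ => mul_nonneg ((hT ρ j _ hh).1 σ) (abs_nonneg _)
          have hr : ∀ H H' : P.Hash pp, 0 ≤ ∑ σ, T ρ j (H (ρ, m)) σ * V H' σ ∧
              ∑ σ, T ρ j (H (ρ, m)) σ * V H' σ ≤ M := fun H H' => by
            have hd := hT ρ j (H (ρ, m)) hh
            refine ⟨Finset.sum_nonneg fun σ _ => mul_nonneg (hd.1 σ) (hVb H' σ).1, ?_⟩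
            refine (Finset.sum_le_sum fun σ _ =>
              mul_le_mul_of_nonneg_left (hVb H' σ).2 (hd.1 σ)).trans ?_
            rw [← Finset.sum_mul, hd.2, one_mul]
          by_cases hx : h ω (ρ, m) = a (ρ, m)
          · simp only [hx, ne_eq, not_true_eq_false, if_false, zero_mul, zero_add]
            refine abs_sum_sub_le _ fun σ => ?_
            rw [← mul_sub, abs_mul, abs_of_nonneg ((hT ρ j _ hh).1 σ)]
          · simp only [hx, ne_eq, not_false_eq_true, if_true, one_mul]
            have h1 := hr (h ω) (h ω)
            have h2 := hr a a
            have : |∑ σ, T ρ j (h ω (ρ, m)) σ * V (h ω) σ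
                - ∑ σ, T ρ j (a (ρ, m)) σ * V a σ| ≤ M := by
              rw [abs_le]
              constructor <;> linarith
            linarith
        refine (Finset.sum_le_sum fun ω _ => mul_le_mul_of_nonneg_left (step ω) (hp.1 ω)).trans ?_
        simp only [mul_add, Finset.sum_add_distrib, ← mul_assoc]
        rw [← Finset.sum_mul]
        have s1 := mul_le_mul_of_nonneg_right (hbad (ρ, m)) hM
        have s2 : ∑ ω, p ω * ∑ σ, T ρ j (a (ρ, m)) σ * |V (h ω) σ - V a σ| ≤ c * M := by
          simp only [Finset.mul_sum]
          rw [Finset.sum_comm]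
          have hd := hT ρ j (a (ρ, m)) hh
          calc _ = ∑ σ, T ρ j (a (ρ, m)) σ * ∑ ω, p ω * |V (h ω) σ - V a σ| := by
                refine Finset.sum_congr rfl fun σ _ => ?_
                rw [Finset.mul_sum]
                exact Finset.sum_congr rfl fun ω _ => by ring
            _ ≤ ∑ σ, T ρ j (a (ρ, m)) σ * (c * M) := Finset.sum_le_sum fun σ _ =>
                mul_le_mul_of_nonneg_left (hVi σ) (hd.1 σ)
            _ = c * M := by rw [← Finset.sum_mul, hd.2, one_mul]
        have e2 : (c + ε) * M = (↑(List.countP ForgerOp.isHash os) * (2 * (t * ε + t⁻¹))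
          + (↑(List.countP ForgerOp.isSign os) + 1) * ε + ε) * M := by rw [hcdef]; ring
        simp only [mul_add] at e2
        refine (add_le_add s1 s2).trans ?_
        nlinarith [e2]

end Reprogram

/-! ## The sequence of games for fixed keys -/

theorem toReal_map_apply {A B : Type} [Fintype A] (p : PMF A) (f : A → B) (b : B) :
    ((p.map f) b).toReal = ∑ a, (p a).toReal * if f a = b then 1 else 0 := by
  rw [PMF.map_apply, tsum_fintype, ENNReal.toReal_sum]
  · refine Finset.sum_congr rfl fun a _ => ?_
    by_cases h : f a = b
    · simp [h]
    · simp [h, Ne.symm h]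
  · intro a _
    split_ifs
    · exact p.apply_ne_top a
    · simp

theorem toReal_filter_apply {A : Type} [Fintype A] (p : PMF A) (s : Set A)
    (h : ∃ a ∈ s, a ∈ p.support) (a : A) :
    ((p.filter s h) a).toReal
      = (p a).toReal * (if a ∈ s then 1 else 0) / ∑ b, (p b).toReal * if b ∈ s then 1 else 0 := by
  rw [PMF.filter_apply, ENNReal.toReal_mul, ENNReal.toReal_inv, tsum_fintype, ENNReal.toReal_sum,
    div_eq_mul_inv]
  · congr 1
    · by_cases ha : a ∈ s <;> simp [ha]
    · congr 1
      exact Finset.sum_congr rfl fun b _ => by by_cases hb : b ∈ s <;> simp [hb]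
  · intro b _
    exact ne_top_of_le_ne_top (p.apply_ne_top b) (Set.indicator_le_self _ _ _)

section Games

variable {P : RPSF} {N W : ℕ} {qs : ℕ} {pp : Bits P.ppLen} (kp : Fin N → P.KeyPair)

/-- The ring of `x` contains a public key of the game. -/
def GoodPoint (x : P.Rng × P.Msg) : Prop := ∃ j, x.1.Has (kp j).1

/-- The weights of the uniform distribution on the range. -/
def ranWeight (P : RPSF) (pp : Bits P.ppLen) (x : P.Rng × P.Msg) (_ : P.Ran pp x.1) : ℝ :=
  (Fintype.card (P.Ran pp x.1) : ℝ)⁻¹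

/-- The weights of the domain sampler. -/
def domWeight (P : RPSF) (pp : Bits P.ppLen) (x : P.Rng × P.Msg) (d : P.Dom pp x.1) : ℝ :=
  (P.domDist pp x.1 d).toReal

/-- Hash values that are images of sampled domain elements, if the ring contains a key of the
game. -/
def imageWeight (pp : Bits P.ppLen) (x : P.Rng × P.Msg) (r : P.Ran pp x.1) : ℝ :=
  if GoodPoint kp x then (((P.domDist pp x.1).map (P.f pp x.1)) r).toReal else ranWeight P pp x r

/-- Domain elements conditioned on their image. -/
def condWeight (pp : Bits P.ppLen) (x : P.Rng × P.Msg) (r : P.Ran pp x.1) (d : P.Dom pp x.1) : ℝ :=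
  if h : GoodPoint kp x ∧ P.Hit pp x.1 r then (P.condDist pp x.1 r h.2 d).toReal
  else domWeight P pp x d

/-- Signatures sampled with the trapdoor. -/
def trapSign {pp : Bits P.ppLen} (H : P.Hash pp) (ρ : P.Rng) (m : P.Msg) (j : Fin N)
    (σ : P.Dom pp ρ) : ℝ := (P.SamplePre pp ρ (kp j).2 (H (ρ, m)) σ).toReal

/-- Signatures sampled from the conditional distribution. -/
def condSign {pp : Bits P.ppLen} (H : P.Hash pp) (ρ : P.Rng) (m : P.Msg) (_ : Fin N)
    (σ : P.Dom pp ρ) : ℝ := condWeight kp pp (ρ, m) (H (ρ, m)) σ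

theorem isDist_ranWeight (x : P.Rng × P.Msg) : IsDist (ranWeight P pp x) := isDist_uniform _

theorem isDist_domWeight (x : P.Rng × P.Msg) : IsDist (domWeight P pp x) := isDist_toReal _

theorem isDist_imageWeight (x : P.Rng × P.Msg) : IsDist (imageWeight kp pp x) := by
  unfold imageWeight
  split_ifs
  · exact isDist_toReal _
  · exact isDist_ranWeight x

theorem isDist_condWeight (x : P.Rng × P.Msg) (r : P.Ran pp x.1) :
    IsDist (condWeight kp pp x r) := by
  unfold condWeight
  split_ifs
  · exact isDist_toReal _
  · exact isDist_domWeight x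

theorem stochastic_trapSign (H : P.Hash pp) : Stochastic kp (trapSign kp H) :=
  fun _ _ _ _ => isDist_toReal _

theorem stochastic_condSign (H : P.Hash pp) : Stochastic kp (condSign kp H) :=
  fun ρ m _ _ => isDist_condWeight kp (ρ, m) _

theorem hit_of_imageWeight_ne_zero {x : P.Rng × P.Msg} {r : P.Ran pp x.1}
    (hx : GoodPoint kp x) (h : imageWeight kp pp x r ≠ 0) : P.Hit pp x.1 r := by
  rw [imageWeight, if_pos hx] at h
  have : r ∈ ((P.domDist pp x.1).map (P.f pp x.1)).support := by
    rw [PMF.mem_support_iff]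
    rintro h0
    simp [h0] at h
  rw [PMF.mem_support_map_iff] at this
  obtain ⟨d, hd, rfl⟩ := this
  exact ⟨d, rfl, hd⟩

/-- Bayes' rule. At a good point both sides are the joint probability of the element `d` and its
image `r`; elsewhere `d` and `r` are independent. Images that are never hit have weight zero on both
sides. -/
theorem domWeight_mul_eq (x : P.Rng × P.Msg) (r : P.Ran pp x.1) (d : P.Dom pp x.1) :
    domWeight P pp x d * (∑ r₀, ranWeight P pp x r₀ *
        if (if GoodPoint kp x then P.f pp x.1 d else r₀) = r then 1 else 0)
      = imageWeight kp pp x r * condWeight kp pp x r d := by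
  by_cases hx : GoodPoint kp x
  · simp only [hx, if_true, ← Finset.sum_mul, (isDist_ranWeight x).2, one_mul]
    by_cases hh : P.Hit pp x.1 r
    · rw [imageWeight, if_pos hx, condWeight, dif_pos ⟨hx, hh⟩, toReal_map_apply]
      have hc : (P.condDist pp x.1 r hh d).toReal = _ :=
        toReal_filter_apply (P.domDist pp x.1) {d | P.f pp x.1 d = r} hh d
      rw [hc]
      have key : ∀ A B S T : ℝ, A = B → S = T → S ≠ 0 → A = S * (B / T) := by
        rintro A _ S _ rfl rfl h
        field_simp
      refine key _ _ _ _ (by unfold domWeight; congr!) (by congr!) ?_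
      obtain ⟨d', h1, h2⟩ := hh
      refine (Finset.sum_pos' (fun a _ => by split_ifs <;> simp) ⟨d', Finset.mem_univ _, ?_⟩).ne'
      have h1' : P.f pp x.1 d' = r := h1
      simp only [h1', if_true, mul_one]
      exact ENNReal.toReal_pos ((PMF.mem_support_iff _ _).1 h2) (PMF.apply_ne_top _ _)
    · have h0 : imageWeight kp pp x r = 0 := by
        by_contra h
        exact hh (hit_of_imageWeight_ne_zero kp hx h)
      rw [h0, zero_mul]
      by_cases hf : P.f pp x.1 d = r
      · have : d ∉ (P.domDist pp x.1).support := fun h => hh ⟨d, hf, h⟩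
        rw [PMF.mem_support_iff, not_not] at this
        simp [domWeight, this]
      · simp [hf]
  · simp [hx, imageWeight, condWeight, mul_comm]

/-! ### Forgery events and the success values of the games. -/

variable (out : P.RIdx ⊕ (Fin P.msgLen ⊕ Fin P.domLen) ↪ Fin W)

/-- Probability of a forgery. -/
def forgeVal (H : P.Hash pp) (L : List (P.Rng × P.Msg)) (ψ : QState W) : ℝ :=
  probOf (fun b => Forges kp H L (b ∘ out)) ψ

/-- A forgery whose signature is equal to the sampled domain element, if `e` is true, and different
from it, if `e` is false. -/
def ForgesAt (e : Bool) {pp : Bits P.ppLen} (H : P.Hash pp)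
    (d : (x : P.Rng × P.Msg) → P.Dom pp x.1) (L : List (P.Rng × P.Msg))
    (x : P.RIdx ⊕ (Fin P.msgLen ⊕ Fin P.domLen) → Bool) : Prop :=
  ∃ ρ : P.Rng, encRing ρ = x ∘ Sum.inl ∧ RingIn kp ρ ∧ (ρ, x ∘ Sum.inr ∘ Sum.inl) ∉ L ∧
    P.Verify H ρ (x ∘ Sum.inr ∘ Sum.inl) (x ∘ Sum.inr ∘ Sum.inr) ∧
    ((d (ρ, x ∘ Sum.inr ∘ Sum.inl)).1 = x ∘ Sum.inr ∘ Sum.inr ↔ e)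

/-- Probability of a forgery of the given kind. -/
def forgeAtVal (e : Bool) (H : P.Hash pp) (d : (x : P.Rng × P.Msg) → P.Dom pp x.1)
    (L : List (P.Rng × P.Msg)) (ψ : QState W) : ℝ :=
  probOf (fun b => ForgesAt kp e H d L (b ∘ out)) ψ

theorem forges_iff {H : P.Hash pp} {d : (x : P.Rng × P.Msg) → P.Dom pp x.1}
    {L : List (P.Rng × P.Msg)} {x : P.RIdx ⊕ (Fin P.msgLen ⊕ Fin P.domLen) → Bool} :
    Forges kp H L x ↔ ForgesAt kp true H d L x ∨ ForgesAt kp false H d L x := by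
  constructor
  · rintro ⟨ρ, h1, h2, h3, h4⟩
    by_cases h : (d (ρ, x ∘ Sum.inr ∘ Sum.inl)).1 = x ∘ Sum.inr ∘ Sum.inr
    · exact Or.inl ⟨ρ, h1, h2, h3, h4, by simpa using h⟩
    · exact Or.inr ⟨ρ, h1, h2, h3, h4, by simpa using h⟩
  · rintro (⟨ρ, h1, h2, h3, h4, -⟩ | ⟨ρ, h1, h2, h3, h4, -⟩) <;> exact ⟨ρ, h1, h2, h3, h4⟩

/-- The two kinds of forgery exclude each other because the output string determines the ring. The
coefficient `1` gives the form required by `sum_runWith`. -/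
theorem forgeVal_eq (H : P.Hash pp) (d : (x : P.Rng × P.Msg) → P.Dom pp x.1)
    (L : List (P.Rng × P.Msg)) (ψ : QState W) :
    forgeVal kp out H L ψ = ∑ e : Bool, 1 * forgeAtVal kp out e H d L ψ := by
  simp only [forgeVal, forgeAtVal, probOf, one_mul, Fintype.sum_bool]
  rw [← Finset.sum_add_distrib]
  refine Finset.sum_congr rfl fun b _ => ?_
  have hor := forges_iff kp (H := H) (d := d) (L := L) (x := b ∘ out)
  by_cases h1 : ForgesAt kp true H d L (b ∘ out)
  · have h2 : ¬ ForgesAt kp false H d L (b ∘ out) := by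
      rintro ⟨ρ', h', -, -, -, h2⟩
      obtain ⟨ρ, h, -, -, -, h3⟩ := h1
      obtain rfl := encRing_injective (h.trans h'.symm)
      exact Bool.false_ne_true (h2.1 (h3.2 rfl))
    simp [h1, h2, hor.2 (Or.inl h1)]
  · by_cases h2 : ForgesAt kp false H d L (b ∘ out)
    · simp [h1, h2, hor.2 (Or.inr h2)]
    · have : ¬ Forges kp H L (b ∘ out) := fun h => (hor.1 h).elim h1 h2
      simp [h1, h2, this]

theorem forgeVal_bounds (H : P.Hash pp) (L : List (P.Rng × P.Msg)) (ψ : QState W) :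
    0 ≤ forgeVal kp out H L ψ ∧ forgeVal kp out H L ψ ≤ normSqr ψ :=
  ⟨probOf_nonneg _ _, probOf_le _ _⟩

/-- For a given output string, verification reads the oracle at a single point. -/
theorem sum_abs_forgeVal_sub_le {Ω : Type} [Fintype Ω] {p : Ω → ℝ} (hp : IsDist p)
    {h : Ω → P.Hash pp} {a : P.Hash pp} {ε : ℝ} (hε : 0 ≤ ε)
    (hbad : ∀ x, (∑ ω, p ω * if h ω x ≠ a x then 1 else 0) ≤ ε)
    (L : List (P.Rng × P.Msg)) (ψ : QState W) :
    ∑ ω, p ω * |forgeVal kp out (h ω) L ψ - forgeVal kp out a L ψ| ≤ ε * normSqr ψ := by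
  rw [normSqr, Finset.mul_sum]
  refine sum_abs_sum_sub_le hp _ fun b => ?_
  rcases hd : decode encRing (b ∘ out ∘ Sum.inl) with _ | ρ
  · have hn : ∀ H : P.Hash pp, ¬ Forges kp H L (b ∘ out) := by
      rintro H ⟨ρ, hρ, -⟩
      exact decode_eq_none_iff.1 hd ρ hρ
    simp only [hn, if_false, sub_self, abs_zero, mul_zero, Finset.sum_const_zero]
    positivity
  · refine le_trans ?_ (mul_le_mul_of_nonneg_right (hbad (ρ, b ∘ out ∘ Sum.inr ∘ Sum.inl))
      (by positivity : 0 ≤ ‖ψ b‖ ^ 2))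
    rw [Finset.sum_mul]
    refine Finset.sum_le_sum fun ω _ => ?_
    rw [mul_assoc]
    refine mul_le_mul_of_nonneg_left ?_ (hp.1 ω)
    by_cases hx : h ω (ρ, b ∘ out ∘ Sum.inr ∘ Sum.inl) = a (ρ, b ∘ out ∘ Sum.inr ∘ Sum.inl)
    · have : Forges kp (h ω) L (b ∘ out) ↔ Forges kp a L (b ∘ out) := by
        have e1 : ∀ ρ', encRing ρ' = (b ∘ out) ∘ Sum.inl → ρ' = ρ := fun ρ' h' => by
          have := (decode_eq_some_iff encRing_injective).1 hd
          exact encRing_injective (h'.trans this.symm)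
        constructor
        all_goals
          rintro ⟨ρ', h1, h2, h3, h4, h5⟩
          obtain rfl := e1 ρ' h1
          refine ⟨ρ', h1, h2, h3, h4, h5.trans ?_⟩
        · exact hx
        · exact hx.symm
      simp [this, hx]
    · simp only [hx, ne_eq, not_false_eq_true, if_true, one_mul]
      split_ifs <;> simp

variable (os : List (ForgerOp P W)) (ψ : QState W)

/-- Success probability with trapdoor signatures. -/
def trapVal (qs : ℕ) (H : P.Hash pp) : ℝ :=
  runWith qs pp kp H (trapSign kp H) (forgeVal kp out H) os [] ψ

/-- Success probability with signatures from the conditional distributions. -/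
def condVal (qs : ℕ) (H : P.Hash pp) : ℝ :=
  runWith qs pp kp H (condSign kp H) (forgeVal kp out H) os [] ψ

/-- Probability of a forgery that differs from the sampled domain element. -/
def sampleVal (qs : ℕ) (H : P.Hash pp) (d : (x : P.Rng × P.Msg) → P.Dom pp x.1) : ℝ :=
  runWith qs pp kp H (pointSign N d) (forgeAtVal kp out false H d) os [] ψ

variable {kp}

/-- The coupling reduces the claim to perturbations of a fixed table `c`, to which the hybrid bound
applies. The factor two arises because each of the two oracles is compared with the common one. At
points without a game key the two laws coincide. -/
theorem abs_trapVal_sub_le {ε t : ℝ} (hε : 0 ≤ ε) (hε1 : ε < 1) (ht : 0 < t) (hψ : normSqr ψ = 1)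
    (hdom : ∀ x, GoodPoint kp x → statDist ((P.domDist pp x.1).map (P.f pp x.1))
      (PMF.uniformOfFintype (P.Ran pp x.1)) ≤ ε) :
    |piExp (ranWeight P pp) (trapVal kp out os ψ qs)
        - piExp (imageWeight kp pp) (trapVal kp out os ψ qs)|
      ≤ 2 * (os.countP ForgerOp.isHash * (2 * (t * ε + t⁻¹)) + os.countP ForgerOp.isSign * ε + ε) := by
  refine abs_piExp_sub_le isDist_ranWeight (isDist_imageWeight kp) hε1 (fun x => ?_) _ ?_
  · by_cases hx : GoodPoint kp x
    · refine le_trans (le_of_eq ?_) (hdom x hx)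
      unfold statDist
      congr 1
      refine Finset.sum_congr rfl fun r _ => ?_
      rw [abs_sub_comm, imageWeight, if_pos hx, ranWeight]
      simp
    · simp [imageWeight, hx, hε]
  · intro c k hk hbad
    have hb : ∀ x, (∑ h : P.Hash pp, (∏ x, k x (h x)) * if h x ≠ c x then 1 else 0) ≤ ε := by
      intro x
      refine le_trans (le_of_eq ?_) (hbad x)
      exact piExp_coord hk x (fun r => if r ≠ c x then 1 else 0)
    have := sum_abs_runWith_sub_le (qs := qs) (kp := kp) (h := fun h : P.Hash pp => h) (a := c)
      (IsDist.pi hk) hε ht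
      hb (T := fun ρ j r σ => (P.SamplePre pp ρ (kp j).2 r σ).toReal) (fun _ _ _ _ => isDist_toReal _)
      (fin := forgeVal kp out) (forgeVal_bounds kp out)
      (fun H L => abs_probOf_sub_le ht _) (sum_abs_forgeVal_sub_le kp out (IsDist.pi hk) hε hb) os []
      ψ
    rw [hψ, mul_one] at this
    exact this

/-- Only oracles of positive weight matter; for them every hash value at a good point is an image of
the sampler, so the conditional distribution is defined there. -/
theorem abs_trapVal_sub_condVal_le {ε : ℝ} (hε : 0 ≤ ε) (hψ : normSqr ψ = 1)
    (hpre : ∀ ρ j, ρ.Has (kp j).1 → ∀ (r : P.Ran pp ρ) (h : P.Hit pp ρ r),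
      statDist (P.SamplePre pp ρ (kp j).2 r) (P.condDist pp ρ r h) ≤ ε) :
    |piExp (imageWeight kp pp) (trapVal kp out os ψ qs)
        - piExp (imageWeight kp pp) (condVal kp out os ψ qs)|
      ≤ os.countP ForgerOp.isSign * ε := by
  rw [← piExp_sub]
  refine (abs_piExp_le (isDist_imageWeight kp) _).trans ?_
  refine (piExp_mono (isDist_imageWeight kp) fun H hH => ?_).trans_eq
    (piExp_const (isDist_imageWeight kp) _)
  have := abs_runWith_sub_le_of_statDist (H := H) (qs := qs) (stochastic_trapSign kp H)
    (stochastic_condSign kp H) (forgeVal_bounds kp out H) hε (fun ρ m j hj => ?_) os [] ψ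
  · rwa [hψ, mul_one] at this
  · have hg : GoodPoint kp (ρ, m) := ⟨j, hj⟩
    have hh := hit_of_imageWeight_ne_zero kp hg (hH (ρ, m))
    have := hpre ρ j hj (H (ρ, m)) hh
    unfold statDist at this
    simpa only [trapSign, condSign, condWeight, dif_pos (And.intro hg hh)] using this

theorem trapVal_le_of_renyi {γ R : ℝ} (h0 : 0 < γ) (h1 : γ ≤ 1) (hR : 1 ≤ R) (hψ : normSqr ψ = 1)
    (hpre : ∀ ρ j, ρ.Has (kp j).1 → ∀ (r : P.Ran pp ρ) (h : P.Hit pp ρ r) (v : P.Dom pp ρ → ℝ),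
      (∀ d, 0 ≤ v d) → ∑ d, (P.SamplePre pp ρ (kp j).2 r d).toReal * v d ^ γ
        ≤ (R * ∑ d, (P.condDist pp ρ r h d).toReal * v d) ^ γ) (H : P.Hash pp)
    (hH : ∀ x, imageWeight kp pp x (H x) ≠ 0) :
    trapVal kp out os ψ qs H
      ≤ (R ^ os.countP ForgerOp.isSign * condVal kp out os ψ qs H) ^ γ := by
  have := runWith_le_of_renyi (H := H) (qs := qs) (stochastic_trapSign kp H)
    (stochastic_condSign kp H) (forgeVal_bounds kp out H) h0 h1 hR (fun ρ m j hj v hv => ?_) os [] ψ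
  · rwa [hψ, Real.one_rpow, mul_one] at this
  · have hg : GoodPoint kp (ρ, m) := ⟨j, hj⟩
    have hh := hit_of_imageWeight_ne_zero kp hg (hH (ρ, m))
    have := hpre ρ j hj (H (ρ, m)) hh v hv
    simpa only [trapSign, condSign, condWeight, dif_pos (And.intro hg hh)] using this

theorem condVal_bounds (hψ : normSqr ψ = 1) (H : P.Hash pp) :
    0 ≤ condVal kp out os ψ qs H ∧ condVal kp out os ψ qs H ≤ 1 := by
  rw [← hψ]
  exact runWith_bounds (stochastic_condSign kp H) (forgeVal_bounds kp out H) os [] ψ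

theorem trapVal_bounds (hψ : normSqr ψ = 1) (H : P.Hash pp) :
    0 ≤ trapVal kp out os ψ qs H ∧ trapVal kp out os ψ qs H ≤ 1 := by
  rw [← hψ]
  exact runWith_bounds (stochastic_trapSign kp H) (forgeVal_bounds kp out H) os [] ψ

theorem goodPoint_of_ringIn {ρ : P.Rng} (h : RingIn kp ρ) (m : P.Msg) : GoodPoint kp (ρ, m) := by
  obtain ⟨j, hj⟩ := h 0
  exact ⟨j, 0, hj.symm⟩

/-- With all signatures drawn in advance, the value at the forged pair is untouched by the run since
that pair is unsigned. Given the output, it still has the conditional law, so it equals the forged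
signature with probability at most `b`. -/
theorem condVal_le {b : ℝ} (hb : 0 ≤ b) (hψ : normSqr ψ = 1)
    (hent : ∀ ρ, RingIn kp ρ → ∀ (r : P.Ran pp ρ) (h : P.Hit pp ρ r) (d : P.Dom pp ρ),
      (P.condDist pp ρ r h d).toReal ≤ b)
    (H : P.Hash pp) (hH : ∀ x, imageWeight kp pp x (H x) ≠ 0) :
    condVal kp out os ψ qs H
      ≤ b + piExp (fun x => condWeight kp pp x (H x)) (sampleVal kp out os ψ qs H) := by
  have hK := fun x => isDist_condWeight kp x (H x)
  have hupd : ∀ e L, ∀ x ∈ L, ∀ (d : (x : P.Rng × P.Msg) → P.Dom pp x.1) (y : P.Dom pp x.1)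
      (ψ : QState W), forgeAtVal kp out e H (Function.update d x y) L ψ
        = forgeAtVal kp out e H d L ψ := by
    intro e L x hx d y ψ
    unfold forgeAtVal
    congr 1
    funext b
    unfold ForgesAt
    refine propext (exists_congr fun ρ => and_congr_right fun _ => and_congr_right fun _ =>
      and_congr_right fun h3 => and_congr_right fun _ => ?_)
    rw [Function.update_of_ne]
    rintro rfl
    exact h3 hx
  -- Signatures are drawn in advance while the final value is still independent of `d`; only then is
  -- the forgery event split according to `d`.
  have e1 : condVal kp out os ψ qs H = ∑ e : Bool, 1 * piExp (fun x => condWeight kp pp x (H x))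
      (fun d => runWith qs pp kp H (pointSign N d) (forgeAtVal kp out e H d) os [] ψ) := by
    have h1 := piExp_runWith_pointSign (H := H) (qs := qs) (kp := kp) hK
      (fins := fun _ => forgeVal kp out H) (fun _ _ _ _ _ _ => rfl) os [] ψ
    simp only [piExp_const hK] at h1
    rw [condVal]
    refine Eq.trans h1.symm ?_
    simp only [one_mul]
    rw [← piExp_sum]
    refine piExp_congr fun d _ => ?_
    have := sum_runWith (H := H) (qs := qs) (kp := kp) (S := pointSign N d) Finset.univ
      (fun _ : Bool => (1 : ℝ)) (fun e => forgeAtVal kp out e H d) os [] ψ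
    simp only [← forgeVal_eq] at this
    rw [← this]
    simp
  rw [e1, Fintype.sum_bool, one_mul, one_mul]
  refine add_le_add ?_ le_rfl
  rw [piExp_runWith_pointSign (H := H) (qs := qs) (kp := kp) hK (hupd true)]
  have hS : Stochastic kp (fun ρ m (_ : Fin N) => condWeight kp pp (ρ, m) (H (ρ, m))) :=
    fun ρ m _ _ => hK (ρ, m)
  -- A sum over one element, so that `sum_runWith` pulls the constant `b` out of the run.
  refine (runWith_mono hS (fin' := fun L ψ => ∑ _i ∈ ({()} : Finset Unit), b * forgeVal kp out H L ψ)
    (fun L φ => ?_) os [] ψ).trans ?_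
  · simp only [Finset.sum_const, Finset.card_singleton, one_smul, forgeAtVal, probOf, forgeVal]
    rw [piExp_sum, Finset.mul_sum]
    refine Finset.sum_le_sum fun s _ => ?_
    by_cases hf : Forges kp H L (s ∘ out)
    · rw [if_pos hf]
      obtain ⟨ρ, h1, h2, h3, h4⟩ := hf
      have hx := goodPoint_of_ringIn h2 ((s ∘ out) ∘ Sum.inr ∘ Sum.inl)
      have hh := hit_of_imageWeight_ne_zero kp hx (hH _)
      obtain ⟨hσ, h5⟩ := h4
      have hle := hent ρ h2 _ hh ⟨_, hσ⟩
      calc _ ≤ piExp (fun x => condWeight kp pp x (H x)) (fun d => ‖φ s‖ ^ 2 *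
            if d (ρ, (s ∘ out) ∘ Sum.inr ∘ Sum.inl) = ⟨_, hσ⟩ then 1 else 0) := by
            refine piExp_mono hK fun d _ => ?_
            by_cases hd : d (ρ, (s ∘ out) ∘ Sum.inr ∘ Sum.inl) = ⟨_, hσ⟩
            · rw [if_pos hd]
              split_ifs <;> simp
            · have : ¬ ForgesAt kp true H d L (s ∘ out) := by
                rintro ⟨ρ', h1', -, -, -, h6⟩
                obtain rfl := encRing_injective (h1.trans h1'.symm)
                exact hd (Subtype.ext (h6.2 rfl))
              simp [this, hd]
        _ = ‖φ s‖ ^ 2 * condWeight kp pp (ρ, (s ∘ out) ∘ Sum.inr ∘ Sum.inl) (H _) ⟨_, hσ⟩ := by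
            rw [piExp_const_mul]
            congr 1
            refine (piExp_coord hK (ρ, (s ∘ out) ∘ Sum.inr ∘ Sum.inl)
              (fun r => if r = ⟨_, hσ⟩ then 1 else 0)).trans ?_
            simp
        _ ≤ ‖φ s‖ ^ 2 * b := by
            refine mul_le_mul_of_nonneg_left ?_ (by positivity)
            rw [condWeight, dif_pos ⟨hx, hh⟩]
            exact hle
        _ = b * ‖φ s‖ ^ 2 := mul_comm _ _
    · have : ∀ d, ¬ ForgesAt kp true H d L (s ∘ out) := fun d h =>
        hf ((forges_iff kp).2 (Or.inl h))
      simp [this, hf, piExp]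
  · have := sum_runWith (H := H) (qs := qs) (kp := kp)
      (S := fun ρ m (_ : Fin N) => condWeight kp pp (ρ, m) (H (ρ, m))) ({()} : Finset Unit)
      (fun _ => b) (fun _ => forgeVal kp out H) os [] ψ
    rw [← this, Finset.sum_singleton]
    have hb2 := (runWith_bounds (H := H) (qs := qs) hS (forgeVal_bounds kp out H) os [] ψ).2
    rw [hψ] at hb2
    nlinarith

/-! ### Joint generation of hash values and preimages from coins. -/

/-- The random oracle simulated from coins `G` for the domain sampler and a random oracle `H`. -/
def simHash (kp : Fin N → P.KeyPair) (G : P.Rng × P.Msg → Bits P.coinLen) (H : P.Hash pp) :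
    P.Hash pp :=
  fun x => if GoodPoint kp x then P.f pp x.1 (P.SampleDom pp x.1 (G x)) else H x

/-- The domain elements sampled with coins `G`. -/
def simDom (pp : Bits P.ppLen) (G : P.Rng × P.Msg → Bits P.coinLen) (x : P.Rng × P.Msg) :
    P.Dom pp x.1 :=
  P.SampleDom pp x.1 (G x)

/-- Drawing the image and then a conditional preimage is the same as drawing coins and computing
both. The product weights are compared coordinate by coordinate with `domWeight_mul_eq`. -/
theorem piExp_imageWeight_condWeight
    (Φ : P.Hash pp → ((x : P.Rng × P.Msg) → P.Dom pp x.1) → ℝ) :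
    piExp (imageWeight kp pp) (fun H => piExp (fun x => condWeight kp pp x (H x)) (Φ H))
      = piExp (fun (_ : P.Rng × P.Msg) (_ : Bits P.coinLen) =>
          (Fintype.card (Bits P.coinLen) : ℝ)⁻¹) fun G =>
        piExp (ranWeight P pp) fun H => Φ (simHash kp G H) (simDom pp G) := by
  have h1 := piExp_map (fun (_ : P.Rng × P.Msg) (_ : Bits P.coinLen) =>
    (Fintype.card (Bits P.coinLen) : ℝ)⁻¹) (fun x c => P.SampleDom pp x.1 c)
    (fun d => piExp (ranWeight P pp) fun H =>
      Φ (fun x => if GoodPoint kp x then P.f pp x.1 (d x) else H x) d)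
  refine Eq.trans ?_ h1.symm
  have h2 : (fun (x : P.Rng × P.Msg) (b : P.Dom pp x.1) => ∑ a : Bits P.coinLen,
      (Fintype.card (Bits P.coinLen) : ℝ)⁻¹ * if P.SampleDom pp x.1 a = b then 1 else 0)
      = domWeight P pp := by
    funext x d
    rw [domWeight, RPSF.domDist, toReal_map_apply]
    simp
  rw [h2]
  have h3 : ∀ d : (x : P.Rng × P.Msg) → P.Dom pp x.1, (piExp (ranWeight P pp) fun H =>
      Φ (fun x => if GoodPoint kp x then P.f pp x.1 (d x) else H x) d)
      = piExp (fun x r => ∑ r₀, ranWeight P pp x r₀ *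
        if (if GoodPoint kp x then P.f pp x.1 (d x) else r₀) = r then 1 else 0) fun H => Φ H d :=
    fun d => piExp_map (ranWeight P pp) (fun x r => if GoodPoint kp x then P.f pp x.1 (d x) else r)
      (fun H => Φ H d)
  simp only [h3]
  simp only [piExp, Finset.mul_sum]
  rw [Finset.sum_comm]
  refine Finset.sum_congr rfl fun d _ => Finset.sum_congr rfl fun H _ => ?_
  rw [← mul_assoc, ← mul_assoc, ← Finset.prod_mul_distrib, ← Finset.prod_mul_distrib]
  congr 1
  exact Finset.prod_congr rfl fun x _ => (domWeight_mul_eq kp x (H x) (d x)).symm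

end Games

/-! ## Functions of few values of a random function -/

section Junta

variable {X Y : Type}

/-- Linear combinations of functions of at most `k` values of `G`. -/
def juntaSpan (X Y : Type) (k : ℕ) : Submodule ℂ ((X → Y) → ℂ) :=
  Submodule.span ℂ {g | ∃ S : Finset X, S.card ≤ k ∧ DependsOn g (S : Set X)}

theorem juntaSpan_mono {k l : ℕ} (h : k ≤ l) : juntaSpan X Y k ≤ juntaSpan X Y l :=
  Submodule.span_mono fun _ ⟨S, hS, hg⟩ => ⟨S, hS.trans h, hg⟩

theorem mul_mem_juntaSpan {k l : ℕ} {f g : (X → Y) → ℂ} (hf : f ∈ juntaSpan X Y k)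
    (hg : g ∈ juntaSpan X Y l) : (fun G => f G * g G) ∈ juntaSpan X Y (k + l) := by
  change f * g ∈ _
  induction hf using Submodule.span_induction with
  | mem f hf =>
    obtain ⟨S, hS, hf⟩ := hf
    induction hg using Submodule.span_induction with
    | mem g hg =>
      obtain ⟨T, hT, hg⟩ := hg
      refine Submodule.subset_span ⟨S ∪ T, (Finset.card_union_le _ _).trans (add_le_add hS hT), ?_⟩
      intro G G' h
      have h1 : f G = f G' := hf fun i hi => h i (by simp at hi ⊢; exact Or.inl hi)
      have h2 : g G = g G' := hg fun i hi => h i (by simp at hi ⊢; exact Or.inr hi)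
      simp [h1, h2]
    | zero => simp
    | add g g' _ _ h1 h2 => rw [mul_add]; exact add_mem h1 h2
    | smul c g _ h1 => rw [mul_smul_comm]; exact Submodule.smul_mem _ _ h1
  | zero => simp
  | add f f' _ _ h1 h2 => rw [add_mul]; exact add_mem h1 h2
  | smul c f _ h1 => rw [smul_mul_assoc]; exact Submodule.smul_mem _ _ h1

theorem conj_mem_juntaSpan {k : ℕ} {f : (X → Y) → ℂ} (hf : f ∈ juntaSpan X Y k) :
    (fun G => (starRingEnd ℂ) (f G)) ∈ juntaSpan X Y k := by
  change star f ∈ _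
  induction hf using Submodule.span_induction with
  | mem f hf =>
    obtain ⟨S, hS, hf⟩ := hf
    exact Submodule.subset_span ⟨S, hS, fun G G' h => by simp [hf h]⟩
  | zero => simp
  | add f f' _ _ h1 h2 => rw [star_add]; exact add_mem h1 h2
  | smul c f _ h1 => rw [star_smul]; exact Submodule.smul_mem _ _ h1

theorem sum_mem_juntaSpan {I : Type} {k : ℕ} (s : Finset I) {f : I → (X → Y) → ℂ}
    (hf : ∀ i, f i ∈ juntaSpan X Y k) : (fun G => ∑ i ∈ s, f i G) ∈ juntaSpan X Y k := by
  have : (fun G => ∑ i ∈ s, f i G) = ∑ i ∈ s, f i := by funext G; simp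
  rw [this]
  exact sum_mem fun i _ => hf i

theorem list_sum_mem_juntaSpan {I : Type} {k : ℕ} (l : List I) {f : I → (X → Y) → ℂ}
    (hf : ∀ i, f i ∈ juntaSpan X Y k) :
    (fun G => (l.map fun i => f i G).sum) ∈ juntaSpan X Y k := by
  induction l with
  | nil => exact (juntaSpan X Y k).zero_mem
  | cons i l ih => exact add_mem (hf i) ih

theorem const_mul_mem_juntaSpan {k : ℕ} {f : (X → Y) → ℂ} (c : ℂ) (hf : f ∈ juntaSpan X Y k) :
    (fun G => c * f G) ∈ juntaSpan X Y k := Submodule.smul_mem _ c hf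

theorem single_mem_juntaSpan {f : (X → Y) → ℂ} (x : X) (hf : ∀ G G', G x = G' x → f G = f G') :
    f ∈ juntaSpan X Y 1 :=
  Submodule.subset_span ⟨{x}, by simp, fun G G' h => hf G G' (h x (by simp))⟩

theorem const_mem_juntaSpan (c : ℂ) (k : ℕ) : (fun _ : X → Y => c) ∈ juntaSpan X Y k :=
  Submodule.subset_span ⟨∅, by simp, fun _ _ _ => rfl⟩

/-- All fibres of `f` have the same size. -/
def UniformFibres {A B : Type} [Fintype A] [Fintype B] (f : A → B) : Prop :=
  ∀ φ : B → ℂ, (∑ a, φ (f a)) / Fintype.card A = (∑ b, φ b) / Fintype.card B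

/-- The fibres are cosets of the kernel. -/
theorem UniformFibres.of_addMonoidHom {A B : Type} [Fintype A] [Fintype B] [AddCommGroup A]
    [AddCommGroup B] (f : A →+ B) (hf : Function.Surjective f) : UniformFibres f := by
  intro φ
  have hfib : ∀ b, (Finset.univ.filter fun a => f a = b).card
      = (Finset.univ.filter fun a => f a = 0).card := by
    intro b
    obtain ⟨a, rfl⟩ := hf b
    refine Finset.card_bij' (fun x _ => x - a) (fun x _ => x + a) ?_ ?_ ?_ ?_ <;> simp +contextual
  set c := (Finset.univ.filter fun a => f a = 0).card with hc
  have h1 : ∀ ψ : B → ℂ, ∑ a, ψ (f a) = c * ∑ b, ψ b := by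
    intro ψ
    rw [← Finset.sum_fiberwise Finset.univ f, Finset.mul_sum]
    refine Finset.sum_congr rfl fun b _ => ?_
    rw [Finset.sum_congr rfl fun a ha => by rw [(Finset.mem_filter.1 ha).2], Finset.sum_const,
      hfib, nsmul_eq_mul]
  have h2 := h1 fun _ => 1
  simp only [Finset.sum_const, Finset.card_univ, nsmul_eq_mul, mul_one] at h2
  have hA : (Fintype.card A : ℂ) ≠ 0 := by
    have : 0 < Fintype.card A := Fintype.card_pos_iff.2 ⟨0⟩
    exact_mod_cast this.ne'
  have hB : (Fintype.card B : ℂ) ≠ 0 := by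
    have : 0 < Fintype.card B := Fintype.card_pos_iff.2 ⟨0⟩
    exact_mod_cast this.ne'
  rw [h1, h2]
  have hc0 : (c : ℂ) ≠ 0 := fun h => hA (by rw [h2, h, zero_mul])
  field_simp

theorem UniformFibres.equiv_comp {A A' B B' : Type} [Fintype A] [Fintype A'] [Fintype B] [Fintype B']
    {f : A → B} (hf : UniformFibres f) (e : A' ≃ A) (e' : B ≃ B') :
    UniformFibres fun a => e' (f (e a)) := by
  intro φ
  have h := hf fun b => φ (e' b)
  rwa [Equiv.sum_comp e' φ, ← Equiv.sum_comp e fun a => φ (e' (f a)), ← Fintype.card_congr e,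
    Fintype.card_congr e'] at h

/-- The family `g` is `k`-wise independent and uniform. -/
def KWise {Θ : Type} [Fintype Θ] [Fintype Y] [DecidableEq X] (k : ℕ) (g : Θ → X → Y) : Prop :=
  ∀ S : Finset X, S.card ≤ k → UniformFibres fun θ (x : S) => g θ x

/-- Both averages are linear in `f`, which leaves functions of at most `k` coordinates; for these
only the joint law of those coordinates matters, and it is uniform on both sides. -/
theorem KWise.sum_eq [Fintype X] [Fintype Y] [DecidableEq X] [Nonempty Y] {Θ : Type} [Fintype Θ] {k : ℕ}
    {g : Θ → X → Y} (hg : KWise k g)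
    (hall : ∀ S : Finset X, UniformFibres fun (G : X → Y) (x : S) => G x)
    {f : (X → Y) → ℂ} (hf : f ∈ juntaSpan X Y k) :
    (∑ θ, f (g θ)) / Fintype.card Θ = (∑ G, f G) / Fintype.card (X → Y) := by
  induction hf using Submodule.span_induction with
  | mem f hf =>
    obtain ⟨S, hS, hf⟩ := hf
    set φ : (S → Y) → ℂ := fun y => f fun x =>
      if h : x ∈ S then y ⟨x, h⟩ else Classical.arbitrary Y with hφ
    have h1 : ∀ G : X → Y, f G = φ fun x : S => G x := fun G =>
      hf fun x hx => by simp [Finset.mem_coe.1 hx]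
    simp only [h1]
    exact (hg S hS φ).trans (hall S φ).symm
  | zero => simp
  | add f f' _ _ h1 h2 =>
    simp only [Pi.add_apply, Finset.sum_add_distrib, add_div, h1, h2]
  | smul c f _ h1 =>
    simp only [Pi.smul_apply, ← Finset.smul_sum, smul_div_assoc, h1]

end Junta

/-! ## Polynomials over finite fields -/

/-- Bits as elements of the field with two elements. -/
def bitEquiv : ZMod 2 ≃ Bool where
  toFun z := decide (z ≠ 0)
  invFun b := if b then 1 else 0
  left_inv := by decide
  right_inv := by decide

theorem bitEquiv_symm_xor (a b : Bool) :
    bitEquiv.symm (xor a b) = bitEquiv.symm a + bitEquiv.symm b := by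
  revert a b; decide

theorem bitEquiv_symm_and (a b : Bool) :
    bitEquiv.symm (a && b) = bitEquiv.symm a * bitEquiv.symm b := by
  revert a b; decide

theorem balanced_restrict {X : Type} [Fintype X] [DecidableEq X] (c : ℕ) (S : Finset X) :
    UniformFibres fun (G : X → Bits c) (x : S) => G x := by
  have h := UniformFibres.of_addMonoidHom (A := X → Fin c → ZMod 2) (B := S → Fin c → ZMod 2)
    { toFun := fun G x => G x, map_zero' := rfl, map_add' := fun _ _ => rfl } (fun t => by
      refine ⟨fun x => if h : x ∈ S then t ⟨x, h⟩ else 0, ?_⟩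
      funext x
      simp)
  have h2 := h.equiv_comp (Equiv.piCongrRight fun _ : X => Equiv.piCongrRight fun _ : Fin c =>
    bitEquiv.symm) (Equiv.piCongrRight fun _ : S => Equiv.piCongrRight fun _ : Fin c => bitEquiv)
  convert h2 using 1
  funext G x k
  exact (bitEquiv.apply_symm_apply _).symm

section Poly

variable {F : Type} [Field F] [Algebra (ZMod 2) F] {n : ℕ} (b : Module.Basis (Fin n) (ZMod 2) F)

/-- A bit of the coordinates of a field element. -/
def coordBit (y : F) (k : Fin n) : Bool := bitEquiv (b.repr y k)

/-- Bit strings as field elements. -/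
def strElem {I : Type} [Fintype I] (e : I ↪ Fin n) (v : I → Bool) : F :=
  ∑ i, bitEquiv.symm (v i) • b (e i)

/-- Values of polynomials on bit strings. -/
def polyFun {I : Type} [Fintype I] {c K : ℕ} (e : I ↪ Fin n) (o : Fin c ↪ Fin n) (θ : Fin K → F)
    (v : I → Bool) : Bits c :=
  fun k => coordBit b (∑ i, θ i * strElem b e v ^ i.1) (o k)

theorem repr_strElem {I : Type} [Fintype I] (e : I ↪ Fin n) (v : I → Bool) (k : Fin n) :
    b.repr (strElem b e v) k = ∑ i, if e i = k then bitEquiv.symm (v i) else 0 := by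
  rw [strElem, map_sum, Finsupp.finsetSum_apply]
  refine Finset.sum_congr rfl fun i _ => ?_
  simp [Finsupp.single_apply]

theorem strElem_injective {I : Type} [Fintype I] (e : I ↪ Fin n) :
    Function.Injective (strElem b e : (I → Bool) → F) := by
  intro v v' h
  funext i
  have h1 := repr_strElem b e v (e i)
  rw [h, repr_strElem] at h1
  simp only [e.injective.eq_iff, Finset.sum_ite_eq', Finset.mem_univ, if_true] at h1
  exact (bitEquiv.symm.injective h1).symm

theorem coordBit_strElem {I : Type} [Fintype I] (e : I ↪ Fin n) (v : I → Bool) (k : Fin n) :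
    coordBit b (strElem b e v) k = if h : ∃ i, e i = k then v h.choose else false := by
  rw [coordBit, repr_strElem]
  split_ifs with h
  · have hs := h.choose_spec
    generalize h.choose = i₀ at hs
    simp [← hs, e.injective.eq_iff]
  · push Not at h
    simp only [h, if_false, Finset.sum_const_zero]
    rfl

theorem coordBit_add (y z : F) (k : Fin n) :
    coordBit b (y + z) k = xor (coordBit b y k) (coordBit b z k) := by
  apply bitEquiv.symm.injective
  simp [bitEquiv_symm_xor, coordBit]

/-- Multiplication is bilinear over the field with two elements; the bits `coordBit b (b p.1 * b
p.2) k` are its structure constants, which programs can hard-wire. -/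
theorem symm_coordBit_mul (y z : F) (k : Fin n) :
    bitEquiv.symm (coordBit b (y * z) k) = ∑ p : Fin n × Fin n, bitEquiv.symm
      ((coordBit b y p.1 && coordBit b z p.2) && coordBit b (b p.1 * b p.2) k) := by
  simp only [bitEquiv_symm_and, coordBit, Equiv.symm_apply_apply]
  conv_lhs => rw [← b.sum_repr y, ← b.sum_repr z]
  rw [Finset.sum_mul_sum, map_sum, Finsupp.finsetSum_apply, Fintype.sum_prod_type]
  refine Finset.sum_congr rfl fun i _ => ?_
  rw [map_sum, Finsupp.finsetSum_apply]
  refine Finset.sum_congr rfl fun j _ => ?_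
  rw [smul_mul_smul_comm, map_smul, Finsupp.smul_apply, smul_eq_mul]

/-- Evaluation at `S.card ≤ K` distinct points is additive in the coefficients. Lagrange
interpolation makes it surjective onto all prescribed coordinates, so its fibres have equal size. -/
theorem kWise_polyFun [Fintype F] {I : Type} [Fintype I] {c K : ℕ} (e : I ↪ Fin n)
    (o : Fin c ↪ Fin n) {X : Type} [DecidableEq X] (pt : X → I → Bool) (hpt : Function.Injective pt) :
    KWise (Θ := Fin K → F) K fun θ x => polyFun b e o θ (pt x) := by
  intro S hS
  set f : (Fin K → F) →+ (S → Fin c → ZMod 2) :=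
    { toFun := fun θ x k => b.repr (∑ i, θ i * strElem b e (pt x) ^ i.1) (o k)
      map_zero' := by funext x k; simp
      map_add' := fun θ θ' => by
        funext x k; simp [add_mul, Finset.sum_add_distrib] } with hf
  have hsurj : Function.Surjective f := by
    intro t
    have hinj : Set.InjOn (fun x : X => strElem b e (pt x)) (S : Set X) :=
      fun x _ y _ h => hpt (strElem_injective b e h)
    set y : X → F := fun x => if h : x ∈ S then ∑ k, t ⟨x, h⟩ k • b (o k) else 0 with hy
    set p := Lagrange.interpolate S (fun x : X => strElem b e (pt x)) y with hp
    have hdeg : p.degree < S.card := Lagrange.degree_interpolate_lt _ hinj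
    refine ⟨fun i => p.coeff i, ?_⟩
    funext x k
    have hev : ∑ i : Fin K, p.coeff i * strElem b e (pt x) ^ i.1 = y x := by
      rw [Fin.sum_univ_eq_sum_range (fun i => p.coeff i * strElem b e (pt x) ^ i) K]
      rw [← Lagrange.eval_interpolate_at_node y hinj x.2, ← hp]
      -- For `K = 0` the set `S` is empty and has no point `x`.
      rcases Nat.eq_zero_or_pos K with h0 | h0
      · exact absurd (Finset.card_pos.2 ⟨x.1, x.2⟩) (by omega)
      · refine (Polynomial.eval_eq_sum_range' ?_ _).symm
        by_cases hp0 : p = 0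
        · simpa [hp0] using h0
        · exact ((Polynomial.natDegree_lt_iff_degree_lt hp0).2 hdeg).trans_le hS
    change b.repr (∑ i : Fin K, p.coeff i * strElem b e (pt x) ^ i.1) (o k) = t x k
    rw [hev, hy]
    simp only [Finset.coe_mem, dif_pos, map_sum, Finsupp.finsetSum_apply]
    simp [Finsupp.single_apply]
  have := (UniformFibres.of_addMonoidHom f hsurj).equiv_comp (Equiv.refl _)
    (Equiv.piCongrRight fun _ : S => Equiv.piCongrRight fun _ : Fin c => bitEquiv)
  exact this

end Poly

/-! ## Runs as functions of the coins -/

section RunJunta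

variable {P : RPSF} {N W : ℕ} {qs : ℕ} {pp : Bits P.ppLen} {kp : Fin N → P.KeyPair}
  (out : P.RIdx ⊕ (Fin P.msgLen ⊕ Fin P.domLen) ↪ Fin W)

theorem linearMap_mem_juntaSpan {X Y : Type} {k : ℕ} (M : QState W →ₗ[ℂ] QState W)
    {ψ : (X → Y) → QState W} (hψ : ∀ b, (fun G => ψ G b) ∈ juntaSpan X Y k) (b : Bits W) :
    (fun G => M (ψ G) b) ∈ juntaSpan X Y k := by
  have : (fun G => M (ψ G) b)
      = fun G => ∑ c, M (fun j => if c = j then 1 else 0) b * ψ G c := by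
    funext G
    rw [LinearMap.pi_apply_eq_sum_univ M (ψ G)]
    simp [Finset.sum_apply, mul_comm]
  rw [this]
  exact sum_mem_juntaSpan _ fun c => const_mul_mem_juntaSpan _ (hψ c)

/-- Expanding over the possible answers `y`, each amplitude is an old amplitude times the indicator
that the answer is `y`. The indicator depends on one value of `G` at most. -/
theorem hash_mem_juntaSpan (H : P.Hash pp) {k : ℕ}
    (w : (P.RIdx ⊕ Fin P.msgLen) ⊕ Fin P.ranLen ↪ Fin W)
    {ψ : (P.Rng × P.Msg → Bits P.coinLen) → QState W}
    (hψ : ∀ b, (fun G => ψ G b) ∈ juntaSpan _ _ k) (b : Bits W) :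
    (fun G => applyOracle w (P.hashBits (simHash kp G H)) (ψ G) b) ∈ juntaSpan _ _ (k + 1) := by
  have : (fun G => applyOracle w (P.hashBits (simHash kp G H)) (ψ G) b)
      = fun G => ∑ y, ψ G (xorOn (Function.Embedding.inr.trans w) y b)
        * if P.hashBits (simHash kp G H) (b ∘ w ∘ Sum.inl) = y then 1 else 0 := by
    funext G
    simp [applyOracle]
  rw [this]
  refine sum_mem_juntaSpan _ fun y => mul_mem_juntaSpan (hψ _) ?_
  rcases hd : decode encRing ((b ∘ w ∘ Sum.inl) ∘ Sum.inl) with _ | ρ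
  · have : ∀ H : P.Hash pp, P.hashBits H (b ∘ w ∘ Sum.inl) = fun _ => false := fun H => by
      unfold RPSF.hashBits
      rw [hd]
    simp only [this]
    exact const_mem_juntaSpan _ _
  · refine single_mem_juntaSpan (ρ, (b ∘ w ∘ Sum.inl) ∘ Sum.inr) fun G G' h => ?_
    have : ∀ H : P.Hash pp, P.hashBits H (b ∘ w ∘ Sum.inl)
        = (H (ρ, (b ∘ w ∘ Sum.inl) ∘ Sum.inr)).1 := fun H => by
      unfold RPSF.hashBits
      rw [hd]
    simp only [this, simHash, h]

/-- A probability is an amplitude times its conjugate, which doubles the degree. The forgery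
condition reads the hash value and the sampled element at the same point, so it adds only one. -/
theorem forgeAtVal_mem_juntaSpan (H : P.Hash pp) (L : List (P.Rng × P.Msg)) {k : ℕ}
    {ψ : (P.Rng × P.Msg → Bits P.coinLen) → QState W}
    (hψ : ∀ b, (fun G => ψ G b) ∈ juntaSpan _ _ k) :
    (fun G => (forgeAtVal kp out false (simHash kp G H) (simDom pp G) L (ψ G) : ℂ))
      ∈ juntaSpan _ _ (2 * k + 1) := by
  have : (fun G => (forgeAtVal kp out false (simHash kp G H) (simDom pp G) L (ψ G) : ℂ))
      = fun G => ∑ b, (ψ G b * (starRingEnd ℂ) (ψ G b)) *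
        if ForgesAt kp false (simHash kp G H) (simDom pp G) L (b ∘ out) then 1 else 0 := by
    funext G
    rw [forgeAtVal, probOf]
    push_cast
    refine Finset.sum_congr rfl fun b _ => ?_
    split_ifs
    · rw [Complex.mul_conj, Complex.normSq_eq_norm_sq]
      push_cast
      ring
    · simp
  rw [this]
  refine sum_mem_juntaSpan _ fun b => ?_
  rw [two_mul]
  refine mul_mem_juntaSpan (mul_mem_juntaSpan (hψ b) (conj_mem_juntaSpan (hψ b))) ?_
  rcases hd : decode encRing ((b ∘ out) ∘ Sum.inl) with _ | ρ
  · have hn : ∀ G, ¬ ForgesAt kp false (simHash kp G H) (simDom pp G) L (b ∘ out) := by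
      rintro G ⟨ρ, hρ, -⟩
      exact decode_eq_none_iff.1 hd ρ hρ
    simp only [hn, if_false]
    exact const_mem_juntaSpan _ _
  · refine single_mem_juntaSpan (ρ, (b ∘ out) ∘ Sum.inr ∘ Sum.inl) fun G G' h => ?_
    have hρ := (decode_eq_some_iff encRing_injective).1 hd
    have key : ∀ G G' : P.Rng × P.Msg → Bits P.coinLen,
        G (ρ, (b ∘ out) ∘ Sum.inr ∘ Sum.inl) = G' (ρ, (b ∘ out) ∘ Sum.inr ∘ Sum.inl) →
        ForgesAt kp false (simHash kp G H) (simDom pp G) L (b ∘ out) →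
        ForgesAt kp false (simHash kp G' H) (simDom pp G') L (b ∘ out) := by
      rintro G G' h ⟨ρ', h1, h2, h3, ⟨h4, h5⟩, h6⟩
      obtain rfl := encRing_injective (h1.trans hρ.symm)
      refine ⟨ρ', h1, h2, h3, ⟨h4, ?_⟩, ?_⟩
      · rw [h5]
        simp only [simHash, h]
      · simpa only [simDom, ← h] using h6
    simp only [propext (⟨key G G' h, key G' G h.symm⟩ :
      ForgesAt kp false (simHash kp G H) (simDom pp G) L (b ∘ out) ↔ _)]

/-- A hash query raises the degree of the amplitudes by one, hence that of the value by two. A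
signing query multiplies the value by the indicator of one signature and raises it by one. Other
operations do not raise it. -/
theorem runWith_mem_juntaSpan (H : P.Hash pp) (os : List (ForgerOp P W))
    (L : List (P.Rng × P.Msg)) {k : ℕ} {ψ : (P.Rng × P.Msg → Bits P.coinLen) → QState W}
    (hψ : ∀ b, (fun G => ψ G b) ∈ juntaSpan _ _ k) :
    (fun G => (runWith qs pp kp (simHash kp G H) (pointSign N (simDom pp G))
        (forgeAtVal kp out false (simHash kp G H) (simDom pp G)) os L (ψ G) : ℂ))
      ∈ juntaSpan _ _ (2 * k + 2 * os.length + 1) := by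
  induction os generalizing L k ψ with
  | nil => exact forgeAtVal_mem_juntaSpan out H L hψ
  | cons o os ih =>
    cases o with
    | op o =>
      by_cases ho : ∃ w, o = .hash w
      · obtain ⟨w, rfl⟩ := ho
        have e : ∀ (H : P.Hash pp) S' fin' ψ, runWith qs pp kp H S' fin' (.op (.hash w) :: os) L ψ
            = runWith qs pp kp H S' fin' os L (applyOracle w (P.hashBits H) ψ) :=
          fun H S' fin' ψ => List.sum_singleton
        simp only [e]
        have := ih L (hash_mem_juntaSpan (kp := kp) H w hψ)
        refine juntaSpan_mono ?_ this
        simp only [List.length_cons]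
        omega
      · have hm : ∀ H' : P.Hash pp, o.maps pp H' = o.maps pp H := by
          intro H'
          cases o with
          | hash w => exact absurd ⟨w, rfl⟩ ho
          | _ => rfl
        simp only [runWith, hm]
        have := list_sum_mem_juntaSpan (o.maps pp H) fun M =>
          ih L (fun b => linearMap_mem_juntaSpan M hψ b)
        refine juntaSpan_mono ?_ (k := 2 * k + 2 * os.length + 1) ?_
        · simp only [List.length_cons]
          omega
        · convert this using 2
          refine (map_list_sum Complex.ofRealHom _).trans ?_
          rw [List.map_map]
          rfl
    | sign w =>
      have hproj : ∀ x b, (fun G => project (w ∘ Sum.inl) x (ψ G) b) ∈ juntaSpan _ _ k := by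
        intro x b
        unfold project
        split_ifs
        · exact hψ b
        · exact const_mem_juntaSpan _ _
      simp only [runWith_sign, Complex.ofReal_sum]
      refine sum_mem_juntaSpan _ fun x => ?_
      rcases hc : signCheck qs kp L x with _ | ⟨ρ, m, j⟩
      · simp only [signBranch_none hc]
        refine juntaSpan_mono ?_ (ih L (hproj x))
        simp only [List.length_cons]
        omega
      · simp only [signBranch_some hc, Complex.ofReal_sum, Complex.ofReal_mul]
        refine sum_mem_juntaSpan _ fun σ => ?_
        refine juntaSpan_mono ?_ (mul_mem_juntaSpan (k := 1)
          (single_mem_juntaSpan (ρ, m) fun G G' h => ?_)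
          (ih ((ρ, m) :: L) fun b => hproj x (xorOn _ _ b)))
        · simp only [List.length_cons]
          omega
        · have e : simDom pp G (ρ, m) = simDom pp G' (ρ, m) := congrArg _ h
          simp only [pointSign, e]

theorem sampleVal_mem_juntaSpan (H : P.Hash pp) (os : List (ForgerOp P W)) (ψ : QState W) :
    (fun G => (sampleVal kp out os ψ qs (simHash kp G H) (simDom pp G) : ℂ))
      ∈ juntaSpan _ _ (2 * os.length + 1) := by
  have := runWith_mem_juntaSpan (qs := qs) (kp := kp) out H os [] (k := 0) (ψ := fun _ => ψ)
    fun b => const_mem_juntaSpan _ _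
  rwa [mul_zero, zero_add] at this

/-- Random coins may be replaced by values of a `k`-wise independent family. -/
theorem piExp_sampleVal_eq (os : List (ForgerOp P W)) (ψ : QState W) (H : P.Hash pp)
    {Θ : Type} [Fintype Θ] {k : ℕ}
    (hk : 2 * os.length + 1 ≤ k) {g : Θ → P.Rng × P.Msg → Bits P.coinLen} (hg : KWise k g) :
    piExp (fun (_ : P.Rng × P.Msg) (_ : Bits P.coinLen) => (Fintype.card (Bits P.coinLen) : ℝ)⁻¹)
        (fun G => sampleVal kp out os ψ qs (simHash kp G H) (simDom pp G))
      = (∑ θ, sampleVal kp out os ψ qs (simHash kp (g θ) H) (simDom pp (g θ))) / Fintype.card Θ := by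
  have h := hg.sum_eq (fun S => balanced_restrict P.coinLen S)
    (juntaSpan_mono hk (sampleVal_mem_juntaSpan (qs := qs) (kp := kp) out H os ψ))
  have h' : (∑ θ, sampleVal kp out os ψ qs (simHash kp (g θ) H) (simDom pp (g θ)))
      / Fintype.card Θ = (∑ G : P.Rng × P.Msg → Bits P.coinLen,
        sampleVal kp out os ψ qs (simHash kp G H) (simDom pp G))
      / Fintype.card (P.Rng × P.Msg → Bits P.coinLen) := by
    exact_mod_cast h
  have hc : (Fintype.card (P.Rng × P.Msg → Bits P.coinLen) : ℝ)
      = (Fintype.card (Bits P.coinLen) : ℝ) ^ Fintype.card (P.Rng × P.Msg) := by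
    rw [Fintype.card_fun, Nat.cast_pow]
  rw [h', piExp, ← Finset.mul_sum, Finset.prod_const, Finset.card_univ, div_eq_inv_mul, hc, inv_pow]

end RunJunta

/-! ## Straight-line programs -/

/-- An instruction of a straight-line program: a Boolean function of two operands, each of which is
a variable or the result of an earlier instruction. -/
structure Instr (V : Type) where
  a : V ⊕ ℕ
  b : V ⊕ ℕ
  g : Bool → Bool → Bool

section Programs

variable {V : Type}

/-- Value of an operand. -/
def operand (x : V → Bool) (m : List Bool) : V ⊕ ℕ → Bool := Sum.elim x fun k => m.getD k false

/-- Results of the instructions of a program. -/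
def memory (x : V → Bool) (p : List (Instr V)) : List Bool :=
  p.foldl (fun m n => m ++ [n.g (operand x m n.a) (operand x m n.b)]) []

/-- The operand is available after `k` instructions. -/
def Available (k : ℕ) : V ⊕ ℕ → Prop := Sum.elim (fun _ => True) fun i => i < k

/-- Programs whose operands are available. -/
inductive WellFormed : List (Instr V) → Prop
  | nil : WellFormed []
  | snoc {p : List (Instr V)} {n : Instr V} : WellFormed p → Available p.length n.a →
      Available p.length n.b → WellFormed (p ++ [n])

/-- The operand `w` has the value `g` after the program `p`. -/
def Computes (p : List (Instr V)) (w : V ⊕ ℕ) (g : (V → Bool) → Bool) : Prop :=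
  Available p.length w ∧ ∀ x, operand x (memory x p) w = g x

theorem memory_snoc (x : V → Bool) (p : List (Instr V)) (n : Instr V) :
    memory x (p ++ [n])
      = memory x p ++ [n.g (operand x (memory x p) n.a) (operand x (memory x p) n.b)] := by
  simp [memory]

theorem length_memory (x : V → Bool) (p : List (Instr V)) : (memory x p).length = p.length := by
  induction p using List.reverseRecOn with
  | nil => rfl
  | append_singleton p n ih => rw [memory_snoc]; simp [ih]

theorem memory_prefix (x : V → Bool) {p q : List (Instr V)} (h : p <+: q) :
    memory x p <+: memory x q := by
  obtain ⟨r, rfl⟩ := h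
  induction r using List.reverseRecOn with
  | nil => simp
  | append_singleton r n ih =>
    rw [← List.append_assoc, memory_snoc]
    exact ih.trans (List.prefix_append _ _)

theorem Computes.mono {p q : List (Instr V)} (h : p <+: q) {w : V ⊕ ℕ} {g : (V → Bool) → Bool}
    (hw : Computes p w g) : Computes q w g := by
  obtain ⟨h1, h2⟩ := hw
  rcases w with v | k
  · exact ⟨trivial, h2⟩
  · have hk : k < p.length := h1
    refine ⟨hk.trans_le h.length_le, fun x => ?_⟩
    rw [← h2 x]
    obtain ⟨r, hr⟩ := memory_prefix x h
    simp only [operand, Sum.elim_inr, ← hr]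
    rw [List.getD_append _ _ _ _ (by rwa [length_memory])]

theorem Computes.snoc {p : List (Instr V)} {u v : V ⊕ ℕ} {g h : (V → Bool) → Bool}
    (hu : Computes p u g) (hv : Computes p v h) (o : Bool → Bool → Bool) :
    Computes (p ++ [⟨u, v, o⟩]) (Sum.inr p.length) fun x => o (g x) (h x) := by
  refine ⟨by simp [Available], fun x => ?_⟩
  rw [memory_snoc, hu.2, hv.2]
  have : p.length = (memory x p).length := (length_memory x p).symm
  simp [operand, this]

/-- The function `g` can be computed with `s` additional instructions once the program `p₀` has
been run. -/
def Cost (p₀ : List (Instr V)) (s : ℕ) (g : (V → Bool) → Bool) : Prop :=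
  ∀ p, WellFormed p → p₀ <+: p → ∃ q, WellFormed q ∧ p <+: q ∧ q.length ≤ p.length + s ∧
    ∃ w, Computes q w g

variable {p₀ : List (Instr V)}

theorem Cost.mono {s t : ℕ} {g : (V → Bool) → Bool} (h : Cost p₀ s g) (hst : s ≤ t) :
    Cost p₀ t g := by
  intro p hp hp0
  obtain ⟨q, h1, h2, h3, h4⟩ := h p hp hp0
  exact ⟨q, h1, h2, by omega, h4⟩

theorem Cost.prefix {p₁ : List (Instr V)} {s : ℕ} {g : (V → Bool) → Bool} (h : Cost p₀ s g)
    (hp : p₀ <+: p₁) : Cost p₁ s g := fun p h1 h2 => h p h1 (hp.trans h2)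

theorem Computes.cost {w : V ⊕ ℕ} {g : (V → Bool) → Bool} (h : Computes p₀ w g) : Cost p₀ 0 g :=
  fun p hp h0 => ⟨p, hp, List.prefix_refl _, le_rfl, w, h.mono h0⟩

theorem Cost.var (v : V) : Cost p₀ 0 fun x => x v :=
  Computes.cost (w := Sum.inl v) ⟨trivial, fun _ => rfl⟩

theorem Cost.map₂ {s t : ℕ} {g h : (V → Bool) → Bool} (o : Bool → Bool → Bool)
    (hg : Cost p₀ s g) (hh : Cost p₀ t h) : Cost p₀ (s + t + 1) fun x => o (g x) (h x) := by
  intro p hp h0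
  obtain ⟨q, h1, h2, h3, u, hu⟩ := hg p hp h0
  obtain ⟨r, h4, h5, h6, v, hv⟩ := hh q h1 (h0.trans h2)
  have hu' := hu.mono h5
  refine ⟨r ++ [⟨u, v, o⟩], h4.snoc hu'.1 hv.1, (h2.trans h5).trans (List.prefix_append _ _), ?_,
    _, hu'.snoc hv o⟩
  simp
  omega

theorem Cost.map {s : ℕ} {g : (V → Bool) → Bool} (o : Bool → Bool) (hg : Cost p₀ s g) :
    Cost p₀ (s + 1) fun x => o (g x) := by
  intro p hp h0
  obtain ⟨q, h1, h2, h3, u, hu⟩ := hg p hp h0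
  refine ⟨q ++ [⟨u, u, fun a _ => o a⟩], h1.snoc hu.1 hu.1, h2.trans (List.prefix_append _ _), ?_,
    _, hu.snoc hu fun a _ => o a⟩
  simp
  omega

theorem Cost.const [Nonempty V] (c : Bool) : Cost p₀ 1 fun _ => c :=
  (Cost.var (Classical.arbitrary V)).map fun _ => c

theorem Cost.foldr [Nonempty V] {I : Type} (l : List I) {s : ℕ} {g : I → (V → Bool) → Bool}
    (o : Bool → Bool → Bool) (c : Bool) (hg : ∀ i, Cost p₀ s (g i)) :
    Cost p₀ (l.length * (s + 1) + 1) fun x => l.foldr (fun i r => o (g i x) r) c := by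
  induction l with
  | nil => simpa using Cost.const c
  | cons i l ih =>
    refine ((hg i).map₂ o ih).mono ?_
    simp only [List.length_cons, Nat.add_mul]
    omega

/-- The predicate `R` can be decided with `s` additional instructions. -/
def CostProp (p₀ : List (Instr V)) (s : ℕ) (R : (V → Bool) → Prop) : Prop :=
  Cost p₀ s fun x => decide (R x)

theorem CostProp.mono {s t : ℕ} {R : (V → Bool) → Prop} (h : CostProp p₀ s R) (hst : s ≤ t) :
    CostProp p₀ t R := Cost.mono h hst

theorem CostProp.var (v : V) : CostProp p₀ 0 fun x => x v = true := by
  simpa [CostProp] using Cost.var v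

theorem CostProp.const [Nonempty V] (Q : Prop) : CostProp p₀ 1 fun _ => Q := Cost.const _

theorem CostProp.and {s t : ℕ} {R Q : (V → Bool) → Prop} (h : CostProp p₀ s R)
    (h' : CostProp p₀ t Q) : CostProp p₀ (s + t + 1) fun x => R x ∧ Q x := by
  simpa [CostProp] using Cost.map₂ (fun a b => a && b) h h'

theorem CostProp.imp {s t : ℕ} {R Q : (V → Bool) → Prop} (h : CostProp p₀ s R)
    (h' : CostProp p₀ t Q) : CostProp p₀ (s + t + 1) fun x => R x → Q x := by
  have := Cost.map₂ (fun a b => !a || b) h h'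
  unfold CostProp
  convert this using 2 with x
  by_cases hR : R x <;> simp [hR]

theorem CostProp.not {s : ℕ} {R : (V → Bool) → Prop} (h : CostProp p₀ s R) :
    CostProp p₀ (s + 1) fun x => ¬ R x := by
  simpa [CostProp] using Cost.map (fun a => !a) h

theorem CostProp.eq (v w : V) : CostProp p₀ 1 fun x => x v = x w := by
  have := Cost.map₂ (p₀ := p₀) (fun a b => a == b) (Cost.var v) (Cost.var w)
  unfold CostProp
  convert this using 2 with x
  rcases hv : x v <;> rcases hw : x w <;> simp [hv, hw]

theorem CostProp.forall [Nonempty V] {I : Type} [Fintype I] {s : ℕ} {R : I → (V → Bool) → Prop}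
    (h : ∀ i, CostProp p₀ s (R i)) :
    CostProp p₀ (Fintype.card I * (s + 1) + 1) fun x => ∀ i, R i x := by
  have := Cost.foldr (Finset.univ : Finset I).toList (fun a b => a && b) true h
  rw [Finset.length_toList, Finset.card_univ] at this
  unfold CostProp
  convert this using 2 with x
  have key : ∀ l : List I, l.foldr (fun i r => decide (R i x) && r) true
      = decide (∀ i ∈ l, R i x) := fun l => by
    induction l with
    | nil => simp
    | cons a l ih => simp [ih]
  rw [key]
  simp

theorem CostProp.exists [Nonempty V] {I : Type} [Fintype I] {s : ℕ} {R : I → (V → Bool) → Prop}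
    (h : ∀ i, CostProp p₀ s (R i)) :
    CostProp p₀ (Fintype.card I * (s + 1) + 1) fun x => ∃ i, R i x := by
  have := Cost.foldr (Finset.univ : Finset I).toList (fun a b => a || b) false h
  rw [Finset.length_toList, Finset.card_univ] at this
  unfold CostProp
  convert this using 2 with x
  have key : ∀ l : List I, l.foldr (fun i r => decide (R i x) || r) false
      = decide (∃ i ∈ l, R i x) := fun l => by
    induction l with
    | nil => simp
    | cons a l ih => simp [ih]
  rw [key]
  simp

/-- Programs are only extended, so results computed earlier remain available; this is why costs are
stated relative to an arbitrary extension of `p₀`. -/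
theorem Cost.family {O : Type} [Fintype O] {s : ℕ} {g : O → (V → Bool) → Bool}
    (h : ∀ o, Cost p₀ s (g o)) {p : List (Instr V)} (hp : WellFormed p) (h0 : p₀ <+: p) :
    ∃ q, WellFormed q ∧ p <+: q ∧ q.length ≤ p.length + Fintype.card O * s ∧
      ∀ o, ∃ w, Computes q w (g o) := by
  have key : ∀ l : List O, ∃ q, WellFormed q ∧ p <+: q ∧ q.length ≤ p.length + l.length * s ∧
      ∀ o ∈ l, ∃ w, Computes q w (g o) := by
    intro l
    induction l with
    | nil => exact ⟨p, hp, List.prefix_refl _, by simp, by simp⟩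
    | cons a l ih =>
      obtain ⟨q, h1, h2, h3, h4⟩ := ih
      obtain ⟨r, h5, h6, h7, h8⟩ := h a q h1 (h0.trans h2)
      refine ⟨r, h5, h2.trans h6, ?_, ?_⟩
      · rw [List.length_cons, Nat.add_mul]
        omega
      · intro o ho
        rcases List.mem_cons.1 ho with rfl | ho
        · exact h8
        · obtain ⟨w, hw⟩ := h4 o ho
          exact ⟨w, hw.mono h6⟩
  obtain ⟨q, h1, h2, h3, h4⟩ := key (Finset.univ : Finset O).toList
  exact ⟨q, h1, h2, by simpa using h3, fun o => h4 o (by simp)⟩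

end Programs

/-! ## Evaluation of polynomials -/

section PolyProgram

variable {V : Type} [Nonempty V] {F : Type} [Field F] [Algebra (ZMod 2) F] {n : ℕ}
  (b : Module.Basis (Fin n) (ZMod 2) F)

theorem coordBit_mul (y z : F) (k : Fin n) :
    coordBit b (y * z) k = (Finset.univ : Finset (Fin n × Fin n)).toList.foldr
      (fun p r => xor ((coordBit b y p.1 && coordBit b z p.2) && coordBit b (b p.1 * b p.2) k) r)
      false := by
  apply bitEquiv.symm.injective
  rw [symm_coordBit_mul, ← Finset.sum_map_toList]
  induction (Finset.univ : Finset (Fin n × Fin n)).toList with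
  | nil => rfl
  | cons p l ih =>
    rw [List.map_cons, List.sum_cons, List.foldr_cons, bitEquiv_symm_xor, ih]

theorem cost_coordBit_strElem {I : Type} [Fintype I] (e : I ↪ Fin n) (u : I → V)
    {p₀ : List (Instr V)} (k : Fin n) :
    Cost p₀ 1 fun x => coordBit b (strElem b e (x ∘ u)) k := by
  simp only [coordBit_strElem]
  by_cases h : ∃ i, e i = k
  · simp only [h, dif_pos]
    exact (Cost.var _).mono (Nat.zero_le _)
  · simp only [h, dif_neg, not_false_eq_true]
    exact Cost.const _

/-- Each of the `n ^ 2` products of coordinates takes four instructions and one addition, plus one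
instruction to start the sum. The constant `c` takes two more. -/
theorem cost_coordBit_mul {I : Type} [Fintype I] (e : I ↪ Fin n) (u : I → V)
    {p₀ : List (Instr V)} {y : (V → Bool) → F} (hy : ∀ k, Cost p₀ 0 fun x => coordBit b (y x) k)
    (c : F) (k : Fin n) :
    Cost p₀ (5 * n ^ 2 + 3) fun x => coordBit b (c + y x * strElem b e (x ∘ u)) k := by
  simp only [coordBit_add]
  refine ((Cost.const (coordBit b c k)).map₂ xor (t := 5 * n ^ 2 + 1) ?_).mono (by omega)
  rw [show (fun x => coordBit b (y x * strElem b e (x ∘ u)) k) = _ from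
    funext fun x => coordBit_mul b (y x) (strElem b e (x ∘ u)) k]
  have := Cost.foldr (p₀ := p₀) (Finset.univ : Finset (Fin n × Fin n)).toList xor false fun p =>
    (((hy p.1).map₂ (fun a b => a && b) (cost_coordBit_strElem b e u p.2)).map₂ (fun a b => a && b)
      (Cost.const (coordBit b (b p.1 * b p.2) k)))
  refine this.mono (le_of_eq ?_)
  simp
  ring

/-- Horner's rule: a round multiplies the previous value by the argument and adds a coefficient. The
coordinates of the previous value are already in memory and cost nothing. -/
theorem exists_program_polynomial {I : Type} [Fintype I] (e : I ↪ Fin n) (u : I → V) (K : ℕ)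
    (θ : Fin K → F) :
    ∃ q : List (Instr V), WellFormed q ∧ q.length ≤ n + K * (n * (5 * n ^ 2 + 3)) ∧
      ∀ k, ∃ w, Computes q w fun x => coordBit b (∑ i, θ i * strElem b e (x ∘ u) ^ i.1) k := by
  induction K with
  | zero =>
    obtain ⟨q, h1, -, h3, h4⟩ := Cost.family (p₀ := ([] : List (Instr V)))
      (fun k : Fin n => Cost.const (V := V) (coordBit b (0 : F) k)) WellFormed.nil
      (List.prefix_refl _)
    exact ⟨q, h1, by simpa using h3, by simpa using h4⟩
  | succ K ih =>
    obtain ⟨q, h1, h2, h3⟩ := ih fun i => θ i.succ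
    obtain ⟨r, h4, h5, h6, h7⟩ := Cost.family (fun k => cost_coordBit_mul b e u
      (fun k => (h3 k).choose_spec.cost) (θ 0) k) h1 (List.prefix_refl _)
    refine ⟨r, h4, ?_, fun k => ?_⟩
    · rw [Fintype.card_fin] at h6
      rw [Nat.add_mul, one_mul]
      omega
    · obtain ⟨w, hw⟩ := h7 k
      refine ⟨w, ?_⟩
      convert hw using 3 with x
      rw [Fin.sum_univ_succ, Finset.sum_mul]
      simp [pow_succ, mul_assoc]

end PolyProgram

/-! ## Programs for the checks of the signing oracle -/

/-- The conditions say that the ring is nonempty, the occupied slots form an initial segment,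
unoccupied slots are zero, and the members are distinct. All are decided by short bit tests. -/
theorem exists_encRing_iff {κ ℓ : ℕ} (v : RingIdx κ ℓ → Bool) :
    (∃ ρ : KeyRing κ ℓ, encRing ρ = v) ↔
      (∃ i, v (i, none) = true) ∧
      (∀ i i', i' ≤ i → v (i, none) = true → v (i', none) = true) ∧
      (∀ i j, v (i, some j) = true → v (i, none) = true) ∧
      ∀ i i', i ≠ i' → v (i, none) = true → v (i', none) = true →
        ∃ j, ¬ v (i, some j) = v (i', some j) := by
  constructor
  · rintro ⟨⟨n, ρ⟩, rfl⟩
    have hp : ∀ i : Fin κ, encRing (⟨n, ρ⟩ : KeyRing κ ℓ) (i, none) = true ↔ i.1 < n.1 + 1 := by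
      intro i
      simp [encRing]
    have hs : ∀ (i : Fin κ) (h : i.1 < n.1 + 1) j,
        encRing (⟨n, ρ⟩ : KeyRing κ ℓ) (i, some j) = ρ ⟨i.1, h⟩ j := by
      intro i h j
      simp [encRing, h]
    simp only [hp]
    refine ⟨⟨n, by simp⟩, fun i i' h1 h2 => by have : i'.1 ≤ i.1 := h1; omega, fun i j h => ?_,
      fun i i' hne h1 h2 => ?_⟩
    · by_contra hi
      simp [encRing, hi] at h
    · by_contra hc
      push Not at hc
      have : ρ ⟨i.1, h1⟩ = ρ ⟨i'.1, h2⟩ := by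
        funext j
        rw [← hs i h1, ← hs i' h2, hc j]
      have := congrArg Fin.val (ρ.injective this)
      exact hne (Fin.ext this)
  · rintro ⟨⟨i₀, h0⟩, h1, h2, h3⟩
    have hne : (Finset.univ.filter fun i : Fin κ => v (i, none) = true).Nonempty :=
      ⟨i₀, by simp [h0]⟩
    -- The last occupied slot; the ring has `n + 1` members.
    set n := (Finset.univ.filter fun i : Fin κ => v (i, none) = true).max' hne with hn
    have hnv : v (n, none) = true := (Finset.mem_filter.1 (Finset.max'_mem _ hne)).2
    have hv : ∀ i : Fin κ, v (i, none) = true ↔ i.1 < n.1 + 1 := by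
      intro i
      constructor
      · intro hi
        have : i ≤ n := Finset.le_max' _ _ (by simp [hi])
        have : i.1 ≤ n.1 := this
        omega
      · intro hi
        exact h1 n i (by change i.1 ≤ n.1; omega) hnv
    have hlt : ∀ k : Fin (n.1 + 1), k.1 < κ := fun k => by omega
    refine ⟨⟨n, ⟨fun k j => v (⟨k.1, hlt k⟩, some j), ?_⟩⟩, ?_⟩
    · intro k k' h
      by_contra hc
      obtain ⟨j, hj⟩ := h3 ⟨k.1, hlt k⟩ ⟨k'.1, hlt k'⟩
        (fun he => hc (Fin.ext (by simpa using congrArg Fin.val he))) ((hv _).2 k.2) ((hv _).2 k'.2)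
      exact hj (congrFun h j)
    · funext ⟨i, o⟩
      unfold encRing
      by_cases hi : i.1 < n.1 + 1
      · simp only [hi, dif_pos]
        cases o with
        | none => exact ((hv i).2 hi).symm
        | some j => rfl
      · simp only [hi, dif_neg, not_false_eq_true]
        have hf : v (i, none) ≠ true := fun h => hi ((hv i).1 h)
        cases o with
        | none => exact (Bool.eq_false_iff.2 hf).symm
        | some j => exact (Bool.eq_false_iff.2 fun h => hf (h2 i j h)).symm

theorem exists_encPos_iff {κ : ℕ} (v : Fin κ → Bool) :
    (∃ i, encPos i = v) ↔ (∃ i, v i = true) ∧ ∀ i j, v i = true → v j = true → i = j := by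
  constructor
  · rintro ⟨i, rfl⟩
    simp [encPos]
  · rintro ⟨⟨i, hi⟩, h⟩
    refine ⟨i, ?_⟩
    funext j
    by_cases hj : v j = true
    · simp [encPos, h j i hj hi, hi]
    · have : j ≠ i := fun e => hj (e ▸ hi)
      simp [encPos, this, hj]

/-! ### Instruction counts of the checks, with one bound `s` for all lengths. -/

section Checks

variable {V : Type} [Nonempty V] {p₀ : List (Instr V)} {κ ℓ N t M s : ℕ}

/-- A member of the ring is one of the given keys, in a slot marked by `ps`. -/
def SlotMatches (r : RingIdx κ ℓ → V) (ps : Fin κ → V) (key : Fin N → Fin ℓ → V) (x : V → Bool) :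
    Prop :=
  ∃ i j, x (ps i) = true ∧ x (r (i, none)) = true ∧ ∀ k, x (r (i, some k)) = x (key j k)

/-- The inputs of a signing query pass the check, where `hist` holds the earlier queries. -/
def SignOk (r : RingIdx κ ℓ → V) (ps : Fin κ → V) (m : Fin M → V) (key : Fin N → Fin ℓ → V)
    (hist : Fin t → Option (RingIdx κ ℓ ⊕ Fin M) → V) (x : V → Bool) : Prop :=
  (∃ ρ : KeyRing κ ℓ, encRing ρ = x ∘ r) ∧ (∃ i, encPos i = x ∘ ps) ∧ SlotMatches r ps key x ∧
    ∀ t', ¬ (x (hist t' none) = true ∧ ∀ z, x (hist t' (some z)) = x (Sum.elim r m z))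

theorem CostProp.forall_le {I : Type} [Fintype I] {c : ℕ} {R : I → (V → Bool) → Prop}
    (hs : Fintype.card I ≤ s) (h : ∀ i, CostProp p₀ c (R i)) :
    CostProp p₀ (s * (c + 1) + 1) fun x => ∀ i, R i x :=
  (CostProp.forall h).mono (by gcongr)

theorem CostProp.exists_le {I : Type} [Fintype I] {c : ℕ} {R : I → (V → Bool) → Prop}
    (hs : Fintype.card I ≤ s) (h : ∀ i, CostProp p₀ c (R i)) :
    CostProp p₀ (s * (c + 1) + 1) fun x => ∃ i, R i x :=
  (CostProp.exists h).mono (by gcongr)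

theorem costProp_slotMatches (hκ : κ ≤ s) (hℓ : ℓ ≤ s) (hN : N ≤ s) (r : RingIdx κ ℓ → V)
    (ps : Fin κ → V) (key : Fin N → Fin ℓ → V) :
    CostProp p₀ (s * (s * (s * 2 + 4) + 2) + 1) (SlotMatches r ps key) := by
  unfold SlotMatches
  refine (CostProp.exists_le (s := s) (by simpa using hκ) fun i =>
    CostProp.exists_le (s := s) (by simpa using hN) fun j =>
      (CostProp.var (ps i)).and ((CostProp.var (r (i, none))).and
        (CostProp.forall_le (s := s) (by simpa using hℓ) fun k => CostProp.eq _ _))).mono ?_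
  apply le_of_eq
  ring

theorem costProp_validRing (hκ : κ ≤ s) (hℓ : ℓ ≤ s) (r : RingIdx κ ℓ → V) :
    CostProp p₀ (3 * s ^ 3 + 14 * s ^ 2 + 7 * s + 7)
      fun x => ∃ ρ : KeyRing κ ℓ, encRing ρ = x ∘ r := by
  simp only [exists_encRing_iff, Function.comp_apply]
  have hκ' : Fintype.card (Fin κ) ≤ s := by simpa using hκ
  have hℓ' : Fintype.card (Fin ℓ) ≤ s := by simpa using hℓ
  refine ((CostProp.exists_le hκ' fun i => CostProp.var _).and
    ((CostProp.forall_le hκ' fun i => CostProp.forall_le hκ' fun i' =>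
      (CostProp.const (i' ≤ i)).imp ((CostProp.var _).imp (CostProp.var _))).and
    ((CostProp.forall_le hκ' fun i => CostProp.forall_le hℓ' fun j =>
      (CostProp.var _).imp (CostProp.var _)).and
    (CostProp.forall_le hκ' fun i => CostProp.forall_le hκ' fun i' =>
      (CostProp.const (i ≠ i')).imp ((CostProp.var _).imp ((CostProp.var _).imp
        (CostProp.exists_le hℓ' fun j => (CostProp.eq _ _).not))))))).mono ?_
  ring_nf
  omega

theorem costProp_validPos (hκ : κ ≤ s) (ps : Fin κ → V) :
    CostProp p₀ (4 * s ^ 2 + 3 * s + 3) fun x => ∃ i, encPos i = x ∘ ps := by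
  simp only [exists_encPos_iff, Function.comp_apply]
  have hκ' : Fintype.card (Fin κ) ≤ s := by simpa using hκ
  refine ((CostProp.exists_le hκ' fun i => CostProp.var _).and
    (CostProp.forall_le hκ' fun i => CostProp.forall_le hκ' fun j =>
      (CostProp.var _).imp ((CostProp.var _).imp (CostProp.const (i = j))))).mono ?_
  ring_nf
  omega

theorem costProp_signOk (hκ : κ ≤ s) (hℓ : ℓ ≤ s) (hN : N ≤ s) (ht : t ≤ s)
    (hz : κ * (ℓ + 1) + M ≤ s) (r : RingIdx κ ℓ → V) (ps : Fin κ → V) (m : Fin M → V)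
    (key : Fin N → Fin ℓ → V) (hist : Fin t → Option (RingIdx κ ℓ ⊕ Fin M) → V) :
    CostProp p₀ (5 * s ^ 3 + 24 * s ^ 2 + 16 * s + 15) (SignOk r ps m key hist) := by
  unfold SignOk
  have hz' : Fintype.card (RingIdx κ ℓ ⊕ Fin M) ≤ s := by simpa using hz
  refine ((costProp_validRing hκ hℓ r).and ((costProp_validPos hκ ps).and
    ((costProp_slotMatches hκ hℓ hN r ps key).and
    (CostProp.forall_le (s := s) (by simpa using ht) fun t' => ((CostProp.var _).and
      (CostProp.forall_le hz' fun z => CostProp.eq _ _)).not)))).mono ?_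
  ring_nf
  omega

end Checks

/-- The check of the signing oracle, in terms of the predicate decided by programs. -/
theorem signCheck_eq_none_iff {P : RPSF} {N qs : ℕ} {kp : Fin N → P.KeyPair}
    {L : List (P.Rng × P.Msg)} {x : P.RIdx ⊕ (Fin P.κ ⊕ Fin P.msgLen) → Bool}
    (hL : L.length ≠ qs) :
    signCheck qs kp L x = none ↔ ¬ ((∃ ρ : P.Rng, encRing ρ = x ∘ Sum.inl) ∧
      (∃ i, encPos i = x ∘ Sum.inr ∘ Sum.inl) ∧
      (∃ (i : Fin P.κ) (j : Fin N), x (Sum.inr (Sum.inl i)) = true ∧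
        x (Sum.inl (i, none)) = true ∧ ∀ k, x (Sum.inl (i, some k)) = (kp j).1 k) ∧
      ∀ ρ : P.Rng, encRing ρ = x ∘ Sum.inl → (ρ, x ∘ Sum.inr ∘ Sum.inr) ∉ L) := by
  unfold signCheck
  split
  · rename_i ρ i h1 h2
    rw [decode_eq_some_iff encRing_injective] at h1
    rw [decode_eq_some_iff encPos_injective] at h2
    have hslot : (∃ (i : Fin P.κ) (j : Fin N), x (Sum.inr (Sum.inl i)) = true ∧
        x (Sum.inl (i, none)) = true ∧ ∀ k, x (Sum.inl (i, some k)) = (kp j).1 k)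
        ↔ ∃ j, ∃ hi : i.1 < ρ.1.1 + 1, (kp j).1 = ρ.2 ⟨i.1, hi⟩ := by
      have e1 : ∀ i' k, x (Sum.inl (i', k)) = encRing ρ (i', k) := fun i' k =>
        (congrFun h1 (i', k)).symm
      have e2 : ∀ i', x (Sum.inr (Sum.inl i')) = true ↔ i' = i := fun i' => by
        have := congrFun h2 i'
        simp only [Function.comp_apply] at this
        rw [← this]
        simp [encPos]
      simp only [e1, e2]
      constructor
      · rintro ⟨i', j, rfl, h3, h4⟩
        have hi : i'.1 < ρ.1.1 + 1 := by
          by_contra hc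
          simp [encRing, hc] at h3
        refine ⟨j, hi, ?_⟩
        funext k
        rw [← h4 k]
        simp [encRing, hi]
      · rintro ⟨j, hi, h3⟩
        refine ⟨i, j, rfl, by simp [encRing, hi], fun k => ?_⟩
        rw [h3]
        simp [encRing, hi]
    have hmem : (∀ ρ' : P.Rng, encRing ρ' = x ∘ Sum.inl → (ρ', x ∘ Sum.inr ∘ Sum.inr) ∉ L)
        ↔ (ρ, x ∘ Sum.inr ∘ Sum.inr) ∉ L := by
      constructor
      · exact fun h => h ρ h1
      · intro h ρ' h'
        rwa [encRing_injective (h'.trans h1.symm)]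
    rw [hslot, hmem]
    have t1 : ∃ ρ : P.Rng, encRing ρ = x ∘ Sum.inl := ⟨ρ, h1⟩
    have t2 : ∃ i, encPos i = x ∘ Sum.inr ∘ Sum.inl := ⟨i, h2⟩
    -- With the quota not exhausted, the refusal condition reduces to the pair having been signed
    -- already.
    simp only [t1, t2, true_and, hL, false_or]
    split_ifs with h3 h4
    · exact iff_of_true rfl fun h => h.2 h4
    · exact iff_of_false (by simp) fun h => h ⟨h3, h4⟩
    · exact iff_of_true rfl fun h => h3 h.1
  · rename_i h
    simp only [true_iff]
    rintro ⟨⟨ρ, h1⟩, ⟨i, h2⟩, -⟩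
    exact h ρ i ((decode_eq_some_iff encRing_injective).2 h1)
      ((decode_eq_some_iff encPos_injective).2 h2)

/-- Turns membership of a game key into a bit test on the query wires, which decides whether a hash
value is programmed. -/
theorem goodPoint_iff_of_encRing {P : RPSF} {N : ℕ} {kp : Fin N → P.KeyPair} {ρ : P.Rng}
    {m : P.Msg} {v : P.RIdx → Bool} (h : encRing ρ = v) :
    GoodPoint kp (ρ, m) ↔ ∃ (i : Fin P.κ) (j : Fin N), v (i, none) = true ∧
      ∀ k, v (i, some k) = (kp j).1 k := by
  subst h
  constructor
  · rintro ⟨j, i, hi⟩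
    have hlt : i.1 < P.κ := by have := i.2; have := ρ.1.2; omega
    have hi' : i.1 < ρ.1.1 + 1 := i.2
    refine ⟨⟨i.1, hlt⟩, j, by simp only [encRing, hi', dif_pos], fun k => ?_⟩
    rw [← hi]
    simp only [encRing, hi', dif_pos]
  · rintro ⟨i, j, h1, h2⟩
    have hi : i.1 < ρ.1.1 + 1 := by
      by_contra hc
      simp [encRing, hc] at h1
    refine ⟨j, ⟨i.1, hi⟩, ?_⟩
    funext k
    rw [← h2 k]
    simp [encRing, hi]

/-! ## Reversible circuits on arbitrary sets of wires -/

section Wires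

variable {ι I O : Type}

/-- The string `b` with `y` added on the wires `w`. -/
def xorAt (w : O ↪ ι) (y : O → Bool) (b : ι → Bool) : ι → Bool :=
  fun i => xor (b i) (Function.extend w y (fun _ => false) i)

theorem xorAt_apply (w : O ↪ ι) (y : O → Bool) (b : ι → Bool) (o : O) :
    xorAt w y b (w o) = xor (b (w o)) (y o) := by
  rw [xorAt, w.injective.extend_apply]

theorem xorAt_apply_of_ne {w : O ↪ ι} (y : O → Bool) (b : ι → Bool) {i : ι} (h : ∀ o, w o ≠ i) :
    xorAt w y b i = b i := by
  rw [xorAt, Function.extend_apply' _ _ _ (by simpa using h), Bool.xor_false]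

theorem eq_xorAt {w : O ↪ ι} {y : O → Bool} {b b' : ι → Bool}
    (h1 : ∀ o, b' (w o) = xor (b (w o)) (y o)) (h2 : ∀ i, (∀ o, w o ≠ i) → b' i = b i) :
    b' = xorAt w y b := by
  funext i
  by_cases h : ∃ o, w o = i
  · obtain ⟨o, rfl⟩ := h
    rw [xorAt_apply, h1]
  · push Not at h
    rw [xorAt_apply_of_ne y b h, h2 i h]

theorem xorAt_comp_of_ne {w : O ↪ ι} (y : O → Bool) (b : ι → Bool) {u : I → ι}
    (h : ∀ i o, w o ≠ u i) : xorAt w y b ∘ u = b ∘ u :=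
  funext fun i => xorAt_apply_of_ne y b (h i)

theorem xorAt_xorAt (w : O ↪ ι) (y y' : O → Bool) (b : ι → Bool) :
    xorAt w y (xorAt w y' b) = xorAt w (fun o => xor (y o) (y' o)) b := by
  refine eq_xorAt (fun o => ?_) fun i h => ?_
  · rw [xorAt_apply, xorAt_apply, Bool.xor_assoc, Bool.xor_comm (y o)]
  · rw [xorAt_apply_of_ne _ _ h, xorAt_apply_of_ne _ _ h]

theorem xorAt_self (w : O ↪ ι) (y : O → Bool) (b : ι → Bool) : xorAt w y (xorAt w y b) = b := by
  rw [xorAt_xorAt]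
  exact (eq_xorAt (by simp) fun _ _ => rfl).symm

/-- The permutation that adds a function of the wires `u` on the wires `w`. -/
def controlPerm (w : O ↪ ι) (u : I → ι) (h : ∀ i o, w o ≠ u i) (F : (I → Bool) → O → Bool) :
    Equiv.Perm (ι → Bool) where
  toFun b := xorAt w (F (b ∘ u)) b
  invFun b := xorAt w (F (b ∘ u)) b
  left_inv b := by simp only [xorAt_comp_of_ne _ _ h, xorAt_self]
  right_inv b := by simp only [xorAt_comp_of_ne _ _ h, xorAt_self]

theorem controlPerm_apply (w : O ↪ ι) (u : I → ι) (h : ∀ i o, w o ≠ u i)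
    (F : (I → Bool) → O → Bool) (b : ι → Bool) :
    controlPerm w u h F b = xorAt w (F (b ∘ u)) b := rfl

theorem controlPerm_symm (w : O ↪ ι) (u : I → ι) (h : ∀ i o, w o ≠ u i)
    (F : (I → Bool) → O → Bool) : (controlPerm w u h F).symm = controlPerm w u h F := rfl

end Wires

section Circuits

variable {P : RPSF} {W' : ℕ} {ι : Type} (e : ι ≃ Fin W')

/-- Amplitudes in terms of the wires `ι`. -/
def ofWires (ψ : (ι → Bool) → ℂ) : QState W' := fun b => ψ (b ∘ e)

/-- The operations `l` act as the permutation `F` of the basis states. -/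
def Acts (pp : Bits P.ppLen) (H : P.Hash pp) (l : List (QOp P W')) (F : Equiv.Perm (ι → Bool)) :
    Prop :=
  ∀ fin tail ψ, runOps pp H fin (l ++ tail) (ofWires e ψ)
    = runOps pp H fin tail (ofWires e (ψ ∘ F.symm))

/-- The permutation `F` is performed by at most `c` operations. -/
def Realizable (c : ℕ) (F : (pp : Bits P.ppLen) → P.Hash pp → Equiv.Perm (ι → Bool)) : Prop :=
  ∃ l : List (QOp P W'), l.length ≤ c ∧
    ∀ pp H, Acts e pp H l (F pp H) ∧ Acts e pp H l.reverse (F pp H)⁻¹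

variable {e}

theorem Acts.nil {pp : Bits P.ppLen} {H : P.Hash pp} : Acts e pp H [] 1 := fun _ _ _ => rfl

theorem Acts.append {pp : Bits P.ppLen} {H : P.Hash pp} {l l' : List (QOp P W')}
    {F F' : Equiv.Perm (ι → Bool)} (h : Acts e pp H l F) (h' : Acts e pp H l' F') :
    Acts e pp H (l ++ l') (F' * F) := by
  intro fin tail ψ
  rw [List.append_assoc, h, h']
  rfl

theorem Realizable.one (c : ℕ) : Realizable (P := P) e c fun _ _ => 1 :=
  ⟨[], Nat.zero_le _, fun _ _ => ⟨Acts.nil, by simpa using Acts.nil⟩⟩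

theorem Realizable.mono {c c' : ℕ} {F : (pp : Bits P.ppLen) → P.Hash pp → Equiv.Perm (ι → Bool)}
    (h : Realizable e c F) (hc : c ≤ c') : Realizable e c' F := by
  obtain ⟨l, h1, h2⟩ := h
  exact ⟨l, h1.trans hc, h2⟩

theorem Realizable.mul {c c' : ℕ} {F F' : (pp : Bits P.ppLen) → P.Hash pp → Equiv.Perm (ι → Bool)}
    (h : Realizable e c F) (h' : Realizable e c' F') :
    Realizable e (c + c') fun pp H => F' pp H * F pp H := by
  obtain ⟨l, h1, h2⟩ := h
  obtain ⟨l', h3, h4⟩ := h'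
  refine ⟨l ++ l', by simp; omega, fun pp H => ⟨(h2 pp H).1.append (h4 pp H).1, ?_⟩⟩
  rw [List.reverse_append, mul_inv_rev]
  exact (h4 pp H).2.append (h2 pp H).2

theorem Realizable.inv {c : ℕ} {F : (pp : Bits P.ppLen) → P.Hash pp → Equiv.Perm (ι → Bool)}
    (h : Realizable e c F) : Realizable e c fun pp H => (F pp H)⁻¹ := by
  obtain ⟨l, h1, h2⟩ := h
  refine ⟨l.reverse, by simpa using h1, fun pp H => ⟨(h2 pp H).2, ?_⟩⟩
  rw [List.reverse_reverse, inv_inv]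
  exact (h2 pp H).1

/-- Adding a function of untouched wires is an involution, so the one-operation circuit is also its
own inverse. -/
theorem realizable_of_branches {I O : Type} {w : O ↪ ι} {u : I → ι} {h : ∀ i o, w o ≠ u i}
    {F : (pp : Bits P.ppLen) → P.Hash pp → (I → Bool) → O → Bool} (o : QOp P W')
    (ho : ∀ pp H ψ, o.branches pp H (ofWires e ψ)
      = [ofWires e (ψ ∘ controlPerm w u h (F pp H))]) :
    Realizable e 1 fun pp H => controlPerm w u h (F pp H) := by
  have key : ∀ pp H, Acts e pp H [o] (controlPerm w u h (F pp H)) := by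
    intro pp H fin tail ψ
    simp [runOps, ho, controlPerm_symm]
  exact ⟨[o], by simp, fun pp H => ⟨key pp H, key pp H⟩⟩

theorem xorOn_comp {O : Type} (w : O ↪ ι) (y : O → Bool) (b : Bits W') :
    xorOn (w.trans e.toEmbedding) y b ∘ e = xorAt w y (b ∘ e) := by
  refine eq_xorAt (fun o => ?_) fun i h => ?_
  · simp only [xorOn, Function.comp_apply]
    congr 1
    exact (w.trans e.toEmbedding).injective.extend_apply _ _ o
  · simp only [xorOn, Function.comp_apply]
    rw [Function.extend_apply', Bool.xor_false]
    rintro ⟨o, ho⟩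
    exact h o (e.injective ho)

theorem applyOracle_ofWires {I O : Type} (w : I ⊕ O ↪ ι) (F : (I → Bool) → O → Bool)
    (h : ∀ i o, Function.Embedding.inr.trans w o ≠ (w ∘ Sum.inl) i) (ψ : (ι → Bool) → ℂ) :
    applyOracle (w.trans e.toEmbedding) F (ofWires e ψ)
      = ofWires e (ψ ∘ controlPerm (Function.Embedding.inr.trans w) (w ∘ Sum.inl) h F) := by
  funext b
  simp only [applyOracle, ofWires, Function.comp_apply, controlPerm_apply]
  congr 1
  exact xorOn_comp (Function.Embedding.inr.trans w) _ b

theorem inr_ne_inl {I O : Type} (w : I ⊕ O ↪ ι) (i : I) (o : O) :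
    Function.Embedding.inr.trans w o ≠ (w ∘ Sum.inl) i := by
  intro h
  simpa using w.injective h

theorem realizable_evalF (w : (P.RIdx ⊕ Fin P.domLen) ⊕ Fin P.ranLen ↪ ι) :
    Realizable e 1 fun pp (_ : P.Hash pp) => controlPerm (Function.Embedding.inr.trans w)
      (w ∘ Sum.inl) (inr_ne_inl w) (P.fBits pp) :=
  realizable_of_branches (.evalF (w.trans e.toEmbedding)) fun _ _ ψ => by
    rw [QOp.branches, applyOracle_ofWires]

theorem realizable_sampleDom (w : (P.RIdx ⊕ Fin P.coinLen) ⊕ Fin P.domLen ↪ ι) :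
    Realizable e 1 fun pp (_ : P.Hash pp) => controlPerm (Function.Embedding.inr.trans w)
      (w ∘ Sum.inl) (inr_ne_inl w) (P.sampleDomBits pp) :=
  realizable_of_branches (.sampleDom (w.trans e.toEmbedding)) fun _ _ ψ => by
    rw [QOp.branches, applyOracle_ofWires]

theorem realizable_hash (w : (P.RIdx ⊕ Fin P.msgLen) ⊕ Fin P.ranLen ↪ ι) :
    Realizable e 1 fun _ (H : P.Hash _) => controlPerm (Function.Embedding.inr.trans w)
      (w ∘ Sum.inl) (inr_ne_inl w) (P.hashBits H) :=
  realizable_of_branches (.hash (w.trans e.toEmbedding)) fun _ _ ψ => by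
    rw [QOp.branches, applyOracle_ofWires]

/-- The unitary that permutes the basis states of three qubits. -/
def permUnitary (σ : Equiv.Perm (Bits 3)) : Matrix.unitaryGroup (Bits 3) ℂ :=
  ⟨σ.permMatrix ℂ, by
    rw [Matrix.mem_unitaryGroup_iff, Matrix.star_eq_conjTranspose, Matrix.conjTranspose_permMatrix,
      ← Matrix.permMatrix_mul]
    simp⟩

theorem applyGate_permUnitary (σ : Equiv.Perm (Bits 3)) (w : Fin 3 ↪ Fin W') (ψ : QState W')
    (b : Bits W') :
    applyGate w (permUnitary σ) ψ b = ψ (Function.extend w (σ (b ∘ w)) b) := by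
  simp only [applyGate, permUnitary, Equiv.Perm.permMatrix, PEquiv.toMatrix_apply,
    Equiv.toPEquiv_apply, Option.mem_some_iff, ite_mul, one_mul, zero_mul]
  simp

/-- The two operands may be the same wire; then an unrelated third wire fills the gate, which is why
three wires are required. -/
theorem exists_three_wires [Fintype ι] (hι : 3 ≤ Fintype.card ι) {t a a' : ι} (h : t ≠ a)
    (h' : t ≠ a') : ∃ (w : Fin 3 ↪ ι) (i i' : Fin 3), i ≠ 2 ∧ i' ≠ 2 ∧ w 2 = t ∧ w i = a ∧
      w i' = a' := by
  have key : ∀ x y : ι, t ≠ x → t ≠ y → x ≠ y → Function.Injective ![x, y, t] := by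
    intro x y h1 h2 h3 i j hij
    fin_cases i <;> fin_cases j <;> simp_all
  by_cases haa : a = a'
  · subst haa
    obtain ⟨c, hc⟩ : ∃ c, c ∉ ({t, a} : Finset ι) := by
      by_contra hc
      push Not at hc
      have h2 := Finset.card_le_card (fun x _ => hc x : (Finset.univ : Finset ι) ⊆ {t, a})
      have := Finset.card_le_two (a := t) (b := a)
      rw [Finset.card_univ] at h2
      omega
    simp only [Finset.mem_insert, Finset.mem_singleton, not_or] at hc
    exact ⟨⟨_, key a c h (Ne.symm hc.1) (Ne.symm hc.2)⟩, 0, 0, by simp, by simp, rfl, rfl, rfl⟩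
  · exact ⟨⟨_, key a a' h h' haa⟩, 0, 1, by simp, by simp, rfl, rfl, rfl⟩

theorem realizable_bit [Fintype ι] (hι : 3 ≤ Fintype.card ι) (g : Bool → Bool → Bool)
    (t : Unit ↪ ι) (u : Bool → ι) (h : ∀ i o, t o ≠ u i) :
    Realizable (P := P) e 1 fun _ _ => controlPerm t u h fun v _ => g (v false) (v true) := by
  obtain ⟨w, i, i', hi, hi', hwt, hwa, hwa'⟩ := exists_three_wires hι (h false ()) (h true ())
  have hu : ∀ (k : Bool) (o : Unit), (⟨fun _ => 2, fun _ _ _ => rfl⟩ : Unit ↪ Fin 3) o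
      ≠ (fun k => if k then i' else i) k := by
    intro k o
    rcases k
    · exact hi.symm
    · exact hi'.symm
  set σ := controlPerm (⟨fun _ => 2, fun _ _ _ => rfl⟩ : Unit ↪ Fin 3) (fun k => if k then i' else i)
    hu (fun v _ => g (v false) (v true)) with hσ
  refine realizable_of_branches (.gate (w.trans e.toEmbedding) (permUnitary σ)) fun pp H ψ => ?_
  simp only [QOp.branches, List.cons.injEq, and_true]
  funext b
  rw [applyGate_permUnitary]
  simp only [ofWires, Function.comp_apply, controlPerm_apply]
  congr 1
  have hext : ∀ k, Function.extend (w.trans e.toEmbedding) (σ (b ∘ w.trans e.toEmbedding)) b (e (w k))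
      = σ (b ∘ w.trans e.toEmbedding) k := fun k =>
    (w.trans e.toEmbedding).injective.extend_apply _ _ k
  refine eq_xorAt (fun _ => ?_) fun j hj => ?_
  · simp only [Function.comp_apply]
    rw [← hwt, hext, hσ, controlPerm_apply]
    refine (xorAt_apply _ _ _ ()).trans ?_
    simp [← hwa, ← hwa']
    rfl
  · by_cases hk : ∃ k, w k = j
    · obtain ⟨k, rfl⟩ := hk
      have hk2 : k ≠ 2 := by
        rintro rfl
        exact hj () hwt.symm
      simp only [Function.comp_apply]
      rw [hext, hσ, controlPerm_apply]
      exact xorAt_apply_of_ne _ _ fun _ => hk2.symm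
    · simp only [Function.comp_apply]
      rw [Function.extend_apply']
      rintro ⟨k, hk'⟩
      exact hk ⟨k, e.injective hk'⟩

/-- Adding Boolean functions of two wires on several wires. -/
theorem exists_realizable_bits [Fintype ι] (hι : 3 ≤ Fintype.card ι) {O : Type} [Fintype O]
    (τ : O ↪ ι) (a a' : O → ι) (h : ∀ o o', τ o ≠ a o') (h' : ∀ o o', τ o ≠ a' o')
    (g : O → Bool → Bool → Bool) :
    ∃ F : Equiv.Perm (ι → Bool), Realizable (P := P) e (Fintype.card O) (fun _ _ => F) ∧
      ∀ b, F b = xorAt τ (fun o => g o (b (a o)) (b (a' o))) b := by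
  have key : ∀ s : Finset O, ∃ F : Equiv.Perm (ι → Bool),
      Realizable (P := P) e s.card (fun _ _ => F) ∧
      ∀ b, F b = xorAt τ (fun o => if o ∈ s then g o (b (a o)) (b (a' o)) else false) b := by
    intro s
    induction s using Finset.induction_on with
    | empty =>
      refine ⟨1, Realizable.one _, fun b => ?_⟩
      exact eq_xorAt (by simp) fun _ _ => rfl
    | insert o s ho ih =>
      obtain ⟨F, h1, h2⟩ := ih
      have hu : ∀ (k : Bool) (x : Unit), (⟨fun _ => τ o, fun _ _ _ => rfl⟩ : Unit ↪ ι) x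
          ≠ (fun k => if k then a' o else a o) k := by
        intro k _
        rcases k
        · exact h o o
        · exact h' o o
      refine ⟨_, ((h1.mul (realizable_bit hι (g o) _ _ hu)).mono
        (by rw [Finset.card_insert_of_notMem ho])), fun b => ?_⟩
      rw [Equiv.Perm.mul_apply, controlPerm_apply, h2]
      refine eq_xorAt (fun o' => ?_) fun i hi => ?_
      · by_cases hoo : o' = o
        · subst hoo
          refine (xorAt_apply _ _ _ ()).trans ?_
          have e1 : ∀ y, xorAt τ y b (a o') = b (a o') := fun y =>
            xorAt_apply_of_ne _ _ fun x => h x o'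
          have e2 : ∀ y, xorAt τ y b (a' o') = b (a' o') := fun y =>
            xorAt_apply_of_ne _ _ fun x => h' x o'
          change xor (xorAt τ _ b (τ o')) _ = _
          simp only [Function.comp_apply, Bool.false_eq_true, if_false,
            if_true, e1, e2, xorAt_apply, Finset.mem_insert_self, ho, Bool.xor_false]
        · rw [xorAt_apply_of_ne _ _ fun _ => ?_, xorAt_apply]
          · simp [hoo]
          · exact fun he => hoo (τ.injective he).symm
      · rw [xorAt_apply_of_ne _ _ fun _ => hi o, xorAt_apply_of_ne _ _ hi]
  obtain ⟨F, h1, h2⟩ := key Finset.univ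
  exact ⟨F, by simpa using h1, by simpa using h2⟩

/-! ### Running straight-line programs reversibly on clean cells. -/

section RunProgram

variable {V : Type} {S : ℕ} {c : Fin S ↪ ι} {u : V → ι}

/-- The second clause separates the operand from the cells still to be written, the third from
external target wires; both are needed to apply a gate with the operand as control. -/
theorem exists_wire_operand (hcu : ∀ v k, c k ≠ u v) {p : List (Instr V)} (hS : p.length ≤ S)
    {o : V ⊕ ℕ} (ho : Available p.length o) :
    ∃ i : ι, (∀ k, p.length ≤ k.1 → c k ≠ i) ∧ (∀ i', (∀ v, u v ≠ i') → (∀ k, c k ≠ i') → i' ≠ i) ∧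
      ∀ b, (∀ k, b (c k) = false) →
        xorAt c (fun k => (memory (b ∘ u) p).getD k.1 false) b i
          = operand (b ∘ u) (memory (b ∘ u) p) o := by
  rcases o with v | k
  · exact ⟨u v, fun k _ => hcu v k, fun i' h _ he => h v he.symm, fun b _ =>
      xorAt_apply_of_ne _ _ (hcu v)⟩
  · have hk : k < p.length := ho
    refine ⟨c ⟨k, hk.trans_le hS⟩, fun k' h he => ?_, fun i' _ h he => h _ he.symm, fun b hb => ?_⟩
    · have := congrArg Fin.val (c.injective he)
      simp only at this
      omega
    · rw [xorAt_apply, hb]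
      simp [operand]

/-- Instruction `k` adds its result to cell `k`, which is still zero at that time. The default value
of `getD` says that the cells past the program stay zero. -/
theorem exists_realizable_memory [Fintype ι] (hι : 3 ≤ Fintype.card ι) (hcu : ∀ v k, c k ≠ u v)
    {p : List (Instr V)} (hp : WellFormed p) (hS : p.length ≤ S) :
    ∃ F : Equiv.Perm (ι → Bool), Realizable (P := P) e p.length (fun _ _ => F) ∧
      ∀ b, (∀ k, b (c k) = false) →
        F b = xorAt c (fun k => (memory (b ∘ u) p).getD k.1 false) b := by
  induction hp with
  | nil =>
    refine ⟨1, Realizable.one _, fun b _ => eq_xorAt (by simp [memory]) fun _ _ => rfl⟩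
  | @snoc p n hp ha hb ih =>
    rw [List.length_append, List.length_singleton] at hS
    obtain ⟨F, h1, h2⟩ := ih (by omega)
    obtain ⟨i, hi1, -, hi2⟩ := exists_wire_operand hcu (by omega) ha
    obtain ⟨j, hj1, -, hj2⟩ := exists_wire_operand hcu (by omega) hb
    set k : Fin S := ⟨p.length, by omega⟩ with hk
    have hu : ∀ (z : Bool) (x : Unit), (⟨fun _ => c k, fun _ _ _ => rfl⟩ : Unit ↪ ι) x
        ≠ (fun z => if z then j else i) z := by
      intro z _
      rcases z
      · exact hi1 k le_rfl
      · exact hj1 k le_rfl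
    refine ⟨_, (h1.mul (realizable_bit hι n.g _ _ hu)).mono (by simp), fun b hb => ?_⟩
    rw [Equiv.Perm.mul_apply, controlPerm_apply, h2 b hb]
    simp only [Function.comp_apply, Bool.false_eq_true, if_false, if_true, hi2 b hb, hj2 b hb]
    rw [memory_snoc]
    refine eq_xorAt (fun k' => ?_) fun i' hi' => ?_
    · by_cases hkk : k' = k
      · subst hkk
        refine (xorAt_apply _ _ _ ()).trans ?_
        change xor (xorAt c _ b (c k)) _ = _
        simp only [xorAt_apply, hb]
        rw [List.getD_append_right _ _ _ _ (by rw [length_memory]),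
          List.getD_eq_default _ _ (by rw [length_memory])]
        simp [length_memory, show k.1 - p.length = 0 from Nat.sub_self _]
      · have hck : c k ≠ c k' := fun he => hkk (c.injective he).symm
        refine (xorAt_apply_of_ne _ _ fun _ => hck).trans ?_
        rw [xorAt_apply]
        have hne : k'.1 ≠ p.length := fun he => hkk (Fin.ext he)
        rcases lt_or_ge k'.1 p.length with hlt | hge
        · rw [List.getD_append _ _ _ _ (by rwa [length_memory])]
        · rw [List.getD_eq_default _ _ (by rwa [length_memory]),
            List.getD_eq_default _ _ (by simp [length_memory]; omega)]
    · rw [xorAt_apply_of_ne _ _ fun _ => hi' k, xorAt_apply_of_ne _ _ hi']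

/-- A program can be run on clean cells, so that its results are added on the wires `τ` and the
cells are clean again. -/
theorem exists_realizable_program [Fintype ι] (hι : 3 ≤ Fintype.card ι) (hcu : ∀ v k, c k ≠ u v)
    {p : List (Instr V)} (hp : WellFormed p) (hS : p.length ≤ S) {O : Type} [Fintype O] (τ : O ↪ ι)
    (hτu : ∀ v o, τ o ≠ u v) (hτc : ∀ k o, τ o ≠ c k) {g : O → (V → Bool) → Bool}
    (hg : ∀ o, ∃ w, Computes p w (g o)) :
    ∃ F : Equiv.Perm (ι → Bool), Realizable (P := P) e (2 * p.length + Fintype.card O)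
        (fun _ _ => F) ∧
      ∀ b, (∀ k, b (c k) = false) → F b = xorAt τ (fun o => g o (b ∘ u)) b := by
  obtain ⟨F, h1, h2⟩ := exists_realizable_memory (P := P) (e := e) hι hcu hp hS
  choose w hw using hg
  choose i _ hi1 hi2 using fun o => exists_wire_operand hcu hS (hw o).1
  have hne : ∀ o o', τ o ≠ i o' := fun o o' =>
    hi1 o' (τ o) (fun v => (hτu v o).symm) (fun k => (hτc k o).symm)
  obtain ⟨F', h3, h4⟩ := exists_realizable_bits (P := P) (e := e) hι τ i i hne hne
    fun _ a _ => a
  -- Compute, copy the results to `τ`, uncompute. The program neither reads nor writes `τ`, so `F⁻¹`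
  -- restores the cells.
  refine ⟨F⁻¹ * (F' * F), ((h1.mul h3).mul h1.inv).mono (by omega), fun b hb => ?_⟩
  rw [Equiv.Perm.mul_apply, Equiv.Perm.mul_apply, h4, Equiv.Perm.inv_eq_iff_eq]
  have hb' : ∀ y k, xorAt τ y b (c k) = false := fun y k => by
    rw [xorAt_apply_of_ne _ _ (hτc k), hb]
  have hbu : ∀ y, xorAt τ y b ∘ u = b ∘ u := fun y => xorAt_comp_of_ne _ _ hτu
  rw [h2 _ (hb' _), hbu, h2 b hb]
  simp only [hi2 _ b hb, (hw _).2]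
  have hct : ∀ o k, c k ≠ τ o := fun o k => (hτc k o).symm
  funext j
  by_cases hj : ∃ o, τ o = j
  · obtain ⟨o, rfl⟩ := hj
    rw [xorAt_apply, xorAt_apply_of_ne _ _ (hct o), xorAt_apply_of_ne _ _ (hct o), xorAt_apply]
  · push Not at hj
    rw [xorAt_apply_of_ne _ _ hj]
    by_cases hk : ∃ k, c k = j
    · obtain ⟨k, rfl⟩ := hk
      rw [xorAt_apply, xorAt_apply, xorAt_apply_of_ne _ _ hj]
    · push Not at hk
      rw [xorAt_apply_of_ne _ _ hk, xorAt_apply_of_ne _ _ hk, xorAt_apply_of_ne _ _ hj]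

end RunProgram

end Circuits

/-! ## Registers of the reduction -/

/-- Bitwise addition of strings. -/
def strXor {O : Type} (x y : O → Bool) : O → Bool := fun o => xor (x o) (y o)

theorem zero_strXor {O : Type} (x : O → Bool) : strXor (fun _ => false) x = x := by
  funext o; simp [strXor]

theorem strXor_self {O : Type} (x : O → Bool) : strXor x x = fun _ => false := by
  funext o; simp [strXor]

/-- The function `g` is computed by a program of length at most `S`. -/
def Programmable {V O : Type} (S : ℕ) (g : (V → Bool) → O → Bool) : Prop :=
  ∃ p : List (Instr V), WellFormed p ∧ p.length ≤ S ∧ ∀ o, ∃ w, Computes p w fun x => g x o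

section Registers

variable (P : RPSF) (W T S : ℕ)

/-- Wires of the keys received by the reduction. -/
abbrev KeyWire : Type := Fin P.κ × Fin P.keyLen

/-- Wires of a history of `T` signing queries: a flag, a ring and a message for each query. -/
abbrev HistWire : Type := Fin T × Option (P.RIdx ⊕ Fin P.msgLen)

/-- Wires that programs may read. -/
abbrev VarWire : Type := Fin W ⊕ (KeyWire P ⊕ HistWire P T)

/-- All wires of the reduction, which runs a forger on `W` wires and programs on `S` cells. -/
abbrev Wire : Type :=
  VarWire P W T ⊕ (Fin P.coinLen ⊕ (Fin P.domLen ⊕ (Fin P.domLen ⊕ (Fin P.ranLen ⊕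
    (Fin P.ranLen ⊕ (Unit ⊕ Fin S))))))

/-- Contents of the registers of the reduction, with clean cells. -/
@[ext]
structure Regs where
  main : Fin W → Bool
  key : KeyWire P → Bool
  hist : HistWire P T → Bool
  coin : Fin P.coinLen → Bool
  dom : Fin P.domLen → Bool
  dom' : Fin P.domLen → Bool
  ran : Fin P.ranLen → Bool
  ran' : Fin P.ranLen → Bool
  flag : Unit → Bool

variable {P W T}

/-- Contents of the wires that programs may read. -/
def Regs.vars (R : Regs P W T) : VarWire P W T → Bool :=
  Sum.elim R.main (Sum.elim R.key R.hist)

/-- Contents of all wires. -/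
def Regs.toWires (R : Regs P W T) : Wire P W T S → Bool :=
  Sum.elim R.vars (Sum.elim R.coin (Sum.elim R.dom (Sum.elim R.dom' (Sum.elim R.ran
    (Sum.elim R.ran' (Sum.elim R.flag fun _ => false))))))

/-- Registers with clean working memory. -/
def Regs.clean (a : Fin W → Bool) (k : KeyWire P → Bool) (h : HistWire P T → Bool) : Regs P W T where
  main := a
  key := k
  hist := h
  coin := fun _ => false
  dom := fun _ => false
  dom' := fun _ => false
  ran := fun _ => false
  ran' := fun _ => false
  flag := fun _ => false

variable {S} {W' : ℕ} (e : Wire P W T S ≃ Fin W')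

/-- The map `f` is performed by at most `c` operations. -/
def Implements (c : ℕ) (f : (pp : Bits P.ppLen) → P.Hash pp → Regs P W T → Regs P W T) : Prop :=
  ∃ l : List (QOp P W'), l.length ≤ c ∧ ∀ pp H, ∃ F, Acts e pp H l F ∧
    ∀ R : Regs P W T, F (R.toWires S) = (f pp H R).toWires S

variable {e}

theorem Implements.comp {c c' : ℕ}
    {f f' : (pp : Bits P.ppLen) → P.Hash pp → Regs P W T → Regs P W T}
    (h : Implements e c f) (h' : Implements e c' f') :
    Implements e (c + c') fun pp H R => f' pp H (f pp H R) := by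
  obtain ⟨l, h1, h2⟩ := h
  obtain ⟨l', h3, h4⟩ := h'
  refine ⟨l ++ l', by simp; omega, fun pp H => ?_⟩
  obtain ⟨F, hF, hF'⟩ := h2 pp H
  obtain ⟨G, hG, hG'⟩ := h4 pp H
  exact ⟨G * F, hF.append hG, fun R => by rw [Equiv.Perm.mul_apply, hF', hG']⟩

theorem Implements.mono {c c' : ℕ}
    {f : (pp : Bits P.ppLen) → P.Hash pp → Regs P W T → Regs P W T}
    (h : Implements e c f) (hc : c ≤ c') : Implements e c' f := by
  obtain ⟨l, h1, h2⟩ := h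
  exact ⟨l, h1.trans hc, h2⟩

theorem Realizable.implements {c : ℕ}
    {F : (pp : Bits P.ppLen) → P.Hash pp → Equiv.Perm (Wire P W T S → Bool)}
    (h : Realizable e c F) {f : (pp : Bits P.ppLen) → P.Hash pp → Regs P W T → Regs P W T}
    (hf : ∀ pp H (R : Regs P W T), F pp H (R.toWires S) = (f pp H R).toWires S) :
    Implements e c f := by
  obtain ⟨l, h1, h2⟩ := h
  exact ⟨l, h1, fun pp H => ⟨F pp H, (h2 pp H).1, hf pp H⟩⟩

theorem implements_bits {O : Type} [Fintype O] (hS : 3 ≤ S) (τ : O ↪ Wire P W T S)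
    (a a' : O → Wire P W T S) (h : ∀ o o', τ o ≠ a o') (h' : ∀ o o', τ o ≠ a' o')
    (g : O → Bool → Bool → Bool) {f : Regs P W T → Regs P W T}
    (hf : ∀ R : Regs P W T, (f R).toWires S
      = xorAt τ (fun o => g o (R.toWires S (a o)) (R.toWires S (a' o))) (R.toWires S)) :
    Implements e (Fintype.card O) fun _ _ => f := by
  obtain ⟨F, h1, h2⟩ := exists_realizable_bits (P := P) (e := e)
    (by simp only [Fintype.card_sum, Fintype.card_fin]; omega) τ a a' h h' g
  exact h1.implements fun _ _ R => by rw [h2, hf]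

theorem implements_program {V O : Type} [Fintype O] (hS : 3 ≤ S) {u : V → VarWire P W T}
    {g : (V → Bool) → O → Bool} (hg : Programmable S g) (τ : O ↪ Wire P W T S)
    (hτu : ∀ v o, τ o ≠ Sum.inl (u v))
    (hτc : ∀ (k : Fin S) o, τ o ≠ Sum.inr (Sum.inr (Sum.inr (Sum.inr (Sum.inr (Sum.inr (Sum.inr k)))))))
    {f : Regs P W T → Regs P W T}
    (hf : ∀ R : Regs P W T, (f R).toWires S = xorAt τ (g (R.vars ∘ u)) (R.toWires S)) :
    Implements e (2 * S + Fintype.card O) fun _ _ => f := by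
  obtain ⟨p, h1, h2, h3⟩ := hg
  obtain ⟨F, h4, h5⟩ := exists_realizable_program (P := P) (e := e)
    (c := ⟨fun k : Fin S => (Sum.inr (Sum.inr (Sum.inr (Sum.inr (Sum.inr (Sum.inr (Sum.inr k)))))) :
      Wire P W T S), fun _ _ h => by simpa using h⟩) (u := fun v => Sum.inl (u v))
    (by simp only [Fintype.card_sum, Fintype.card_fin]; omega) (fun _ _ => by simp) h1 h2 τ hτu hτc
    (g := fun o x => g x o) h3
  refine (h4.mono (by omega)).implements fun _ _ R => ?_
  rw [h5 _ fun _ => rfl, hf]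
  rfl

/-! ### Elementary maps of the registers. -/

section Steps

variable {V : Type} (u : V → VarWire P W T)

theorem implements_flag (hS : 3 ≤ S) {g : (V → Bool) → Unit → Bool} (hg : Programmable S g) :
    Implements e (2 * S + 1) fun _ _ (R : Regs P W T) =>
      { R with flag := strXor R.flag (g (R.vars ∘ u)) } :=
  implements_program hS hg ⟨fun x => Sum.inr (Sum.inr (Sum.inr (Sum.inr (Sum.inr (Sum.inr
    (Sum.inl x)))))), fun _ _ _ => rfl⟩ (fun _ _ h => by cases h) (fun _ _ h => by cases h) fun R => by
    refine eq_xorAt (fun _ => rfl) ?_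
    rintro (i | (i | (i | (i | (i | (i | (i | i))))))) hi <;> first | rfl | exact absurd rfl (hi _)

theorem implements_coin (hS : 3 ≤ S) {g : (V → Bool) → Bits P.coinLen} (hg : Programmable S g) :
    Implements e (2 * S + P.coinLen) fun _ _ (R : Regs P W T) =>
      { R with coin := strXor R.coin (g (R.vars ∘ u)) } :=
  (implements_program hS hg ⟨fun x => Sum.inr (Sum.inl x), fun _ _ h => by simpa using h⟩
    (fun _ _ h => by cases h) (fun _ _ h => by cases h) fun R => by
    refine eq_xorAt (fun _ => rfl) ?_
    rintro (i | (i | (i | (i | (i | (i | (i | i))))))) hi <;>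
      first | rfl | exact absurd rfl (hi _)).mono (by simp)

theorem implements_constCoin (hS : 3 ≤ S) (c : Bits P.coinLen) :
    Implements e P.coinLen fun _ _ (R : Regs P W T) => { R with coin := strXor R.coin c } := by
  refine (implements_bits hS ⟨fun x : Fin P.coinLen => Sum.inr (Sum.inl x),
    fun _ _ h => by simpa using h⟩
    (fun _ => Sum.inr (Sum.inr (Sum.inr (Sum.inr (Sum.inr (Sum.inr (Sum.inl ())))))))
    (fun _ => Sum.inr (Sum.inr (Sum.inr (Sum.inr (Sum.inr (Sum.inr (Sum.inl ())))))))
    (fun _ _ h => by cases h) (fun _ _ h => by cases h) (fun k _ _ => c k) fun R => ?_).mono (by simp)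
  refine eq_xorAt (fun _ => rfl) ?_
  rintro (i | (i | (i | (i | (i | (i | (i | i))))))) hi <;> first | rfl | exact absurd rfl (hi _)

theorem implements_sampleDom (r : P.RIdx ↪ Fin W) :
    Implements e 1 fun pp _ (R : Regs P W T) =>
      { R with dom := strXor R.dom (P.sampleDomBits pp (Sum.elim (R.main ∘ r) R.coin)) } := by
  refine (realizable_sampleDom (e := e) ⟨Sum.elim (Sum.elim (fun i => Sum.inl (Sum.inl (r i)))
    fun i => Sum.inr (Sum.inl i)) fun i => Sum.inr (Sum.inr (Sum.inl i)), ?_⟩).implements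
    fun pp H R => ?_
  · rintro ((i | i) | i) ((j | j) | j) h <;> simp_all
  · symm
    rw [controlPerm_apply]
    have : (R.toWires S ∘ (Sum.elim (Sum.elim (fun i => Sum.inl (Sum.inl (r i)))
        fun i => Sum.inr (Sum.inl i)) fun i => Sum.inr (Sum.inr (Sum.inl i))) ∘ Sum.inl)
        = Sum.elim (R.main ∘ r) R.coin := by
      funext i
      rcases i with i | i <;> rfl
    refine eq_xorAt (fun i => ?_) ?_
    · refine congrArg (xor (R.dom i)) (congrFun (congrArg (P.sampleDomBits pp) this.symm) i)
    · rintro (i | (i | (i | (i | (i | (i | (i | i))))))) hi <;> first | rfl | exact absurd rfl (hi _)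

theorem implements_sampleDom' (r : P.RIdx ↪ Fin W) :
    Implements e 1 fun pp _ (R : Regs P W T) =>
      { R with dom' := strXor R.dom' (P.sampleDomBits pp (Sum.elim (R.main ∘ r) R.coin)) } := by
  refine (realizable_sampleDom (e := e) ⟨Sum.elim (Sum.elim (fun i => Sum.inl (Sum.inl (r i)))
    fun i => Sum.inr (Sum.inl i)) fun i => Sum.inr (Sum.inr (Sum.inr (Sum.inl i))), ?_⟩).implements
    fun pp H R => ?_
  · rintro ((i | i) | i) ((j | j) | j) h <;> simp_all
  · symm
    rw [controlPerm_apply]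
    have : (R.toWires S ∘ (Sum.elim (Sum.elim (fun i => Sum.inl (Sum.inl (r i)))
        fun i => Sum.inr (Sum.inl i)) fun i => Sum.inr (Sum.inr (Sum.inr (Sum.inl i)))) ∘ Sum.inl)
        = Sum.elim (R.main ∘ r) R.coin := by
      funext i
      rcases i with i | i <;> rfl
    refine eq_xorAt (fun i => ?_) ?_
    · refine congrArg (xor (R.dom' i)) (congrFun (congrArg (P.sampleDomBits pp) this.symm) i)
    · rintro (i | (i | (i | (i | (i | (i | (i | i))))))) hi <;> first | rfl | exact absurd rfl (hi _)

theorem implements_evalF (r : P.RIdx ↪ Fin W) :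
    Implements e 1 fun pp _ (R : Regs P W T) =>
      { R with ran := strXor R.ran (P.fBits pp (Sum.elim (R.main ∘ r) R.dom)) } := by
  refine (realizable_evalF (e := e) ⟨Sum.elim (Sum.elim (fun i => Sum.inl (Sum.inl (r i)))
    fun i => Sum.inr (Sum.inr (Sum.inl i)))
    fun i => Sum.inr (Sum.inr (Sum.inr (Sum.inr (Sum.inl i)))), ?_⟩).implements fun pp H R => ?_
  · rintro ((i | i) | i) ((j | j) | j) h <;> simp_all
  · symm
    rw [controlPerm_apply]
    have : (R.toWires S ∘ (Sum.elim (Sum.elim (fun i => Sum.inl (Sum.inl (r i)))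
        fun i => Sum.inr (Sum.inr (Sum.inl i)))
        fun i => Sum.inr (Sum.inr (Sum.inr (Sum.inr (Sum.inl i))))) ∘ Sum.inl)
        = Sum.elim (R.main ∘ r) R.dom := by
      funext i
      rcases i with i | i <;> rfl
    refine eq_xorAt (fun i => ?_) ?_
    · refine congrArg (xor (R.ran i)) (congrFun (congrArg (P.fBits pp) this.symm) i)
    · rintro (i | (i | (i | (i | (i | (i | (i | i))))))) hi <;> first | rfl | exact absurd rfl (hi _)

theorem implements_hash (r : P.RIdx ⊕ Fin P.msgLen ↪ Fin W) :
    Implements e 1 fun _ H (R : Regs P W T) =>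
      { R with ran' := strXor R.ran' (P.hashBits H (R.main ∘ r)) } := by
  refine (realizable_hash (e := e) ⟨Sum.elim (fun i => Sum.inl (Sum.inl (r i)))
    fun i => Sum.inr (Sum.inr (Sum.inr (Sum.inr (Sum.inr (Sum.inl i))))), ?_⟩).implements
    fun pp H R => ?_
  · rintro (i | i) (j | j) h <;> simp_all
  · symm
    rw [controlPerm_apply]
    refine eq_xorAt (fun i => rfl) ?_
    rintro (i | (i | (i | (i | (i | (i | (i | i))))))) hi <;> first | rfl | exact absurd rfl (hi _)

/-- Adding functions of two bits on wires of the main register. -/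
theorem implements_main {O : Type} [Fintype O] (hS : 3 ≤ S) (w : O ↪ Fin W)
    (a a' : O → Wire P W T S) (h : ∀ o i, Sum.inl (Sum.inl i) ≠ a o)
    (h' : ∀ o i, Sum.inl (Sum.inl i) ≠ a' o) (g : O → Bool → Bool → Bool) :
    Implements e (Fintype.card O) fun _ _ (R : Regs P W T) =>
      { R with main := xorOn w (fun o => g o (R.toWires S (a o)) (R.toWires S (a' o))) R.main } := by
  refine implements_bits hS ⟨fun o => Sum.inl (Sum.inl (w o)), fun _ _ h => by simpa using h⟩ a a'
    (fun o o' => h o' (w o)) (fun o o' => h' o' (w o)) g fun R => ?_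
  refine eq_xorAt (fun o => xorAt_apply w _ R.main o) ?_
  rintro ((i | i) | i) hi
  · exact xorAt_apply_of_ne (w := w) _ R.main fun o ho =>
      hi o (congrArg (fun i => Sum.inl (Sum.inl i)) ho)
  all_goals rfl

/-- Adding functions of two bits in the history. -/
theorem implements_hist {O : Type} [Fintype O] (hS : 3 ≤ S) (w : O ↪ HistWire P T)
    (a a' : O → Wire P W T S) (h : ∀ o i, Sum.inl (Sum.inr (Sum.inr i)) ≠ a o)
    (h' : ∀ o i, Sum.inl (Sum.inr (Sum.inr i)) ≠ a' o) (g : O → Bool → Bool → Bool) :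
    Implements e (Fintype.card O) fun _ _ (R : Regs P W T) =>
      { R with hist := xorAt w (fun o => g o (R.toWires S (a o)) (R.toWires S (a' o))) R.hist } := by
  refine implements_bits hS ⟨fun o => Sum.inl (Sum.inr (Sum.inr (w o))),
    fun _ _ h => by simpa using h⟩ a a'
    (fun o o' => h o' (w o)) (fun o o' => h' o' (w o)) g fun R => ?_
  refine eq_xorAt (fun o => xorAt_apply w _ R.hist o) ?_
  rintro ((i | (i | i)) | i) hi
  · rfl
  · rfl
  · exact xorAt_apply_of_ne (w := w) _ R.hist fun o ho =>
      hi o (congrArg (fun i => Sum.inl (Sum.inr (Sum.inr i))) ho)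
  · rfl

end Steps

end Registers

/-! ## Building blocks of the reduction -/

section Macros

variable {P : RPSF} {W T S W' : ℕ} {e : Wire P W T S ≃ Fin W'}

/-- The variables `u` of a program with values from the main register, the keys and the history. -/
abbrev readVars {V : Type} (u : V → VarWire P W T) (a : Bits W) (k : KeyWire P → Bool)
    (h : HistWire P T → Bool) : V → Bool := Sum.elim a (Sum.elim k h) ∘ u

/-- Both candidates, the programmed value and the true hash value, are computed, and the flag
selects which one is added to the answer register. Every preparatory step is an addition, so
repeating them in reverse order clears the working registers; `hu` ensures that the programs do not
read the modified wires. -/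
theorem exists_implements_hash {V : Type} (hS : 3 ≤ S)
    (w : (P.RIdx ⊕ Fin P.msgLen) ⊕ Fin P.ranLen ↪ Fin W) (u : V → VarWire P W T)
    (hu : ∀ v o, u v ≠ Sum.inl (w (Sum.inr o))) {gf : (V → Bool) → Unit → Bool}
    (hf : Programmable S gf) {gc : (V → Bool) → Bits P.coinLen} (hc : Programmable S gc) :
    ∃ f, Implements e (8 * S + 8 + 2 * P.coinLen + 2 * P.ranLen) f ∧
      ∀ pp H a k h, f pp H (Regs.clean a k h) = Regs.clean (xorOn (Function.Embedding.inr.trans w)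
        (if gf (readVars u a k h) () then P.fBits pp (Sum.elim (a ∘ w ∘ Sum.inl ∘ Sum.inl)
            (P.sampleDomBits pp (Sum.elim (a ∘ w ∘ Sum.inl ∘ Sum.inl) (gc (readVars u a k h)))))
          else P.hashBits H (a ∘ w ∘ Sum.inl)) a) k h := by
  set r : P.RIdx ↪ Fin W := (Function.Embedding.inl.trans Function.Embedding.inl).trans w with hr
  set rm : P.RIdx ⊕ Fin P.msgLen ↪ Fin W := Function.Embedding.inl.trans w with hrm
  have s1 := implements_flag (e := e) u hS hf
  have s2 := implements_coin (e := e) u hS hc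
  have s3 := implements_sampleDom (e := e) r
  have s4 := implements_evalF (e := e) r
  have s5 := implements_hash (e := e) rm
  have s6 := implements_main (e := e) hS (Function.Embedding.inr.trans w)
    (fun _ => Sum.inr (Sum.inr (Sum.inr (Sum.inr (Sum.inr (Sum.inr (Sum.inl ())))))))
    (fun o => Sum.inr (Sum.inr (Sum.inr (Sum.inr (Sum.inl o)))))
    (fun _ _ => by simp) (fun _ _ => by simp) fun _ x y => x && y
  have s7 := implements_main (e := e) hS (Function.Embedding.inr.trans w)
    (fun _ => Sum.inr (Sum.inr (Sum.inr (Sum.inr (Sum.inr (Sum.inr (Sum.inl ())))))))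
    (fun o => Sum.inr (Sum.inr (Sum.inr (Sum.inr (Sum.inr (Sum.inl o))))))
    (fun _ _ => by simp) (fun _ _ => by simp) fun _ x y => !x && y
  refine ⟨_, ((((((s1.comp s2).comp s3).comp s4).comp s5).comp (s6.comp s7)).comp
    ((((s5.comp s4).comp s3).comp s2).comp s1)).mono (by simp; omega), fun pp H a k h => ?_⟩
  have hx : ∀ y, Sum.elim (xorOn (Function.Embedding.inr.trans w) y a) (Sum.elim k h) ∘ u
      = Sum.elim a (Sum.elim k h) ∘ u := by
    intro y
    funext v
    simp only [Function.comp_apply]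
    rcases hv : u v with i | i
    · exact xorAt_apply_of_ne y a fun o ho => hu v o (by rw [hv, ← ho]; rfl)
    · rfl
  have hm : ∀ y, xorOn (Function.Embedding.inr.trans w) y a ∘ rm = a ∘ rm := fun y =>
    xorOn_comp_inl w y a
  have hm' : ∀ y, xorOn (Function.Embedding.inr.trans w) y a ∘ r = a ∘ r := fun y =>
    congrArg (fun z => z ∘ Sum.inl) (hm y)
  have h2 : ∀ y y', xorOn (Function.Embedding.inr.trans w) y (xorOn (Function.Embedding.inr.trans w) y' a)
      = xorOn (Function.Embedding.inr.trans w) (fun o => xor (y o) (y' o)) a := fun y y' =>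
    xorAt_xorAt _ y y' a
  simp only [Regs.clean, Regs.vars, Regs.toWires, zero_strXor, Sum.elim_inr, Sum.elim_inl, h2, hx, hm,
    hm', strXor_self, Regs.mk.injEq, and_self, and_true]
  congr 1
  funext o
  rcases gf (Sum.elim a (Sum.elim k h) ∘ u) () <;> simp <;> rfl

/-- Wires of the ring and the message in a signing query. -/
def signPoint (w : (P.RIdx ⊕ (Fin P.κ ⊕ Fin P.msgLen)) ⊕ Option (Fin P.domLen) ↪ Fin W) :
    P.RIdx ⊕ Fin P.msgLen → Fin W :=
  w ∘ Sum.inl ∘ Sum.map id Sum.inr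

/-- Compute, copy and uncompute again, but the query is also recorded in slot `t`. The programs read
neither this slot nor the answer register, hence the second pass sees the same inputs and cleans up
correctly. -/
theorem exists_implements_sign {V : Type} (hS : 3 ≤ S)
    (w : (P.RIdx ⊕ (Fin P.κ ⊕ Fin P.msgLen)) ⊕ Option (Fin P.domLen) ↪ Fin W) (t : Fin T)
    (u : V → VarWire P W T) (hu : ∀ v o, u v ≠ Sum.inl (w (Sum.inr o)))
    (hut : ∀ v z, u v ≠ Sum.inr (Sum.inr (t, z))) {gf : (V → Bool) → Unit → Bool}
    (hf : Programmable S gf) {gc : (V → Bool) → Bits P.coinLen} (hc : Programmable S gc) :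
    ∃ f, Implements e (8 * S + 6 + 2 * P.coinLen + P.domLen + P.κ * (P.keyLen + 1) + P.msgLen) f ∧
      ∀ pp H a k h, f pp H (Regs.clean a k h) = Regs.clean (xorOn (Function.Embedding.inr.trans w)
        (fun o => gf (readVars u a k h) () && signAnswer (P.sampleDomBits pp
          (Sum.elim (a ∘ w ∘ Sum.inl ∘ Sum.inl) (gc (readVars u a k h)))) o) a) k
        (xorAt (Function.Embedding.sectR t _) (fun o => match o with
          | none => gf (readVars u a k h) ()
          | some z => a (signPoint w z)) h) := by
  set r : P.RIdx ↪ Fin W := (Function.Embedding.inl.trans Function.Embedding.inl).trans w with hr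
  have s1 := implements_flag (e := e) u hS hf
  have s2 := implements_coin (e := e) u hS hc
  have s3 := implements_sampleDom (e := e) r
  have s4 := implements_main (e := e) hS (Function.Embedding.inr.trans w)
    (fun _ => Sum.inr (Sum.inr (Sum.inr (Sum.inr (Sum.inr (Sum.inr (Sum.inl ())))))))
    (fun o => match o with
      | none => Sum.inr (Sum.inr (Sum.inr (Sum.inr (Sum.inr (Sum.inr (Sum.inl ()))))))
      | some o => Sum.inr (Sum.inr (Sum.inl o)))
    (fun _ _ => by simp) (fun o _ => by rcases o <;> simp) fun _ x y => x && y
  have s5 := implements_hist (e := e) hS (Function.Embedding.sectR t (Option (P.RIdx ⊕ Fin P.msgLen)))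
    (fun o => match o with
      | none => Sum.inr (Sum.inr (Sum.inr (Sum.inr (Sum.inr (Sum.inr (Sum.inl ()))))))
      | some z => Sum.inl (Sum.inl (signPoint w z)))
    (fun _ => Sum.inr (Sum.inr (Sum.inr (Sum.inr (Sum.inr (Sum.inr (Sum.inl ())))))))
    (fun o _ => by rcases o <;> simp) (fun _ _ => by simp) fun _ x _ => x
  refine ⟨_, ((((s1.comp s2).comp s3).comp (s4.comp s5)).comp
    ((s3.comp s2).comp s1)).mono (by simp; omega), fun pp H a k h => ?_⟩
  have hx : ∀ y y', Sum.elim (xorOn (Function.Embedding.inr.trans w) y a)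
      (Sum.elim k (xorAt (Function.Embedding.sectR t _) y' h)) ∘ u
      = Sum.elim a (Sum.elim k h) ∘ u := by
    intro y y'
    funext v
    simp only [Function.comp_apply]
    rcases hv : u v with i | (i | i)
    · exact xorAt_apply_of_ne y a fun o ho => hu v o (by rw [hv, ← ho]; rfl)
    · rfl
    · exact xorAt_apply_of_ne y' h fun o ho => hut v o (by rw [hv, ← ho]; rfl)
  have hm' : ∀ y, xorOn (Function.Embedding.inr.trans w) y a ∘ r = a ∘ r := fun y =>
    congrArg (fun z => z ∘ Sum.inl) (xorOn_comp_inl w y a)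
  have hm : ∀ y z, xorOn (Function.Embedding.inr.trans w) y a (signPoint w z) = a (signPoint w z) :=
    fun y z => congrFun (xorOn_comp_inl w y a) (Sum.map id Sum.inr z)
  simp only [Regs.clean, Regs.vars, Regs.toWires, zero_strXor, Sum.elim_inr, Sum.elim_inl, hx,
    hm', strXor_self, Regs.mk.injEq, and_self, and_true]
  refine ⟨?_, trivial, ?_⟩
  · congr 1
    funext o
    rcases o with _ | o
    · simp [signAnswer]
    · simp [signAnswer]
      rfl
  · congr 1
    funext o
    rcases o with _ | z
    · simp
    · simp [hm]

theorem exists_implements_sample {V : Type} (hS : 3 ≤ S) (r : P.RIdx ↪ Fin W)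
    (u : V → VarWire P W T) {gc : (V → Bool) → Bits P.coinLen} (hc : Programmable S gc) :
    ∃ f, Implements e (2 * S + P.coinLen + 1) f ∧ ∀ pp H a k h,
      (f pp H (Regs.clean a k h)).main = a ∧ (f pp H (Regs.clean a k h)).dom
        = P.sampleDomBits pp (Sum.elim (a ∘ r) (gc (readVars u a k h))) := by
  refine ⟨_, (implements_coin (e := e) u hS hc).comp (implements_sampleDom (e := e) r),
    fun pp H a k h => ?_⟩
  simp only [Regs.clean, Regs.vars, zero_strXor, and_self]

theorem exists_implements_samples (hS : 3 ≤ S) (r : P.RIdx ↪ Fin W) (c c' : Bits P.coinLen) :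
    ∃ f, Implements e (2 * P.coinLen + 2) f ∧ ∀ pp H a k h,
      (f pp H (Regs.clean (T := T) a k h)).main = a ∧
      (f pp H (Regs.clean (T := T) a k h)).dom = P.sampleDomBits pp (Sum.elim (a ∘ r) c) ∧
      (f pp H (Regs.clean (T := T) a k h)).dom' = P.sampleDomBits pp (Sum.elim (a ∘ r) c') := by
  -- Adding `strXor c c'` turns the coins `c` into `c'` for the second sample.
  refine ⟨_, (((implements_constCoin (e := e) hS c).comp (implements_sampleDom (e := e) r)).comp
    ((implements_constCoin (e := e) hS (strXor c c')).comp (implements_sampleDom' (e := e) r))).mono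
    (by omega), fun pp H a k h => ?_⟩
  have : strXor c (strXor c c') = c' := by
    funext o; simp [strXor]
  simp only [Regs.clean, zero_strXor, this, and_self]

theorem exists_implements_copyKeys {N : ℕ} (hS : 3 ≤ S) (hN : N ≤ P.κ)
    (w : Fin N × Fin P.keyLen ↪ Fin W) :
    ∃ f, Implements e (P.κ * P.keyLen) f ∧ ∀ pp H a k h, f pp H (Regs.clean (T := T) a k h)
      = Regs.clean (xorOn w (fun x => k (Fin.castLE hN x.1, x.2)) a) k h := by
  refine ⟨_, (implements_main (e := e) hS w
    (fun x => Sum.inl (Sum.inr (Sum.inl (Fin.castLE hN x.1, x.2))))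
    (fun x => Sum.inl (Sum.inr (Sum.inl (Fin.castLE hN x.1, x.2))))
    (fun _ _ => by simp) (fun _ _ => by simp) fun _ x _ => x).mono (by simp; gcongr),
    fun pp H a k h => ?_⟩
  rfl

end Macros

/-! ## States of the forger inside the reduction -/

section Lift

variable {P : RPSF} {W T S W' : ℕ} (e : Wire P W T S ≃ Fin W')

/-- The state `ψ` of the forger with given keys and history and clean working memory. -/
def liftState (k : KeyWire P → Bool) (h : HistWire P T → Bool) (ψ : QState W) : QState W' :=
  ofWires e fun b => if b = (Regs.clean (b ∘ Sum.inl ∘ Sum.inl) k h).toWires S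
    then ψ (b ∘ Sum.inl ∘ Sum.inl) else 0

/-- The wires of the forger. -/
def mainWire : Fin W ↪ Fin W' :=
  ⟨fun i => e (Sum.inl (Sum.inl i)), fun _ _ h => by simpa using h⟩

variable {e}

theorem toWires_main (R : Regs P W T) : R.toWires S ∘ Sum.inl ∘ Sum.inl = R.main := rfl

/-- The permutation need only be known on the support of `ψ`. After a measurement this lets the
classical query be treated as a constant. -/
theorem liftState_eq_of_acts {pp : Bits P.ppLen} {H : P.Hash pp} {l : List (QOp P W')}
    {F : Equiv.Perm (Wire P W T S → Bool)} (hl : Acts e pp H l F) {ψ : QState W}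
    {k : KeyWire P → Bool} {h h' : HistWire P T → Bool} {f : Bits W → Bits W}
    (hf : Function.Involutive f) (hF : ∀ a, ψ a ≠ 0 →
      F ((Regs.clean a k h).toWires S) = (Regs.clean (f a) k h').toWires S)
    (fin : QState W' → ℝ) (tail : List (QOp P W')) :
    runOps pp H fin (l ++ tail) (liftState e k h ψ)
      = runOps pp H fin tail (liftState e k h' (ψ ∘ f)) := by
  rw [liftState, hl, liftState]
  congr 2
  funext b
  simp only [Function.comp_apply]
  by_cases hb : ∃ a, ψ a ≠ 0 ∧ b = (Regs.clean (f a) k h').toWires S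
  · obtain ⟨a, ha, rfl⟩ := hb
    rw [← hF a ha, Equiv.symm_apply_apply, hF a ha]
    simp [toWires_main, Regs.clean, hf a]
  · push Not at hb
    trans 0
    · split_ifs with h1
      · by_contra hc
        refine hb _ hc ?_
        rw [← hF _ hc, ← h1, Equiv.apply_symm_apply]
      · rfl
    · symm
      split_ifs with h1
      · by_contra hc
        refine hb _ hc ?_
        rwa [hf]
      · rfl

theorem project_liftState (i : Fin W) (x : Bool) (k : KeyWire P → Bool) (h : HistWire P T → Bool)
    (ψ : QState W) :
    project (fun _ : Unit => mainWire e i) (fun _ => x) (liftState e k h ψ)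
      = liftState e k h (project (fun _ : Unit => i) (fun _ => x) ψ) := by
  funext b
  simp only [project, liftState, ofWires]
  have : b ∘ (fun _ : Unit => mainWire e i)
      = ((b ∘ e) ∘ Sum.inl ∘ Sum.inl) ∘ fun _ : Unit => i := rfl
  rw [this]
  split_ifs <;> rfl

/-- Overwriting wires of the forger does not affect whether the remaining registers are clean, so
the gate commutes with adjoining them. -/
theorem applyGate_liftState (w : Fin 3 ↪ Fin W) (U : Matrix.unitaryGroup (Bits 3) ℂ)
    (k : KeyWire P → Bool) (h : HistWire P T → Bool) (ψ : QState W) :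
    applyGate (w.trans (mainWire e)) U (liftState e k h ψ) = liftState e k h (applyGate w U ψ) := by
  funext b
  simp only [applyGate, liftState, ofWires]
  have hext : ∀ v, Function.extend (w.trans (mainWire e)) v b ∘ e
      = fun z => match z with
        | Sum.inl (Sum.inl i) => Function.extend w v (b ∘ mainWire e) i
        | z => b (e z) := by
    intro v
    funext z
    rcases z with (i | z) | z
    · simp only [Function.comp_apply]
      by_cases hi : ∃ j, w j = i
      · obtain ⟨j, rfl⟩ := hi
        rw [w.injective.extend_apply]
        exact (w.trans (mainWire e)).injective.extend_apply _ _ j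
      · rw [Function.extend_apply' _ _ _ hi, Function.extend_apply']
        · rfl
        · rintro ⟨j, hj⟩
          exact hi ⟨j, (mainWire e).injective hj⟩
    all_goals
      simp only [Function.comp_apply]
      rw [Function.extend_apply']
      rintro ⟨j, hj⟩
      have := e.injective hj
      simp at this
  have hiff : ∀ v, (Function.extend (w.trans (mainWire e)) v b ∘ e = (Regs.clean
      ((Function.extend (w.trans (mainWire e)) v b ∘ e) ∘ Sum.inl ∘ Sum.inl) k h).toWires S)
      ↔ b ∘ e = (Regs.clean ((b ∘ e) ∘ Sum.inl ∘ Sum.inl) k h).toWires S := by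
    intro v
    rw [hext]
    constructor
    · intro hb
      funext z
      rcases z with (i | z) | z
      · rfl
      · exact congrFun hb (Sum.inl (Sum.inr z))
      · exact congrFun hb (Sum.inr z)
    · intro hb
      funext z
      rcases z with (i | z) | z
      · rfl
      · exact congrFun hb (Sum.inl (Sum.inr z))
      · exact congrFun hb (Sum.inr z)
  have hmain : ∀ v, (Function.extend (w.trans (mainWire e)) v b ∘ e) ∘ Sum.inl ∘ Sum.inl
      = Function.extend w v ((b ∘ e) ∘ Sum.inl ∘ Sum.inl) := by
    intro v
    rw [hext]
    rfl
  simp only [hmain] at hiff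
  simp only [hmain, hiff]
  split_ifs with hb
  · rfl
  · simp

theorem applyOracle_liftState {I O : Type} (w : I ⊕ O ↪ Fin W) (F : (I → Bool) → O → Bool)
    (k : KeyWire P → Bool) (h : HistWire P T → Bool) (ψ : QState W) :
    applyOracle (w.trans (mainWire e)) F (liftState e k h ψ)
      = liftState e k h (applyOracle w F ψ) := by
  funext b
  simp only [applyOracle, liftState, ofWires]
  set y := F (b ∘ w.trans (mainWire e) ∘ Sum.inl) with hy
  have hext : xorOn (Function.Embedding.inr.trans (w.trans (mainWire e))) y b ∘ e
      = fun z => match z with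
        | Sum.inl (Sum.inl i) => xorOn (Function.Embedding.inr.trans w) y (b ∘ mainWire e) i
        | z => b (e z) := by
    funext z
    rcases z with (i | z) | z
    · simp only [Function.comp_apply]
      by_cases hi : ∃ j, Function.Embedding.inr.trans w j = i
      · obtain ⟨j, rfl⟩ := hi
        exact (xorAt_apply (Function.Embedding.inr.trans (w.trans (mainWire e))) y b j).trans
          (xorAt_apply (Function.Embedding.inr.trans w) y (b ∘ mainWire e) j).symm
      · push Not at hi
        exact (xorAt_apply_of_ne (w := Function.Embedding.inr.trans (w.trans (mainWire e))) y b
          fun j hj => hi j ((mainWire e).injective hj)).trans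
          (xorAt_apply_of_ne y (b ∘ mainWire e) hi).symm
    all_goals
      simp only [Function.comp_apply]
      refine xorAt_apply_of_ne (w := Function.Embedding.inr.trans (w.trans (mainWire e))) y b
        fun j hj => ?_
      have := e.injective hj
      simp at this
  have hiff : (xorOn (Function.Embedding.inr.trans (w.trans (mainWire e))) y b ∘ e = (Regs.clean
      ((xorOn (Function.Embedding.inr.trans (w.trans (mainWire e))) y b ∘ e) ∘ Sum.inl ∘ Sum.inl)
        k h).toWires S)
      ↔ b ∘ e = (Regs.clean ((b ∘ e) ∘ Sum.inl ∘ Sum.inl) k h).toWires S := by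
    rw [hext]
    constructor
    · intro hb
      funext z
      rcases z with (i | z) | z
      · rfl
      · exact congrFun hb (Sum.inl (Sum.inr z))
      · exact congrFun hb (Sum.inr z)
    · intro hb
      funext z
      rcases z with (i | z) | z
      · rfl
      · exact congrFun hb (Sum.inl (Sum.inr z))
      · exact congrFun hb (Sum.inr z)
  have hmain : (xorOn (Function.Embedding.inr.trans (w.trans (mainWire e))) y b ∘ e)
      ∘ Sum.inl ∘ Sum.inl = xorOn (Function.Embedding.inr.trans w) y
        ((b ∘ e) ∘ Sum.inl ∘ Sum.inl) := by
    rw [hext]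
    rfl
  simp only [hmain] at hiff
  simp only [hmain, hiff]
  rfl

/-- An elementary operation of the forger, performed by the reduction. -/
def QOp.embed (w : Fin W ↪ Fin W') : QOp P W → QOp P W'
  | .gate v U => .gate (v.trans w) U
  | .measure i => .measure (w i)
  | .evalF v => .evalF (v.trans w)
  | .sampleDom v => .sampleDom (v.trans w)
  | .hash v => .hash (v.trans w)

theorem runOps_embed {pp : Bits P.ppLen} {H H' : P.Hash pp} {o : QOp P W}
    (ho : ForgerOp.isHash (.op o) = false) (fin : QState W' → ℝ) (tail : List (QOp P W'))
    (k : KeyWire P → Bool) (h : HistWire P T → Bool) (ψ : QState W) :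
    runOps pp H fin (o.embed (mainWire e) :: tail) (liftState e k h ψ)
      = ((o.maps pp H').map fun M => runOps pp H fin tail (liftState e k h (M ψ))).sum := by
  cases o with
  | gate v U =>
    simp only [runOps, QOp.embed, QOp.branches, QOp.maps, applyGate_liftState]
    rfl
  | measure i =>
    simp only [runOps, QOp.embed, QOp.branches, QOp.maps, project_liftState]
    rfl
  | evalF v =>
    simp only [runOps, QOp.embed, QOp.branches, QOp.maps, applyOracle_liftState]
    rfl
  | sampleDom v =>
    simp only [runOps, QOp.embed, QOp.branches, QOp.maps, applyOracle_liftState]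
    rfl
  | hash v => simp [ForgerOp.isHash] at ho

/-- The reduction measures one qubit at a time. Successive projections compose to the projection for
the whole register. -/
theorem runOps_measure_fin {pp : Bits P.ppLen} {H : P.Hash pp} (fin : QState W' → ℝ)
    (tail : List (QOp P W')) (k : KeyWire P → Bool) (h : HistWire P T → Bool) {n : ℕ}
    (w : Fin n → Fin W) (ψ : QState W) :
    runOps pp H fin ((List.ofFn fun i => QOp.measure (mainWire e (w i))) ++ tail)
        (liftState e k h ψ)
      = ∑ x : Fin n → Bool, runOps pp H fin tail (liftState e k h (project w x ψ)) := by
  induction n generalizing ψ with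
  | zero =>
    rw [List.ofFn_zero, List.nil_append, Fintype.sum_unique]
    congr 2
    funext b
    simp only [project]
    rw [if_pos (Subsingleton.elim _ _)]
  | succ n ih =>
    rw [List.ofFn_succ, List.cons_append]
    simp only [runOps, QOp.branches, List.map_cons, List.map_nil, List.sum_cons, List.sum_nil,
      project_liftState, add_zero]
    rw [ih (fun i => w i.succ), ih (fun i => w i.succ), ← (Fin.consEquiv fun _ => Bool).sum_comp,
      Fintype.sum_prod_type, Fintype.sum_bool, add_comm]
    have key : ∀ (v : Bool) (x : Fin n → Bool),
        project (fun i => w i.succ) x (project (fun _ : Unit => w 0) (fun _ => v) ψ)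
          = project w (Fin.consEquiv (fun _ => Bool) (v, x)) ψ := by
      intro v x
      funext b
      simp only [project]
      have : b ∘ w = Fin.consEquiv (fun _ => Bool) (v, x)
          ↔ (b ∘ fun i => w i.succ) = x ∧ (b ∘ fun _ : Unit => w 0) = fun _ => v := by
        constructor
        · intro h
          exact ⟨funext fun i => congrFun h i.succ, funext fun _ => congrFun h 0⟩
        · rintro ⟨h1, h2⟩
          funext i
          refine Fin.cases ?_ (fun i => ?_) i
          · exact congrFun h2 ()
          · exact congrFun h1 i
      by_cases h1 : (b ∘ fun i => w i.succ) = x <;>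
        by_cases h2 : (b ∘ fun _ : Unit => w 0) = fun _ => v <;> simp [this, h1, h2]
    simp only [key]

theorem exists_runOps_measure {I : Type} [Fintype I] [DecidableEq I] (w : I → Fin W) :
    ∃ l : List (QOp P W'), l.length = Fintype.card I ∧
      ∀ (pp : Bits P.ppLen) (H : P.Hash pp) (fin : QState W' → ℝ) (tail : List (QOp P W'))
        (k : KeyWire P → Bool) (h : HistWire P T → Bool) (ψ : QState W),
        runOps pp H fin (l ++ tail) (liftState e k h ψ)
          = ∑ x : I → Bool, runOps pp H fin tail (liftState e k h (project w x ψ)) := by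
  refine ⟨_, List.length_ofFn, fun pp H fin tail k h ψ =>
    (runOps_measure_fin fin tail k h (w ∘ (Fintype.equivFin I).symm) ψ).trans ?_⟩
  rw [← ((Fintype.equivFin I).symm.arrowCongr (Equiv.refl Bool)).symm.sum_comp]
  refine Finset.sum_congr rfl fun x _ => ?_
  congr 2
  funext b
  simp only [project]
  congr 1
  refine propext ⟨fun h => funext fun i => ?_, fun h => funext fun i => ?_⟩
  · have := congrFun h (Fintype.equivFin I i)
    simpa using this
  · have := congrFun h ((Fintype.equivFin I).symm i)
    simpa using this

end Lift

/-! ## Simulation of a forger -/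

theorem CostProp.programmable {V : Type} {s S : ℕ} {R : (V → Bool) → Prop}
    (h : CostProp [] s R) (hs : s ≤ S) : Programmable S fun x (_ : Unit) => decide (R x) := by
  obtain ⟨q, h1, -, h3, h4⟩ := h [] WellFormed.nil (List.prefix_refl _)
  exact ⟨q, h1, by simp at h3; omega, fun _ => h4⟩

theorem programmable_polyFun {V F : Type} [Nonempty V] [Field F] [Algebra (ZMod 2) F] {n : ℕ}
    (b : Module.Basis (Fin n) (ZMod 2) F) {I : Type} [Fintype I] {c K S : ℕ} (e : I ↪ Fin n)
    (o : Fin c ↪ Fin n) (θ : Fin K → F) (u : I → V) (hS : n + K * (n * (5 * n ^ 2 + 3)) ≤ S) :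
    Programmable S fun x => polyFun b e o θ (x ∘ u) := by
  obtain ⟨q, h1, h2, h3⟩ := exists_program_polynomial b e u K θ
  exact ⟨q, h1, h2.trans hS, fun k => h3 (o k)⟩

section Simulation

variable {P : RPSF} {N W T S W' : ℕ} {e : Wire P W T S ≃ Fin W'}

/-- The history `h` of `t` signing queries contains the pairs in `L`. -/
def HistMatches (t : ℕ) (h : HistWire P T → Bool) (L : List (P.Rng × P.Msg)) : Prop :=
  (∀ ρ m, (ρ, m) ∈ L ↔ ∃ t' : Fin T, t'.1 < t ∧ h (t', none) = true ∧
    ∀ z, h (t', some z) = Sum.elim (encRing ρ) m z) ∧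
  ∀ t' z, t ≤ t'.1 → h (t', z) = false

/-- The coins that the polynomial `θ` assigns to a ring and a message. -/
def polyCoins {F : Type} [Field F] [Algebra (ZMod 2) F] {n K : ℕ}
    (b : Module.Basis (Fin n) (ZMod 2) F) (i : P.RIdx ⊕ Fin P.msgLen ↪ Fin n)
    (o : Fin P.coinLen ↪ Fin n) (θ : Fin K → F) (x : P.Rng × P.Msg) : Bits P.coinLen :=
  polyFun b i o θ (Sum.elim (encRing x.1) x.2)

theorem fBits_sampleDomBits {pp : Bits P.ppLen} (ρ : P.Rng) (c : Bits P.coinLen) :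
    P.fBits pp (Sum.elim (encRing ρ) (P.sampleDomBits pp (Sum.elim (encRing ρ) c)))
      = (P.f pp ρ (P.SampleDom pp ρ c)).1 := by
  have h1 : P.sampleDomBits pp (Sum.elim (encRing ρ) c) = (P.SampleDom pp ρ c).1 := by
    simp [RPSF.sampleDomBits, decode_enc encRing_injective]
  simp [RPSF.fBits, decode_enc encRing_injective, h1]

theorem sampleDomBits_encRing {pp : Bits P.ppLen} (ρ : P.Rng) (c : Bits P.coinLen) :
    P.sampleDomBits pp (Sum.elim (encRing ρ) c) = (P.SampleDom pp ρ c).1 := by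
  simp [RPSF.sampleDomBits, decode_enc encRing_injective]

/-- Bits of a simulated random oracle. -/
theorem hashBits_simHash {pp : Bits P.ppLen} {kp : Fin N → P.KeyPair}
    {G : P.Rng × P.Msg → Bits P.coinLen} (H : P.Hash pp) (x : P.RIdx ⊕ Fin P.msgLen → Bool)
    {c : Bits P.coinLen} (hc : ∀ ρ, encRing ρ = x ∘ Sum.inl → c = G (ρ, x ∘ Sum.inr)) {Q : Prop} [Decidable Q]
    (hQ : Q ↔ ∃ (i : Fin P.κ) (j : Fin N), x (Sum.inl (i, none)) = true ∧
      ∀ k, x (Sum.inl (i, some k)) = (kp j).1 k) :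
    (if Q then P.fBits pp (Sum.elim (x ∘ Sum.inl) (P.sampleDomBits pp (Sum.elim (x ∘ Sum.inl) c)))
      else P.hashBits H x) = P.hashBits (simHash kp G H) x := by
  by_cases hρ : ∃ ρ : P.Rng, encRing ρ = x ∘ Sum.inl
  · obtain ⟨ρ, hρ⟩ := hρ
    have hgood := goodPoint_iff_of_encRing (kp := kp) (m := x ∘ Sum.inr) hρ
    have hQ' : Q ↔ GoodPoint kp (ρ, x ∘ Sum.inr) := by
      rw [hQ, hgood]
      rfl
    rw [← hρ, fBits_sampleDomBits, hc ρ hρ]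
    simp only [RPSF.hashBits, ← hρ, decode_enc encRing_injective, simHash]
    by_cases hq : Q
    · simp [hq, hQ'.1 hq]
    · have : ¬ GoodPoint kp (ρ, x ∘ Sum.inr) := fun h => hq (hQ'.2 h)
      simp [hq, this]
  -- If no ring is encoded, both candidates are the zero string, so neither `Q` nor the coins
  -- matter.
  · have hd : decode (encRing (κ := P.κ) (ℓ := P.keyLen)) (x ∘ Sum.inl) = none :=
      decode_eq_none_iff.2 (not_exists.1 hρ)
    simp [RPSF.hashBits, RPSF.fBits, hd]

theorem sum_pointSign {pp : Bits P.ppLen} {d : (x : P.Rng × P.Msg) → P.Dom pp x.1} (ρ : P.Rng)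
    (m : P.Msg) (j : Fin N) (g : P.Dom pp ρ → ℝ) :
    ∑ σ, pointSign N d ρ m j σ * g σ = g (d (ρ, m)) := by
  simp [pointSign]

/-- A refused query still writes its ring and message, but its false flag makes the slot invisible.
-/
theorem HistMatches.succ_false {t : Fin T} {h : HistWire P T → Bool} {L : List (P.Rng × P.Msg)}
    (hL : HistMatches t.1 h L) {y : Option (P.RIdx ⊕ Fin P.msgLen) → Bool} (hy : y none = false) :
    HistMatches (t.1 + 1) (xorAt (Function.Embedding.sectR t _) y h) L := by
  have h1 : ∀ t' z, t' ≠ t → xorAt (Function.Embedding.sectR t _) y h (t', z) = h (t', z) :=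
    fun t' z ht => xorAt_apply_of_ne _ _ fun o ho => ht (congrArg Prod.fst ho).symm
  have h2 : ∀ z, xorAt (Function.Embedding.sectR t _) y h (t, z) = y z := fun z =>
    (xorAt_apply (Function.Embedding.sectR t _) y h z).trans (by
      change xor (h (t, z)) _ = _
      rw [hL.2 t z le_rfl, Bool.false_xor])
  refine ⟨fun ρ m => ?_, fun t' z ht => ?_⟩
  · rw [hL.1 ρ m]
    constructor
    · rintro ⟨t', h3, h4, h5⟩
      have hne : t' ≠ t := fun he => by rw [he] at h3; omega
      exact ⟨t', by omega, by rwa [h1 _ _ hne], fun z => by rw [h1 _ _ hne, h5]⟩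
    · rintro ⟨t', h3, h4, h5⟩
      have hne : t' ≠ t := fun he => by
        rw [he, h2, hy] at h4
        simp at h4
      have : t'.1 ≠ t.1 := fun he => hne (Fin.ext he)
      exact ⟨t', by omega, by rwa [h1 _ _ hne] at h4, fun z => by rw [← h1 _ _ hne, h5]⟩
  · have hne : t' ≠ t := fun he => by rw [he] at ht; omega
    rw [h1 _ _ hne]
    exact hL.2 t' z (by omega)

theorem HistMatches.succ_true {t : Fin T} {h : HistWire P T → Bool} {L : List (P.Rng × P.Msg)}
    (hL : HistMatches t.1 h L) {y : Option (P.RIdx ⊕ Fin P.msgLen) → Bool} (hy : y none = true)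
    {ρ : P.Rng} {m : P.Msg} (hρ : ∀ z, y (some z) = Sum.elim (encRing ρ) m z) :
    HistMatches (t.1 + 1) (xorAt (Function.Embedding.sectR t _) y h) ((ρ, m) :: L) := by
  have h1 : ∀ t' z, t' ≠ t → xorAt (Function.Embedding.sectR t _) y h (t', z) = h (t', z) :=
    fun t' z ht => xorAt_apply_of_ne _ _ fun o ho => ht (congrArg Prod.fst ho).symm
  have h2 : ∀ z, xorAt (Function.Embedding.sectR t _) y h (t, z) = y z := fun z =>
    (xorAt_apply (Function.Embedding.sectR t _) y h z).trans (by
      change xor (h (t, z)) _ = _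
      rw [hL.2 t z le_rfl, Bool.false_xor])
  refine ⟨fun ρ' m' => ?_, fun t' z ht => ?_⟩
  · rw [List.mem_cons, hL.1 ρ' m']
    constructor
    · rintro (heq | ⟨t', h3, h4, h5⟩)
      · obtain ⟨rfl, rfl⟩ := Prod.mk.inj heq
        exact ⟨t, by omega, by rw [h2, hy], fun z => by rw [h2, hρ]⟩
      · have hne : t' ≠ t := fun he => by rw [he] at h3; omega
        exact ⟨t', by omega, by rwa [h1 _ _ hne], fun z => by rw [h1 _ _ hne, h5]⟩
    · rintro ⟨t', h3, h4, h5⟩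
      by_cases hne : t' = t
      · subst hne
        left
        have h6 : ∀ z, Sum.elim (encRing ρ) m z = Sum.elim (encRing ρ') m' z := fun z => by
          rw [← hρ, ← h2, h5]
        have h7 : ρ = ρ' := encRing_injective (funext fun z => h6 (Sum.inl z))
        have h8 : m = m' := funext fun z => h6 (Sum.inr z)
        rw [h7, h8]
      · have : t'.1 ≠ t.1 := fun he => hne (Fin.ext he)
        exact Or.inr ⟨t', by omega, by rwa [h1 _ _ hne] at h4, fun z => by rw [← h1 _ _ hne, h5]⟩
  · have hne : t' ≠ t := fun he => by rw [he] at ht; omega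
    rw [h1 _ _ hne]
    exact hL.2 t' z (by omega)

variable {F : Type} [Field F] [Algebra (ZMod 2) F] {n K : ℕ}
  (b : Module.Basis (Fin n) (ZMod 2) F) (i : P.RIdx ⊕ Fin P.msgLen ↪ Fin n)
  (o : Fin P.coinLen ↪ Fin n) (θ : Fin K → F)

/-- A hash query in the reduction. -/
theorem exists_sim_hash {s : ℕ} (hS3 : 3 ≤ S) (hN : N ≤ P.κ) (hκ : 0 < P.κ) (hκs : P.κ ≤ s) (hℓs : P.keyLen ≤ s)
    (hs : s * (s * (s * 2 + 4) + 2) + 1 ≤ S) (hS : n + K * (n * (5 * n ^ 2 + 3)) ≤ S)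
    (w : (P.RIdx ⊕ Fin P.msgLen) ⊕ Fin P.ranLen ↪ Fin W) :
    ∃ l : List (QOp P W'), l.length ≤ 8 * S + 8 + 2 * P.coinLen + 2 * P.ranLen ∧
      ∀ (pp : Bits P.ppLen) (H : P.Hash pp) (kp : Fin N → P.KeyPair) (kr : KeyWire P → Bool),
        (∀ j k, kr (Fin.castLE hN j, k) = (kp j).1 k) →
        ∀ (fin : QState W' → ℝ) (tail : List (QOp P W')) (h : HistWire P T → Bool) (ψ : QState W),
          runOps pp H fin (l ++ tail) (liftState e kr h ψ) = runOps pp H fin tail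
            (liftState e kr h (applyOracle w (P.hashBits (simHash kp (polyCoins b i o θ) H)) ψ)) := by
  set u : (P.RIdx ⊕ Fin P.msgLen) ⊕ KeyWire P → VarWire P W T :=
    Sum.elim (fun z => Sum.inl (w (Sum.inl z))) fun z => Sum.inr (Sum.inl z) with hu
  have : Nonempty ((P.RIdx ⊕ Fin P.msgLen) ⊕ KeyWire P) := ⟨Sum.inl (Sum.inl (⟨0, hκ⟩, none))⟩
  -- The presence bits themselves serve as slot marks, so that any member of the ring is admitted.
  have hf := (costProp_slotMatches (p₀ := []) (N := N) (s := s) hκs hℓs (hN.trans hκs)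
    (fun z => (Sum.inl (Sum.inl z) : (P.RIdx ⊕ Fin P.msgLen) ⊕ KeyWire P))
    (fun z => Sum.inl (Sum.inl (z, none))) (fun j k => Sum.inr (Fin.castLE hN j, k))).programmable hs
  have hc := programmable_polyFun b i o θ
    (Sum.inl : _ → (P.RIdx ⊕ Fin P.msgLen) ⊕ KeyWire P) hS
  have hne : ∀ v z, u v ≠ Sum.inl (w (Sum.inr z)) := by
    rintro (v | v) z
    · simp [hu]
    · simp [hu]
  obtain ⟨f, ⟨l, hl, hf1⟩, hf2⟩ := exists_implements_hash (e := e) hS3 w u hne hf hc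
  refine ⟨l, hl, fun pp H kp kr hkr fin tail h ψ => ?_⟩
  obtain ⟨F, hF1, hF2⟩ := hf1 pp H
  refine liftState_eq_of_acts hF1
    (f := oraclePerm w (P.hashBits (simHash kp (polyCoins b i o θ) H)))
    (oraclePerm w (P.hashBits (simHash kp (polyCoins b i o θ) H))).left_inv (fun a _ => ?_) fin tail
  rw [hF2, hf2]
  congr 2
  change xorOn _ _ a = xorOn _ _ a
  congr 1
  refine hashBits_simHash (G := polyCoins b i o θ) H (a ∘ w ∘ Sum.inl) (fun ρ hρ => ?_) ?_
  · rw [polyCoins, hρ]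
    simp only
    congr 1
    funext z
    rcases z with z | z <;> rfl
  · refine decide_eq_true_iff.trans ?_
    unfold SlotMatches
    refine exists_congr fun i => exists_congr fun j => ?_
    simp only [readVars, Function.comp_apply, hu, Sum.elim_inl, Sum.elim_inr, hkr]
    tauto

/-- A signing query in the reduction. -/
theorem exists_sim_sign {s : ℕ} (hS3 : 3 ≤ S) (hN : N ≤ P.κ) (hκ : 0 < P.κ) (hκs : P.κ ≤ s)
    (hℓs : P.keyLen ≤ s) (hTs : T ≤ s) (hzs : P.κ * (P.keyLen + 1) + P.msgLen ≤ s)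
    (hs : 5 * s ^ 3 + 24 * s ^ 2 + 16 * s + 15 ≤ S) (hS : n + K * (n * (5 * n ^ 2 + 3)) ≤ S)
    (w : (P.RIdx ⊕ (Fin P.κ ⊕ Fin P.msgLen)) ⊕ Option (Fin P.domLen) ↪ Fin W) (t : Fin T) :
    ∃ l : List (QOp P W'), l.length ≤ 8 * S + 6 + 2 * P.coinLen + P.domLen
        + 2 * (P.κ * (P.keyLen + 1)) + P.κ + 2 * P.msgLen ∧
      ∀ (pp : Bits P.ppLen) (H : P.Hash pp) (kp : Fin N → P.KeyPair) (kr : KeyWire P → Bool),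
        (∀ j k, kr (Fin.castLE hN j, k) = (kp j).1 k) →
        ∀ (fin : QState W' → ℝ) (tail : List (QOp P W')) (qs : ℕ) (L : List (P.Rng × P.Msg))
          (k : List (P.Rng × P.Msg) → QState W → ℝ), L.length ≠ qs →
          (∀ h L' φ, HistMatches (t.1 + 1) h L' → L'.length ≤ L.length + 1 →
            runOps pp H fin tail (liftState e kr h φ) = k L' φ) →
          ∀ (h : HistWire P T → Bool) (ψ : QState W), HistMatches t.1 h L →
          runOps pp H fin (l ++ tail) (liftState e kr h ψ)
            = ∑ x, signBranch qs kp (pointSign N (simDom pp (polyCoins b i o θ))) k w L ψ x := by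
  -- The programs read only the first `t` slots, so recording the query in slot `t` does not disturb
  -- their uncomputation.
  set u : (P.RIdx ⊕ (Fin P.κ ⊕ Fin P.msgLen)) ⊕
      (KeyWire P ⊕ Fin t.1 × Option (P.RIdx ⊕ Fin P.msgLen)) → VarWire P W T :=
    Sum.elim (fun z => Sum.inl (w (Sum.inl z))) (Sum.elim (fun z => Sum.inr (Sum.inl z))
      fun z => Sum.inr (Sum.inr (Fin.castLE t.2.le z.1, z.2))) with hu
  have : Nonempty ((P.RIdx ⊕ (Fin P.κ ⊕ Fin P.msgLen)) ⊕
    (KeyWire P ⊕ Fin t.1 × Option (P.RIdx ⊕ Fin P.msgLen))) := ⟨Sum.inl (Sum.inl (⟨0, hκ⟩, none))⟩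
  have hf := (costProp_signOk (p₀ := []) (N := N) (s := s) hκs hℓs (hN.trans hκs)
    (t.2.le.trans hTs) hzs
    (fun z => (Sum.inl (Sum.inl z) : (P.RIdx ⊕ (Fin P.κ ⊕ Fin P.msgLen)) ⊕
      (KeyWire P ⊕ Fin t.1 × Option (P.RIdx ⊕ Fin P.msgLen))))
    (fun z => Sum.inl (Sum.inr (Sum.inl z))) (fun z => Sum.inl (Sum.inr (Sum.inr z)))
    (fun j k => Sum.inr (Sum.inl (Fin.castLE hN j, k)))
    (fun t' z => Sum.inr (Sum.inr (t', z)))).programmable hs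
  have hc := programmable_polyFun b i o θ
    (Sum.inl ∘ Sum.map id Sum.inr : _ → (P.RIdx ⊕ (Fin P.κ ⊕ Fin P.msgLen)) ⊕
      (KeyWire P ⊕ Fin t.1 × Option (P.RIdx ⊕ Fin P.msgLen))) hS
  have hne : ∀ v z, u v ≠ Sum.inl (w (Sum.inr z)) := by
    rintro (v | v | v) z <;> simp [hu]
  have hne' : ∀ v z, u v ≠ Sum.inr (Sum.inr (t, z)) := by
    rintro (v | v | ⟨v, y⟩) z
    · simp [hu]
    · simp [hu]
    · intro hv
      simp only [hu, Sum.elim_inr, Sum.inr.injEq, Prod.mk.injEq] at hv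
      have := congrArg Fin.val hv.1
      simp only [Fin.val_castLE] at this
      exact absurd v.2 (by omega)
  obtain ⟨f, ⟨l, hl, hf1⟩, hf2⟩ := exists_implements_sign (e := e) hS3 w t u hne hne' hf hc
  obtain ⟨l', hl', hmeas⟩ := exists_runOps_measure (P := P) (e := e) (w ∘ Sum.inl)
  refine ⟨l' ++ l, ?_, fun pp H kp kr hkr fin tail qs L k hLqs hk h ψ hh => ?_⟩
  · rw [List.length_append, hl']
    simp only [Fintype.card_sum, Fintype.card_prod, Fintype.card_option, Fintype.card_fin]
    omega
  -- Signing queries are classical, so the query register is measured first. On each outcome `x` the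
  -- flag and the coins are then constants.
  rw [List.append_assoc, hmeas]
  refine Finset.sum_congr rfl fun x _ => ?_
  obtain ⟨F, hF1, hF2⟩ := hf1 pp H
  -- the values of the variables on the support of the projected state
  set v : (P.RIdx ⊕ (Fin P.κ ⊕ Fin P.msgLen)) ⊕
      (KeyWire P ⊕ Fin t.1 × Option (P.RIdx ⊕ Fin P.msgLen)) → Bool :=
    Sum.elim x (Sum.elim kr fun z => h (Fin.castLE t.2.le z.1, z.2)) with hv
  have hread : ∀ a, project (w ∘ Sum.inl) x ψ a ≠ 0 → a ∘ w ∘ Sum.inl = x := by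
    intro a ha
    by_contra hc
    exact ha (if_neg hc)
  have hvars : ∀ a, project (w ∘ Sum.inl) x ψ a ≠ 0 → readVars u a kr h = v := by
    intro a ha
    funext z
    rcases z with z | z | z
    · exact congrFun (hread a ha) z
    · rfl
    · rfl
  set ok : Bool := decide (SignOk (fun z => Sum.inl (Sum.inl z)) (fun z => Sum.inl (Sum.inr (Sum.inl z)))
    (fun z => Sum.inl (Sum.inr (Sum.inr z))) (fun (j : Fin N) k => Sum.inr (Sum.inl (Fin.castLE hN j, k)))
    (fun t' z => Sum.inr (Sum.inr (t', z))) v) with hok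
  set c : Bits P.coinLen := polyFun b i o θ (v ∘ Sum.inl ∘ Sum.map id Sum.inr) with hcdef
  set y : Option (P.RIdx ⊕ Fin P.msgLen) → Bool := fun z => match z with
    | none => ok
    | some z => x (Sum.map id Sum.inr z) with hy
  set σ := P.sampleDomBits pp (Sum.elim (x ∘ Sum.inl) c) with hσ
  have hrun := liftState_eq_of_acts hF1 (ψ := project (w ∘ Sum.inl) x ψ) (k := kr) (h := h)
    (h' := xorAt (Function.Embedding.sectR t _) y h)
    (f := xorOn (Function.Embedding.inr.trans w) fun z => ok && signAnswer σ z)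
    (xorOn_self _ _) (fun a ha => by
      rw [hF2, hf2]
      have h1 := hvars a ha
      have h2 := hread a ha
      have h3 : a ∘ w ∘ Sum.inl ∘ Sum.inl = x ∘ Sum.inl := congrArg (fun z => z ∘ Sum.inl) h2
      have h4 : ∀ z, a (signPoint w z) = x (Sum.map id Sum.inr z) := fun z =>
        congrFun h2 (Sum.map id Sum.inr z)
      simp only [h1, h3, h4]
      rfl) fin tail
  rw [hrun]
  have hok' : ok = true ↔ signCheck qs kp L x ≠ none := by
    rw [ne_eq, signCheck_eq_none_iff hLqs, not_not, hok, decide_eq_true_eq]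
    unfold SignOk SlotMatches
    simp only [hv, Sum.elim_inl, Sum.elim_inr, hkr]
    refine and_congr_right fun hvalid => and_congr Iff.rfl (and_congr Iff.rfl ?_)
    constructor
    · intro hall ρ hρ hmem
      obtain ⟨t', h1, h2, h3⟩ := (hh.1 _ _).1 hmem
      refine hall ⟨t'.1, h1⟩ ⟨h2, fun z => ?_⟩
      refine (h3 z).trans ?_
      rcases z with z | z
      · exact congrFun hρ z
      · rfl
    · rintro hall t' ⟨h1, h2⟩
      obtain ⟨ρ, hρ⟩ := hvalid
      refine hall ρ hρ ((hh.1 _ _).2 ⟨Fin.castLE t.2.le t', t'.2, h1, fun z => ?_⟩)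
      refine (h2 z).trans ?_
      rcases z with z | z
      · exact (congrFun hρ z).symm
      · rfl
  rcases hsc : signCheck qs kp L x with _ | ⟨ρ, m, j⟩
  · have hfalse : ok = false := by
      by_contra hc
      exact hok'.1 (by simpa using hc) hsc
    rw [signBranch_none hsc]
    have hid : (project (w ∘ Sum.inl) x ψ) ∘
        (xorOn (Function.Embedding.inr.trans w) fun z => ok && signAnswer σ z)
        = project (w ∘ Sum.inl) x ψ := by
      funext a
      simp only [Function.comp_apply]
      congr 1
      exact (eq_xorAt (by simp [hfalse]) fun _ _ => rfl).symm
    rw [hid]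
    exact hk _ _ _ (hh.succ_false hfalse) (Nat.le_succ _)
  · have htrue : ok = true := hok'.2 (by simp [hsc])
    obtain ⟨h1, h2, -, -⟩ := signCheck_eq_some hsc
    rw [signBranch_some hsc, sum_pointSign]
    have hcoin : c = polyCoins b i o θ (ρ, m) := by
      rw [hcdef, polyCoins, h1, h2]
      congr 1
      funext z
      rcases z with z | z <;> rfl
    have hσ' : σ = (simDom pp (polyCoins b i o θ) (ρ, m)).1 := by
      rw [hσ, hcoin, ← h1, sampleDomBits_encRing]
      rfl
    rw [← hσ']
    have hid : (project (w ∘ Sum.inl) x ψ) ∘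
        (xorOn (Function.Embedding.inr.trans w) fun z => ok && signAnswer σ z)
        = applyXor (Function.Embedding.inr.trans w) (signAnswer σ) (project (w ∘ Sum.inl) x ψ) := by
      funext a
      simp only [Function.comp_apply, htrue, Bool.true_and]
      rfl
    rw [hid]
    refine hk _ _ _ (hh.succ_true htrue fun z => ?_) (by simp)
    rcases z with z | z
    · exact (congrFun h1 z).symm
    · exact (congrFun h2 z).symm

end Simulation

/-! ## The collision adversary -/

section Reduction

variable {P : RPSF} {N W T S W' : ℕ} {e : Wire P W T S ≃ Fin W'}
  {F : Type} [Field F] [Algebra (ZMod 2) F] {n K : ℕ}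
  (b : Module.Basis (Fin n) (ZMod 2) F) (i : P.RIdx ⊕ Fin P.msgLen ↪ Fin n)
  (o : Fin P.coinLen ↪ Fin n) (θ : Fin K → F)

/-- Bound on the number of operations that simulate one operation of a forger. -/
def stepCost (P : RPSF) (S : ℕ) : ℕ :=
  8 * S + 8 + 2 * P.coinLen + 2 * P.ranLen + P.domLen + 2 * (P.κ * (P.keyLen + 1)) + P.κ
    + 2 * P.msgLen

/-- Sizes of the working memory that suffice for the simulation. -/
structure Fits (P : RPSF) (n K T S s : ℕ) : Prop where
  three : 3 ≤ S
  κ_le : P.κ ≤ s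
  key_le : P.keyLen ≤ s
  T_le : T ≤ s
  point_le : P.κ * (P.keyLen + 1) + P.msgLen ≤ s
  slot_le : s * (s * (s * 2 + 4) + 2) + 1 ≤ S
  sign_le : 5 * s ^ 3 + 24 * s ^ 2 + 16 * s + 15 ≤ S
  poly_le : n + K * (n * (5 * n ^ 2 + 3)) ≤ S

/-- Slot `t` belongs to the `t`-th signing operation, answered or not. The bound on `L.length` plus
the remaining signing operations keeps the quota from refusing any of them. The final value ignores
the list, since a collision need not come from an unsigned pair. -/
theorem exists_simulation {s : ℕ} (hfit : Fits P n K T S s) (hN : N ≤ P.κ) (hκ : 0 < P.κ)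
    (os : List (ForgerOp P W)) (t : ℕ) (ht : t + os.countP ForgerOp.isSign ≤ T) :
    ∃ l : List (QOp P W'), l.length ≤ os.length * stepCost P S ∧
      ∀ (pp : Bits P.ppLen) (H : P.Hash pp) (kp : Fin N → P.KeyPair) (kr : KeyWire P → Bool),
        (∀ j k, kr (Fin.castLE hN j, k) = (kp j).1 k) →
        ∀ (fin : QState W' → ℝ) (tail : List (QOp P W')) (val : QState W → ℝ),
          (∀ h ψ, runOps pp H fin tail (liftState e kr h ψ) = val ψ) →
          ∀ (qs : ℕ) (h : HistWire P T → Bool) (L : List (P.Rng × P.Msg)) (ψ : QState W),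
          HistMatches t h L → L.length + os.countP ForgerOp.isSign ≤ qs →
          runOps pp H fin (l ++ tail) (liftState e kr h ψ)
            = runWith qs pp kp (simHash kp (polyCoins b i o θ) H)
                (pointSign N (simDom pp (polyCoins b i o θ))) (fun _ => val) os L ψ := by
  induction os generalizing t with
  | nil =>
    refine ⟨[], by simp, fun pp H kp kr hkr fin tail val hval qs h L ψ _ _ => ?_⟩
    exact hval h ψ
  | cons a os ih =>
    rw [List.countP_cons] at ht
    cases a with
    | op a =>
      obtain ⟨l, hl, hrun⟩ := ih t (by omega)
      by_cases ha : ForgerOp.isHash (.op a) = true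
      · cases a with
        | hash w =>
          obtain ⟨l', hl', hrun'⟩ := exists_sim_hash (e := e) b i o θ hfit.three hN hκ hfit.κ_le
            hfit.key_le hfit.slot_le hfit.poly_le w
          refine ⟨l' ++ l, ?_, fun pp H kp kr hkr fin tail val hval qs h L ψ hh hL => ?_⟩
          · rw [List.length_append, List.length_cons, Nat.add_mul, one_mul]
            unfold stepCost at hl ⊢
            omega
          · rw [List.countP_cons] at hL
            rw [List.append_assoc, hrun' pp H kp kr hkr, hrun pp H kp kr hkr fin tail val hval qs h L _ hh
              (by omega)]
            simp only [runWith, QOp.maps, List.map_cons, List.map_nil, List.sum_cons, List.sum_nil,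
              add_zero]
            rfl
        | _ => simp [ForgerOp.isHash] at ha
      · refine ⟨a.embed (mainWire e) :: l, ?_, fun pp H kp kr hkr fin tail val hval qs h L ψ hh hL => ?_⟩
        · rw [List.length_cons, List.length_cons, Nat.add_mul, one_mul]
          have : 1 ≤ stepCost P S := by unfold stepCost; omega
          omega
        · rw [List.countP_cons] at hL
          rw [List.cons_append, runOps_embed (H' := simHash kp (polyCoins b i o θ) H) (by simpa using ha)]
          simp only [runWith]
          congr 1
          refine List.map_congr_left fun M _ => ?_
          exact hrun pp H kp kr hkr fin tail val hval qs h L _ hh (by omega)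
    | sign w =>
      have hs : (if (ForgerOp.sign w : ForgerOp P W).isSign = true then 1 else 0) = 1 := rfl
      rw [hs] at ht
      obtain ⟨l, hl, hrun⟩ := ih (t + 1) (by omega)
      obtain ⟨l', hl', hrun'⟩ := exists_sim_sign (e := e) b i o θ hfit.three hN hκ hfit.κ_le
        hfit.key_le hfit.T_le hfit.point_le hfit.sign_le hfit.poly_le w ⟨t, by omega⟩
      refine ⟨l' ++ l, ?_, fun pp H kp kr hkr fin tail val hval qs h L ψ hh hL => ?_⟩
      · rw [List.length_append, List.length_cons, Nat.add_mul, one_mul]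
        unfold stepCost at hl ⊢
        omega
      · rw [List.countP_cons, hs] at hL
        rw [List.append_assoc, runWith_sign]
        refine hrun' pp H kp kr hkr fin (l ++ tail) qs L _ (by omega) (fun h' L' φ hh' hL' => ?_) h ψ hh
        exact hrun pp H kp kr hkr fin tail val hval qs h' L' φ hh' (by omega)

/-- The outcome of a measurement after a map of registers. -/
theorem exists_runOps_probOf {c : ℕ} {f : (pp : Bits P.ppLen) → P.Hash pp → Regs P W T → Regs P W T}
    (hf : Implements e c f) : ∃ l : List (QOp P W'), l.length ≤ c ∧
      ∀ (pp : Bits P.ppLen) (H : P.Hash pp) (k : KeyWire P → Bool) (h : HistWire P T → Bool)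
        (ψ : QState W) (p : Bits W' → Prop),
        runOps pp H (probOf p) l (liftState e k h ψ)
          = probOf (fun a => p ((f pp H (Regs.clean a k h)).toWires S ∘ e.symm)) ψ := by
  obtain ⟨l, hl, hF⟩ := hf
  refine ⟨l, hl, fun pp H k h ψ p => ?_⟩
  obtain ⟨G, hG1, hG2⟩ := hF pp H
  have h1 := hG1 (probOf p) [] (fun z => if z = (Regs.clean (z ∘ Sum.inl ∘ Sum.inl) k h).toWires S
    then ψ (z ∘ Sum.inl ∘ Sum.inl) else 0)
  rw [List.append_nil] at h1
  refine h1.trans ?_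
  simp only [runOps, probOf]
  -- The circuit permutes basis states, so distinct strings `a` end in distinct basis states and all
  -- others have amplitude zero.
  refine (Fintype.sum_of_injective
    (fun a : Bits W => (f pp H (Regs.clean a k h)).toWires S ∘ e.symm) ?_ _ _ ?_ ?_).symm
  · intro a a' haa
    have h2 : (f pp H (Regs.clean a k h)).toWires S = (f pp H (Regs.clean a' k h)).toWires S := by
      funext z
      simpa using congrFun haa (e z)
    rw [← hG2, ← hG2] at h2
    exact congrArg (fun z => z ∘ Sum.inl ∘ Sum.inl) (G.injective h2)
  · intro z hz
    have : ofWires e ((fun z => if z = (Regs.clean (z ∘ Sum.inl ∘ Sum.inl) k h).toWires S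
        then ψ (z ∘ Sum.inl ∘ Sum.inl) else 0) ∘ G.symm) z = 0 := by
      simp only [ofWires, Function.comp_apply]
      refine if_neg fun hc => hz ⟨(G.symm (z ∘ e)) ∘ Sum.inl ∘ Sum.inl, ?_⟩
      simp only
      rw [← hG2]
      have h3 : G ((Regs.clean ((G.symm (z ∘ e)) ∘ Sum.inl ∘ Sum.inl) k h).toWires S) = z ∘ e := by
        rw [← Equiv.eq_symm_apply]
        exact hc.symm
      rw [h3]
      funext y
      simp
    rw [this]
    simp
  · intro a
    have : ofWires e ((fun z => if z = (Regs.clean (z ∘ Sum.inl ∘ Sum.inl) k h).toWires S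
        then ψ (z ∘ Sum.inl ∘ Sum.inl) else 0) ∘ G.symm)
        ((f pp H (Regs.clean a k h)).toWires S ∘ e.symm) = ψ a := by
      have h3 : ((f pp H (Regs.clean a k h)).toWires S ∘ e.symm) ∘ e
          = G ((Regs.clean a k h).toWires S) := by
        rw [hG2]
        funext z
        simp
      simp only [ofWires, Function.comp_apply, h3, Equiv.symm_apply_apply, toWires_main]
      simp [Regs.clean]
    rw [this]

variable (e) in
/-- The wires on which the reduction receives its input. -/
def reductionInput (inp : (Fin P.ppLen ⊕ Fin N × Fin P.keyLen) ↪ Fin W) :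
    (Fin P.ppLen ⊕ Fin P.κ × Fin P.keyLen) ↪ Fin W' where
  toFun := Sum.elim (fun k => e (Sum.inl (Sum.inl (inp (Sum.inl k)))))
    fun x => e (Sum.inl (Sum.inr (Sum.inl x)))
  inj' := by rintro (k | x) (k' | x') h <;> simp_all

/-- The keys as contents of the key register. -/
def keyBits (kp : Fin P.κ → P.KeyPair) : KeyWire P → Bool := fun x => (kp x.1).1 x.2

/-- The public parameters arrive directly on the forger's wires. The `κ` keys go to a separate
register, from which the first `N` are copied to the forger's input. -/
theorem initState_reductionInput (inp : (Fin P.ppLen ⊕ Fin N × Fin P.keyLen) ↪ Fin W)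
    (pp : Bits P.ppLen) (kp : Fin P.κ → P.KeyPair) :
    initState (reductionInput e inp) pp kp = liftState e (keyBits kp) (fun _ => false)
      (basisState (Function.extend (Function.Embedding.inl.trans inp) pp fun _ => false)) := by
  set a := Function.extend (Function.Embedding.inl.trans inp) pp fun _ => false with ha
  have key : Function.extend (reductionInput e inp) (inputBits pp kp) (fun _ => false) ∘ e
      = (Regs.clean a (keyBits kp) fun _ => false).toWires S := by
    funext z
    simp only [Function.comp_apply]
    by_cases hz : ∃ x, reductionInput e inp x = e z
    · obtain ⟨x, hx⟩ := hz
      rw [← hx, (reductionInput e inp).injective.extend_apply]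
      rcases x with k | x
      · obtain rfl := e.injective hx
        change pp k = a (inp (Sum.inl k))
        exact ((Function.Embedding.inl.trans inp).injective.extend_apply _ _ k).symm
      · obtain rfl := e.injective hx
        rfl
    · rw [Function.extend_apply' _ _ _ hz]
      rcases z with (z | (z | z)) | (z | (z | (z | (z | (z | (z | z))))))
      · change false = a z
        rw [ha, Function.extend_apply']
        rintro ⟨k, hk⟩
        exact hz ⟨Sum.inl k, congrArg (fun z => e (Sum.inl (Sum.inl z))) hk⟩
      · exact absurd ⟨Sum.inr z, rfl⟩ hz
      all_goals rfl
  funext z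
  rw [initState, basisState, Pi.single_apply, liftState, ofWires]
  have h1 : z = Function.extend (reductionInput e inp) (inputBits pp kp) (fun _ => false)
      ↔ z ∘ e = (Regs.clean a (keyBits kp) fun _ => false).toWires S := by
    rw [← key]
    exact e.surjective.injective_comp_right.eq_iff.symm
  rw [basisState, Pi.single_apply]
  by_cases h : z ∘ e = (Regs.clean a (keyBits kp) fun _ => false).toWires S
  · rw [if_pos (h1.2 h), h]
    simp [toWires_main, Regs.clean]
  · rw [if_neg (fun h2 => h (h1.1 h2))]
    symm
    split_ifs with h3 h4
    · rw [h4] at h3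
      exact absurd h3 h
    · rfl
    · rfl

theorem initState_comp_xorOn (inp : (Fin P.ppLen ⊕ Fin N × Fin P.keyLen) ↪ Fin W)
    (pp : Bits P.ppLen) (kp : Fin N → P.KeyPair) :
    basisState (Function.extend (Function.Embedding.inl.trans inp) pp fun _ => false)
        ∘ xorOn (Function.Embedding.inr.trans inp) (fun x => (kp x.1).1 x.2)
      = initState inp pp kp := by
  have key : xorOn (Function.Embedding.inr.trans inp) (fun x => (kp x.1).1 x.2)
      (Function.extend (Function.Embedding.inl.trans inp) pp fun _ => false)
      = Function.extend inp (inputBits pp kp) fun _ => false := by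
    symm
    refine eq_xorAt (fun x => ?_) fun j hj => ?_
    · rw [show Function.Embedding.inr.trans inp x = inp (Sum.inr x) from rfl,
        inp.injective.extend_apply, Function.extend_apply']
      · simp [inputBits]
      · rintro ⟨k, hk⟩
        simpa using inp.injective hk
    · by_cases hk : ∃ k, inp (Sum.inl k) = j
      · obtain ⟨k, rfl⟩ := hk
        rw [inp.injective.extend_apply]
        exact ((Function.Embedding.inl.trans inp).injective.extend_apply _ _ k).symm
      · rw [Function.extend_apply', Function.extend_apply']
        · exact hk
        · rintro ⟨k | x, hx⟩
          · exact hk ⟨k, hx⟩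
          · exact hj x hx
  funext z
  simp only [Function.comp_apply, basisState, initState, Pi.single_apply]
  congr 1
  rw [← key]
  refine propext ⟨fun h => ?_, fun h => ?_⟩
  · rw [← h, xorOn_self]
  · rw [h, xorOn_self]

/-- A forger, its oracles being simulated, followed by the operations `lf`, as a collision
adversary. -/
theorem exists_reduction {s : ℕ} (hN : N ≤ P.κ) (hκ : 0 < P.κ) (A : Forger P N)
    {e : Wire P A.W T S ≃ Fin W'} (hfit : Fits P n K T S s)
    {qs : ℕ} (hqs : A.signQueries ≤ qs) (hT : A.signQueries ≤ T)
    {c : ℕ} {f : (pp : Bits P.ppLen) → P.Hash pp → Regs P A.W T → Regs P A.W T}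
    (hf : Implements e c f) (out : P.RIdx ⊕ (Fin P.domLen ⊕ Fin P.domLen) ↪ Wire P A.W T S)
    (g : Bits P.ppLen → Bits A.W → P.RIdx ⊕ (Fin P.domLen ⊕ Fin P.domLen) → Bool)
    (hg : ∀ pp H a k h, (f pp H (Regs.clean a k h)).toWires S ∘ out = g pp a) :
    ∃ B : ColAdversary P, B.size ≤ W' + P.κ * P.keyLen + A.prog.length * stepCost P S + c ∧
      B.adv = P.gameExpect P.κ fun pp kp H =>
        runWith qs pp (kp ∘ Fin.castLE hN) (simHash (kp ∘ Fin.castLE hN) (polyCoins b i o θ) H)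
          (pointSign N (simDom pp (polyCoins b i o θ)))
          (fun _ => probOf fun a => ColWins pp kp (g pp a)) A.prog []
          (initState A.inp pp (kp ∘ Fin.castLE hN)) := by
  obtain ⟨f₁, ⟨l₁, hl₁, hrun₁⟩, hf₁⟩ := exists_implements_copyKeys (e := e) hfit.three hN
    (Function.Embedding.inr.trans A.inp)
  obtain ⟨l₂, hl₂, hrun₂⟩ := exists_simulation (e := e) b i o θ hfit hN hκ A.prog 0
    (by rw [zero_add]; exact hT)
  obtain ⟨l₃, hl₃, hrun₃⟩ := exists_runOps_probOf hf
  refine ⟨⟨W', reductionInput e A.inp, out.trans e.toEmbedding, l₁ ++ (l₂ ++ l₃)⟩, ?_, ?_⟩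
  · simp only [ColAdversary.size, List.length_append]
    omega
  · unfold ColAdversary.adv
    congr 1
    funext pp kp H
    obtain ⟨G, hG1, hG2⟩ := hrun₁ pp H
    simp only
    rw [initState_reductionInput, liftState_eq_of_acts hG1 (h' := fun _ => false)
      (f := xorOn (Function.Embedding.inr.trans A.inp)
        fun x => ((kp ∘ Fin.castLE hN) x.1).1 x.2) (xorOn_self _ _) (fun a _ => by
          rw [hG2, hf₁]; rfl), initState_comp_xorOn]
    refine hrun₂ pp H (kp ∘ Fin.castLE hN) (keyBits kp) (fun _ _ => rfl) _ l₃ _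
      (fun h ψ => ?_) qs _ [] _ ⟨fun ρ m => ?_, fun _ _ _ => rfl⟩ ?_
    · rw [hrun₃]
      congr 1
      funext a
      rw [← hg pp H a (keyBits kp) h]
      congr 1
      funext x
      simp
    · simp
    · simpa [Forger.signQueries] using hqs

end Reduction

/-! ## Expectation over the keys -/

section KeyExpect

variable (P : RPSF) {n : ℕ}

/-- Probability of public parameters and independent key pairs. -/
def keyWeight (n : ℕ) (x : Bits P.ppLen × (Fin n → P.KeyPair)) : ℝ :=
  (P.Stp x.1).toReal * ∏ i, (P.TpdGen x.1 (x.2 i)).toReal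

/-- Expectation over the public parameters and independent key pairs. -/
def keyExpect (n : ℕ) (g : Bits P.ppLen → (Fin n → P.KeyPair) → ℝ) : ℝ :=
  ∑ x, keyWeight P n x * g x.1 x.2

variable {P}

theorem keyWeight_nonneg (x : Bits P.ppLen × (Fin n → P.KeyPair)) : 0 ≤ keyWeight P n x :=
  mul_nonneg ENNReal.toReal_nonneg (Finset.prod_nonneg fun _ _ => ENNReal.toReal_nonneg)

theorem keyExpect_eq (g : Bits P.ppLen → (Fin n → P.KeyPair) → ℝ) :
    keyExpect P n g = ∑ pp, (P.Stp pp).toReal * ∑ kp : Fin n → P.KeyPair,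
      (∏ i, (P.TpdGen pp (kp i)).toReal) * g pp kp := by
  simp only [keyExpect, Fintype.sum_prod_type, keyWeight, Finset.mul_sum, mul_assoc]

theorem keyExpect_const (c : ℝ) : keyExpect P n (fun _ _ => c) = c := by
  have h : ∀ pp, ∑ kp : Fin n → P.KeyPair, ∏ i, (P.TpdGen pp (kp i)).toReal = 1 := fun pp =>
    (IsDist.pi (w := fun (_ : Fin n) a => (P.TpdGen pp a).toReal) fun _ => isDist_toReal _).2
  simp only [keyExpect_eq, ← Finset.sum_mul, h, one_mul, (isDist_toReal P.Stp).2]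

theorem sum_keyWeight : ∑ x, keyWeight P n x = 1 := by
  simpa [keyExpect] using keyExpect_const (P := P) (n := n) 1

theorem keyExpect_mono {g g' : Bits P.ppLen → (Fin n → P.KeyPair) → ℝ}
    (h : ∀ pp kp, (∀ j, P.Honest pp (kp j).1 (kp j).2) → g pp kp ≤ g' pp kp) :
    keyExpect P n g ≤ keyExpect P n g' := by
  refine Finset.sum_le_sum fun x _ => ?_
  by_cases h0 : keyWeight P n x = 0
  · simp [h0]
  · refine mul_le_mul_of_nonneg_left (h x.1 x.2 fun j => ?_) (keyWeight_nonneg x)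
    rw [keyWeight, ← ne_eq, mul_ne_zero_iff, Finset.prod_ne_zero_iff] at h0
    refine ⟨?_, ?_⟩
    · rw [PMF.mem_support_iff]
      exact fun h => h0.1 (by simp [h])
    · rw [PMF.mem_support_iff]
      exact fun h => h0.2 j (Finset.mem_univ _) (by simp [h])

theorem keyExpect_add (g g' : Bits P.ppLen → (Fin n → P.KeyPair) → ℝ) :
    keyExpect P n (fun pp kp => g pp kp + g' pp kp) = keyExpect P n g + keyExpect P n g' := by
  simp [keyExpect, mul_add, Finset.sum_add_distrib]

theorem keyExpect_const_mul (c : ℝ) (g : Bits P.ppLen → (Fin n → P.KeyPair) → ℝ) :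
    keyExpect P n (fun pp kp => c * g pp kp) = c * keyExpect P n g := by
  simp only [keyExpect, Finset.mul_sum]
  exact Finset.sum_congr rfl fun _ _ => by ring

theorem keyExpect_sum {I : Type} (s : Finset I)
    (g : I → Bits P.ppLen → (Fin n → P.KeyPair) → ℝ) :
    keyExpect P n (fun pp kp => ∑ i ∈ s, g i pp kp) = ∑ i ∈ s, keyExpect P n (g i) := by
  simp only [keyExpect, Finset.mul_sum]
  exact Finset.sum_comm

theorem keyExpect_rpow_le {g : Bits P.ppLen → (Fin n → P.KeyPair) → ℝ} (hg : ∀ pp kp, 0 ≤ g pp kp)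
    {γ : ℝ} (h0 : 0 ≤ γ) (h1 : γ ≤ 1) :
    keyExpect P n (fun pp kp => g pp kp ^ γ) ≤ keyExpect P n g ^ γ :=
  sum_mul_rpow_le Finset.univ (fun x _ => keyWeight_nonneg x) sum_keyWeight
    (fun x _ => hg x.1 x.2) h0 h1

/-- Unused key pairs may be dropped. -/
theorem keyExpect_castLE {N : ℕ} (hN : N ≤ n) (g : Bits P.ppLen → (Fin N → P.KeyPair) → ℝ) :
    keyExpect P n (fun pp kp => g pp (kp ∘ Fin.castLE hN)) = keyExpect P N g := by
  simp only [keyExpect_eq]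
  refine Finset.sum_congr rfl fun pp _ => ?_
  congr 1
  exact sum_prod_comp_embedding (Fin.castLEEmb hN) (isDist_toReal (P.TpdGen pp)).2 (g pp)

theorem expect_uniform_hash {pp : Bits P.ppLen} (g : P.Hash pp → ℝ) :
    expect (PMF.uniformOfFintype (P.Hash pp)) g = piExp (ranWeight P pp) g := by
  unfold expect piExp ranWeight
  refine Finset.sum_congr rfl fun H _ => ?_
  congr 1
  rw [PMF.uniformOfFintype_apply, ENNReal.toReal_inv, ENNReal.toReal_natCast, Finset.prod_inv_distrib,
    Fintype.card_pi, Nat.cast_prod]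

theorem gameExpect_eq (g : (pp : Bits P.ppLen) → (Fin n → P.KeyPair) → P.Hash pp → ℝ) :
    P.gameExpect n g = keyExpect P n fun pp kp => piExp (ranWeight P pp) (g pp kp) := by
  simp only [RPSF.gameExpect, keyExpect_eq, expect, ← expect_uniform_hash]

theorem piExp_rpow_le {X : Type} [Fintype X] [DecidableEq X] {D : X → Type} [∀ x, Fintype (D x)]
    {w : ∀ x, D x → ℝ} (hw : ∀ x, IsDist (w x)) {g : (∀ x, D x) → ℝ} (hg : ∀ d, 0 ≤ g d)
    {γ : ℝ} (h0 : 0 ≤ γ) (h1 : γ ≤ 1) : piExp w (fun d => g d ^ γ) ≤ piExp w g ^ γ :=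
  sum_mul_rpow_le Finset.univ (fun d _ => (IsDist.pi hw).1 d) (IsDist.pi hw).2
    (fun d _ => hg d) h0 h1

end KeyExpect

/-! ## Rényi divergence -/

/-- Hölder's inequality with exponents `α` and `α / (α - 1)` for the factorisation `p v ^ γ = (p q ^
(-γ)) ((q v) ^ γ)`; the first factor yields the divergence. For `α = ∞` it is the pointwise bound `p
≤ R q`. -/
theorem sum_mul_rpow_le_of_renyiDiv {D : Type} [Fintype D] {p q : PMF D} {α : ℝ≥0∞} {R : ℝ≥0}
    (hα : 1 < α) (h : renyiDiv α p q ≤ R) {v : D → ℝ} (hv : ∀ d, 0 ≤ v d) :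
    ∑ d, (p d).toReal * v d ^ (1 - α⁻¹).toReal
      ≤ (R * ∑ d, (q d).toReal * v d) ^ (1 - α⁻¹).toReal := by
  unfold renyiDiv at h
  split_ifs at h with hinf
  · subst hinf
    simp only [ENNReal.inv_top, tsub_zero, ENNReal.toReal_one, Real.rpow_one]
    rw [Finset.mul_sum]
    refine Finset.sum_le_sum fun d _ => ?_
    rw [← mul_assoc]
    refine mul_le_mul_of_nonneg_right ?_ (hv d)
    by_cases hd : d ∈ p.support
    · have h1 : p d / q d ≤ R := (le_iSup₂ (f := fun x (_ : x ∈ p.support) => p x / q x) d hd).trans h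
      have hq : q d ≠ 0 := by
        intro hq
        rw [hq, ENNReal.div_zero ((PMF.mem_support_iff _ _).1 hd)] at h1
        simp at h1
      have h2 : p d ≤ R * q d := (ENNReal.div_le_iff hq (q.apply_ne_top d)).1 h1
      have := ENNReal.toReal_mono (ENNReal.mul_ne_top ENNReal.coe_ne_top (q.apply_ne_top d)) h2
      simpa using this
    · have : p d = 0 := by
        by_contra hc
        exact hd ((PMF.mem_support_iff _ _).2 hc)
      rw [this]
      simp
      positivity
  · set a := α.toReal with ha
    have ha1 : 1 < a := by
      rw [ha, ← ENNReal.toReal_one]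
      exact (ENNReal.toReal_lt_toReal ENNReal.one_ne_top hinf).2 hα
    have hγ : (1 - α⁻¹).toReal = 1 - a⁻¹ := by
      rw [ENNReal.toReal_sub_of_le (ENNReal.inv_le_one.2 hα.le) ENNReal.one_ne_top, ENNReal.toReal_one,
        ENNReal.toReal_inv]
    rw [hγ]
    set γ := 1 - a⁻¹ with hγd
    have ha0 : 0 < a := by linarith
    have hγ0 : 0 < γ := by
      have := inv_lt_one_of_one_lt₀ ha1
      linarith
    have hγa : γ * a = a - 1 := by
      rw [hγd]
      field_simp
    have h1 : ∑ x, p x ^ a * q x ^ (1 - a) ≤ (R : ℝ≥0∞) ^ (a - 1) := by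
      have := ENNReal.rpow_le_rpow h (by linarith : 0 ≤ a - 1)
      rwa [← ENNReal.rpow_mul, one_div, inv_mul_cancel₀ (by linarith), ENNReal.rpow_one] at this
    have hfin : (R : ℝ≥0∞) ^ (a - 1) ≠ ∞ := ENNReal.rpow_ne_top_of_nonneg (by linarith)
      ENNReal.coe_ne_top
    have hterm : ∀ x, p x ^ a * q x ^ (1 - a) ≠ ∞ := fun x =>
      ne_top_of_le_ne_top hfin ((Finset.single_le_sum (f := fun x => p x ^ a * q x ^ (1 - a))
        (fun _ _ => bot_le) (Finset.mem_univ x)).trans h1)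
    -- A point of the support of `p` outside that of `q` would contribute an infinite term, so
    -- finiteness of `R` forces absolute continuity.
    have hq0 : ∀ x, q x = 0 → p x = 0 := by
      intro x hx
      by_contra hp
      refine hterm x ?_
      rw [hx, ENNReal.zero_rpow_of_neg (by linarith), ENNReal.mul_top]
      exact (ENNReal.rpow_pos (pos_iff_ne_zero.2 hp) (p.apply_ne_top x)).ne'
    have h2 : ∑ x, (p x).toReal ^ a * (q x).toReal ^ (1 - a) ≤ (R : ℝ) ^ (a - 1) := by
      have := ENNReal.toReal_mono hfin h1
      rw [ENNReal.toReal_sum fun x _ => hterm x] at this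
      simpa [ENNReal.toReal_mul, ← ENNReal.toReal_rpow] using this
    set A := fun x => (p x).toReal * (q x).toReal ^ (-γ) with hA
    set B := fun x => ((q x).toReal * v x) ^ γ with hB
    have hab : ∀ x, (p x).toReal * v x ^ γ = A x * B x := by
      intro x
      rcases eq_or_ne (q x) 0 with hx | hx
      · simp [hA, hq0 x hx]
      · have hqx : 0 < (q x).toReal := ENNReal.toReal_pos hx (q.apply_ne_top x)
        rw [hA, hB]
        simp only
        rw [Real.mul_rpow hqx.le (hv x), Real.rpow_neg hqx.le]
        have := (Real.rpow_pos_of_pos hqx γ).ne'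
        field_simp
    have hconj : a.HolderConjugate γ⁻¹ := by
      rw [Real.holderConjugate_iff]
      refine ⟨ha1, ?_⟩
      rw [inv_inv, hγd]
      ring
    have hH := Real.inner_le_Lp_mul_Lq Finset.univ A B hconj
    simp only [hab]
    refine hH.trans ?_
    have e1 : ∀ x, |A x| ^ a = (p x).toReal ^ a * (q x).toReal ^ (1 - a) := by
      intro x
      rw [abs_of_nonneg (by positivity), hA]
      simp only
      rw [Real.mul_rpow ENNReal.toReal_nonneg (by positivity), ← Real.rpow_mul ENNReal.toReal_nonneg]
      congr 2
      linarith
    have e2 : ∀ x, |B x| ^ γ⁻¹ = (q x).toReal * v x := by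
      intro x
      have : 0 ≤ (q x).toReal * v x := mul_nonneg ENNReal.toReal_nonneg (hv x)
      rw [abs_of_nonneg (Real.rpow_nonneg this _), ← Real.rpow_mul this, mul_inv_cancel₀ hγ0.ne', Real.rpow_one]
    simp only [e1, e2, one_div, inv_inv]
    have hs : 0 ≤ ∑ d, (q d).toReal * v d :=
      Finset.sum_nonneg fun d _ => mul_nonneg ENNReal.toReal_nonneg (hv d)
    rw [Real.mul_rpow R.coe_nonneg hs]
    refine mul_le_mul_of_nonneg_right ?_ (Real.rpow_nonneg hs _)
    have hs2 : 0 ≤ ∑ x, (p x).toReal ^ a * (q x).toReal ^ (1 - a) :=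
      Finset.sum_nonneg fun d _ => by positivity
    refine (Real.rpow_le_rpow hs2 h2 (by positivity)).trans (le_of_eq ?_)
    rw [← Real.rpow_mul R.coe_nonneg]
    congr 1
    rw [← hγa]
    field_simp

/-! ## Advantage and size of the collision adversary -/

section Sizes

variable {P : RPSF} {N : ℕ}

/-- The field degree is `O(s)` and the polynomial has `O(s)` coefficients, so its evaluation needs
`O(s ^ 4)` instructions. This dominates the cubic cost of the checks. -/
theorem fits_of_size (hκ : 0 < P.κ) {L s : ℕ} (hs : L + P.bitLength + 1 ≤ s) :
    Fits P (P.κ * (P.keyLen + 1) + P.msgLen + P.coinLen + 1) (2 * L + 1) L (100 * s ^ 4) s := by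
  unfold RPSF.bitLength at hs
  have h1 : P.κ ≤ P.κ * (P.keyLen + 1) := Nat.le_mul_of_pos_right _ (Nat.succ_pos _)
  have h2 : P.keyLen + 1 ≤ P.κ * (P.keyLen + 1) := Nat.le_mul_of_pos_left _ hκ
  have s1 : 1 ≤ s := by omega
  have p1 : s ≤ s ^ 4 := Nat.le_self_pow (by norm_num) s
  have p2 : s ^ 2 ≤ s ^ 4 := Nat.pow_le_pow_right s1 (by norm_num)
  have p3 : s ^ 3 ≤ s ^ 4 := Nat.pow_le_pow_right s1 (by norm_num)
  set n := P.κ * (P.keyLen + 1) + P.msgLen + P.coinLen + 1 with hn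
  have hns : n ≤ s := by omega
  refine ⟨by omega, by omega, by omega, by omega, by omega, ?_, by omega, ?_⟩
  · have : s * (s * (s * 2 + 4) + 2) + 1 = 2 * s ^ 3 + 4 * s ^ 2 + 2 * s + 1 := by ring
    omega
  · calc n + (2 * L + 1) * (n * (5 * n ^ 2 + 3)) ≤ s + (2 * s) * (s * (5 * s ^ 2 + 3)) := by
          gcongr
          omega
      _ = 10 * s ^ 4 + 6 * s ^ 2 + s := by ring
      _ ≤ _ := by omega

/-- The size is of order `s ^ 5`: each of at most `s` operations costs `O(s ^ 4)`. The large
exponent only lets one constant serve as both factor and exponent. -/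
theorem reduction_size_le {W L s c : ℕ} (hs : W + L + P.bitLength + 1 ≤ s)
    (hc : c ≤ 2 * (100 * s ^ 4) + 2 * P.coinLen + 2) :
    Fintype.card (Wire P W L (100 * s ^ 4)) + P.κ * P.keyLen + L * stepCost P (100 * s ^ 4) + c
      ≤ 2000 * s ^ 2000 := by
  unfold RPSF.bitLength at hs
  have h1 : P.κ ≤ P.κ * (P.keyLen + 1) := Nat.le_mul_of_pos_right _ (Nat.succ_pos _)
  have h3 : P.κ * P.keyLen ≤ P.κ * (P.keyLen + 1) := Nat.mul_le_mul_left _ (Nat.le_succ _)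
  have s1 : 1 ≤ s := by omega
  have p0 : 1 ≤ s ^ 4 := Nat.one_le_pow _ _ s1
  have p1 : s ≤ s ^ 4 := Nat.le_self_pow (by norm_num) s
  have p2 : s ^ 2 ≤ s ^ 4 := Nat.pow_le_pow_right s1 (by norm_num)
  have p5 : s ^ 4 ≤ s ^ 5 := Nat.pow_le_pow_right s1 (by norm_num)
  have p6 : s ^ 5 ≤ s ^ 2000 := Nat.pow_le_pow_right s1 (by norm_num)
  have hstep : stepCost P (100 * s ^ 4) ≤ 900 * s ^ 4 := by
    unfold stepCost
    omega
  have hL : L * stepCost P (100 * s ^ 4) ≤ 900 * s ^ 5 :=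
    (Nat.mul_le_mul (by omega : L ≤ s) hstep).trans (le_of_eq (by ring))
  have hH : L * (P.κ * (P.keyLen + 1) + P.msgLen + 1) ≤ s ^ 2 :=
    (Nat.mul_le_mul (by omega : L ≤ s) (by omega : _ ≤ s)).trans (le_of_eq (by ring))
  simp only [Fintype.card_sum, Fintype.card_prod, Fintype.card_option, Fintype.card_fin,
    Fintype.card_unit]
  omega

end Sizes

section Advantage

variable {P : RPSF} {N : ℕ}

theorem normSqr_initState {n W : ℕ} (inp : (Fin P.ppLen ⊕ Fin n × Fin P.keyLen) ↪ Fin W)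
    (pp : Bits P.ppLen) (kp : Fin n → P.KeyPair) : normSqr (initState inp pp kp) = 1 :=
  normSqr_basisState _

theorem RingIn.castLE (hN : N ≤ P.κ) {kp : Fin P.κ → P.KeyPair} {ρ : P.Rng}
    (h : RingIn (kp ∘ Fin.castLE hN) ρ) : RingIn kp ρ := fun i =>
  let ⟨j, hj⟩ := h i
  ⟨Fin.castLE hN j, hj⟩

/-- A forgery that differs from the sampled domain element is a collision. -/
theorem colWins_of_forgesAt (hN : N ≤ P.κ) {pp : Bits P.ppLen} {kp : Fin P.κ → P.KeyPair}
    {G : P.Rng × P.Msg → Bits P.coinLen} {H : P.Hash pp} {L : List (P.Rng × P.Msg)}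
    {x : P.RIdx ⊕ (Fin P.msgLen ⊕ Fin P.domLen) → Bool} {c : Bits P.coinLen}
    (hc : ∀ ρ, encRing ρ = x ∘ Sum.inl → c = G (ρ, x ∘ Sum.inr ∘ Sum.inl))
    (h : ForgesAt (kp ∘ Fin.castLE hN) false (simHash (kp ∘ Fin.castLE hN) G H) (simDom pp G) L x) :
    ColWins pp kp (Sum.elim (x ∘ Sum.inl) (Sum.elim (x ∘ Sum.inr ∘ Sum.inr)
      (P.sampleDomBits pp (Sum.elim (x ∘ Sum.inl) c)))) := by
  obtain ⟨ρ, h1, h2, -, ⟨hσ, h4⟩, h5⟩ := h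
  have hgood := goodPoint_of_ringIn h2 (x ∘ Sum.inr ∘ Sum.inl)
  refine ⟨ρ, h1, h2.castLE hN, ⟨_, hσ⟩, P.SampleDom pp ρ c, rfl, ?_, ?_, ?_⟩
  · rw [← h1, sampleDomBits_encRing]
    rfl
  · intro he
    rw [hc ρ h1] at he
    have : (simDom pp G (ρ, x ∘ Sum.inr ∘ Sum.inl)).1 = x ∘ Sum.inr ∘ Sum.inr :=
      (congrArg Subtype.val he).symm
    simp [this] at h5
  · rw [h4, simHash, if_pos hgood, hc ρ h1]

/-- The polynomial `θ` yields a collision adversary that wins whenever the simulated forger outputs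
a forgery that differs from the sampled domain element. -/
theorem exists_adv_ge (hN : N ≤ P.κ) (hκ : 0 < P.κ) (A : Forger P N) {qs : ℕ}
    (hqs : A.signQueries ≤ qs) {F : Type} [Field F] [Algebra (ZMod 2) F]
    (b : Module.Basis (Fin (P.κ * (P.keyLen + 1) + P.msgLen + P.coinLen + 1)) (ZMod 2) F)
    (i : P.RIdx ⊕ Fin P.msgLen ↪ Fin (P.κ * (P.keyLen + 1) + P.msgLen + P.coinLen + 1))
    (o : Fin P.coinLen ↪ Fin (P.κ * (P.keyLen + 1) + P.msgLen + P.coinLen + 1))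
    (θ : Fin (2 * A.prog.length + 1) → F) :
    ∃ B : ColAdversary P, B.size ≤ 2000 * (A.size + P.bitLength + 1) ^ 2000 ∧
      keyExpect P N (fun pp kp => piExp (ranWeight P pp) fun H =>
        sampleVal kp A.out A.prog (initState A.inp pp kp) qs (simHash kp (polyCoins b i o θ) H)
          (simDom pp (polyCoins b i o θ))) ≤ B.adv := by
  set s := A.size + P.bitLength + 1 with hs
  have hsz : A.W + A.prog.length + P.bitLength + 1 ≤ s := le_rfl
  have hfit : Fits P _ (2 * A.prog.length + 1) A.prog.length (100 * s ^ 4) s :=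
    fits_of_size hκ (by omega)
  set e := Fintype.equivFin (Wire P A.W A.prog.length (100 * s ^ 4)) with he
  set u : P.RIdx ⊕ Fin P.msgLen → VarWire P A.W A.prog.length :=
    fun z => Sum.inl (A.out (Sum.map id Sum.inl z)) with hu
  have : Nonempty (P.RIdx ⊕ Fin P.msgLen) := ⟨Sum.inl (⟨0, hκ⟩, none)⟩
  have hc := programmable_polyFun b i o θ (id : P.RIdx ⊕ Fin P.msgLen → _) hfit.poly_le
  obtain ⟨f, hf, hf'⟩ := exists_implements_sample (e := e) hfit.three
    (Function.Embedding.inl.trans A.out) u hc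
  set out : P.RIdx ⊕ (Fin P.domLen ⊕ Fin P.domLen) ↪ Wire P A.W A.prog.length (100 * s ^ 4) :=
    ⟨Sum.elim (fun z => Sum.inl (Sum.inl (A.out (Sum.inl z)))) (Sum.elim
      (fun z => Sum.inl (Sum.inl (A.out (Sum.inr (Sum.inr z))))) fun z => Sum.inr (Sum.inr (Sum.inl z))),
      by rintro (z | z | z) (z' | z' | z') h <;> simp_all⟩ with hout
  set g : Bits P.ppLen → Bits A.W → P.RIdx ⊕ (Fin P.domLen ⊕ Fin P.domLen) → Bool := fun pp a =>
    Sum.elim ((a ∘ A.out) ∘ Sum.inl) (Sum.elim ((a ∘ A.out) ∘ Sum.inr ∘ Sum.inr)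
      (P.sampleDomBits pp (Sum.elim ((a ∘ A.out) ∘ Sum.inl)
        (polyFun b i o θ ((a ∘ A.out) ∘ Sum.map id Sum.inl))))) with hg
  obtain ⟨B, hB1, hB2⟩ := exists_reduction b i o θ hN hκ A (e := e) hfit hqs
    List.countP_le_length hf out g (fun pp H a k h => by
      obtain ⟨h1, h2⟩ := hf' pp H a k h
      funext z
      rcases z with z | z | z
      · exact congrFun h1 _
      · exact congrFun h1 _
      · exact congrFun h2 z)
  refine ⟨B, hB1.trans (reduction_size_le hsz (by omega)), ?_⟩
  rw [hB2, gameExpect_eq, ← keyExpect_castLE hN]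
  refine keyExpect_mono fun pp kp _ => piExp_mono isDist_ranWeight fun H _ => ?_
  refine runWith_mono (stochastic_pointSign _) (fun L ψ => probOf_mono (fun a ha => ?_) ψ) _ _ _
  refine colWins_of_forgesAt hN (fun ρ hρ => ?_) ha
  rw [polyCoins, hρ]
  congr 1
  funext z
  rcases z with z | z <;> rfl

/-- Random coins are exchanged for those of a random polynomial without loss, and some fixed
polynomial is at least as good as the average. No security parameter enters the choice. -/
theorem exists_adv_ge_sampleVal (hN : N ≤ P.κ) (hκ : 0 < P.κ) (A : Forger P N) {qs : ℕ}
    (hqs : A.signQueries ≤ qs) :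
    ∃ B : ColAdversary P, B.size ≤ 2000 * (A.size + P.bitLength + 1) ^ 2000 ∧
      keyExpect P N (fun pp kp => piExp (imageWeight kp pp) fun H =>
        piExp (fun x => condWeight kp pp x (H x))
          (sampleVal kp A.out A.prog (initState A.inp pp kp) qs H)) ≤ B.adv := by
  -- A degree large enough to embed the encoded pairs and the coins; the summand one keeps it
  -- positive.
  set n := P.κ * (P.keyLen + 1) + P.msgLen + P.coinLen + 1 with hn
  set F := GaloisField 2 n with hF
  have hfin : Module.finrank (ZMod 2) F = n := GaloisField.finrank 2 (by omega)
  have : Fintype F := Fintype.ofFinite F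
  set b := Module.finBasisOfFinrankEq (ZMod 2) F hfin with hb
  obtain ⟨i⟩ : Nonempty (P.RIdx ⊕ Fin P.msgLen ↪ Fin n) :=
    Function.Embedding.nonempty_of_card_le (by simp; omega)
  obtain ⟨o⟩ : Nonempty (Fin P.coinLen ↪ Fin n) :=
    Function.Embedding.nonempty_of_card_le (by simp; omega)
  set K := 2 * A.prog.length + 1 with hK
  have hkw : KWise (Θ := Fin K → F) K fun θ => polyCoins b i o θ :=
    kWise_polyFun b i o (fun x : P.Rng × P.Msg => Sum.elim (encRing x.1) x.2) (fun x y h => by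
      have h1 : x.1 = y.1 := encRing_injective (funext fun z => congrFun h (Sum.inl z))
      have h2 : x.2 = y.2 := funext fun z => congrFun h (Sum.inr z)
      exact Prod.ext h1 h2)
  set v : (Fin K → F) → ℝ := fun θ => keyExpect P N (fun pp kp => piExp (ranWeight P pp) fun H =>
    sampleVal kp A.out A.prog (initState A.inp pp kp) qs (simHash kp (polyCoins b i o θ) H)
      (simDom pp (polyCoins b i o θ))) with hv
  have hcard : (0 : ℝ) < Fintype.card (Fin K → F) := by
    exact_mod_cast Fintype.card_pos
  have key : keyExpect P N (fun pp kp => piExp (imageWeight kp pp) fun H =>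
      piExp (fun x => condWeight kp pp x (H x))
        (sampleVal kp A.out A.prog (initState A.inp pp kp) qs H))
      = (Fintype.card (Fin K → F) : ℝ)⁻¹ * ∑ θ, v θ := by
    rw [hv]
    simp only
    rw [← keyExpect_sum, ← keyExpect_const_mul]
    congr 1
    funext pp kp
    rw [piExp_imageWeight_condWeight, ← piExp_sum, ← piExp_const_mul]
    have hswap : ∀ Φ : (P.Rng × P.Msg → Bits P.coinLen) → P.Hash pp → ℝ,
        piExp (fun (_ : P.Rng × P.Msg) (_ : Bits P.coinLen) =>
          (Fintype.card (Bits P.coinLen) : ℝ)⁻¹) (fun G => piExp (ranWeight P pp) (Φ G))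
        = piExp (ranWeight P pp) fun H => piExp (fun (_ : P.Rng × P.Msg) (_ : Bits P.coinLen) =>
          (Fintype.card (Bits P.coinLen) : ℝ)⁻¹) fun G => Φ G H := by
      intro Φ
      simp only [piExp, Finset.mul_sum]
      rw [Finset.sum_comm]
      exact Finset.sum_congr rfl fun _ _ => Finset.sum_congr rfl fun _ _ => by ring
    rw [hswap]
    refine piExp_congr fun H _ => ?_
    rw [piExp_sampleVal_eq A.out A.prog _ H (k := K) le_rfl hkw, div_eq_inv_mul]
  rw [key]
  obtain ⟨θ, -, hθ⟩ := Finset.exists_le_of_sum_le (s := (Finset.univ : Finset (Fin K → F)))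
    (f := fun _ => (Fintype.card (Fin K → F) : ℝ)⁻¹ * ∑ θ, v θ) (g := v) Finset.univ_nonempty (by
      rw [Finset.sum_const, Finset.card_univ, nsmul_eq_mul, ← mul_assoc, mul_inv_cancel₀ hcard.ne',
        one_mul])
  obtain ⟨B, hB1, hB2⟩ := exists_adv_ge hN hκ A hqs b i o θ
  exact ⟨B, hB1, hθ.trans hB2⟩

end Advantage

/-! ## Forgers without queries -/

section NoQuery

variable {P : RPSF} {N : ℕ}

theorem RingIn.honestRing {pp : Bits P.ppLen} {kp : Fin N → P.KeyPair}
    (hkp : ∀ j, P.Honest pp (kp j).1 (kp j).2) {ρ : P.Rng} (h : RingIn kp ρ) :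
    P.HonestRing pp ρ := fun i =>
  let ⟨j, hj⟩ := h i
  ⟨(kp j).2, hj ▸ hkp j⟩

/-- A collision of the domain elements sampled with coins `c` and `c'`. -/
def SampleCollision (pp : Bits P.ppLen) (ρ : P.Rng) (c c' : Bits P.coinLen) : Prop :=
  P.SampleDom pp ρ c ≠ P.SampleDom pp ρ c' ∧
    P.f pp ρ (P.SampleDom pp ρ c) = P.f pp ρ (P.SampleDom pp ρ c')

theorem toReal_domDist_apply (pp : Bits P.ppLen) (ρ : P.Rng) (d : P.Dom pp ρ) :
    (P.domDist pp ρ d).toReal = ∑ c : Bits P.coinLen, (Fintype.card (Bits P.coinLen) : ℝ)⁻¹ *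
      if P.SampleDom pp ρ c = d then 1 else 0 := by
  rw [RPSF.domDist, toReal_map_apply]
  simp

/-- Conditioning on the image of a sampled element can only increase its probability, so the
conditional bound carries over to the sampler itself. -/
theorem toReal_domDist_le {pp : Bits P.ppLen} {ρ : P.Rng} {b : ℝ}
    (hent : ∀ (r : P.Ran pp ρ) (h : P.Hit pp ρ r) (d : P.Dom pp ρ),
      (P.condDist pp ρ r h d).toReal ≤ b) (c : Bits P.coinLen) :
    (P.domDist pp ρ (P.SampleDom pp ρ c)).toReal ≤ b := by
  set d := P.SampleDom pp ρ c with hd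
  have hsupp : d ∈ (P.domDist pp ρ).support := by
    rw [RPSF.domDist, PMF.mem_support_map_iff]
    exact ⟨c, by simp, rfl⟩
  have hit : P.Hit pp ρ (P.f pp ρ d) := ⟨d, rfl, hsupp⟩
  refine le_trans ?_ (hent _ hit d)
  have hc : (P.condDist pp ρ (P.f pp ρ d) hit d).toReal = _ :=
    toReal_filter_apply (P.domDist pp ρ) {d' | P.f pp ρ d' = P.f pp ρ d} hit d
  rw [hc, if_pos (show d ∈ {d' | P.f pp ρ d' = P.f pp ρ d} from rfl), mul_one]
  refine (le_div_iff₀ ?_).2 (mul_le_of_le_one_right ENNReal.toReal_nonneg ?_)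
  · refine Finset.sum_pos' (fun a _ => by split_ifs <;> simp) ⟨d, Finset.mem_univ _, ?_⟩
    rw [if_pos (show d ∈ {d' | P.f pp ρ d' = P.f pp ρ d} from rfl), mul_one]
    exact ENNReal.toReal_pos ((PMF.mem_support_iff _ _).1 hsupp) (PMF.apply_ne_top _ _)
  · refine le_trans (Finset.sum_le_sum fun a _ => ?_) (isDist_toReal (P.domDist pp ρ)).2.le
    split_ifs <;> simp

/-- Two sampled domain elements have the same image at least as often as a uniform range element
takes a given value. -/
theorem inv_card_le_collision {pp : Bits P.ppLen} {ρ : P.Rng} {b : ℝ}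
    (hent : ∀ (r : P.Ran pp ρ) (h : P.Hit pp ρ r) (d : P.Dom pp ρ),
      (P.condDist pp ρ r h d).toReal ≤ b) :
    (Fintype.card (P.Ran pp ρ) : ℝ)⁻¹ ≤ b + ∑ x : Bits P.coinLen × Bits P.coinLen,
      ((Fintype.card (Bits P.coinLen) : ℝ)⁻¹) ^ 2 *
        if SampleCollision pp ρ x.1 x.2 then 1 else 0 := by
  set u := (Fintype.card (Bits P.coinLen) : ℝ)⁻¹ with hu
  have hu1 : ∑ _c : Bits P.coinLen, u = 1 := (isDist_uniform (Bits P.coinLen)).2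
  set q : P.Ran pp ρ → ℝ := fun r =>
    ∑ c : Bits P.coinLen, u * if P.f pp ρ (P.SampleDom pp ρ c) = r then 1 else 0 with hq
  have hq1 : ∑ r, q r = 1 := by
    rw [hq, Finset.sum_comm]
    simpa [← Finset.mul_sum] using hu1
  have hcard : (0 : ℝ) < Fintype.card (P.Ran pp ρ) := by exact_mod_cast Fintype.card_pos
  -- Cauchy–Schwarz: among distributions on the range, the uniform one has the least collision
  -- probability.
  have hcs : (Fintype.card (P.Ran pp ρ) : ℝ)⁻¹ ≤ ∑ r, q r ^ 2 := by
    have := sq_sum_le_card_mul_sum_sq (s := Finset.univ) (f := q)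
    rw [hq1, one_pow, Finset.card_univ] at this
    rwa [inv_le_iff_one_le_mul₀' hcard]
  have hsq : ∑ r, q r ^ 2 = ∑ c, ∑ c', u ^ 2 *
      if P.f pp ρ (P.SampleDom pp ρ c) = P.f pp ρ (P.SampleDom pp ρ c') then 1 else 0 := by
    simp only [hq, sq, Finset.sum_mul_sum]
    rw [Finset.sum_comm]
    refine Finset.sum_congr rfl fun c _ => ?_
    rw [Finset.sum_comm]
    refine Finset.sum_congr rfl fun c' _ => ?_
    have : ∀ r, (u * if P.f pp ρ (P.SampleDom pp ρ c) = r then 1 else 0) *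
        (u * if P.f pp ρ (P.SampleDom pp ρ c') = r then 1 else 0)
        = if P.f pp ρ (P.SampleDom pp ρ c) = r then
          u * u * (if P.f pp ρ (P.SampleDom pp ρ c') = r then 1 else 0) else 0 := fun r => by
      split_ifs <;> ring
    simp only [this, Finset.sum_ite_eq, Finset.mem_univ, if_true]
    simp only [eq_comm]
  -- Equal images arise from equal samples, which this bounds by the min-entropy, or from a genuine
  -- collision.
  have hdiag : ∑ c, ∑ c', u ^ 2 * (if P.SampleDom pp ρ c' = P.SampleDom pp ρ c then (1 : ℝ) else 0)
      ≤ b := by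
    have : ∀ c, ∑ c', u ^ 2 * (if P.SampleDom pp ρ c' = P.SampleDom pp ρ c then (1 : ℝ) else 0)
        = u * (P.domDist pp ρ (P.SampleDom pp ρ c)).toReal := fun c => by
      rw [toReal_domDist_apply, Finset.mul_sum]
      exact Finset.sum_congr rfl fun _ _ => by ring
    simp only [this]
    calc _ ≤ ∑ _c : Bits P.coinLen, u * b := Finset.sum_le_sum fun c _ =>
          mul_le_mul_of_nonneg_left (toReal_domDist_le hent c) (by positivity)
      _ = b := by rw [← Finset.sum_mul, hu1, one_mul]
  refine (hcs.trans_eq hsq).trans ((?_ : _ ≤ _).trans (add_le_add hdiag le_rfl))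
  rw [Fintype.sum_prod_type, ← Finset.sum_add_distrib]
  refine Finset.sum_le_sum fun c _ => ?_
  rw [← Finset.sum_add_distrib]
  refine Finset.sum_le_sum fun c' _ => ?_
  rw [← mul_add]
  refine mul_le_mul_of_nonneg_left ?_ (by positivity)
  by_cases h1 : P.f pp ρ (P.SampleDom pp ρ c) = P.f pp ρ (P.SampleDom pp ρ c')
  · by_cases h2 : P.SampleDom pp ρ c' = P.SampleDom pp ρ c
    · rw [if_pos h1, if_pos h2]
      split_ifs <;> norm_num
    · rw [if_pos h1, if_neg h2, if_pos ⟨Ne.symm h2, h1⟩, zero_add]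
  · rw [if_neg h1]
    split_ifs <;> norm_num

/-- The output of the forger, the message and the signature being replaced by the domain elements
sampled with coins `c` and `c'`. -/
def samplesOut (pp : Bits P.ppLen) (c c' : Bits P.coinLen)
    (x : P.RIdx ⊕ (Fin P.msgLen ⊕ Fin P.domLen) → Bool) :
    P.RIdx ⊕ (Fin P.domLen ⊕ Fin P.domLen) → Bool :=
  Sum.elim (x ∘ Sum.inl) (Sum.elim (P.sampleDomBits pp (Sum.elim (x ∘ Sum.inl) c))
    (P.sampleDomBits pp (Sum.elim (x ∘ Sum.inl) c')))

theorem colWins_samplesOut {pp : Bits P.ppLen} {kp : Fin N → P.KeyPair} {ρ : P.Rng}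
    {c c' : Bits P.coinLen} {x : P.RIdx ⊕ (Fin P.msgLen ⊕ Fin P.domLen) → Bool}
    (h1 : encRing ρ = x ∘ Sum.inl) (h2 : RingIn kp ρ) (h : SampleCollision pp ρ c c') :
    ColWins pp kp (samplesOut pp c c' x) := by
  refine ⟨ρ, h1, h2, P.SampleDom pp ρ c, P.SampleDom pp ρ c', ?_, ?_, h.1, h.2⟩
  · rw [← sampleDomBits_encRing, h1]
    rfl
  · rw [← sampleDomBits_encRing, h1]
    rfl

variable {W : ℕ} {pp : Bits P.ppLen} {kp : Fin N → P.KeyPair}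

/-- A forgery for a hash function that was not queried. -/
theorem piExp_forgeVal_le (out : P.RIdx ⊕ (Fin P.msgLen ⊕ Fin P.domLen) ↪ Fin W) {b : ℝ}
    (hb : 0 ≤ b) (hent : ∀ ρ, RingIn kp ρ → ∀ (r : P.Ran pp ρ) (h : P.Hit pp ρ r) (d : P.Dom pp ρ),
      (P.condDist pp ρ r h d).toReal ≤ b) (L : List (P.Rng × P.Msg)) (ψ : QState W) :
    piExp (ranWeight P pp) (fun H => forgeVal kp out H L ψ)
      ≤ b * normSqr ψ + ∑ x : Bits P.coinLen × Bits P.coinLen,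
        ((Fintype.card (Bits P.coinLen) : ℝ)⁻¹) ^ 2 *
          probOf (fun a => ColWins pp kp (samplesOut pp x.1 x.2 (a ∘ out))) ψ := by
  simp only [forgeVal, probOf, normSqr, Finset.mul_sum]
  rw [piExp_sum, Finset.sum_comm, ← Finset.sum_add_distrib]
  refine Finset.sum_le_sum fun s _ => ?_
  have hnn : 0 ≤ b * ‖ψ s‖ ^ 2 + ∑ x : Bits P.coinLen × Bits P.coinLen,
      ((Fintype.card (Bits P.coinLen) : ℝ)⁻¹) ^ 2 *
        (if ColWins pp kp (samplesOut pp x.1 x.2 (s ∘ out)) then ‖ψ s‖ ^ 2 else 0) :=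
    add_nonneg (by positivity) (Finset.sum_nonneg fun x _ => by split_ifs <;> positivity)
  -- If some oracle makes this output a forgery, it forges exactly when the hash value hits the one
  -- image `r`, an event of probability `1 / |R|`.
  by_cases hf : ∃ H : P.Hash pp, Forges kp H L (s ∘ out)
  · obtain ⟨H₀, ρ, h1, h2, h3, hσ, h5⟩ := hf
    set r : P.Ran pp ρ := P.f pp ρ ⟨_, hσ⟩ with hr
    calc _ ≤ piExp (ranWeight P pp) (fun H => ‖ψ s‖ ^ 2 *
          if H (ρ, (s ∘ out) ∘ Sum.inr ∘ Sum.inl) = r then 1 else 0) := by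
          refine piExp_mono isDist_ranWeight fun H _ => ?_
          by_cases hH : H (ρ, (s ∘ out) ∘ Sum.inr ∘ Sum.inl) = r
          · rw [if_pos hH]
            split_ifs <;> simp
          · rw [if_neg hH, if_neg, mul_zero]
            rintro ⟨ρ', h1', -, -, hσ', h5'⟩
            obtain rfl := encRing_injective (h1.trans h1'.symm)
            exact hH h5'.symm
      _ = ‖ψ s‖ ^ 2 * (Fintype.card (P.Ran pp ρ) : ℝ)⁻¹ := by
          rw [piExp_const_mul]
          congr 1
          refine (piExp_coord isDist_ranWeight (ρ, (s ∘ out) ∘ Sum.inr ∘ Sum.inl)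
            (fun r' => if r' = r then 1 else 0)).trans ?_
          simp [ranWeight]
      _ ≤ ‖ψ s‖ ^ 2 * (b + ∑ x : Bits P.coinLen × Bits P.coinLen,
            ((Fintype.card (Bits P.coinLen) : ℝ)⁻¹) ^ 2 *
              if SampleCollision pp ρ x.1 x.2 then 1 else 0) :=
          mul_le_mul_of_nonneg_left (inv_card_le_collision (hent ρ h2)) (by positivity)
      _ ≤ _ := by
          rw [mul_add, mul_comm _ b, Finset.mul_sum]
          refine add_le_add le_rfl (Finset.sum_le_sum fun x _ => ?_)
          rw [mul_left_comm]
          refine mul_le_mul_of_nonneg_left ?_ (by positivity)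
          by_cases hx : SampleCollision pp ρ x.1 x.2
          · rw [if_pos hx, if_pos (colWins_samplesOut h1 h2 hx), mul_one]
          · rw [if_neg hx, mul_zero]
            split_ifs <;> positivity
  · push Not at hf
    simp only [hf, if_false]
    rwa [piExp_const isDist_ranWeight]

/-- Probability of a collision of samples in the ring output by the forger. -/
def samplesVal (A : Forger P N) (qs : ℕ) (c c' : Bits P.coinLen) : ℝ :=
  keyExpect P N fun pp kp => piExp (ranWeight P pp) fun H => runWith qs pp kp H (trapSign kp H)
    (fun _ => probOf fun a => ColWins pp kp (samplesOut pp c c' (a ∘ A.out))) A.prog []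
    (initState A.inp pp kp)

/-- A run without queries does not depend on the oracle, so the average over the oracle can be moved
inside to the final verification. -/
theorem adv_le_samplesVal (A : Forger P N) {qs : ℕ} (hs : A.signQueries = 0)
    (hh : A.hashQueries = 0) {b : ℝ} (hb : 0 ≤ b)
    (hent : ∀ pp ρ, P.HonestRing pp ρ → ∀ (r : P.Ran pp ρ) (h : P.Hit pp ρ r) (d : P.Dom pp ρ),
      (P.condDist pp ρ r h d).toReal ≤ b) :
    A.adv qs ≤ b + ∑ x : Bits P.coinLen × Bits P.coinLen,
      ((Fintype.card (Bits P.coinLen) : ℝ)⁻¹) ^ 2 * samplesVal A qs x.1 x.2 := by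
  simp only [samplesVal, ← keyExpect_const_mul]
  rw [← keyExpect_sum, ← keyExpect_const (P := P) (n := N) b, ← keyExpect_add, Forger.adv,
    gameExpect_eq]
  refine keyExpect_mono fun pp kp hkp => ?_
  set ψ := initState A.inp pp kp
  have hψ : normSqr ψ = 1 := normSqr_initState _ _ _
  obtain ⟨H₀⟩ : Nonempty (P.Hash pp) := inferInstance
  have hno := fun (H : P.Hash pp) (fin : List (P.Rng × P.Msg) → QState A.W → ℝ)
    (S : (ρ : P.Rng) → P.Msg → Fin N → P.Dom pp ρ → ℝ) =>
    runWith_noQuery (qs := qs) (kp := kp) (H := H) (H' := H₀) (fin := fin) (S := S)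
      (S' := trapSign kp H₀) A.prog hs hh [] ψ
  simp only [runForger_eq, hno, piExp_const isDist_ranWeight]
  have hsum : piExp (ranWeight P pp) (fun H => runWith qs pp kp H₀ (trapSign kp H₀)
      (fun L => probOf fun b => Forges kp H L (b ∘ A.out)) A.prog [] ψ)
      = runWith qs pp kp H₀ (trapSign kp H₀)
        (fun L φ => piExp (ranWeight P pp) fun H => forgeVal kp A.out H L φ) A.prog [] ψ :=
    sum_runWith Finset.univ (fun H : P.Hash pp => ∏ x, ranWeight P pp x (H x))
      (fun H => forgeVal kp A.out H) A.prog [] ψ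
  rw [hsum]
  -- The index `none` carries the term `b * normSqr`, the others the pairs of coins, so that
  -- linearity treats the whole bound at once.
  have hsum2 := sum_runWith (qs := qs) (kp := kp) (H := H₀) (S := trapSign kp H₀)
    (Finset.univ : Finset (Option (Bits P.coinLen × Bits P.coinLen)))
    (fun y => y.elim b fun _ => ((Fintype.card (Bits P.coinLen) : ℝ)⁻¹) ^ 2)
    (fun y => y.elim (fun _ => normSqr) fun x _ =>
      probOf fun a => ColWins pp kp (samplesOut pp x.1 x.2 (a ∘ A.out))) A.prog [] ψ
  simp only [Fintype.sum_option, Option.elim_none, Option.elim_some] at hsum2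
  refine (runWith_mono (stochastic_trapSign kp H₀) (fun L φ => piExp_forgeVal_le A.out hb
    (fun ρ hρ => hent pp ρ (hρ.honestRing hkp)) L φ) A.prog [] ψ).trans ?_
  rw [← hsum2]
  refine add_le_add ?_ le_rfl
  have := (runWith_bounds (qs := qs) (H := H₀) (stochastic_trapSign kp H₀)
    (fin := fun _ => normSqr) (fun _ φ => ⟨normSqr_nonneg φ, le_rfl⟩) A.prog [] ψ).2
  rw [hψ] at this
  exact mul_le_of_le_one_right hb this

theorem exists_adv_ge_samplesVal (hN : N ≤ P.κ) (hκ : 0 < P.κ) (A : Forger P N) {qs : ℕ}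
    (hs : A.signQueries = 0) (hh : A.hashQueries = 0) (c c' : Bits P.coinLen) :
    ∃ B : ColAdversary P, B.size ≤ 2000 * (A.size + P.bitLength + 1) ^ 2000 ∧
      samplesVal A qs c c' ≤ B.adv := by
  set n := P.κ * (P.keyLen + 1) + P.msgLen + P.coinLen + 1 with hn
  set F := GaloisField 2 n with hF
  have hfin : Module.finrank (ZMod 2) F = n := GaloisField.finrank 2 (by omega)
  set b := Module.finBasisOfFinrankEq (ZMod 2) F hfin with hb
  obtain ⟨i⟩ : Nonempty (P.RIdx ⊕ Fin P.msgLen ↪ Fin n) :=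
    Function.Embedding.nonempty_of_card_le (by simp; omega)
  obtain ⟨o⟩ : Nonempty (Fin P.coinLen ↪ Fin n) :=
    Function.Embedding.nonempty_of_card_le (by simp; omega)
  set θ : Fin (2 * A.prog.length + 1) → F := fun _ => 0
  set s := A.size + P.bitLength + 1 with hs'
  have hsz : A.W + A.prog.length + P.bitLength + 1 ≤ s := le_rfl
  have hfit : Fits P n (2 * A.prog.length + 1) A.prog.length (100 * s ^ 4) s :=
    fits_of_size hκ (by omega)
  set e := Fintype.equivFin (Wire P A.W A.prog.length (100 * s ^ 4)) with he
  obtain ⟨f, hf, hf'⟩ := exists_implements_samples (e := e) hfit.three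
    (Function.Embedding.inl.trans A.out) c c'
  set out : P.RIdx ⊕ (Fin P.domLen ⊕ Fin P.domLen) ↪ Wire P A.W A.prog.length (100 * s ^ 4) :=
    ⟨Sum.elim (fun z => Sum.inl (Sum.inl (A.out (Sum.inl z)))) (Sum.elim
      (fun z => Sum.inr (Sum.inr (Sum.inl z))) fun z => Sum.inr (Sum.inr (Sum.inr (Sum.inl z)))),
      by rintro (z | z | z) (z' | z' | z') h <;> simp_all⟩ with hout
  obtain ⟨B, hB1, hB2⟩ := exists_reduction b i o θ hN hκ A (e := e) hfit (qs := qs) (by omega)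
    List.countP_le_length hf out (fun pp a => samplesOut pp c c' (a ∘ A.out)) (fun pp H a k h => by
      obtain ⟨h1, h2, h3⟩ := hf' pp H a k h
      funext z
      rcases z with z | z | z
      · exact congrFun h1 _
      · exact congrFun h2 z
      · exact congrFun h3 z)
  refine ⟨B, hB1.trans (reduction_size_le hsz (by omega)), ?_⟩
  rw [hB2, gameExpect_eq, samplesVal, ← keyExpect_castLE hN]
  refine keyExpect_mono fun pp kp _ => piExp_mono isDist_ranWeight fun H _ => ?_
  refine le_trans ?_ (runWith_noQuery (H := H) (S := trapSign (kp ∘ Fin.castLE hN) H) A.prog hs hh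
    _ _).le
  refine runWith_mono (stochastic_trapSign _ H) (fun L ψ => probOf_mono (fun a ha => ?_) ψ) _ _ _
  obtain ⟨ρ, h1, h2, h3⟩ := ha
  exact ⟨ρ, h1, h2.castLE hN, h3⟩

/-- Only the ring of the forger's output is used. Two coin strings that maximise the probability of
a collision are built into the adversary, a choice independent of `β`. -/
theorem exists_adv_le_of_noQuery (hN : N ≤ P.κ) (hκ : 0 < P.κ) (A : Forger P N) {qs : ℕ}
    (hs : A.signQueries = 0) (hh : A.hashQueries = 0) :
    ∃ B : ColAdversary P, B.size ≤ 2000 * (A.size + P.bitLength + 1) ^ 2000 ∧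
      ∀ β : ℝ, P.PreMinEntropy β → A.adv qs ≤ (2 : ℝ) ^ (-β) + B.adv := by
  obtain ⟨⟨c, c'⟩, -, hc⟩ := Finset.exists_max_image
    (Finset.univ : Finset (Bits P.coinLen × Bits P.coinLen))
    (fun x => samplesVal A qs x.1 x.2) Finset.univ_nonempty
  obtain ⟨B, hB1, hB2⟩ := exists_adv_ge_samplesVal hN hκ A (qs := qs) hs hh c c'
  refine ⟨B, hB1, fun β hβ => (adv_le_samplesVal A hs hh (by positivity) hβ).trans
    (add_le_add le_rfl (le_trans ?_ hB2))⟩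
  have hcard : (0 : ℝ) < Fintype.card (Bits P.coinLen) := by exact_mod_cast Fintype.card_pos
  calc _ ≤ ∑ _x : Bits P.coinLen × Bits P.coinLen,
        ((Fintype.card (Bits P.coinLen) : ℝ)⁻¹) ^ 2 * samplesVal A qs c c' :=
        Finset.sum_le_sum fun x hx => mul_le_mul_of_nonneg_left (hc x hx) (by positivity)
    _ = _ := by
        rw [Finset.sum_const, Finset.card_univ, Fintype.card_prod, nsmul_eq_mul, ← mul_assoc]
        push_cast
        field_simp

end NoQuery

/-! ## The security bounds -/

section Bounds

variable {P : RPSF} {N : ℕ}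

/-- The best weight `t = 1/√ε` gives `8 nh √ε + 2 (ns + 1) ε`. The gap between `8` and `8√2`,
together with `qs + qH ≥ 1`, absorbs the terms of order `ε`. -/
theorem le_add_of_hop_bound {T T' ε : ℝ} {ns nh qs qH : ℕ} (hε : 0 ≤ ε) (hT : T ≤ 1) (hT' : 0 ≤ T')
    (hs : ns ≤ qs) (hh : nh ≤ qH) (hq : 1 ≤ qs + qH)
    (h : ε < 1 → ∀ t : ℝ, 0 < t → T - T' ≤ 2 * (nh * (2 * (t * ε + t⁻¹)) + ns * ε + ε)) :
    T ≤ 8 * ((qs : ℝ) + qH) * Real.sqrt (2 * ε) + T' := by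
  have hs' : (ns : ℝ) ≤ qs := by exact_mod_cast hs
  have hh' : (nh : ℝ) ≤ qH := by exact_mod_cast hh
  have hq' : (1 : ℝ) ≤ qs + qH := by exact_mod_cast hq
  have hs0 : (0 : ℝ) ≤ ns := Nat.cast_nonneg _
  have hh0 : (0 : ℝ) ≤ nh := Nat.cast_nonneg _
  -- At `ε ≥ 1/128` one has `8 √(2ε) ≥ 1`, and the bound exceeds any probability.
  rcases le_or_gt (1 / 128) ε with h1 | h1
  · have h2 : (1 : ℝ) / 8 ≤ Real.sqrt (2 * ε) := Real.le_sqrt_of_sq_le (by linarith)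
    nlinarith
  rcases hε.eq_or_lt with rfl | h0
  · rw [mul_zero, Real.sqrt_zero, mul_zero, zero_add]
    refine le_of_forall_pos_le_add fun η hη => ?_
    -- For `ε = 0` only `4 nh / t` remains, which a large `t` makes at most `η`.
    have := h (by norm_num) ((4 * nh + 1) / η) (by positivity)
    rw [inv_div] at this
    have h3 : nh * (η / (4 * nh + 1)) ≤ η / 4 := by
      rw [mul_div_assoc', div_le_iff₀ (by positivity)]
      nlinarith
    linarith
  · set x := Real.sqrt ε with hx
    have hx0 : 0 < x := Real.sqrt_pos.2 h0
    have hxx : x * x = ε := Real.mul_self_sqrt hε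
    have hx1 : x ≤ 1 / 10 := by nlinarith
    -- The number `7/5` is a rational lower bound for `√2`.
    have hy : 7 / 5 * x ≤ Real.sqrt (2 * ε) := Real.le_sqrt_of_sq_le (by nlinarith)
    have := h (by linarith) x⁻¹ (inv_pos.2 hx0)
    rw [inv_inv, ← hxx, inv_mul_cancel_left₀ hx0.ne'] at this
    have h3 : 8 * ((qs : ℝ) + qH) * (7 / 5 * x) ≤ 8 * ((qs : ℝ) + qH) * Real.sqrt (2 * ε) :=
      mul_le_mul_of_nonneg_left hy (by linarith)
    have h4 : (ns + 1) * (x * x) ≤ (ns + 1) * (1 / 10 * x) :=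
      mul_le_mul_of_nonneg_left (mul_le_mul_of_nonneg_right hx1 hx0.le) (by linarith)
    have h5 : 0 ≤ x * (56 / 5 * ((qs : ℝ) + qH) - 8 * nh - 1 / 5 * (ns + 1)) :=
      mul_nonneg hx0.le (by linarith)
    nlinarith

/-- A bound for the Rényi divergence of the preimage sampler is at least one. -/
theorem one_le_of_preRenyi {α : ℝ≥0∞} {R : ℝ≥0} (hα : 1 < α) (hκ : 0 < P.κ)
    (hpre : P.PreRenyi α R) {pp : Bits P.ppLen} {a : Bits P.keyLen} {t : Bits P.trapLen}
    (h : P.Honest pp a t) : (1 : ℝ) ≤ R := by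
  set ρ : P.Rng := ⟨⟨0, hκ⟩, ⟨fun _ => a, fun i j _ => Subsingleton.elim (α := Fin 1) i j⟩⟩
  set d := P.SampleDom pp ρ fun _ => false with hd
  have hit : P.Hit pp ρ (P.f pp ρ d) := by
    refine ⟨d, rfl, ?_⟩
    rw [RPSF.domDist, PMF.mem_support_map_iff]
    exact ⟨_, by simp, rfl⟩
  -- The test function `1` turns the divergence bound into `1 ≤ R ^ γ`.
  have h1 := sum_mul_rpow_le_of_renyiDiv hα (hpre pp a t h ρ ⟨0, rfl⟩ _ hit) (v := fun _ => 1)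
    fun _ => zero_le_one
  simp only [Real.one_rpow, mul_one] at h1
  rw [(isDist_toReal _).2, (isDist_toReal _).2, mul_one] at h1
  by_contra hR
  push Not at hR
  have hγ : 0 < (1 - α⁻¹).toReal :=
    ENNReal.toReal_pos (tsub_pos_of_lt (ENNReal.inv_lt_one.2 hα)).ne' (by simp)
  exact absurd (Real.rpow_lt_one R.coe_nonneg hR hγ) (not_lt.2 h1)

theorem adv_eq_trapVal (A : Forger P N) (qs : ℕ) :
    A.adv qs = keyExpect P N fun pp kp => piExp (ranWeight P pp)
      (trapVal kp A.out A.prog (initState A.inp pp kp) qs) := by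
  rw [Forger.adv, gameExpect_eq]
  simp only [runForger_eq]
  rfl

theorem adv_bounds (A : Forger P N) (qs : ℕ) : 0 ≤ A.adv qs ∧ A.adv qs ≤ 1 := by
  rw [adv_eq_trapVal]
  constructor
  · refine (keyExpect_const (P := P) (n := N) 0).symm.trans_le (keyExpect_mono fun pp kp _ => ?_)
    rw [← piExp_const (isDist_ranWeight (P := P) (pp := pp)) 0]
    exact piExp_mono isDist_ranWeight fun H _ => (trapVal_bounds _ _ _ (normSqr_initState _ _ _) H).1
  · refine (keyExpect_mono fun pp kp _ => ?_).trans_eq (keyExpect_const (P := P) (n := N) 1)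
    rw [← piExp_const (isDist_ranWeight (P := P) (pp := pp)) 1]
    exact piExp_mono isDist_ranWeight fun H _ => (trapVal_bounds _ _ _ (normSqr_initState _ _ _) H).2

/-- Replacing the random oracle by images of sampled domain elements. -/
theorem adv_le_image (A : Forger P N) {qs qH : ℕ} (hs : A.signQueries ≤ qs)
    (hh : A.hashQueries ≤ qH) (hq : 1 ≤ qs + qH) {ε : ℝ≥0} (hdom : P.DomUniform ε) :
    A.adv qs ≤ 8 * ((qs : ℝ) + qH) * Real.sqrt (2 * ε) + keyExpect P N fun pp kp =>
      piExp (imageWeight kp pp) (trapVal kp A.out A.prog (initState A.inp pp kp) qs) := by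
  rw [adv_eq_trapVal, ← keyExpect_const (P := P) (n := N) (8 * ((qs : ℝ) + qH) * _), ← keyExpect_add]
  refine keyExpect_mono fun pp kp hkp => ?_
  have hψ := normSqr_initState A.inp pp kp
  have hb := fun H : P.Hash pp => trapVal_bounds (qs := qs) (kp := kp) A.out A.prog _ hψ H
  refine le_add_of_hop_bound (NNReal.coe_nonneg ε) ?_ ?_ hs hh hq fun hε t ht =>
    (le_abs_self _).trans (abs_trapVal_sub_le A.out A.prog _ (NNReal.coe_nonneg ε) hε ht hψ
      fun x ⟨j, hj⟩ => hdom pp _ _ (hkp j) _ hj)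
  · rw [← piExp_const (isDist_ranWeight (P := P) (pp := pp)) 1]
    exact piExp_mono isDist_ranWeight fun H _ => (hb H).2
  · rw [← piExp_const (isDist_imageWeight (P := P) (pp := pp) kp) 0]
    exact piExp_mono (isDist_imageWeight kp) fun H _ => (hb H).1

theorem keyExpect_condVal_le (A : Forger P N) {qs : ℕ} {β : ℝ} (hβ : P.PreMinEntropy β) {p : ℝ}
    (hp : keyExpect P N (fun pp kp => piExp (imageWeight kp pp) fun H =>
        piExp (fun x => condWeight kp pp x (H x))
          (sampleVal kp A.out A.prog (initState A.inp pp kp) qs H)) ≤ p) :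
    keyExpect P N (fun pp kp => piExp (imageWeight kp pp)
      (condVal kp A.out A.prog (initState A.inp pp kp) qs)) ≤ (2 : ℝ) ^ (-β) + p := by
  refine le_trans ?_ (add_le_add le_rfl hp)
  rw [← keyExpect_const (P := P) (n := N) ((2 : ℝ) ^ (-β)), ← keyExpect_add]
  refine keyExpect_mono fun pp kp hkp => ?_
  rw [← piExp_const (isDist_imageWeight (P := P) (pp := pp) kp) ((2 : ℝ) ^ (-β)), ← piExp_add]
  exact piExp_mono (isDist_imageWeight kp) fun H hH => condVal_le A.out A.prog _ (by positivity)
    (normSqr_initState _ _ _) (fun ρ hρ => hβ pp ρ (hρ.honestRing hkp)) H hH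

theorem image_le_of_preStat (A : Forger P N) {qs : ℕ} (hs : A.signQueries ≤ qs) {ε : ℝ≥0}
    (hpre : P.PreStat ε) :
    keyExpect P N (fun pp kp => piExp (imageWeight kp pp)
        (trapVal kp A.out A.prog (initState A.inp pp kp) qs))
      ≤ qs * ε + keyExpect P N (fun pp kp => piExp (imageWeight kp pp)
        (condVal kp A.out A.prog (initState A.inp pp kp) qs)) := by
  rw [← keyExpect_const (P := P) (n := N) (qs * ε), ← keyExpect_add]
  refine keyExpect_mono fun pp kp hkp => ?_
  have h1 := (le_abs_self _).trans (abs_trapVal_sub_condVal_le (qs := qs) A.out A.prog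
    (initState A.inp pp kp) (NNReal.coe_nonneg ε) (normSqr_initState _ _ _)
    fun ρ j hj => hpre pp _ _ (hkp j) ρ hj)
  have h2 : (A.prog.countP ForgerOp.isSign : ℝ) * ε ≤ qs * ε :=
    mul_le_mul_of_nonneg_right (by exact_mod_cast hs) ε.coe_nonneg
  linarith

/-- The Rényi bound holds for fixed keys and oracle. Since `x ↦ x ^ γ` is concave, Jensen's
inequality moves the averages over the oracle and over the keys inside. An honest key is needed for
`R ≥ 1`, which allows the exponent to grow to `qs`. -/
theorem image_le_of_preRenyi (hκ : 0 < P.κ) (hN : 0 < N) (A : Forger P N) {qs : ℕ}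
    (hs : A.signQueries ≤ qs) {α : ℝ≥0∞} {R : ℝ≥0} (hα : 1 < α) (hpre : P.PreRenyi α R) :
    keyExpect P N (fun pp kp => piExp (imageWeight kp pp)
        (trapVal kp A.out A.prog (initState A.inp pp kp) qs))
      ≤ ((R : ℝ) ^ qs * keyExpect P N (fun pp kp => piExp (imageWeight kp pp)
        (condVal kp A.out A.prog (initState A.inp pp kp) qs))) ^ (1 - α⁻¹).toReal := by
  set γ := (1 - α⁻¹).toReal with hγ
  have hγ0 : 0 < γ :=
    ENNReal.toReal_pos (tsub_pos_of_lt (ENNReal.inv_lt_one.2 hα)).ne' (by simp)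
  have hγ1 : γ ≤ 1 := by
    rw [hγ, ← ENNReal.toReal_one]
    exact ENNReal.toReal_mono ENNReal.one_ne_top tsub_le_self
  have hc := fun pp kp (H : P.Hash pp) => (condVal_bounds (qs := qs) (kp := kp) A.out A.prog _
    (normSqr_initState A.inp pp kp) H).1
  have hpos : ∀ pp kp, 0 ≤ (R : ℝ) ^ qs * piExp (imageWeight kp pp)
      (condVal kp A.out A.prog (initState A.inp pp kp) qs) := fun pp kp => by
    refine mul_nonneg (by positivity) ?_
    rw [← piExp_const (isDist_imageWeight (P := P) (pp := pp) kp) 0]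
    exact piExp_mono (isDist_imageWeight kp) fun H _ => hc pp kp H
  rw [← keyExpect_const_mul]
  refine (keyExpect_mono fun pp kp hkp => ?_).trans (keyExpect_rpow_le hpos hγ0.le hγ1)
  have hR : (1 : ℝ) ≤ R := one_le_of_preRenyi hα hκ hpre (hkp ⟨0, hN⟩)
  rw [← piExp_const_mul]
  refine (piExp_mono (isDist_imageWeight kp) fun H hH => ?_).trans
    (piExp_rpow_le (isDist_imageWeight kp) (fun H => mul_nonneg (by positivity) (hc pp kp H))
      hγ0.le hγ1)
  refine (trapVal_le_of_renyi A.out A.prog _ hγ0 hγ1 hR (normSqr_initState _ _ _)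
    (fun ρ j hj r h v hv => sum_mul_rpow_le_of_renyiDiv hα (hpre pp _ _ (hkp j) ρ hj r h) hv)
    H hH).trans ?_
  refine Real.rpow_le_rpow (mul_nonneg (by positivity) (hc pp kp H)) ?_ hγ0.le
  exact mul_le_mul_of_nonneg_right (pow_le_pow_right₀ hR hs) (hc pp kp H)

/-- Without keys there is no ring to forge for. -/
theorem adv_eq_zero (A : Forger P 0) (qs : ℕ) : A.adv qs = 0 := by
  refine le_antisymm ?_ (adv_bounds A qs).1
  rw [adv_eq_trapVal]
  refine (keyExpect_mono fun pp kp _ => ?_).trans_eq (keyExpect_const (P := P) (n := 0) 0)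
  rw [← piExp_const (isDist_ranWeight (P := P) (pp := pp)) 0]
  refine piExp_mono isDist_ranWeight fun H _ => ?_
  -- Linearity for the empty sum: a run with final value zero has value zero.
  have h0 := sum_runWith (qs := qs) (kp := kp) (H := H) (S := trapSign kp H) (∅ : Finset Unit)
    (fun _ => 0) (fun _ _ _ => 0) A.prog [] (initState A.inp pp kp)
  rw [Finset.sum_empty] at h0
  rw [h0]
  refine runWith_mono (stochastic_trapSign kp H) (fun L ψ => ?_) _ _ _
  rw [Finset.sum_empty]
  refine (Finset.sum_eq_zero fun s _ => if_neg ?_).le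
  rintro ⟨ρ, -, hρ, -⟩
  exact (hρ 0).choose.elim0

theorem exists_colAdversary (P : RPSF) :
    ∃ B : ColAdversary P, B.size ≤ 2 * P.bitLength ∧ 0 ≤ B.adv := by
  set e := Fintype.equivFin ((Fin P.ppLen ⊕ Fin P.κ × Fin P.keyLen) ⊕
    (P.RIdx ⊕ (Fin P.domLen ⊕ Fin P.domLen)))
  refine ⟨⟨_, Function.Embedding.inl.trans e.toEmbedding, Function.Embedding.inr.trans e.toEmbedding,
    []⟩, ?_, ?_⟩
  · have : P.κ * P.keyLen ≤ P.κ * (P.keyLen + 1) := Nat.mul_le_mul_left _ (Nat.le_succ _)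
    simp only [ColAdversary.size, RPSF.bitLength, Fintype.card_sum, Fintype.card_prod,
      Fintype.card_option, Fintype.card_fin, List.length_nil]
    omega
  · rw [ColAdversary.adv, gameExpect_eq]
    refine (keyExpect_const (P := P) (n := P.κ) 0).symm.trans_le (keyExpect_mono fun pp kp _ => ?_)
    rw [← piExp_const (isDist_ranWeight (P := P) (pp := pp)) 0]
    exact piExp_mono isDist_ranWeight fun H _ => probOf_nonneg _ _

end Bounds

end

theorem mainTheorem4 :
    ∃ C : ℕ, ∀ (P : RPSF) (N qs qH : ℕ), N ≤ P.κ → ∀ A : Forger P N,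
      A.signQueries ≤ qs → A.hashQueries ≤ qH →
      ∃ B : ColAdversary P, B.size ≤ C * (A.size + P.bitLength + 1) ^ C ∧
        ∀ (δ β : ℝ) (εdom : NNReal), P.Correct δ → P.PreMinEntropy β → P.DomUniform εdom →
          (∀ εpre : NNReal, P.PreStat εpre →
            A.adv qs ≤ 8 * ((qs : ℝ) + qH) * Real.sqrt (2 * εdom) + qs * εpre
              + (2 : ℝ) ^ (-β) + B.adv) ∧
          (∀ (α : ENNReal) (R : NNReal), 1 < α → P.PreRenyi α R →
            A.adv qs ≤ 8 * ((qs : ℝ) + qH) * Real.sqrt (2 * εdom)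
              + ((R : ℝ) ^ qs * ((2 : ℝ) ^ (-β) + B.adv)) ^ (1 - α⁻¹).toReal) := by
  refine ⟨2000, fun P N qs qH hN A hs hh => ?_⟩
  -- Without keys a nonempty ring cannot consist of keys of the game, and any adversary of
  -- nonnegative advantage will do. Otherwise `κ` is positive.
  rcases Nat.eq_zero_or_pos N with rfl | hN0
  · obtain ⟨B, hB, hB0⟩ := exists_colAdversary P
    refine ⟨B, hB.trans ?_, fun δ β εdom _ _ _ => ⟨fun εpre _ => ?_, fun α R _ _ => ?_⟩⟩
    · have h1 : A.size + P.bitLength + 1 ≤ (A.size + P.bitLength + 1) ^ 2000 :=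
        Nat.le_self_pow (by norm_num) _
      omega
    · rw [adv_eq_zero]
      positivity
    · rw [adv_eq_zero]
      positivity
  have hκ : 0 < P.κ := hN0.trans_le hN
  -- Without queries the loss term vanishes, so replacing the oracle has to be avoided.
  rcases Nat.eq_zero_or_pos (qs + qH) with hq | hq
  · obtain ⟨rfl, rfl⟩ : qs = 0 ∧ qH = 0 := by omega
    obtain ⟨B, hB, hadv⟩ := exists_adv_le_of_noQuery hN hκ A (qs := 0) (by omega) (by omega)
    refine ⟨B, hB, fun δ β εdom _ hβ _ => ⟨fun εpre _ => ?_, fun α R hα _ => ?_⟩⟩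
    · simpa using hadv β hβ
    · obtain ⟨h0, h1⟩ := adv_bounds A 0
      have hγ1 : (1 - α⁻¹).toReal ≤ 1 := by
        rw [← ENNReal.toReal_one]
        exact ENNReal.toReal_mono ENNReal.one_ne_top tsub_le_self
      -- An advantage is at most one, so raising it to a power with exponent at most one does not
      -- decrease it.
      have h2 := (Real.self_le_rpow_of_le_one h0 h1 hγ1).trans
        (Real.rpow_le_rpow h0 (hadv β hβ) ENNReal.toReal_nonneg)
      simpa using h2
  -- The adversary is fixed before the parameters; both bounds combine the same replacement of the
  -- oracle and the same use of the min-entropy and differ in the treatment of signatures.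
  · obtain ⟨B, hB, hadv⟩ := exists_adv_ge_sampleVal hN hκ A hs
    refine ⟨B, hB, fun δ β εdom _ hβ hdom => ⟨fun εpre hpre => ?_, fun α R hα hpre => ?_⟩⟩
    · have h1 := adv_le_image A hs hh hq hdom
      have h2 := image_le_of_preStat A hs hpre
      have h3 := keyExpect_condVal_le A hβ hadv
      linarith
    · refine (adv_le_image A hs hh hq hdom).trans (add_le_add le_rfl
        ((image_le_of_preRenyi hκ hN0 A hs hα hpre).trans ?_))
      refine Real.rpow_le_rpow (mul_nonneg (by positivity) ?_)
        (mul_le_mul_of_nonneg_left (keyExpect_condVal_le A hβ hadv) (by positivity))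
        ENNReal.toReal_nonneg
      refine (keyExpect_const (P := P) (n := N) 0).symm.trans_le (keyExpect_mono fun pp kp _ => ?_)
      rw [← piExp_const (isDist_imageWeight (P := P) (pp := pp) kp) 0]
      exact piExp_mono (isDist_imageWeight kp) fun H _ =>
        (condVal_bounds A.out A.prog _ (normSqr_initState _ _ _) H).1
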